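/- **Setting.** Let $\kappa\in\mathbb N$ be a security parameter. For each $\kappa$ let $m=m(\kappa)$ be a block length, $\mathbb K=\mathbb K_\kappa$ a finite nonempty key space, and $E:\mathbb K\times\mathbb F_2^m\to\mathbb F_2^m$ a block cipher ($E(K,\cdot)$ is a permutation for each $K$). Let $\ell=\ell(\kappa)$ be a number of decimal digits, $\mathbb P=\{0,\dots,9\}^\ell$ the set of numeric codes (PANs), identified with $\{0,\dots,10^\ell-1\}$, and $n=\lceil\log_2 10^\ell\rceil\le m$. Let $\mathbb U$ be the set of finite binary strings (additional inputs; $u+1$ denotes binary increment) and $f:\mathbb U\times\mathbb P\to\mathbb F_2^{m-n}$ a public function. For a string $c$ let $\bar c$ be the integer it represents. The tokenization algorithm $T(K,X,u)$ with a table of stored tokens is: (1) $t:=f(u,X)\,\|\,[X]_2^n$; (2) $c:=E(K,t)$; (3) if $(\bar c \bmod 2^n)\ge 10^\ell$, put $t:=c$ and go to (2); (4) $\mathtt{token}:=\bar c\bmod 2^n\in\mathbb P$; (5) if $\mathtt{token}$ is already stored, put $u:=u+1$ and go to (1); (6) return $\mathtt{token}$. Each generated token is then stored; the table is initially empty. A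 PPT algorithm is a (uniform) probabilistic program, possibly with oracle queries, that receives $1^\kappa$ and is stopped after $p(\kappa)$ steps for some polynomial $p$. A function of $\kappa$ is negligible if it tends to $0$ faster than every inverse polynomial. **Assumptions.** $1^\kappa\mapsto 1^{m(\kappa)}$ and $1^\kappa\mapsto 1^{\ell(\kappa)}$ are computable in polynomial time; the number $10^{\ell(\kappa)}$ of numeric codes is superpolynomial, that is, $10^{-\ell(\kappa)}$ is negligible; $f$ is computable in polynomial time (from $1^\kappa,u,X$) and collision-resistant (no PPT algorithm outputs, with non-negligible probability, two distinct pairs $(X_1,u_1)\neq(X_2,u_2)$ with $f(u_1,X_1)=f(u_2,X_2)$). $E$ is IND-CPA secure: for every PPT adversary $\mathcal A$, $\left|\Pr[\nu'=\nu]-\tfrac12\right|$ is negligible in the following game. $K\in\mathbb K$ and $\nu\in\{0,1\}$ are uniformly random; $\mathcal A$ asks for encryptions $E(K,x)$ of plaintexts of its choice; once, it submits two plaintexts $x_0^*,x_1^*$ that it has not asked before and receives $E(K,x_\nu^*)$; it may then ask for further encryptions, but not of $x_0^*$ or $x_1^*$; finally it outputs a guess $\nu'$ (a run that breaks the rules or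 exceeds its time counts as the guess $0$). **Claim.** Then $T$ satisfies the following three requirements, where $K\in\mathbb K$ is uniformly random and unknown to the attacker. * **A1 (ciphertext-only).** Let $X\in\mathbb P$ be uniformly random. A PPT attacker who obtains tokens $T(K,X,u)$ of $X$, for additional inputs $u$ that it chooses adaptively, outputs $X$ with negligible probability only. * **A2 (known-plaintext).** The same holds if the attacker may in addition obtain, at any time, token-to-PAN pairs: the tokens $T(K,Y,u)$ for pairs $(Y,u)\in\mathbb P\times\mathbb U$ that it chooses adaptively. * **A3 (unforgeability).** A PPT attacker who obtains tokens $T(K,Y,u)$ for pairs $(Y,u)\in\mathbb P\times\mathbb U$ that it chooses adaptively outputs, with negligible probability only, a triple $(X,u^*,\mathtt{token}^*)$ such that $\mathtt{token}^*=T(K,X,u^*)$, where $T$ is run with the table reached at that time (so that $\mathtt{token}^*$ is a new token). -/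

import Mathlib

/-! ## Probabilistic oracle programs with a step count

Algorithms are programs of the WHILE language on binary trees, extended with coin tosses
and oracle queries. -/

/-- Data: binary trees. -/
inductive Data where
  | nil : Data
  | cons : Data → Data → Data

namespace Data

/-- Number of nodes. -/
def size : Data → ℕ
  | nil => 1
  | cons a b => 1 + a.size + b.size

def head : Data → Data
  | nil => nil
  | cons a _ => a

def tail : Data → Data
  | nil => nil
  | cons _ b => b

def ofBool : Bool → Data
  | false => nil
  | true => cons nil nil

/-- A bit string, as the list of its bits. -/
def ofBits : List Bool → Data
  | [] => nil
  | b :: l => cons (ofBool b) (ofBits l)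

/-- The unary representation `1ᵏ` of `k`. -/
def unary (k : ℕ) : Data := ofBits (List.replicate k true)

/-- The `k` low bits of `x`, least significant bit first. -/
def ofNatBits (k x : ℕ) : Data := ofBits (List.ofFn fun i : Fin k => x.testBit i)

end Data

/-- Expressions over variables `0, 1, 2, …`. -/
inductive Expr where
  | var : ℕ → Expr
  | nil : Expr
  | cons : Expr → Expr → Expr
  | head : Expr → Expr
  | tail : Expr → Expr

def Expr.eval (st : ℕ → Data) : Expr → Data
  | .var x => st x
  | .nil => .nil
  | .cons a b => .cons (a.eval st) (b.eval st)
  | .head a => (a.eval st).head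
  | .tail a => (a.eval st).tail

/-- Programs. In tests, `nil` is false and every other tree is true. -/
inductive Prog where
  | skip : Prog
  /-- `x := e` -/
  | assign (x : ℕ) (e : Expr) : Prog
  /-- `x :=` a fresh coin toss -/
  | flip (x : ℕ) : Prog
  /-- `x :=` the oracle's answer to `e` -/
  | query (x : ℕ) (e : Expr) : Prog
  | seq (c d : Prog) : Prog
  | ite (e : Expr) (c d : Prog) : Prog
  | while (e : Expr) (c : Prog) : Prog

/-- A stateful oracle: `O q d a q'` says that in state `q` the query `d` is answered by `a` and
leads to state `q'`. A query without such `a`, `q'` is never answered: the program hangs. -/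
abbrev Oracle (σ : Type) := σ → Data → Data → σ → Prop

/-- The oracle that answers nothing, for programs that run on their own. -/
def noOracle : Oracle Unit := fun _ _ _ _ => False

structure Config (σ : Type) where
  store : ℕ → Data
  /-- number of coins already tossed -/
  coins : ℕ
  oracle : σ

/-- `Exec O ω c s t s'`: with oracle `O` and coin sequence `ω`, the program `c` started in `s`
halts in `s'` after `t` steps. Writing down a tree costs its size. -/
inductive Exec {σ : Type} (O : Oracle σ) (ω : ℕ → Bool) :
    Prog → Config σ → ℕ → Config σ → Prop
  | skip (s : Config σ) : Exec O ω .skip s 1 s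
  | assign (x : ℕ) (e : Expr) (s : Config σ) :
      Exec O ω (.assign x e) s (1 + (e.eval s.store).size)
        ⟨Function.update s.store x (e.eval s.store), s.coins, s.oracle⟩
  | flip (x : ℕ) (s : Config σ) :
      Exec O ω (.flip x) s 1
        ⟨Function.update s.store x (Data.ofBool (ω s.coins)), s.coins + 1, s.oracle⟩
  | query (x : ℕ) (e : Expr) (s : Config σ) (a : Data) (q : σ)
      (h : O s.oracle (e.eval s.store) a q) :
      Exec O ω (.query x e) s (1 + (e.eval s.store).size + a.size)
        ⟨Function.update s.store x a, s.coins, q⟩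
  | seq (c d : Prog) (s s' s'' : Config σ) (t t' : ℕ)
      (h : Exec O ω c s t s') (h' : Exec O ω d s' t' s'') :
      Exec O ω (.seq c d) s (t + t') s''
  | iteTrue (e : Expr) (c d : Prog) (s s' : Config σ) (t : ℕ)
      (he : e.eval s.store ≠ .nil) (h : Exec O ω c s t s') :
      Exec O ω (.ite e c d) s (1 + t) s'
  | iteFalse (e : Expr) (c d : Prog) (s s' : Config σ) (t : ℕ)
      (he : e.eval s.store = .nil) (h : Exec O ω d s t s') :
      Exec O ω (.ite e c d) s (1 + t) s'
  | whileFalse (e : Expr) (c : Prog) (s : Config σ) (he : e.eval s.store = .nil) :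
      Exec O ω (.while e c) s 1 s
  | whileTrue (e : Expr) (c : Prog) (s s' s'' : Config σ) (t t' : ℕ)
      (he : e.eval s.store ≠ .nil) (h : Exec O ω c s t s')
      (h' : Exec O ω (.while e c) s' t' s'') :
      Exec O ω (.while e c) s (1 + t + t') s''

/-- The program `c`, started on input `d` (in variable `0`, all others `nil`) with oracle
state `q`, halts after at most `T` steps with output `out` (in variable `0`) and oracle
state `q'`. -/
def RunsTo {σ : Type} (O : Oracle σ) (ω : ℕ → Bool) (c : Prog) (d : Data) (q : σ) (T : ℕ)
    (out : Data) (q' : σ) : Prop :=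
  ∃ (t : ℕ) (s' : Config σ),
    Exec O ω c ⟨fun x => if x = 0 then d else .nil, 0, q⟩ t s' ∧
      t ≤ T ∧ s'.store 0 = out ∧ s'.oracle = q'

/-- The function `inp i ↦ out i` is computed in polynomial time (without using coins). -/
def PolyTime {ι : Type} (inp out : ι → Data) : Prop :=
  ∃ (c : Prog) (p : Polynomial ℕ), ∀ (i : ι) (ω : ℕ → Bool),
    RunsTo noOracle ω c (inp i) () (p.eval (inp i).size) (out i) ()

/-- A finite coin tape. A program with time bound `N` tosses at most `N` coins. -/
abbrev Tape (N : ℕ) := Fin N → Bool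

def Tape.coin {N : ℕ} (τ : Tape N) (i : ℕ) : Bool := if h : i < N then τ ⟨i, h⟩ else false

/-! ## Probabilities and negligible functions -/

/-- Probability of the event `A` under the uniform distribution on a finite nonempty `Ω`. -/
noncomputable def uprob {Ω : Type} (A : Set Ω) : ℝ := (A.ncard : ℝ) / (Nat.card Ω : ℝ)

/-- `ε κ` tends to `0` faster than every inverse polynomial in `κ`. -/
def Negligible (ε : ℕ → ℝ) : Prop :=
  Asymptotics.SuperpolynomialDecay Filter.atTop (fun κ : ℕ => (κ : ℝ)) ε

/-! ## Block ciphers and the IND-CPA game -/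

/-- A block cipher, indexed by the security parameter `κ`. -/
structure BlockCipher where
  /-- block length -/
  m : ℕ → ℕ
  Key : ℕ → Type
  key_finite : ∀ κ, Finite (Key κ)
  key_nonempty : ∀ κ, Nonempty (Key κ)
  enc : ∀ κ, Key κ → Equiv.Perm (BitVec (m κ))

namespace BlockCipher

/-- State of the challenger: the plaintexts encrypted so far outside the challenge, and the
challenge plaintexts once they have been submitted. -/
structure CPAState (m : ℕ) where
  asked : Set (BitVec m)
  challenge : Option (BitVec m × BitVec m)

/-- A block as data. -/
def block {m : ℕ} (x : BitVec m) : Data := Data.ofNatBits m x.toNat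

/-- The challenger of the IND-CPA game with encryption function `e` and hidden bit `ν`.
Queries that break the rules are not answered. -/
inductive cpaOracle {m : ℕ} (e : BitVec m → BitVec m) (ν : Bool) : Oracle (CPAState m)
  /-- Phases I and II: encryption of `x`, which is not one of the challenge plaintexts. -/
  | encrypt (q : CPAState m) (x : BitVec m)
      (h : ∀ y₀ y₁, q.challenge = some (y₀, y₁) → x ≠ y₀ ∧ x ≠ y₁) :
      cpaOracle e ν q (.cons (.ofBool false) (block x)) (block (e x))
        ⟨insert x q.asked, q.challenge⟩
  /-- Challenge: made once, on two plaintexts that were never chosen before. -/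
  | challenge (q : CPAState m) (x₀ x₁ : BitVec m) (h : q.challenge = none)
      (h₀ : x₀ ∉ q.asked) (h₁ : x₁ ∉ q.asked) :
      cpaOracle e ν q (.cons (.ofBool true) (.cons (block x₀) (block x₁)))
        (block (e (if ν then x₁ else x₀))) ⟨q.asked, some (x₀, x₁)⟩

variable (E : BlockCipher)

/-- The adversary `c` with time bound `T` guesses `1`. In every other case (in particular if it
breaks the rules or exceeds its time) its guess counts as `0`. -/
def GuessOne (c : Prog) (T κ : ℕ) (K : E.Key κ) (ν : Bool) (τ : Tape T) : Prop :=
  ∃ q', RunsTo (cpaOracle (E.enc κ K) ν) τ.coin c (.unary κ) ⟨∅, none⟩ T (.ofBool true) q'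

/-- The advantage `|Pr[ν' = ν] - 1/2|`, over a uniform key, a uniform bit `ν` and the coins of
the adversary. -/
noncomputable def advantage (c : Prog) (T κ : ℕ) : ℝ :=
  |uprob {w : E.Key κ × Bool × Tape T | E.GuessOne c T κ w.1 w.2.1 w.2.2 ↔ w.2.1 = true}
    - 1 / 2|

/-- `E` is secure in the IND-CPA scenario: every probabilistic polynomial-time adversary
(a program with a polynomial clock) has negligible advantage. -/
def INDCPA : Prop :=
  ∀ (c : Prog) (p : Polynomial ℕ), Negligible fun κ => E.advantage c (p.eval κ) κ

end BlockCipher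

/-! ## The tokenization algorithm -/

/-- `n = ⌈log₂ (10 ^ l)⌉`. -/
def codeBits (l : ℕ) : ℕ := Nat.clog 2 (10 ^ l)

/-- Numeric codes (and tokens) with `l` decimal digits, viewed as integers below `10 ^ l`. -/
abbrev NumCode (l : ℕ) := Fin (10 ^ l)

def NumCode.data {l : ℕ} (X : NumCode l) : Data := Data.ofNatBits (codeBits l) X.val

/-- Additional inputs: binary strings of arbitrary length, least significant bit first. -/
abbrev AddInput := List Bool

/-- `u + 1`, keeping the length of the string unless there is an overflow. -/
def AddInput.succ : AddInput → AddInput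
  | [] => [true]
  | false :: u => true :: u
  | true :: u => false :: AddInput.succ u

/-- The ingredients of the tokenization algorithm. -/
structure TokenScheme where
  E : BlockCipher
  /-- number of decimal digits of a numeric code -/
  l : ℕ → ℕ
  codeBits_le : ∀ κ, codeBits (l κ) ≤ E.m κ
  f : ∀ κ, AddInput → NumCode (l κ) → BitVec (E.m κ - codeBits (l κ))

namespace TokenScheme

variable (S : TokenScheme)

/-- Step 1: `t := f(u, X) || [X]₂ⁿ`. -/
def start (κ : ℕ) (u : AddInput) (X : NumCode (S.l κ)) : BitVec (S.E.m κ) :=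
  (S.f κ u X ++ BitVec.ofNat (codeBits (S.l κ)) X.val).cast
    (Nat.sub_add_cancel (S.codeBits_le κ))

/-- Steps 2 to 4: `Walk κ K t tok` says that steps 2 and 3, entered with the block `t`, end and
yield the token `tok`. -/
inductive Walk (κ : ℕ) (K : S.E.Key κ) : BitVec (S.E.m κ) → NumCode (S.l κ) → Prop
  | done (t : BitVec (S.E.m κ))
      (h : (S.E.enc κ K t).toNat % 2 ^ codeBits (S.l κ) < 10 ^ S.l κ) :
      Walk κ K t ⟨(S.E.enc κ K t).toNat % 2 ^ codeBits (S.l κ), h⟩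
  | again (t : BitVec (S.E.m κ)) (tok : NumCode (S.l κ))
      (h : 10 ^ S.l κ ≤ (S.E.enc κ K t).toNat % 2 ^ codeBits (S.l κ))
      (hw : Walk κ K (S.E.enc κ K t) tok) : Walk κ K t tok

/-- The algorithm `T`: with the tokens in `db` already stored, `T(K, X, u)` returns `tok`. -/
inductive Tokenize (κ : ℕ) (K : S.E.Key κ) (db : Set (NumCode (S.l κ)))
    (X : NumCode (S.l κ)) : AddInput → NumCode (S.l κ) → Prop
  | fresh (u : AddInput) (tok : NumCode (S.l κ)) (hw : S.Walk κ K (S.start κ u X) tok)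
      (h : tok ∉ db) : Tokenize κ K db X u tok
  | retry (u : AddInput) (tok tok' : NumCode (S.l κ)) (hw : S.Walk κ K (S.start κ u X) tok)
      (h : tok ∈ db) (ht : Tokenize κ K db X u.succ tok') : Tokenize κ K db X u tok'

/-- `f` can be computed in polynomial time. -/
def PolyTimeF : Prop :=
  PolyTime (ι := Σ κ : ℕ, AddInput × NumCode (S.l κ))
    (fun i => .cons (.unary i.1) (.cons (.ofBits i.2.1) i.2.2.data))
    (fun i => BlockCipher.block (S.f i.1 i.2.1 i.2.2))

/-- `f` is collision-resistant: no probabilistic polynomial-time program finds, with more than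
negligible probability, two distinct pairs `(X₁, u₁)`, `(X₂, u₂)` with equal images. -/
def CollisionResistant : Prop :=
  ∀ (c : Prog) (p : Polynomial ℕ), Negligible fun κ =>
    uprob {τ : Tape (p.eval κ) | ∃ (X₁ X₂ : NumCode (S.l κ)) (u₁ u₂ : AddInput),
      (X₁, u₁) ≠ (X₂, u₂) ∧ S.f κ u₁ X₁ = S.f κ u₂ X₂ ∧
      RunsTo noOracle τ.coin c (.unary κ) () (p.eval κ)
        (.cons (.cons X₁.data (.ofBits u₁)) (.cons X₂.data (.ofBits u₂))) ()}

/-! ### The requirements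

In all games the state of the oracle is the set of stored tokens, which is empty at first; every
generated token is added to it. -/

/-- Tokens of the hidden numeric code `X`, for additional inputs chosen by the attacker. -/
inductive hiddenOracle (κ : ℕ) (K : S.E.Key κ) (X : NumCode (S.l κ)) :
    Oracle (Set (NumCode (S.l κ)))
  | token (db : Set (NumCode (S.l κ))) (u : AddInput) (tok : NumCode (S.l κ))
      (h : S.Tokenize κ K db X u tok) :
      hiddenOracle κ K X db (.ofBits u) tok.data (insert tok db)

/-- Tokens of numeric codes that are known to (indeed chosen by) the attacker. -/
inductive knownOracle (κ : ℕ) (K : S.E.Key κ) : Oracle (Set (NumCode (S.l κ)))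
  | token (db : Set (NumCode (S.l κ))) (Y : NumCode (S.l κ)) (u : AddInput)
      (tok : NumCode (S.l κ)) (h : S.Tokenize κ K db Y u tok) :
      knownOracle κ K db (.cons Y.data (.ofBits u)) tok.data (insert tok db)

/-- Both kinds of queries, in any order. -/
inductive pairOracle (κ : ℕ) (K : S.E.Key κ) (X : NumCode (S.l κ)) :
    Oracle (Set (NumCode (S.l κ)))
  | hidden (db db' : Set (NumCode (S.l κ))) (d a : Data)
      (h : S.hiddenOracle κ K X db d a db') :
      pairOracle κ K X db (.cons (.ofBool false) d) a db'
  | known (db db' : Set (NumCode (S.l κ))) (d a : Data) (h : S.knownOracle κ K db d a db') :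
      pairOracle κ K X db (.cons (.ofBool true) d) a db'

/-- A1 (ciphertext-only): no probabilistic polynomial-time attacker who collects tokens of one
random hidden numeric code recovers it with more than negligible probability. -/
def A1 : Prop :=
  ∀ (c : Prog) (p : Polynomial ℕ), Negligible fun κ =>
    uprob {w : S.E.Key κ × NumCode (S.l κ) × Tape (p.eval κ) |
      ∃ db', RunsTo (S.hiddenOracle κ w.1 w.2.1) w.2.2.coin c (.unary κ) ∅ (p.eval κ)
        w.2.1.data db'}

/-- A2 (known-plaintext): the same if the attacker has, in addition, pairs of a numeric code and
its token. -/
def A2 : Prop :=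
  ∀ (c : Prog) (p : Polynomial ℕ), Negligible fun κ =>
    uprob {w : S.E.Key κ × NumCode (S.l κ) × Tape (p.eval κ) |
      ∃ db', RunsTo (S.pairOracle κ w.1 w.2.1) w.2.2.coin c (.unary κ) ∅ (p.eval κ)
        w.2.1.data db'}

/-- A3 (unforgeability): no probabilistic polynomial-time attacker who has obtained tokens
outputs, with more than negligible probability, `X`, `u` and the new token that the algorithm
would next generate for `(X, u)`. -/
def A3 : Prop :=
  ∀ (c : Prog) (p : Polynomial ℕ), Negligible fun κ =>
    uprob {w : S.E.Key κ × Tape (p.eval κ) |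
      ∃ (X : NumCode (S.l κ)) (u : AddInput) (tok : NumCode (S.l κ))
        (db' : Set (NumCode (S.l κ))),
        RunsTo (S.knownOracle κ w.1) w.2.coin c (.unary κ) ∅ (p.eval κ)
          (.cons X.data (.cons (.ofBits u) tok.data)) db' ∧
        S.Tokenize κ w.1 db' X u tok}

end TokenScheme

/-! ## Executions of programs -/

/-! The attacker is run inside a machine (`Tokenizer.step`) that answers its queries by carrying out
the tokenization itself, with ciphertexts taken from an exchangeable source. The machine accepts if
the attacker wins, and also if the simulation fails: the low `n` bits of a ciphertext repeat or the
budget of `Q` encryptions is used up (tag `bad`), or two additional inputs have the same image under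
`f` for one code (tag `coll`). With the block cipher as source the simulation is faithful up to
these failures (`reaches_exec`). So an attacker wins with probability at most `2 * real`, where
`real` is the probability of acceptance with real encryptions and the factor 2 pays for drawing the
hidden code as `n` random bits instead of a number below `10 ^ l`.

In this simulation no block is encrypted twice (`Inv`). The blocks that start a tokenization have
low bits below `10 ^ l`, while the intermediate blocks of a walk have low bits at least `10 ^ l`, so
the two kinds differ. Intermediate blocks differ among themselves because a repetition of low bits
stops the machine. A starting block that was used before with the same additional input leads to a
stored token, so the machine passes to `u + 1` without encrypting; one that was used before with
another input is a collision of `f`.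

Therefore the ciphertexts can be replaced by random blocks, by a hybrid argument (`exists_real_le`).
The adversary chooses a random position `i`, asks for the encryptions before it, submits as
challenge a random block and the block due at position `i`, and takes all later ciphertexts from a
pool of random blocks. Encryption is a permutation, so the encryption of a random block is again a
random block, and the two values of the hidden bit give neighbouring hybrids. The challenge is
inadmissible only if the random block has been encrypted before, which has probability at most `Q /
2 ^ m`.

With random blocks everything can be estimated (`exists_hybrid_zero_le`). Repeated low bits are a
birthday event. At least half of all words of `n` bits are numeric codes, so a budget of `C * κ`
encryptions suffices for `C` tokens up to probability `C / 2 ^ κ`. The tag `coll` is reached by a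
program without any oracle, against collision resistance. The answers given to the attacker do not
depend on the hidden code, which can then only be guessed (`uprob_wins_le_of_none`). For
unforgeability the attacker is followed by a query for the pair of its forgery: a win means that the
low bits of a random block were predicted before the block was received (`uprob_wins_le_of_query`).

The reductions have to be polynomial-time programs of the given model. `FP` is a calculus of
polynomial-time functions that can be used as subroutines; a step of the machine is shown to belong
to it (`fp_next`), and `FP.exists_prog` iterates such a step, with oracle queries in between. -/

namespace Data

/-- A list of trees as a tree. -/
def ofList : List Data → Data
  | [] => nil
  | a :: l => cons a (ofList l)

/-- The right spine of a tree. -/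
def toList : Data → List Data
  | nil => []
  | cons a b => a :: toList b

@[simp] theorem ofList_nil : ofList [] = nil := rfl
@[simp] theorem ofList_cons (a : Data) (l : List Data) : ofList (a :: l) = cons a (ofList l) := rfl
@[simp] theorem head_cons (a b : Data) : (cons a b).head = a := rfl
@[simp] theorem tail_cons (a b : Data) : (cons a b).tail = b := rfl
@[simp] theorem head_nil : nil.head = nil := rfl
@[simp] theorem tail_nil : nil.tail = nil := rfl

@[simp] theorem ofList_toList : ∀ d : Data, ofList d.toList = d
  | nil => rfl
  | cons a b => by simp [toList, ofList_toList b]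

@[simp] theorem toList_ofList : ∀ l : List Data, (ofList l).toList = l
  | [] => rfl
  | a :: l => by simp [toList, toList_ofList l]

theorem tail_ofList (l : List Data) : (ofList l).tail = ofList l.tail := by cases l <;> rfl

theorem ofList_eq_nil {l : List Data} : ofList l = nil ↔ l = [] := by cases l <;> simp

theorem ofBits_eq_ofList : ∀ l : List Bool, ofBits l = ofList (l.map ofBool)
  | [] => rfl
  | b :: l => by simp [ofBits, ofBits_eq_ofList l]

theorem size_pos (d : Data) : 0 < d.size := by cases d <;> simp [size]

theorem size_head_le (d : Data) : d.head.size ≤ d.size := by cases d <;> simp [head, size]; omega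

theorem size_tail_le (d : Data) : d.tail.size ≤ d.size := by cases d <;> simp [tail, size]

theorem ofBool_ne_nil {b : Bool} : ofBool b ≠ nil ↔ b = true := by cases b <;> simp [ofBool]

theorem ofBool_eq_nil {b : Bool} : ofBool b = nil ↔ b = false := by cases b <;> simp [ofBool]

theorem ofBool_injective : Function.Injective ofBool := by
  intro a b h; cases a <;> cases b <;> simp_all [ofBool]

theorem size_ofBool_le (b : Bool) : (ofBool b).size ≤ 3 := by cases b <;> simp [ofBool, size]

theorem ofList_injective : Function.Injective ofList :=
  fun a b h => by rw [← toList_ofList a, h, toList_ofList]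

theorem ofBits_injective : Function.Injective ofBits := fun a b h => by
  rw [ofBits_eq_ofList, ofBits_eq_ofList] at h
  exact List.map_injective_iff.2 ofBool_injective (ofList_injective h)

end Data

namespace Expr

/-- A strict bound for the variables of an expression. -/
def vars : Expr → ℕ
  | var x => x + 1
  | nil => 0
  | cons a b => max a.vars b.vars
  | head a => a.vars
  | tail a => a.vars

theorem eval_congr {s r : ℕ → Data} {M : ℕ} (hs : ∀ x < M, r x = s x) :
    ∀ {e : Expr}, e.vars ≤ M → e.eval r = e.eval s
  | var x, h => hs x h
  | nil, _ => rfl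
  | cons a b, h => by
    simp only [vars, max_le_iff] at h
    simp [eval, eval_congr hs h.1, eval_congr hs h.2]
  | head a, h => by simp [eval, eval_congr hs (e := a) h]
  | tail a, h => by simp [eval, eval_congr hs (e := a) h]

end Expr

namespace Prog

/-- A strict bound for the variables of a program. -/
def vars : Prog → ℕ
  | skip => 0
  | assign x e => max (x + 1) e.vars
  | flip x => x + 1
  | query x e => max (x + 1) e.vars
  | seq c d => max c.vars d.vars
  | ite e c d => max e.vars (max c.vars d.vars)
  | .while e c => max e.vars c.vars

/-- Replace coin tosses by `nil`, and delete the queries. -/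
def det : Prog → Prog
  | flip x => assign x .nil
  | query _ _ => skip
  | seq c d => seq c.det d.det
  | ite e c d => ite e c.det d.det
  | .while e c => .while e c.det
  | c => c

end Prog

section Exec

variable {σ : Type} {O : Oracle σ} {ω : ℕ → Bool}

/-- With the all-false coin sequence a toss yields `nil`, and `noOracle` answers no query, so `det`
repeats the computation without coins and queries. The run becomes independent of the surrounding
oracle and can serve as a subroutine. The factor 2 arises because a toss takes one step and the
assignment of `nil` two. -/
theorem Exec.transfer {c : Prog} {s s' : Config Unit} {t : ℕ}
    (h : Exec noOracle (fun _ => false) c s t s') {M : ℕ} (hc : c.vars ≤ M) (r : Config σ)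
    (hr : ∀ x < M, r.store x = s.store x) :
    ∃ t' r', Exec O ω c.det r t' r' ∧ t' ≤ 2 * t ∧ (∀ x < M, r'.store x = s'.store x) ∧
      (∀ x ≥ M, r'.store x = r.store x) ∧ r'.coins = r.coins ∧ r'.oracle = r.oracle := by
  induction h generalizing r with
  | skip s => exact ⟨_, _, .skip r, by omega, hr, fun _ _ => rfl, rfl, rfl⟩
  | assign x e s =>
    simp only [Prog.vars, max_le_iff] at hc
    have he := Expr.eval_congr hr hc.2
    refine ⟨_, _, .assign x e r, by rw [he]; omega, fun y hy => ?_, fun y hy => ?_, rfl, rfl⟩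
    · simp only [Function.update_apply, he]; split <;> simp_all
    · simp only [Function.update_apply]; rw [if_neg (by omega)]
  | flip x s =>
    simp only [Prog.vars] at hc
    refine ⟨_, _, .assign x .nil r, by simp [Expr.eval, Data.size], fun y hy => ?_,
      fun y hy => ?_, rfl, rfl⟩
    · simp only [Function.update_apply, Expr.eval, Data.ofBool]; split <;> simp_all
    · simp only [Function.update_apply]; rw [if_neg (by omega)]
  | query x e s a q h => exact h.elim
  | seq c d s s1 s2 t t' _ _ ih1 ih2 =>
    simp only [Prog.vars, max_le_iff] at hc
    obtain ⟨t1, r1, e1, b1, l1, g1, k1, o1⟩ := ih1 hc.1 r hr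
    obtain ⟨t2, r2, e2, b2, l2, g2, k2, o2⟩ := ih2 hc.2 r1 l1
    exact ⟨_, _, .seq _ _ _ _ _ _ _ e1 e2, by omega, l2, fun x hx => (g2 x hx).trans (g1 x hx),
      k2.trans k1, o2.trans o1⟩
  | iteTrue e c d s s1 t he _ ih =>
    simp only [Prog.vars, max_le_iff] at hc
    obtain ⟨t1, r1, e1, b1, l1⟩ := ih hc.2.1 r hr
    exact ⟨_, _, .iteTrue _ _ _ _ _ _ (by rwa [Expr.eval_congr hr hc.1]) e1, by omega, l1⟩
  | iteFalse e c d s s1 t he _ ih =>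
    simp only [Prog.vars, max_le_iff] at hc
    obtain ⟨t1, r1, e1, b1, l1⟩ := ih hc.2.2 r hr
    exact ⟨_, _, .iteFalse _ _ _ _ _ _ (by rwa [Expr.eval_congr hr hc.1]) e1, by omega, l1⟩
  | whileFalse e c s he =>
    simp only [Prog.vars, max_le_iff] at hc
    exact ⟨_, _, .whileFalse _ _ _ (by rwa [Expr.eval_congr hr hc.1]), by omega, hr,
      fun _ _ => rfl, rfl, rfl⟩
  | whileTrue e c s s1 s2 t t' he _ _ ih1 ih2 =>
    have hc' := hc
    simp only [Prog.vars, max_le_iff] at hc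
    obtain ⟨t1, r1, e1, b1, l1, g1, k1, o1⟩ := ih1 hc.2 r hr
    obtain ⟨t2, r2, e2, b2, l2, g2, k2, o2⟩ := ih2 hc' r1 l1
    exact ⟨_, _, .whileTrue _ _ _ _ _ _ _ (by rwa [Expr.eval_congr hr hc.1]) e1 e2, by omega, l2,
      fun x hx => (g2 x hx).trans (g1 x hx), k2.trans k1, o2.trans o1⟩

/-- A tree that is written down is paid for by its size, except for the result of a coin toss, which
costs one step and may have three nodes; hence the factor 3. -/
theorem Exec.size_le {c : Prog} {s s' : Config σ} {t : ℕ} (h : Exec O ω c s t s') {B : ℕ}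
    (hB : ∀ x, (s.store x).size ≤ B) (x : ℕ) : (s'.store x).size ≤ B + 3 * t := by
  induction h generalizing B x with
  | skip s => exact (hB x).trans (by omega)
  | assign y e s =>
    simp only [Function.update_apply]; split
    · omega
    · exact (hB x).trans (by omega)
  | flip y s =>
    simp only [Function.update_apply]; split
    · exact (Data.size_ofBool_le _).trans (by omega)
    · exact (hB x).trans (by omega)
  | query y e s a q h =>
    simp only [Function.update_apply]; split
    · omega
    · exact (hB x).trans (by omega)
  | seq c d s s1 s2 t t' _ _ ih1 ih2 =>
    have := ih2 (ih1 hB) x; omega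
  | iteTrue e c d s s1 t he _ ih => have := ih hB x; omega
  | iteFalse e c d s s1 t he _ ih => have := ih hB x; omega
  | whileFalse e c s he => exact (hB x).trans (by omega)
  | whileTrue e c s s1 s2 t t' he _ _ ih1 ih2 =>
    have := ih2 (ih1 hB) x; omega

/-- Answers and next states are determined by the query. -/
def Oracle.Functional (O : Oracle σ) : Prop :=
  ∀ q d a a' q' q'', O q d a q' → O q d a' q'' → a = a' ∧ q' = q''

/-- Serves to show that an adversary whose run has been constructed has no other run with a
different guess. -/
theorem Exec.deterministic (hO : O.Functional) {c : Prog} {s s₁ s₂ : Config σ} {t₁ t₂ : ℕ}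
    (h₁ : Exec O ω c s t₁ s₁) (h₂ : Exec O ω c s t₂ s₂) : t₁ = t₂ ∧ s₁ = s₂ := by
  induction h₁ generalizing t₂ s₂ with
  | skip s => cases h₂; exact ⟨rfl, rfl⟩
  | assign y e s => cases h₂; exact ⟨rfl, rfl⟩
  | flip y s => cases h₂; exact ⟨rfl, rfl⟩
  | query y e s a q h =>
    cases h₂ with
    | query _ _ _ a' q' h' => obtain ⟨rfl, rfl⟩ := hO _ _ _ _ _ _ h h'; exact ⟨rfl, rfl⟩
  | seq c d s s1 s2 t t' _ _ ih1 ih2 =>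
    cases h₂ with
    | seq _ _ _ r1 r2 t1 t2 e1 e2 =>
      obtain ⟨rfl, rfl⟩ := ih1 e1
      obtain ⟨rfl, rfl⟩ := ih2 e2
      exact ⟨rfl, rfl⟩
  | iteTrue e c d s s1 t he _ ih =>
    cases h₂ with
    | iteTrue _ _ _ _ _ _ he' e1 => obtain ⟨rfl, rfl⟩ := ih e1; exact ⟨rfl, rfl⟩
    | iteFalse _ _ _ _ _ _ he' e1 => exact absurd he' he
  | iteFalse e c d s s1 t he _ ih =>
    cases h₂ with
    | iteTrue _ _ _ _ _ _ he' e1 => exact absurd he he'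
    | iteFalse _ _ _ _ _ _ he' e1 => obtain ⟨rfl, rfl⟩ := ih e1; exact ⟨rfl, rfl⟩
  | whileFalse e c s he =>
    cases h₂ with
    | whileFalse => exact ⟨rfl, rfl⟩
    | whileTrue _ _ _ _ _ _ _ he' => exact absurd he he'
  | whileTrue e c s s1 s2 t t' he _ _ ih1 ih2 =>
    cases h₂ with
    | whileFalse _ _ _ he' => exact absurd he' he
    | whileTrue _ _ _ _ _ _ _ he' e1 e2 =>
      obtain ⟨rfl, rfl⟩ := ih1 e1
      obtain ⟨rfl, rfl⟩ := ih2 e2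
      exact ⟨rfl, rfl⟩

/-- The program `c`, started in `s`, halts after at most `B` steps in a configuration that
satisfies `Q`. -/
def Ev (O : Oracle σ) (ω : ℕ → Bool) (c : Prog) (s : Config σ) (B : ℕ) (Q : Config σ → Prop) :
    Prop :=
  ∃ t s', Exec O ω c s t s' ∧ t ≤ B ∧ Q s'

theorem Ev.mono {c : Prog} {s : Config σ} {B B' : ℕ} {Q Q' : Config σ → Prop}
    (h : Ev O ω c s B Q) (hB : B ≤ B') (hQ : ∀ s', Q s' → Q' s') : Ev O ω c s B' Q' := by
  obtain ⟨t, s', e, ht, hq⟩ := h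
  exact ⟨t, s', e, ht.trans hB, hQ _ hq⟩

theorem Ev.seq {c d : Prog} {s : Config σ} {B B' : ℕ} {Q Q' : Config σ → Prop}
    (h : Ev O ω c s B Q) (h' : ∀ s', Q s' → Ev O ω d s' B' Q') :
    Ev O ω (.seq c d) s (B + B') Q' := by
  obtain ⟨t, s', e, ht, hq⟩ := h
  obtain ⟨t', s'', e', ht', hq'⟩ := h' s' hq
  exact ⟨_, _, .seq _ _ _ _ _ _ _ e e', by omega, hq'⟩

theorem Ev.skip {s : Config σ} {Q : Config σ → Prop} (h : Q s) : Ev O ω .skip s 1 Q :=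
  ⟨_, _, .skip s, le_rfl, h⟩

theorem Ev.assign {x : ℕ} {e : Expr} {s : Config σ} {B : ℕ} {Q : Config σ → Prop}
    (hB : (e.eval s.store).size ≤ B)
    (h : Q ⟨Function.update s.store x (e.eval s.store), s.coins, s.oracle⟩) :
    Ev O ω (.assign x e) s (1 + B) Q :=
  ⟨_, _, .assign x e s, by omega, h⟩

/-- Assignment followed by a program. -/
theorem Ev.assign_seq {x : ℕ} {e : Expr} {d : Prog} {s : Config σ} {B B' : ℕ}
    {Q : Config σ → Prop} (hB : (e.eval s.store).size ≤ B)
    (h : Ev O ω d ⟨Function.update s.store x (e.eval s.store), s.coins, s.oracle⟩ B' Q) :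
    Ev O ω (.seq (.assign x e) d) s (1 + B + B') Q :=
  (Ev.assign (Q := (· = _)) hB rfl).seq (by rintro _ rfl; exact h)

theorem Ev.ite {e : Expr} {c d : Prog} {s : Config σ} {B : ℕ} {Q : Config σ → Prop}
    (h₁ : e.eval s.store ≠ .nil → Ev O ω c s B Q) (h₂ : e.eval s.store = .nil → Ev O ω d s B Q) :
    Ev O ω (.ite e c d) s (1 + B) Q := by
  by_cases he : e.eval s.store = .nil
  · obtain ⟨t, s', e', ht, hq⟩ := h₂ he
    exact ⟨_, _, .iteFalse _ _ _ _ _ _ he e', by omega, hq⟩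
  · obtain ⟨t, s', e', ht, hq⟩ := h₁ he
    exact ⟨_, _, .iteTrue _ _ _ _ _ _ he e', by omega, hq⟩

/-- A loop that runs through the list in variable `k`. -/
def Prog.forList (k : ℕ) (c : Prog) : Prog :=
  .while (.var k) (.seq c (.assign k (.tail (.var k))))

/-- The loop overwrites variable `k`, so the invariant must not depend on it (`hI`) and the body
must leave it alone. The summand `C` pays for writing down the rest of the list in each round. -/
theorem Ev.forList {k : ℕ} {c : Prog} {N B C : ℕ} (I : ℕ → Config σ → Prop)
    (hI : ∀ j s d, I j s → I j ⟨Function.update s.store k d, s.coins, s.oracle⟩)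
    (hc : ∀ j < N, ∀ s, I j s → Ev O ω c s B fun s' => I (j + 1) s' ∧ s'.store k = s.store k)
    (l : List Data) (j : ℕ) (hj : j + l.length = N) (hC : (Data.ofList l).size ≤ C) (s : Config σ)
    (hs : I j s) (hk : s.store k = Data.ofList l) :
    Ev O ω (Prog.forList k c) s (l.length * (B + C + 2) + 1) (I N) := by
  induction l generalizing j s with
  | nil =>
    obtain rfl : j = N := by simpa using hj
    exact ⟨_, _, .whileFalse _ _ _ (by simpa [Expr.eval] using hk), by omega, hs⟩
  | cons a l ih =>
    simp only [List.length_cons] at hj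
    have hC' : (Data.ofList l).size ≤ C := le_trans (by simp [Data.size]) hC
    obtain ⟨t, s', e, ht, hi, hk'⟩ := hc j (by omega) s hs
    have e2 := Exec.assign (O := O) (ω := ω) k (.tail (.var k)) s'
    have hv : (Expr.tail (.var k)).eval s'.store = Data.ofList l := by
      simp [Expr.eval, hk', hk]
    rw [hv] at e2
    obtain ⟨t2, s2, e3, ht2, hq⟩ := ih (j + 1) (by omega) hC' _ (hI _ _ (Data.ofList l) hi) (by simp)
    refine ⟨_, _, .whileTrue _ _ _ _ _ _ _ ?_ (.seq _ _ _ _ _ _ _ e e2) e3, ?_, hq⟩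
    · simp [Expr.eval, hk]
    · rw [List.length_cons, add_mul]; omega

end Exec


/-! ## Polynomial-time functions -/

theorem Polynomial.eval_nat_mono (p : Polynomial ℕ) {a b : ℕ} (h : a ≤ b) :
    p.eval a ≤ p.eval b := by
  rw [Polynomial.eval_eq_sum_range, Polynomial.eval_eq_sum_range]
  gcongr

theorem Data.length_le_size : ∀ l : List Data, l.length ≤ (ofList l).size
  | [] => by simp
  | a :: l => by have := length_le_size l; simp [size]; omega

/-- The configurations agree from variable `M` on, and in coins and oracle state. -/
def Config.Same {σ : Type} (M : ℕ) (s s' : Config σ) : Prop :=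
  (∀ x ≥ M, s'.store x = s.store x) ∧ s'.coins = s.coins ∧ s'.oracle = s.oracle

theorem Config.Same.refl {σ : Type} (M : ℕ) (s : Config σ) : Config.Same M s s :=
  ⟨fun _ _ => rfl, rfl, rfl⟩

theorem Config.Same.trans {σ : Type} {M : ℕ} {s s' s'' : Config σ} (h : Config.Same M s s')
    (h' : Config.Same M s' s'') : Config.Same M s s'' :=
  ⟨fun x hx => (h'.1 x hx).trans (h.1 x hx), h'.2.1.trans h.2.1, h'.2.2.trans h.2.2⟩

theorem Config.Same.mono {σ : Type} {M M' : ℕ} {s s' : Config σ} (h : Config.Same M s s')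
    (hM : M ≤ M') : Config.Same M' s s' :=
  ⟨fun x hx => h.1 x (hM.trans hx), h.2⟩

/-- The program `c` computes `inp i ↦ out i` in variable `0`, whatever the other variables
contain, in time `p`, and uses no variables from `M` on. -/
def FPWith {ι : Type} (c : Prog) (p : Polynomial ℕ) (M : ℕ) (inp out : ι → Data) : Prop :=
  ∀ i, (out i).size ≤ p.eval (inp i).size ∧
    ∀ {σ : Type} (O : Oracle σ) (ω : ℕ → Bool) (s : Config σ), s.store 0 = inp i →
      Ev O ω c s (p.eval (inp i).size) fun s' => s'.store 0 = out i ∧ Config.Same M s s'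

/-- `inp i ↦ out i` is computed in polynomial time by a program that can be used as a
subroutine. -/
def FP {ι : Type} (inp out : ι → Data) : Prop :=
  ∃ (c : Prog) (p : Polynomial ℕ) (M : ℕ), 0 < M ∧ FPWith c p M inp out

theorem FPWith.mono {ι : Type} {c : Prog} {p : Polynomial ℕ} {M M' : ℕ} {inp out : ι → Data}
    (h : FPWith c p M inp out) (hM : M ≤ M') : FPWith c p M' inp out := fun i =>
  ⟨(h i).1, fun O ω s hs => ((h i).2 O ω s hs).mono le_rfl fun _ h' => ⟨h'.1, h'.2.mono hM⟩⟩

/-- Set the variables `1, …, n` to `nil`. -/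
def Prog.clear : ℕ → Prog
  | 0 => .skip
  | n + 1 => .seq (.assign (n + 1) .nil) (clear n)

theorem Ev.clear {σ : Type} {O : Oracle σ} {ω : ℕ → Bool} (n : ℕ) (s : Config σ) :
    Ev O ω (Prog.clear n) s (2 * n + 1) fun s' =>
      s'.store 0 = s.store 0 ∧ (∀ x, 1 ≤ x → x ≤ n → s'.store x = .nil) ∧
        Config.Same (n + 1) s s' := by
  induction n generalizing s with
  | zero => exact Ev.skip ⟨rfl, fun x h h' => by omega, Config.Same.refl _ _⟩
  | succ n ih =>
    refine ((Ev.assign_seq (B := 1) (by simp [Expr.eval, Data.size]) (ih _))).mono (by omega) ?_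
    rintro s' ⟨h0, h1, h2, h3⟩
    refine ⟨by simpa using h0, fun x hx hx' => ?_, fun x hx => ?_, h3⟩
    · rcases Nat.lt_or_ge n x with h | h
      · rw [h2 x (by omega)]; simp [show x = n + 1 by omega, Expr.eval]
      · exact h1 x hx h
    · rw [h2 x (by omega)]; simp only [Function.update_apply]; rw [if_neg (by omega)]

/-- `PolyTime` promises a run only from a store that is `nil` outside variable `0`; clearing the
variables of `c` first makes every store suitable. The size of the output is bounded through the
running time, by `Exec.size_le`. -/
theorem PolyTime.fp {ι : Type} {inp out : ι → Data} (h : PolyTime inp out) : FP inp out := by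
  obtain ⟨c, p, h⟩ := h
  refine ⟨.seq (.clear c.vars) c.det, .C (2 * c.vars + 1) + 3 * p + .X, c.vars + 1, by omega,
    fun i => ⟨?_, fun O ω s hs => ?_⟩⟩
  · obtain ⟨t, s', e, ht, ho, -⟩ := h i (fun _ => false)
    have := e.size_le (B := (inp i).size)
      (by intro x; dsimp only; split
          · exact le_rfl
          · exact Data.size_pos _) 0
    rw [ho] at this
    simp; omega
  · refine ((Ev.clear c.vars s).seq (B' := 2 * p.eval (inp i).size) ?_).mono ?_ fun _ h => h
    · rintro s₁ ⟨h0, h1, h2⟩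
      obtain ⟨t, s', e, ht, ho, -⟩ := h i (fun _ => false)
      obtain ⟨t', r', e', ht', hl, hg, hk, hq⟩ := e.transfer (O := O) (ω := ω)
        (M := c.vars + 1) (by omega) s₁ (by
          intro x hx
          dsimp only
          split
          · rw [‹x = 0›, h0, hs]
          · exact h1 x (by omega) (by omega))
      exact ⟨t', r', e', by omega, (hl 0 (by omega)).trans ho, h2.trans ⟨hg, hk, hq⟩⟩
    · simp; omega

namespace FP

variable {ι : Type} {inp : ι → Data}

theorem congr {out out' : ι → Data} (h : FP inp out) (he : ∀ i, out i = out' i) :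
    FP inp out' := by
  rwa [funext he] at h

theorem comap {κ : Type} {out : ι → Data} (h : FP inp out) (φ : κ → ι) :
    FP (fun k => inp (φ k)) fun k => out (φ k) := by
  obtain ⟨c, p, M, hM, h⟩ := h
  exact ⟨c, p, M, hM, fun k => h (φ k)⟩

theorem comp {mid out : ι → Data} (h : FP inp mid) (h' : FP mid out) : FP inp out := by
  obtain ⟨c, p, M, hM, h⟩ := h
  obtain ⟨c', p', M', hM', h'⟩ := h'
  have h := h.mono (le_max_left M M')
  have h' := h'.mono (le_max_right M M')
  have key : ∀ i, p'.eval (mid i).size ≤ (p'.comp p).eval (inp i).size := fun i => by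
    rw [Polynomial.eval_comp]; exact p'.eval_nat_mono (h i).1
  refine ⟨.seq c c', p + p'.comp p, max M M', by omega, fun i => ⟨?_, fun O ω s hs => ?_⟩⟩
  · have := (h' i).1
    have := key i
    simp only [Polynomial.eval_add]; omega
  · simp only [Polynomial.eval_add]
    refine ((h i).2 O ω s hs).seq fun s₁ h₁ => ?_
    exact ((h' i).2 O ω s₁ h₁.1).mono (key i) fun s₂ h₂ => ⟨h₂.1, h₁.2.trans h₂.2⟩

theorem id : FP inp inp :=
  ⟨.skip, 1 + .X, 1, one_pos, fun i => ⟨by simp, fun O ω s hs =>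
    (Ev.skip (Q := fun s' => s'.store 0 = inp i ∧ Config.Same 1 s s')
      ⟨hs, .refl _ _⟩).mono (by simp) fun _ h => h⟩⟩

theorem expr {e : Expr} (p : Polynomial ℕ) {out : ι → Data}
    (he : ∀ i (st : ℕ → Data), st 0 = inp i → e.eval st = out i)
    (hp : ∀ i, (out i).size ≤ p.eval (inp i).size) : FP inp out :=
  ⟨.assign 0 e, 1 + p, 1, one_pos, fun i =>
    ⟨(hp i).trans (by simp), fun O ω s hs => by
      have he := he i s.store hs
      refine (Ev.assign (B := p.eval (inp i).size)
        (Q := fun s' => s'.store 0 = out i ∧ Config.Same 1 s s')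
        (by rw [he]; exact hp i) ⟨?_, ?_, rfl, rfl⟩).mono (by simp) fun _ h => h
      · simp [he]
      · intro x hx; simp only [Function.update_apply]; rw [if_neg (by omega)]⟩⟩

theorem nil : FP inp fun _ => Data.nil :=
  expr (e := .nil) 1 (fun _ _ _ => rfl) (by simp [Data.size])

theorem head {a : ι → Data} (h : FP inp a) : FP inp fun i => (a i).head :=
  h.comp (expr (e := .head (.var 0)) .X (by simp +contextual [Expr.eval])
    (by simpa using fun i => (a i).size_head_le))

theorem tail {a : ι → Data} (h : FP inp a) : FP inp fun i => (a i).tail :=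
  h.comp (expr (e := .tail (.var 0)) .X (by simp +contextual [Expr.eval])
    (by simpa using fun i => (a i).size_tail_le))

theorem cons {a b : ι → Data} (h : FP inp a) (h' : FP inp b) :
    FP inp fun i => .cons (a i) (b i) := by
  obtain ⟨c, p, M₁, hM, h⟩ := h
  obtain ⟨c', p', M₂, hM', h'⟩ := h'
  set M := max M₁ M₂ with hMd
  have h := h.mono (show M₁ ≤ M by omega)
  have h' := h'.mono (show M₂ ≤ M by omega)
  -- Variables `M` and `M + 1` keep the input and the first result, since the subroutines may
  -- overwrite everything below `M`.
  refine ⟨.seq (.assign M (.var 0)) (.seq c (.seq (.assign (M + 1) (.var 0))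
    (.seq (.assign 0 (.var M)) (.seq c' (.assign 0 (.cons (.var (M + 1)) (.var 0))))))),
    (1 + .X) + (p + ((1 + p) + ((1 + .X) + (p' + (1 + (1 + p + p')))))), M + 2, by omega, fun i => ?_⟩
  have hsz : (Data.cons (a i) (b i)).size ≤
      1 + p.eval (inp i).size + p'.eval (inp i).size := by
    have := (h i).1
    have := (h' i).1
    simp only [Data.size]; omega
  refine ⟨by simp; omega, fun O ω s hs => ?_⟩
  simp only [Polynomial.eval_add, Polynomial.eval_one, Polynomial.eval_X]
  have hM0 : M ≠ 0 := by omega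
  refine Ev.assign_seq (by simp [Expr.eval, hs]) ?_
  refine ((h i).2 O ω _ (by simp [hM0.symm, hs])).seq ?_
  rintro s₁ ⟨h0, h1, h2, h3⟩
  refine Ev.assign_seq (by simpa [Expr.eval, h0] using (h i).1) ?_
  have e1 : s₁.store M = inp i := by rw [h1 _ le_rfl]; simp [Expr.eval, hs]
  refine Ev.assign_seq (by simp [Expr.eval, e1]) ?_
  refine ((h' i).2 O ω _ (by simp [Expr.eval, e1])).seq ?_
  rintro s₂ ⟨g0, g1, g2, g3⟩
  have e2 : s₂.store (M + 1) = a i := by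
    rw [g1 _ (by omega)]; simp [Expr.eval, h0]
  refine Ev.assign (by simpa [Expr.eval, e2, g0] using hsz) ⟨by simp [Expr.eval, e2, g0], ?_, ?_, ?_⟩
  · intro x hx
    simp only [Function.update_apply]
    rw [if_neg (by omega), g1 x (by omega)]
    simp only [Function.update_apply]
    rw [if_neg (by omega), if_neg (by omega), h1 x (by omega)]
    simp only [Function.update_apply]
    rw [if_neg (by omega)]
  · simp [g2, h2]
  · simp [g3, h3]

/-- Each branch has to be computed only for the indices that take it. In this way index types carry
the promises under which a subroutine is used. -/
theorem ite {t out : ι → Data} (ht : FP inp t)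
    (h₁ : FP (fun i : {i // t i ≠ .nil} => inp i) fun i => out i)
    (h₂ : FP (fun i : {i // t i = .nil} => inp i) fun i => out i) : FP inp out := by
  obtain ⟨c, p, M₀, hM, h⟩ := ht
  obtain ⟨c₁, p₁, M₁, hM₁, h₁⟩ := h₁
  obtain ⟨c₂, p₂, M₂, hM₂, h₂⟩ := h₂
  set M := max M₀ (max M₁ M₂) with hMd
  have h := h.mono (show M₀ ≤ M by omega)
  have h₁ := h₁.mono (show M₁ ≤ M by omega)
  have h₂ := h₂.mono (show M₂ ≤ M by omega)
  refine ⟨.seq (.assign M (.var 0)) (.seq c (.seq (.assign (M + 1) (.var 0))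
    (.seq (.assign 0 (.var M)) (.ite (.var (M + 1)) c₁ c₂)))),
    (1 + .X) + (p + ((1 + p) + ((1 + .X) + (1 + (p₁ + p₂))))), M + 2, by omega, fun i => ?_⟩
  refine ⟨?_, fun O ω s hs => ?_⟩
  · simp only [Polynomial.eval_add, Polynomial.eval_one, Polynomial.eval_X]
    by_cases hi : t i = .nil
    · have := (h₂ ⟨i, hi⟩).1; dsimp only at this; omega
    · have := (h₁ ⟨i, hi⟩).1; dsimp only at this; omega
  simp only [Polynomial.eval_add, Polynomial.eval_one, Polynomial.eval_X]
  have hM0 : M ≠ 0 := by omega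
  refine Ev.assign_seq (by simp [Expr.eval, hs]) ?_
  refine ((h i).2 O ω _ (by simp [hM0.symm, hs])).seq ?_
  rintro s₁ ⟨h0, k1, k2, k3⟩
  refine Ev.assign_seq (by simpa [Expr.eval, h0] using (h i).1) ?_
  have e1 : s₁.store M = inp i := by rw [k1 _ le_rfl]; simp [Expr.eval, hs]
  refine Ev.assign_seq (by simp [Expr.eval, e1]) ?_
  set r : Config _ := _
  change Ev O ω (Prog.ite (Expr.var (M + 1)) c₁ c₂) r _ _
  have r0 : r.store 0 = inp i := by simp [r, Expr.eval, e1]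
  have r1 : r.store (M + 1) = t i := by simp [r, Expr.eval, h0]
  have fin : ∀ s₂ : Config _, Config.Same M r s₂ → Config.Same (M + 2) s s₂ := by
    rintro s₂ ⟨g1, g2, g3⟩
    refine ⟨fun x hx => ?_, g2.trans k2, g3.trans k3⟩
    rw [g1 x (by omega)]
    simp only [r, Function.update_apply]
    rw [if_neg (by omega), if_neg (by omega), k1 x (by omega)]
    simp only [Function.update_apply]
    rw [if_neg (by omega)]
  refine Ev.ite (fun hi => ?_) fun hi => ?_
  · exact ((h₁ ⟨i, by rwa [← r1]⟩).2 O ω _ r0).mono (by simp) fun s₂ hs₂ => ⟨hs₂.1, fin _ hs₂.2⟩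
  · exact ((h₂ ⟨i, by rwa [← r1]⟩).2 O ω _ r0).mono (by simp) fun s₂ hs₂ => ⟨hs₂.1, fin _ hs₂.2⟩

/-- Polynomial time of a single step does not control the growth under iteration, hence the separate
bound `hP` for all intermediate states. -/
theorem iter {l : ι → List Data} {st : ι → ℕ → Data} (P : Polynomial ℕ)
    (hl : FP inp fun i => .ofList (l i)) (h0 : FP inp fun i => st i 0)
    (hs : FP (fun p : {p : ι × ℕ // p.2 < (l p.1).length} => st p.1.1 p.1.2)
      fun p => st p.1.1 (p.1.2 + 1))
    (hP : ∀ i, ∀ k ≤ (l i).length, (st i k).size ≤ P.eval (inp i).size) :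
    FP inp fun i => st i (l i).length := by
  obtain ⟨c, p, M₀, hM, h⟩ := hl
  obtain ⟨c₁, p₁, M₁, hM₁, h₁⟩ := h0
  obtain ⟨c₂, p₂, M₂, hM₂, h₂⟩ := hs
  set M := max M₀ (max M₁ M₂) with hMd
  have h := h.mono (show M₀ ≤ M by omega)
  have h₁ := h₁.mono (show M₁ ≤ M by omega)
  have h₂ := h₂.mono (show M₂ ≤ M by omega)
  refine ⟨.seq (.assign M (.var 0)) (.seq c (.seq (.assign (M + 1) (.var 0))
    (.seq (.assign 0 (.var M)) (.seq c₁ (.forList (M + 1) c₂))))),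
    (1 + .X) + (p + ((1 + p) + ((1 + .X) + (p₁ + (p * (p₂.comp P + p + 2) + 1 + P))))), M + 2,
    by omega, fun i => ?_⟩
  refine ⟨?_, fun O ω s hs => ?_⟩
  · have := hP i _ le_rfl
    simp only [Polynomial.eval_add]; omega
  have hlen : (l i).length ≤ p.eval (inp i).size := (Data.length_le_size _).trans (h i).1
  simp only [Polynomial.eval_add, Polynomial.eval_one, Polynomial.eval_X, Polynomial.eval_mul,
    Polynomial.eval_comp, Polynomial.eval_ofNat]
  have hM0 : M ≠ 0 := by omega
  refine Ev.assign_seq (by simp [Expr.eval, hs]) ?_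
  refine ((h i).2 O ω _ (by simp [hM0.symm, hs])).seq ?_
  rintro s₁ ⟨h0, k1, k2, k3⟩
  refine Ev.assign_seq (by simpa [Expr.eval, h0] using (h i).1) ?_
  have e1 : s₁.store M = inp i := by rw [k1 _ le_rfl]; simp [Expr.eval, hs]
  refine Ev.assign_seq (by simp [Expr.eval, e1]) ?_
  refine ((h₁ i).2 O ω _ (by simp [Expr.eval, e1])).seq ?_
  rintro s₂ ⟨g0, g1, g2, g3⟩
  refine (Ev.forList (B := p₂.eval (P.eval (inp i).size)) (C := p.eval (inp i).size)
    (I := fun k s' => s'.store 0 = st i k ∧ Config.Same (M + 2) s s') (k := M + 1) ?_ ?_ (l i) 0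
    (Nat.zero_add _) (h i).1 s₂ ?_ ?_).mono ?_ fun _ h => h
  · rintro j s' d ⟨j1, j2, j3, j4⟩
    refine ⟨by simp [j1], fun x hx => ?_, j3, j4⟩
    simp only [Function.update_apply]
    rw [if_neg (by omega), j2 x hx]
  · rintro j hj s' ⟨j1, j2⟩
    refine ((h₂ ⟨(i, j), hj⟩).2 O ω s' j1).mono (p₂.eval_nat_mono (hP i j hj.le)) ?_
    rintro s₃ ⟨m1, m2⟩
    exact ⟨⟨m1, j2.trans (m2.mono (by omega))⟩, m2.1 _ (by omega)⟩
  · refine ⟨g0, fun x hx => ?_, g2.trans k2, g3.trans k3⟩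
    rw [g1 x (by omega)]
    simp only [Function.update_apply]
    rw [if_neg (by omega), if_neg (by omega), k1 x (by omega)]
    simp only [Function.update_apply]
    rw [if_neg (by omega)]
  · rw [g1 _ (by omega)]; simp [Expr.eval, h0]
  · refine (Nat.add_le_add_right (Nat.mul_le_mul_right _ hlen) 1).trans (by omega)

end FP


/-! ## Polynomial-time functions on lists of bits -/

/-- `f` is bounded by a polynomial in the size of the input. -/
def PolyBdd {ι : Type} (inp : ι → Data) (f : ι → ℕ) : Prop :=
  ∃ P : Polynomial ℕ, ∀ i, f i ≤ P.eval (inp i).size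

namespace PolyBdd

variable {ι : Type} {inp : ι → Data} {f g : ι → ℕ}

theorem const (n : ℕ) : PolyBdd inp fun _ => n := ⟨.C n, by simp⟩

theorem add (hf : PolyBdd inp f) (hg : PolyBdd inp g) : PolyBdd inp fun i => f i + g i := by
  obtain ⟨P, hP⟩ := hf
  obtain ⟨R, hR⟩ := hg
  exact ⟨P + R, fun i => by simpa using Nat.add_le_add (hP i) (hR i)⟩

theorem mul (hf : PolyBdd inp f) (hg : PolyBdd inp g) : PolyBdd inp fun i => f i * g i := by
  obtain ⟨P, hP⟩ := hf
  obtain ⟨R, hR⟩ := hg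
  exact ⟨P * R, fun i => by simpa using Nat.mul_le_mul (hP i) (hR i)⟩

theorem mono (hf : PolyBdd inp f) (h : ∀ i, g i ≤ f i) : PolyBdd inp g := by
  obtain ⟨P, hP⟩ := hf
  exact ⟨P, fun i => (h i).trans (hP i)⟩

end PolyBdd

theorem FP.size {ι : Type} {inp out : ι → Data} (h : FP inp out) :
    PolyBdd inp fun i => (out i).size := by
  obtain ⟨c, p, M, -, h⟩ := h
  exact ⟨p, fun i => (h i).1⟩

namespace Data

theorem size_ofList : ∀ l : List Data, (ofList l).size = 1 + (l.map fun d => 1 + d.size).sum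
  | [] => rfl
  | a :: l => by simp [size, size_ofList l]; omega

theorem size_ofBits_le (l : List Bool) : (ofBits l).size ≤ 1 + 4 * l.length := by
  induction l with
  | nil => simp [ofBits, size]
  | cons b l ih => have := size_ofBool_le b; simp [ofBits, size]; omega

theorem length_le_size_ofBits (l : List Bool) : l.length ≤ (ofBits l).size := by
  rw [ofBits_eq_ofList]; simpa using length_le_size (l.map ofBool)

theorem size_unary (k : ℕ) : (unary k).size = 1 + 4 * k := by
  rw [unary, ofBits_eq_ofList, size_ofList]
  simp [ofBool, size, mul_comm]

@[simp] theorem ofBits_nil : ofBits [] = nil := rfl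
@[simp] theorem ofBits_cons (b : Bool) (l : List Bool) :
    ofBits (b :: l) = cons (ofBool b) (ofBits l) := rfl

theorem unary_add (a b : ℕ) : unary (a + b) = ofBits (List.replicate a true ++ List.replicate b true) := by
  rw [unary, List.replicate_add]

theorem unary_eq_ofList (k : ℕ) : unary k = ofList (List.replicate k (ofBool true)) := by
  rw [unary, ofBits_eq_ofList, List.map_replicate]

end Data

namespace FP

open Data (ofList ofBits ofBool unary)

variable {ι : Type} {inp : ι → Data}

/-- A function computed on a larger index type. -/
theorem of {κ : Type} {a b : κ → Data} (h : FP a b) (φ : ι → κ)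
    (ha : FP inp fun i => a (φ i)) : FP inp fun i => b (φ i) :=
  ha.comp (h.comap φ)

theorem congr₂ {inp' out out' : ι → Data} (h : FP inp out) (hi : ∀ i, inp i = inp' i)
    (he : ∀ i, out i = out' i) : FP inp' out' := by
  rwa [funext he, funext hi] at h

theorem const : ∀ d : Data, FP inp fun _ => d
  | .nil => nil
  | .cons a b => cons (const a) (const b)

theorem ite_bool {c : ι → Bool} {a b : ι → Data} (hc : FP inp fun i => ofBool (c i))
    (ha : FP inp a) (hb : FP inp b) : FP inp fun i => if c i then a i else b i :=
  hc.ite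
    ((ha.comap _).congr fun i => by
      have := Data.ofBool_ne_nil.1 i.2; simp [this])
    ((hb.comap _).congr fun i => by
      have := Data.ofBool_eq_nil.1 i.2; simp [this])

theorem not {c : ι → Bool} (hc : FP inp fun i => ofBool (c i)) :
    FP inp fun i => ofBool (!c i) :=
  (hc.ite_bool (const (ofBool false)) (const (ofBool true))).congr fun i => by cases c i <;> rfl

theorem and {c d : ι → Bool} (hc : FP inp fun i => ofBool (c i))
    (hd : FP inp fun i => ofBool (d i)) : FP inp fun i => ofBool (c i && d i) :=
  (hc.ite_bool hd (const (ofBool false))).congr fun i => by cases c i <;> rfl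

theorem or {c d : ι → Bool} (hc : FP inp fun i => ofBool (c i))
    (hd : FP inp fun i => ofBool (d i)) : FP inp fun i => ofBool (c i || d i) :=
  (hc.ite_bool (const (ofBool true)) hd).congr fun i => by cases c i <;> rfl

theorem beq {c d : ι → Bool} (hc : FP inp fun i => ofBool (c i))
    (hd : FP inp fun i => ofBool (d i)) : FP inp fun i => ofBool (c i == d i) :=
  (hc.ite_bool hd hd.not).congr fun i => by cases c i <;> cases d i <;> rfl

/-- Whether a value is not `nil`. -/
theorem isCons {a : ι → Data} {c : ι → Bool} (ha : FP inp a) (hc : ∀ i, c i = true ↔ a i ≠ .nil) :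
    FP inp fun i => ofBool (c i) :=
  ha.ite ((const (ofBool true)).congr fun i => by rw [(hc i).2 i.2])
    ((const (ofBool false)).congr fun i => by
      have : c i = false := by
        have := mt (hc i).1 (not_not.2 i.2); simpa using this
      rw [this])

/-- Iterates on pairs of the remaining list and the accumulator. The bound `B` is required for the
accumulators of all prefixes, for the reason given at `iter`. -/
theorem foldl {α β : Type} {encα : α → Data} {encβ : β → Data} {g : α → β → α}
    {l : ι → List β} {a : ι → α} {B : ι → ℕ} (hl : FP inp fun i => ofList ((l i).map encβ))
    (ha : FP inp fun i => encα (a i))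
    (hg : FP (fun p : α × β => .cons (encα p.1) (encβ p.2)) fun p => encα (g p.1 p.2))
    (hB : PolyBdd inp B)
    (h : ∀ i k, (encα (((l i).take k).foldl g (a i))).size ≤ B i) :
    FP inp fun i => encα ((l i).foldl g (a i)) := by
  obtain ⟨P, hP⟩ := hB
  obtain ⟨R, hR⟩ := hl.size
  have key := iter (st := fun i k => .cons (ofList (((l i).drop k).map encβ))
    (encα (((l i).take k).foldl g (a i)))) (1 + R + P) hl (cons (by simpa using hl) (by simpa using ha))
    (?_) (?_)
  · exact key.tail.congr fun i => by simp
  · have hg' : FP (fun p : α × (β × Data) => .cons (.cons (encβ p.2.1) p.2.2) (encα p.1))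
        fun p => .cons p.2.2 (encα (g p.1 p.2.1)) :=
      cons id.head.tail (hg.of (fun p : α × (β × Data) => (p.1, p.2.1)) (cons id.tail id.head.head))
    refine (hg'.comap fun p : {p : ι × ℕ // p.2 < ((l p.1).map encβ).length} =>
      (((l p.1.1).take p.1.2).foldl g (a p.1.1), ((l p.1.1)[p.1.2]'(by simpa using p.2),
        ofList (((l p.1.1).drop (p.1.2 + 1)).map encβ)))).congr₂ (fun p => ?_) fun p => ?_
    · have hp : p.1.2 < (l p.1.1).length := by simpa using p.2
      dsimp only
      rw [List.drop_eq_getElem_cons hp]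
      rfl
    · have hp : p.1.2 < (l p.1.1).length := by simpa using p.2
      dsimp only
      rw [List.take_succ_eq_append_getElem hp, List.foldl_append]
      rfl
  · intro i k _
    have h1 := h i k
    have h2 := hP i
    have h3 : (ofList ((l i).map encβ)).size ≤ _ := hR i
    have h4 : (ofList (((l i).drop k).map encβ)).size ≤ (ofList ((l i).map encβ)).size := by
      have : ((((l i).drop k).map encβ).map fun d => 1 + d.size).sum ≤
          (((l i).map encβ).map fun d => 1 + d.size).sum :=
        (((l i).drop_sublist k).map encβ |>.map _).sum_le_sum (fun _ _ => Nat.zero_le _)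
      rw [Data.size_ofList, Data.size_ofList]; omega
    simp only [Data.size, Polynomial.eval_add, Polynomial.eval_one]
    omega

theorem revAppend {l r : ι → List Data} (hl : FP inp fun i => ofList (l i))
    (hr : FP inp fun i => ofList (r i)) : FP inp fun i => ofList ((l i).reverse ++ r i) := by
  refine (foldl (encα := ofList) (encβ := fun d => d) (g := fun r d => d :: r) (l := l) (a := r)
    (B := fun i => (ofList (l i)).size + (ofList (r i)).size) (by simpa using hl) hr
    (cons id.tail id.head) (hl.size.add hr.size) fun i k => ?_).congr fun i => ?_
  · have : (((l i).take k).map fun d => 1 + d.size).sum ≤ ((l i).map fun d => 1 + d.size).sum :=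
      (((l i).take_sublist k).map _).sum_le_sum (fun _ _ => Nat.zero_le _)
    rw [show ((l i).take k).foldl (fun r d => d :: r) (r i) = ((l i).take k).reverse ++ r i by simp]
    simp only [Data.size_ofList, List.map_append, List.map_reverse, List.sum_append,
      List.sum_reverse]
    omega
  · simp

theorem reverse {l : ι → List Data} (hl : FP inp fun i => ofList (l i)) :
    FP inp fun i => ofList (l i).reverse := by
  simpa using hl.revAppend (r := fun _ => []) nil

theorem append {l r : ι → List Data} (hl : FP inp fun i => ofList (l i))
    (hr : FP inp fun i => ofList (r i)) : FP inp fun i => ofList (l i ++ r i) := by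
  simpa using hl.reverse.revAppend hr

theorem reverse_bits {l : ι → List Bool} (hl : FP inp fun i => ofBits (l i)) :
    FP inp fun i => ofBits (l i).reverse := by
  simp only [Data.ofBits_eq_ofList, List.map_reverse] at *
  exact hl.reverse

theorem append_bits {l r : ι → List Bool} (hl : FP inp fun i => ofBits (l i))
    (hr : FP inp fun i => ofBits (r i)) : FP inp fun i => ofBits (l i ++ r i) := by
  simp only [Data.ofBits_eq_ofList, List.map_append] at *
  exact hl.append hr

theorem foldl_bits {α : Type} {encα : α → Data} {g : α → Bool → α}
    {l : ι → List Bool} {a : ι → α} {B : ι → ℕ} (hl : FP inp fun i => ofBits (l i))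
    (ha : FP inp fun i => encα (a i))
    (hg : FP (fun p : α × Bool => .cons (encα p.1) (ofBool p.2)) fun p => encα (g p.1 p.2))
    (hB : PolyBdd inp B)
    (h : ∀ i k, (encα (((l i).take k).foldl g (a i))).size ≤ B i) :
    FP inp fun i => encα ((l i).foldl g (a i)) :=
  foldl (by simpa only [Data.ofBits_eq_ofList] using hl) ha hg hB h

theorem unary_add {a b : ι → ℕ} (ha : FP inp fun i => unary (a i))
    (hb : FP inp fun i => unary (b i)) : FP inp fun i => unary (a i + b i) :=
  (append_bits ha hb).congr fun _ => (Data.unary_add _ _).symm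

theorem unary_length {l : ι → List Data} (hl : FP inp fun i => ofList (l i)) :
    FP inp fun i => unary (l i).length := by
  refine (foldl (encα := unary) (encβ := fun d => d) (g := fun n _ => n + 1) (l := l)
    (a := fun _ => 0) (B := fun i => 1 + 4 * (ofList (l i)).size) (by simpa using hl)
    (const _) ((cons (const (ofBool true)) id.head).congr fun _ => rfl)
    ((PolyBdd.const 1).add ((PolyBdd.const 4).mul hl.size)) fun i k => ?_).congr fun i => ?_
  · have := Data.length_le_size (l i)
    simp [Data.size_unary]; omega
  · simp

theorem unary_length_bits {l : ι → List Bool} (hl : FP inp fun i => ofBits (l i)) :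
    FP inp fun i => unary (l i).length := by
  simp only [Data.ofBits_eq_ofList] at hl
  simpa using hl.unary_length

theorem unary_mul {a b : ι → ℕ} (ha : FP inp fun i => unary (a i))
    (hb : FP inp fun i => unary (b i)) : FP inp fun i => unary (a i * b i) := by
  have key := foldl_bits (encα := fun p : ℕ × ℕ => .cons (unary p.1) (unary p.2))
    (g := fun p _ => (p.1, p.1 + p.2)) (l := fun i => List.replicate (a i) true)
    (a := fun i => (b i, 0))
    (B := fun i => 1 + (1 + 4 * (unary (b i)).size) + (1 + 4 * ((unary (a i)).size * (unary (b i)).size)))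
    ha (cons hb (const _))
    (cons id.head.head (unary_add id.head.head id.head.tail))
    (((PolyBdd.const 1).add ((PolyBdd.const 1).add ((PolyBdd.const 4).mul hb.size))).add
      ((PolyBdd.const 1).add ((PolyBdd.const 4).mul (ha.size.mul hb.size)))) ?_
  · refine key.tail.congr fun i => ?_
    have : ∀ n c, (List.replicate n true).foldl (fun (p : ℕ × ℕ) _ => (p.1, p.1 + p.2)) (b i, c)
        = (b i, n * b i + c) := by
      intro n
      induction n with
      | zero => simp
      | succ n ih => intro c; simp [List.replicate_succ, ih]; ring
    simp [this]
  · intro i k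
    have : ∀ n c, (List.replicate n true).foldl (fun (p : ℕ × ℕ) _ => (p.1, p.1 + p.2)) (b i, c)
        = (b i, n * b i + c) := by
      intro n
      induction n with
      | zero => simp
      | succ n ih => intro c; simp [List.replicate_succ, ih]; ring
    simp only [List.take_replicate, this, Data.size, Data.size_unary]
    have : min k (a i) * b i ≤ (1 + 4 * a i) * (1 + 4 * b i) :=
      Nat.mul_le_mul (by omega) (by omega)
    omega

theorem unary_eval (p : Polynomial ℕ) {a : ι → ℕ} (ha : FP inp fun i => unary (a i)) :
    FP inp fun i => unary (p.eval (a i)) := by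
  induction p using Polynomial.induction_on with
  | C n => simpa using const (unary n)
  | add p q hp hq => simpa using hp.unary_add hq
  | monomial n m h =>
    refine (h.unary_mul ha).congr fun i => ?_
    simp [pow_succ, mul_assoc]

end FP


/-- The truth value of a tree in a test. -/
def Data.toBool : Data → Bool
  | nil => false
  | cons _ _ => true

theorem Data.toBool_iff {d : Data} : d.toBool = true ↔ d ≠ .nil := by cases d <;> simp [toBool]

/-! ### Arithmetic on lists of bits -/

namespace Bits

/-- The number with the given binary digits, least significant first. -/
def val : List Bool → ℕ
  | [] => 0
  | b :: l => b.toNat + 2 * val l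

/-- The `k` low bits of a number. -/
def ofNat (k x : ℕ) : List Bool := List.ofFn fun i : Fin k => x.testBit i

/-- The first `k` bits, filled up with `false`. -/
def padTake : ℕ → List Bool → List Bool
  | 0, _ => []
  | k + 1, l => l.headD false :: padTake k l.tail

@[simp] theorem length_padTake : ∀ (k : ℕ) (l : List Bool), (padTake k l).length = k
  | 0, _ => rfl
  | k + 1, l => by simp [padTake, length_padTake k]

theorem padTake_eq_take : ∀ {k : ℕ} {l : List Bool}, k ≤ l.length → padTake k l = l.take k
  | 0, _, _ => by simp [padTake]
  | k + 1, [], h => by simp at h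
  | k + 1, a :: l, h => by
    simp [padTake, padTake_eq_take (k := k) (l := l) (by simpa using h)]

theorem val_lt : ∀ l : List Bool, val l < 2 ^ l.length
  | [] => by simp [val]
  | b :: l => by
    have := val_lt l
    have := b.toNat_le
    simp only [val, List.length_cons, pow_succ]; omega

theorem val_append : ∀ l r : List Bool, val (l ++ r) = val l + 2 ^ l.length * val r
  | [], r => by simp [val]
  | b :: l, r => by simp [val, val_append l r, pow_succ]; ring

@[simp] theorem length_ofNat (k x : ℕ) : (ofNat k x).length = k := by simp [ofNat]

theorem ofNat_succ (k x : ℕ) : ofNat (k + 1) x = x.testBit 0 :: ofNat k (x / 2) := by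
  simp [ofNat, List.ofFn_succ, Nat.testBit_succ]

theorem val_ofNat : ∀ k x : ℕ, val (ofNat k x) = x % 2 ^ k
  | 0, x => by simp [ofNat, val, Nat.mod_one]
  | k + 1, x => by
    rw [ofNat_succ, val, val_ofNat k, pow_succ', Nat.mod_mul]
    simp [Nat.testBit_zero]
    rcases Nat.mod_two_eq_zero_or_one x with h | h <;> simp [h]

theorem ofNat_val : ∀ l : List Bool, ofNat l.length (val l) = l
  | [] => by simp [ofNat]
  | b :: l => by
    rw [List.length_cons, ofNat_succ, val]
    have h2 : (b.toNat + 2 * val l) / 2 = val l := by cases b <;> simp <;> omega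
    rw [h2, ofNat_val l]
    cases b <;> simp [Nat.testBit_zero]

theorem ofNat_add (a b x : ℕ) : ofNat (a + b) x = ofNat a x ++ ofNat b (x / 2 ^ a) := by
  induction a generalizing x with
  | zero => simp [ofNat]
  | succ a ih =>
    rw [show a + 1 + b = a + b + 1 by ring, ofNat_succ, ofNat_succ, ih, List.cons_append,
      Nat.div_div_eq_div_mul, pow_succ']

theorem val_injective {l r : List Bool} (hl : l.length = r.length) (h : val l = val r) : l = r := by
  rw [← ofNat_val l, ← ofNat_val r, hl, h]

theorem val_replicate_false (k : ℕ) : val (List.replicate k false) = 0 := by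
  induction k with
  | zero => rfl
  | succ k ih => simp [List.replicate_succ, val, ih]

/-- Comparison of numbers with equally many digits. -/
def lt : List Bool → List Bool → Bool
  | a, b => (a.foldl (fun (p : List Bool × Bool) x =>
      (p.1.tail, if x == p.1.headD false then p.2 else !x)) (b, false)).2

/-- The fold starts at the least significant bit, so the last position where the digits differ
decides. Started with the flag `true` it would decide `≤`; the induction covers both flags at once.
-/
theorem lt_iff {a b : List Bool} (h : a.length = b.length) : lt a b = decide (val a < val b) := by
  have key : ∀ (a b : List Bool) (f : Bool), a.length = b.length →
      (a.foldl (fun (p : List Bool × Bool) x =>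
        (p.1.tail, if x == p.1.headD false then p.2 else !x)) (b, f)).2
        = decide (val a < val b + f.toNat) := by
    intro a
    induction a with
    | nil => intro b f h; cases b <;> simp_all [val]; cases f <;> simp
    | cons x a ih =>
      intro b f h
      cases b with
      | nil => simp at h
      | cons y b =>
        rw [List.foldl_cons, ih _ _ (by simpa using h)]
        simp only [List.tail_cons, List.headD_cons, val]
        congr 1
        cases x <;> cases y <;> cases f <;> simp <;> omega
  simpa [lt] using key a b false h

/-- The words occurring in an arbitrary tree, read as a list of bits. -/
def ofData (d : Data) : List Bool := d.toList.map Data.toBool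

theorem ofData_ofBits (l : List Bool) : ofData (.ofBits l) = l := by
  have : Data.toBool ∘ Data.ofBool = id := by
    funext b; cases b <;> rfl
  rw [Data.ofBits_eq_ofList, ofData, Data.toList_ofList, List.map_map, this, List.map_id]

theorem length_ofData_le (d : Data) : (ofData d).length ≤ d.size := by
  rw [ofData, List.length_map]
  simpa using Data.length_le_size d.toList

/-- A step of the search for the last entry with a given key. -/
def lookupStep (p : List Bool × Option (List Bool)) (e : List Bool × List Bool) :
    List Bool × Option (List Bool) :=
  (p.1, if e.1 = p.1 then some e.2 else p.2)

/-- The last entry with the given key. -/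
def lookup (k : List Bool) (V : List (List Bool × List Bool)) : Option (List Bool) :=
  (V.foldl lookupStep (k, none)).2

theorem foldl_lookupStep (k : List Bool) (V : List (List Bool × List Bool))
    (o : Option (List Bool)) : V.foldl lookupStep (k, o) = (k, (lookup k V).or o) := by
  induction V generalizing o with
  | nil => simp [lookup]
  | cons e V ih =>
    rw [lookup, List.foldl_cons, List.foldl_cons, lookupStep, lookupStep, ih, ih]
    cases lookup k V <;> simp <;> split <;> simp

theorem lookup_cons (k : List Bool) (e : List Bool × List Bool) (V : List (List Bool × List Bool)) :
    lookup k (e :: V) = (lookup k V).or (if e.1 = k then some e.2 else none) := by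
  conv_lhs => rw [lookup, List.foldl_cons, lookupStep, foldl_lookupStep]

theorem lookup_some {k u : List Bool} {V : List (List Bool × List Bool)}
    (h : lookup k V = some u) : (k, u) ∈ V := by
  induction V with
  | nil => simp [lookup] at h
  | cons e V ih =>
    rw [lookup_cons] at h
    cases h' : lookup k V with
    | some v => simp [h'] at h; subst h; exact List.mem_cons_of_mem _ (ih h')
    | none =>
      simp [h'] at h
      obtain ⟨rfl, rfl⟩ := h; simp

theorem lookup_none {k : List Bool} {V : List (List Bool × List Bool)} :
    lookup k V = none ↔ k ∉ V.map Prod.fst := by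
  induction V with
  | nil => simp [lookup]
  | cons e V ih =>
    rw [lookup_cons, Option.or_eq_none_iff, ih]
    simp; grind

/-- A digit step of the multiplication by ten, with a carry. -/
def mulTenStep (p : Fin 10 × List Bool) (b : Bool) : Fin 10 × List Bool :=
  (⟨(10 * b.toNat + (p.1 : ℕ)) / 2, by have := b.toNat_le; omega⟩,
    decide ((10 * b.toNat + (p.1 : ℕ)) % 2 = 1) :: p.2)

/-- Multiplication of the digits by ten, with four more digits. -/
def mulTen (l : List Bool) : List Bool :=
  ((l ++ [false, false, false, false]).foldl mulTenStep (0, [])).2.reverse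

theorem length_mulTen (l : List Bool) : (mulTen l).length = l.length + 4 := by
  have key : ∀ (l : List Bool) (p : Fin 10 × List Bool),
      (l.foldl mulTenStep p).2.length = l.length + p.2.length := by
    intro l
    induction l with
    | nil => simp
    | cons b l ih => intro p; rw [List.foldl_cons, ih]; simp [mulTenStep]; omega
  rw [mulTen, List.length_reverse, key]; simp

theorem val_mulTen (l : List Bool) : val (mulTen l) = 10 * val l := by
  have key : ∀ (l : List Bool) (p : Fin 10 × List Bool), ∃ q : Fin 10 × List Bool,
      l.foldl mulTenStep p = q ∧
      q.2.length = l.length + p.2.length ∧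
      val q.2.reverse + 2 ^ q.2.length * q.1 =
        val p.2.reverse + 2 ^ p.2.length * (p.1 + 10 * val l) := by
    intro l
    induction l with
    | nil => intro p; exact ⟨p, rfl, by simp, by simp [val]⟩
    | cons b l ih =>
      intro p
      rw [List.foldl_cons]
      obtain ⟨q, h1, h2, h3⟩ := ih (mulTenStep p b)
      refine ⟨q, h1, by simp [h2, mulTenStep]; omega, ?_⟩
      simp only [mulTenStep] at h3
      rw [h3, List.reverse_cons, val_append]
      simp only [List.length_reverse, List.length_cons, val, pow_succ]
      have : (decide ((10 * b.toNat + (p.1 : ℕ)) % 2 = 1)).toNat = (10 * b.toNat + (p.1 : ℕ)) % 2 := by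
        rcases Nat.mod_two_eq_zero_or_one (10 * b.toNat + p.1) with h | h <;> simp [h]
      rw [this]
      have h5 := Nat.mod_add_div (10 * b.toNat + (p.1 : ℕ)) 2
      set x := (10 * b.toNat + (p.1 : ℕ)) % 2
      set y := (10 * b.toNat + (p.1 : ℕ)) / 2
      have h6 : (p.1 : ℕ) + 10 * (b.toNat + 2 * val l) = x + 2 * y + 20 * val l := by omega
      rw [h6]; ring
  obtain ⟨q, h1, h2, h3⟩ := key (l ++ [false, false, false, false]) (0, [])
  have hl := val_lt l
  rw [mulTen, h1]
  simp [val_append, val] at h2 h3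
  rw [h2] at h3
  -- A remaining carry would make the value at least `16 * 2 ^ l.length`, whereas `10 * val l` is
  -- below that; four extra digits are therefore enough.
  have : (q.1 : ℕ) = 0 := by
    by_contra h0
    have : 2 ^ (l.length + 4) * 1 ≤ 2 ^ (l.length + 4) * (q.1 : ℕ) :=
      Nat.mul_le_mul_left _ (by omega)
    have h4 : 2 ^ (l.length + 4) = 2 ^ l.length * 16 := by rw [pow_add]; norm_num
    omega
  simpa [this] using h3

/-- The digits of `10 ^ k`, with leading zeros. -/
def tenPow : ℕ → List Bool
  | 0 => [true]
  | k + 1 => mulTen (tenPow k)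

theorem length_tenPow (k : ℕ) : (tenPow k).length = 1 + 4 * k := by
  induction k with
  | zero => rfl
  | succ k ih => rw [tenPow, length_mulTen, ih]; ring

theorem val_tenPow (k : ℕ) : val (tenPow k) = 10 ^ k := by
  induction k with
  | zero => rfl
  | succ k ih => rw [tenPow, val_mulTen, ih]; ring

/-- Remove the leading zeros. -/
def trim (l : List Bool) : List Bool :=
  l.reverse.foldl (fun r b => if r.isEmpty && !b then [] else b :: r) []

theorem trim_aux (l : List Bool) (r : List Bool) (hr : r ≠ []) :
    l.foldl (fun r b => if r.isEmpty && !b then [] else b :: r) r = l.reverse ++ r := by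
  induction l generalizing r with
  | nil => rfl
  | cons b l ih =>
    rw [List.foldl_cons, if_neg (by simp [hr]), ih _ (by simp)]; simp

theorem trim_eq (l : List Bool) (h : val l ≠ 0) : trim l = ofNat (Nat.size (val l)) (val l) := by
  induction l using List.reverseRecOn with
  | nil => simp [val] at h
  | append_singleton l b ih =>
    cases b with
    | false =>
      have : val (l ++ [false]) = val l := by simp [val_append, val]
      rw [this] at h ⊢
      rw [← ih h, trim, trim]; simp
    | true =>
      have h1 : trim (l ++ [true]) = l ++ [true] := by
        rw [trim, List.reverse_append, List.reverse_singleton, List.singleton_append,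
          List.foldl_cons, trim_aux _ _ (by simp)]
        simp
      have h2 : Nat.size (val (l ++ [true])) = (l ++ [true]).length := by
        apply le_antisymm
        · exact Nat.size_le.2 (val_lt _)
        · rw [List.length_append, List.length_singleton, Nat.succ_le_iff, Nat.lt_size, val_append]
          simp [val]
      rw [h1, h2, ofNat_val]

/-- For `k ≥ 1` the number `10 ^ k` is divisible by 5, hence not a power of two, and its bit length
is the rounded logarithm. This fails for `k = 0`, which is why `1 ≤ l` is assumed wherever the
machine is turned into a program. -/
theorem size_ten_pow {k : ℕ} (hk : 1 ≤ k) : Nat.size (10 ^ k) = codeBits k := by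
  apply le_antisymm
  · rw [Nat.size_le]
    refine lt_of_le_of_ne (Nat.le_pow_clog (by norm_num) _) fun h => ?_
    have : 5 ∣ 2 ^ Nat.clog 2 (10 ^ k) := by
      change _ = 2 ^ Nat.clog 2 (10 ^ k) at h
      rw [← h]; exact dvd_pow (by norm_num) (by omega)
    have := (Nat.Prime.dvd_of_dvd_pow (by norm_num) this)
    omega
  · rw [codeBits, Nat.clog_le_iff_le_pow (by norm_num)]
    exact (Nat.lt_size_self _).le

theorem trim_tenPow {k : ℕ} (hk : 1 ≤ k) :
    trim (tenPow k) = ofNat (codeBits k) (10 ^ k) := by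
  rw [trim_eq _ (by rw [val_tenPow]; positivity), val_tenPow, size_ten_pow hk]

/-- A digit step of the increment, with a carry. -/
def succStep (p : Bool × List Bool) (b : Bool) : Bool × List Bool :=
  (p.1 && b, (!(p.1 == b)) :: p.2)

/-- The last step of the increment. -/
def succEnd (p : Bool × List Bool) : List Bool := if p.1 then true :: p.2 else p.2

theorem succ_eq (u : List Bool) :
    (succEnd (u.foldl succStep (true, []))).reverse = AddInput.succ u := by
  have h0 : ∀ (u r : List Bool), u.foldl succStep (false, r) = (false, u.reverse ++ r) := by
    intro u
    induction u with
    | nil => simp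
    | cons b u ih => intro r; rw [List.foldl_cons, succStep, Bool.false_and, ih]; cases b <;> simp
  have h1 : ∀ u r : List Bool,
      (succEnd (u.foldl succStep (true, r))).reverse = r.reverse ++ AddInput.succ u := by
    intro u
    induction u with
    | nil => intro r; simp [AddInput.succ, succEnd]
    | cons b u ih =>
      intro r
      cases b
      · simp [h0, AddInput.succ, succStep, succEnd]
      · simpa [AddInput.succ, succStep] using ih (false :: r)
  simpa using h1 u []

end Bits


/-! ### Comparison, search and increment of bit strings in polynomial time -/

namespace FP

open Data (ofList ofBits ofBool unary)

variable {ι : Type} {inp : ι → Data}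

theorem head_bits {l : ι → List Bool} (hl : FP inp fun i => ofBits (l i)) :
    FP inp fun i => ofBool ((l i).headD false) :=
  hl.head.congr fun i => by cases l i <;> rfl

theorem tail_bits {l : ι → List Bool} (hl : FP inp fun i => ofBits (l i)) :
    FP inp fun i => ofBits (l i).tail :=
  hl.tail.congr fun i => by cases l i <;> rfl

theorem cons_bits {b : ι → Bool} {l : ι → List Bool} (hb : FP inp fun i => ofBool (b i))
    (hl : FP inp fun i => ofBits (l i)) : FP inp fun i => ofBits (b i :: l i) :=
  hb.cons hl

/-- A step of splitting a list. -/
def splitStep (p : List Bool × List Bool) (_ : Bool) : List Bool × List Bool :=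
  (p.1.tail, p.1.headD false :: p.2)

theorem foldl_splitStep (k : ℕ) (l r : List Bool) :
    (List.replicate k true).foldl splitStep (l, r)
      = (l.drop k, (Bits.padTake k l).reverse ++ r) := by
  induction k generalizing l r with
  | zero => simp [Bits.padTake]
  | succ k ih =>
    rw [List.replicate_succ, List.foldl_cons, splitStep, ih]
    simp [Bits.padTake]

theorem split {l : ι → List Bool} {k : ι → ℕ} (hl : FP inp fun i => ofBits (l i))
    (hk : FP inp fun i => unary (k i)) :
    FP inp fun i => .cons (ofBits ((l i).drop (k i))) (ofBits (Bits.padTake (k i) (l i)).reverse) := by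
  refine (foldl_bits (encα := fun p : List Bool × List Bool => .cons (ofBits p.1) (ofBits p.2))
    (g := splitStep) (l := fun i => List.replicate (k i) true) (a := fun i => (l i, []))
    (B := fun i => 1 + ((1 + 4 * (ofBits (l i)).size) + (1 + 4 * (unary (k i)).size)))
    hk (cons hl nil) (cons (tail_bits id.head.head) (cons_bits (head_bits id.head.head) id.head.tail))
    ((PolyBdd.const 1).add (((PolyBdd.const 1).add ((PolyBdd.const 4).mul hl.size)).add
      ((PolyBdd.const 1).add ((PolyBdd.const 4).mul hk.size)))) fun i j => ?_).congr fun i => ?_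
  · rw [List.take_replicate, foldl_splitStep]
    have h1 := Data.size_ofBits_le ((l i).drop (min j (k i)))
    have h2 := Data.size_ofBits_le ((Bits.padTake (min j (k i)) (l i)).reverse ++ [])
    have h3 := Data.length_le_size_ofBits (l i)
    simp only [List.length_drop, List.length_append, List.length_reverse, Bits.length_padTake,
      List.length_nil] at h1 h2
    simp only [Data.size, Data.size_unary]
    omega
  · rw [foldl_splitStep]; simp

theorem drop {l : ι → List Bool} {k : ι → ℕ} (hl : FP inp fun i => ofBits (l i))
    (hk : FP inp fun i => unary (k i)) : FP inp fun i => ofBits ((l i).drop (k i)) :=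
  (split hl hk).head

theorem padTake {l : ι → List Bool} {k : ι → ℕ} (hl : FP inp fun i => ofBits (l i))
    (hk : FP inp fun i => unary (k i)) : FP inp fun i => ofBits (Bits.padTake (k i) (l i)) := by
  simpa using (split hl hk).tail.reverse_bits

/-- A step of the comparison of lists. -/
def eqStep (p : List Bool × Bool) (b : Bool) : List Bool × Bool :=
  (p.1.tail, p.2 && (!p.1.isEmpty && (b == p.1.headD false)))

/-- The flag records agreement on the positions of `a`, a missing digit of `b` counting as a
difference; superfluous digits of `b` are seen at the end as a nonempty rest. -/
theorem foldl_eqStep (a b : List Bool) (f : Bool) :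
    let p := a.foldl eqStep (b, f)
    (p.2 && p.1.isEmpty) = (f && decide (a = b)) := by
  induction a generalizing b f with
  | nil => cases b <;> simp
  | cons x a ih =>
    rw [List.foldl_cons]
    rw [eqStep] at *
    have := ih b.tail (f && (!b.isEmpty && (x == b.headD false)))
    dsimp only at this ⊢
    rw [this]
    cases b with
    | nil => simp
    | cons y b => 
      cases f <;> cases x <;> cases y <;> simp <;> exact decide_eq_decide.2 Iff.rfl

theorem isEmpty {l : ι → List Bool} (hl : FP inp fun i => ofBits (l i)) :
    FP inp fun i => ofBool (l i).isEmpty :=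
  ((hl.isCons (c := fun i => !(l i).isEmpty) fun i => by cases l i <;> simp)).not.congr
    fun i => by simp

theorem pair_fold_size (a : List Bool) (g : List Bool × Bool → Bool → List Bool × Bool)
    (hg : ∀ p b, (g p b).1.length ≤ p.1.length) (p : List Bool × Bool) :
    (Data.cons (ofBits (a.foldl g p).1) (ofBool (a.foldl g p).2)).size ≤
      5 + 4 * p.1.length := by
  have : ∀ p, (a.foldl g p).1.length ≤ p.1.length := by
    induction a with
    | nil => simp
    | cons b a ih => intro p; exact (ih _).trans (hg p b)
  have h1 := Data.size_ofBits_le (a.foldl g p).1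
  have h2 := Data.size_ofBool_le (a.foldl g p).2
  have h3 := this p
  simp only [Data.size]; omega

theorem eq_bits {a b : ι → List Bool} (ha : FP inp fun i => ofBits (a i))
    (hb : FP inp fun i => ofBits (b i)) : FP inp fun i => ofBool (decide (a i = b i)) := by
  have key := foldl_bits (encα := fun p : List Bool × Bool => .cons (ofBits p.1) (ofBool p.2))
    (g := eqStep) (l := a) (a := fun i => (b i, true))
    (B := fun i => 5 + 4 * (ofBits (b i)).size)
    ha (cons hb (const _)) (cons (tail_bits id.head.head) (id.head.tail.and
      ((isEmpty id.head.head).not.and (id.tail.beq (head_bits id.head.head)))))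
    ((PolyBdd.const 5).add ((PolyBdd.const 4).mul hb.size)) fun i j => ?_
  · refine (key.tail.and (isEmpty (key.head))).congr fun i => ?_
    have := foldl_eqStep (a i) (b i) true
    dsimp only at this
    rw [this]; simp
  · refine (pair_fold_size _ _ ?_ _).trans ?_
    · intro p b; simp [eqStep]
    · have := Data.length_le_size_ofBits (b i); dsimp only; omega

theorem eq_unary {a b : ι → ℕ} (ha : FP inp fun i => unary (a i))
    (hb : FP inp fun i => unary (b i)) : FP inp fun i => ofBool (decide (a i = b i)) :=
  (eq_bits ha hb).congr fun i => by
    congr 2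
    exact propext ⟨fun h => by simpa using congrArg List.length h, fun h => by rw [h]⟩

theorem lt_bits {a b : ι → List Bool} (ha : FP inp fun i => ofBits (a i))
    (hb : FP inp fun i => ofBits (b i)) : FP inp fun i => ofBool (Bits.lt (a i) (b i)) := by
  have key := foldl_bits (encα := fun p : List Bool × Bool => .cons (ofBits p.1) (ofBool p.2))
    (g := fun p x => (p.1.tail, if x == p.1.headD false then p.2 else !x)) (l := a)
    (a := fun i => (b i, false)) (B := fun i => 5 + 4 * (ofBits (b i)).size)
    ha (cons hb (const _)) (cons (tail_bits id.head.head)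
      ((ite_bool (id.tail.beq (head_bits id.head.head)) id.head.tail id.tail.not).congr
        fun i => by split <;> rfl))
    ((PolyBdd.const 5).add ((PolyBdd.const 4).mul hb.size)) fun i j => ?_
  · exact key.tail
  · refine (pair_fold_size _ _ ?_ _).trans ?_
    · intro p b; simp
    · have := Data.length_le_size_ofBits (b i); dsimp only; omega

theorem val_lt_val {a b : ι → List Bool} (ha : FP inp fun i => ofBits (a i))
    (hb : FP inp fun i => ofBits (b i)) (h : ∀ i, (a i).length = (b i).length) :
    FP inp fun i => ofBool (decide (Bits.val (a i) < Bits.val (b i))) :=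
  (lt_bits ha hb).congr fun i => by rw [Bits.lt_iff (h i)]

theorem ofData {a : ι → Data} (ha : FP inp a) : FP inp fun i => ofBits (Bits.ofData (a i)) := by
  have key := foldl (encα := ofBits) (encβ := fun d => d)
    (g := fun r d => Data.toBool d :: r) (l := fun i => (a i).toList) (a := fun _ => [])
    (B := fun i => 1 + 4 * (a i).size) (by simpa using ha) (const _)
    (cons_bits (id.tail.isCons fun i => Data.toBool_iff) id.head)
    ((PolyBdd.const 1).add ((PolyBdd.const 4).mul ha.size)) fun i j => ?_
  · refine key.reverse_bits.congr fun i => ?_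
    rw [Bits.ofData]
    congr 1
    simp
  · refine (Data.size_ofBits_le _).trans ?_
    have : ∀ (l : List Data) (r : List Bool),
        (l.foldl (fun r d => Data.toBool d :: r) r).length = l.length + r.length := by
      intro l
      induction l with
      | nil => simp
      | cons d l ih => intro r; rw [List.foldl_cons, ih]; simp; omega
    rw [this]
    have h1 := Data.length_le_size (a i).toList
    rw [Data.ofList_toList] at h1
    simp only [List.length_take, List.length_nil]; omega

/-- The encoding of an optional bit string. -/
def encOption : Option (List Bool) → Data
  | none => .nil
  | some u => .cons .nil (ofBits u)

/-- The encoding of a list of pairs of bit strings. -/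
def encPairs (V : List (List Bool × List Bool)) : Data :=
  ofList (V.map fun e => .cons (ofBits e.1) (ofBits e.2))

theorem size_encPairs (V : List (List Bool × List Bool)) :
    (encPairs V).size = 1 + (V.map fun e => 2 + (ofBits e.1).size + (ofBits e.2).size).sum := by
  rw [encPairs, Data.size_ofList, List.map_map]
  congr 3
  funext e; simp [Data.size]; omega

/-- The accumulator consists of the key and at most one entry of the list, so it does not outgrow
the input. -/
theorem lookup {k : ι → List Bool} {V : ι → List (List Bool × List Bool)}
    (hk : FP inp fun i => ofBits (k i)) (hV : FP inp fun i => encPairs (V i)) :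
    FP inp fun i => encOption (Bits.lookup (k i) (V i)) := by
  refine (foldl (encα := fun p : List Bool × Option (List Bool) => .cons (ofBits p.1) (encOption p.2))
    (encβ := fun e => .cons (ofBits e.1) (ofBits e.2)) (g := Bits.lookupStep) (l := V)
    (a := fun i => (k i, none)) (B := fun i => 3 + ((ofBits (k i)).size + (encPairs (V i)).size)) hV
    (cons hk (const _)) (cons id.head.head ((ite_bool (eq_bits id.tail.head id.head.head)
      (cons nil id.tail.tail) id.head.tail).congr fun i => ?_))
    ((PolyBdd.const 3).add (hk.size.add hV.size)) fun i j => ?_).tail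
  · simp only [decide_eq_true_eq, Bits.lookupStep]
    split <;> rfl
  · rw [Bits.foldl_lookupStep, Option.or_none]
    have hs : (encOption (Bits.lookup (k i) ((V i).take j))).size ≤ 2 + (encPairs (V i)).size := by
      cases h : Bits.lookup (k i) ((V i).take j) with
      | none => simp [encOption, Data.size]; omega
      | some u =>
        have h1 := List.mem_of_mem_take (Bits.lookup_some h)
        have h2 := List.single_le_sum (l := (V i).map fun e => 2 + (ofBits e.1).size + (ofBits e.2).size)
          (by simp) _ (List.mem_map_of_mem h1)
        rw [size_encPairs]
        simp only [encOption, Data.size]; dsimp only at h2; omega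
    simp only [Data.size]; omega

/-- Membership in a list of bit strings. -/
theorem mem {k : ι → List Bool} {L : ι → List (List Bool)}
    (hk : FP inp fun i => ofBits (k i)) (hL : FP inp fun i => ofList ((L i).map ofBits)) :
    FP inp fun i => ofBool (decide (k i ∈ L i)) := by
  have hf : ∀ (L : List (List Bool)) (k : List Bool) (f : Bool),
      L.foldl (fun (p : List Bool × Bool) e => (p.1, p.2 || decide (e = p.1))) (k, f)
        = (k, f || decide (k ∈ L)) := by
    intro L k
    induction L with
    | nil => simp
    | cons e L ih =>
      intro f
      rw [List.foldl_cons, ih, Bool.or_assoc]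
      congr 2
      rw [← Bool.decide_or]
      simp [eq_comm]
  have key := foldl (encα := fun p : List Bool × Bool => .cons (ofBits p.1) (ofBool p.2))
    (encβ := ofBits) (g := fun (p : List Bool × Bool) e => (p.1, p.2 || decide (e = p.1))) (l := L)
    (a := fun i => (k i, false)) (B := fun i => 4 + (ofBits (k i)).size) hL
    (cons hk (const _)) (cons id.head.head (id.head.tail.or (eq_bits id.tail id.head.head)))
    ((PolyBdd.const 4).add hk.size) fun i j => ?_
  · exact key.tail.congr fun i => by simp [hf]
  · rw [hf]
    have := Data.size_ofBool_le (false || decide (k i ∈ (L i).take j))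
    simp only [Data.size]; omega

theorem succ {u : ι → List Bool} (hu : FP inp fun i => ofBits (u i)) :
    FP inp fun i => ofBits (AddInput.succ (u i)) := by
  have key := foldl_bits (encα := fun p : Bool × List Bool => .cons (ofBool p.1) (ofBits p.2))
    (g := Bits.succStep) (l := u) (a := fun _ => (true, []))
    (B := fun i => 5 + 4 * (ofBits (u i)).size) hu (const _)
    (cons (id.head.head.and id.tail) (cons_bits (id.head.head.beq id.tail).not id.head.tail))
    ((PolyBdd.const 5).add ((PolyBdd.const 4).mul hu.size)) fun i j => ?_
  · refine (reverse_bits (l := fun i => Bits.succEnd ((u i).foldl Bits.succStep (true, [])))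
      ((ite_bool key.head (cons_bits (const (ofBool true)) key.tail) key.tail).congr
        fun i => ?_)).congr fun i => by rw [Bits.succ_eq]
    simp only [Bits.succEnd, Data.tail_cons]
    split <;> rfl
  · have : ∀ (l : List Bool) (p : Bool × List Bool),
        (l.foldl Bits.succStep p).2.length = l.length + p.2.length := by
      intro l
      induction l with
      | nil => simp
      | cons d l ih => intro r; rw [List.foldl_cons, ih]; simp [Bits.succStep]; omega
    have h0 := Data.size_ofBool_le (((u i).take j).foldl Bits.succStep (true, [])).1
    have h1 := Data.size_ofBits_le (((u i).take j).foldl Bits.succStep (true, [])).2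
    rw [this] at h1
    have h2 := Data.length_le_size_ofBits (u i)
    simp only [List.length_take, List.length_nil] at h1
    simp only [Data.size]; omega

end FP


/-! ### Unary counters, powers of ten and sizes of trees in polynomial time -/

namespace FP

open Data (ofList ofBits ofBool unary)

variable {ι : Type} {inp : ι → Data}

theorem unary_iff {n : ι → ℕ} : (FP inp fun i => unary (n i)) ↔
    FP inp fun i => ofList (List.replicate (n i) (ofBool true)) := by
  simp only [Data.unary_eq_ofList]

/-- Iteration with a unary counter. -/
theorem iter_unary {n : ι → ℕ} {st : ι → ℕ → Data} {B : ι → ℕ}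
    (hn : FP inp fun i => unary (n i)) (h0 : FP inp fun i => st i 0)
    (hs : FP (fun p : {p : ι × ℕ // p.2 < n p.1} => st p.1.1 p.1.2)
      fun p => st p.1.1 (p.1.2 + 1))
    (hB : PolyBdd inp B) (h : ∀ i, ∀ k ≤ n i, (st i k).size ≤ B i) :
    FP inp fun i => st i (n i) := by
  obtain ⟨P, hP⟩ := hB
  have := iter (l := fun i => List.replicate (n i) (ofBool true)) (st := st) P (unary_iff.1 hn) h0
    (hs.comap fun p : {p : ι × ℕ // p.2 < (List.replicate (n p.1) (ofBool true)).length} =>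
      ⟨p.1, by simpa using p.2⟩)
    (fun i k hk => (h i k (by simpa using hk)).trans (hP i))
  simpa using this

theorem divTwo {n : ι → ℕ} (hn : FP inp fun i => unary (n i)) :
    FP inp fun i => .cons (unary (n i / 2)) (ofBool (decide (n i % 2 = 1))) := by
  refine iter_unary (st := fun _ n => .cons (unary (n / 2)) (ofBool (decide (n % 2 = 1))))
    (B := fun i => 5 + 4 * (unary (n i)).size) hn (const _) ?_
    ((PolyBdd.const 5).add ((PolyBdd.const 4).mul hn.size)) fun i k hk => ?_
  · refine (cons (ite_bool id.tail (cons (const (ofBool true)) id.head) id.head) id.tail.not).congr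
      fun p => ?_
    rcases Nat.mod_two_eq_zero_or_one p.1.2 with h | h
    · rw [show (p.1.2 + 1) / 2 = p.1.2 / 2 by omega, show (p.1.2 + 1) % 2 = 1 by omega]
      simp [h]
    · rw [show (p.1.2 + 1) / 2 = p.1.2 / 2 + 1 by omega, show (p.1.2 + 1) % 2 = 0 by omega]
      simp [h]; rfl
  · have := Data.size_ofBool_le (decide (k % 2 = 1))
    simp only [Data.size, Data.size_unary]; omega

theorem mulTen {l : ι → List Bool} (hl : FP inp fun i => ofBits (l i)) :
    FP inp fun i => ofBits (Bits.mulTen (l i)) := by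
  have hstep : FP (fun p : (Fin 10 × List Bool) × Bool =>
      .cons (.cons (unary p.1.1) (ofBits p.1.2)) (ofBool p.2))
      fun p => .cons (unary (Bits.mulTenStep p.1 p.2).1) (ofBits (Bits.mulTenStep p.1 p.2).2) := by
    have h1 : FP (fun p : (Fin 10 × List Bool) × Bool =>
        .cons (.cons (unary p.1.1) (ofBits p.1.2)) (ofBool p.2))
        fun p => unary (10 * p.2.toNat + p.1.1) :=
      (ite_bool id.tail (unary_add (a := fun _ => 10) (const _) id.head.head) id.head.head).congr
        fun p => by cases p.2 <;> simp
    have h2 := divTwo h1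
    exact cons h2.head (cons_bits h2.tail id.head.tail)
  have key := foldl_bits (encα := fun p : Fin 10 × List Bool => .cons (unary p.1) (ofBits p.2))
    (g := Bits.mulTenStep) (l := fun i => l i ++ [false, false, false, false])
    (a := fun _ => (0, [])) (B := fun i => 60 + 4 * (ofBits (l i)).size)
    (append_bits hl (const _)) (const _) hstep
    ((PolyBdd.const 60).add ((PolyBdd.const 4).mul hl.size)) fun i j => ?_
  · exact key.tail.reverse_bits
  · have : ∀ (l : List Bool) (p : Fin 10 × List Bool),
        (l.foldl Bits.mulTenStep p).2.length = l.length + p.2.length := by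
      intro l
      induction l with
      | nil => simp
      | cons d l ih => intro r; rw [List.foldl_cons, ih]; simp [Bits.mulTenStep]; omega
    have h1 := Data.size_ofBits_le
      (((l i ++ [false, false, false, false]).take j).foldl Bits.mulTenStep (0, [])).2
    rw [this] at h1
    have h2 := Data.length_le_size_ofBits (l i)
    simp only [List.length_take, List.length_nil, List.length_append, List.length_cons] at h1
    simp only [Data.size, Data.size_unary]; omega

theorem tenPow {n : ι → ℕ} (hn : FP inp fun i => unary (n i)) :
    FP inp fun i => ofBits (Bits.tenPow (n i)) := by
  refine iter_unary (st := fun _ n => ofBits (Bits.tenPow n))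
    (B := fun i => 5 + 16 * (unary (n i)).size) hn (const _) (mulTen id)
    ((PolyBdd.const 5).add ((PolyBdd.const 16).mul hn.size)) fun i k hk => ?_
  have := Data.size_ofBits_le (Bits.tenPow k)
  rw [Bits.length_tenPow] at this
  rw [Data.size_unary]; omega

theorem trim {l : ι → List Bool} (hl : FP inp fun i => ofBits (l i)) :
    FP inp fun i => ofBits (Bits.trim (l i)) := by
  refine foldl_bits (encα := ofBits)
    (g := fun r b => if r.isEmpty && !b then [] else b :: r) (l := fun i => (l i).reverse)
    (a := fun _ => []) (B := fun i => 1 + 4 * (ofBits (l i)).size) hl.reverse_bits (const _)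
    ((ite_bool ((isEmpty id.head).and id.tail.not) nil (cons_bits id.tail id.head)).congr
      fun p => by split <;> rfl)
    ((PolyBdd.const 1).add ((PolyBdd.const 4).mul hl.size)) fun i j => ?_
  have : ∀ (l r : List Bool),
      (l.foldl (fun r b => if r.isEmpty && !b then [] else b :: r) r).length ≤ l.length + r.length := by
    intro l
    induction l with
    | nil => simp
    | cons d l ih =>
      intro r; rw [List.foldl_cons]; refine (ih _).trans ?_
      split <;> simp <;> omega
  refine (Data.size_ofBits_le _).trans ?_
  have h1 := this ((l i).reverse.take j) []
  have h2 := Data.length_le_size_ofBits (l i)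
  simp only [List.length_take, List.length_nil, List.length_reverse] at h1
  omega

/-- Remove a node from the first tree of a list. -/
def expand : List Data → List Data
  | [] => []
  | .nil :: l => l
  | .cons a b :: l => a :: b :: l

theorem sum_size_expand (l : List Data) :
    ((expand l).map Data.size).sum = (l.map Data.size).sum - 1 := by
  match l with
  | [] => rfl
  | .nil :: l => simp [expand, Data.size]
  | .cons a b :: l => simp [expand, Data.size]; omega

theorem sum_size_iterate_expand (l : List Data) (k : ℕ) :
    ((expand^[k] l).map Data.size).sum = (l.map Data.size).sum - k := by
  induction k with
  | zero => rfl
  | succ k ih => rw [Function.iterate_succ_apply', sum_size_expand, ih]; omega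

theorem size_ofList_le (l : List Data) : (ofList l).size ≤ 1 + 2 * (l.map Data.size).sum := by
  induction l with
  | nil => simp [Data.size]
  | cons a l ih => have := a.size_pos; simp [Data.size]; omega

/-- `expand` removes one node at a time, so after `n` rounds nothing is left exactly if the tree had
at most `n` nodes. -/
theorem size_le {a : ι → Data} {n : ι → ℕ} (ha : FP inp a) (hn : FP inp fun i => unary (n i)) :
    FP inp fun i => ofBool (decide ((a i).size ≤ n i)) := by
  have hstep : FP ofList fun l => ofList (expand l) := by
    refine ite id (ite id.head ((cons id.head.head (cons id.head.tail id.tail)).congr ?_)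
      (id.tail.congr ?_)) (nil.congr ?_)
    · rintro ⟨⟨l, h⟩, h'⟩
      match l with
      | [] => exact absurd rfl h
      | .nil :: l => exact absurd rfl h'
      | .cons a b :: l => rfl
    · rintro ⟨⟨l, h⟩, h'⟩
      match l with
      | [] => exact absurd rfl h
      | .nil :: l => rfl
      | .cons a b :: l => simp at h'
    · rintro ⟨l, h⟩
      match l with
      | [] => rfl
      | a :: l => simp at h
  have key := iter_unary (st := fun i k => ofList (expand^[k] [a i]))
    (B := fun i => 1 + 2 * (a i).size) hn (cons ha nil)
    ((hstep.comap fun p : {p : ι × ℕ // p.2 < n p.1} => expand^[p.1.2] [a p.1.1]).congr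
      fun p => by rw [Function.iterate_succ_apply'])
    ((PolyBdd.const 1).add ((PolyBdd.const 2).mul ha.size)) fun i k hk => ?_
  · refine (key.isCons (c := fun i => !decide ((a i).size ≤ n i)) fun i => ?_).not.congr
      fun i => by simp
    have h1 := sum_size_iterate_expand [a i] (n i)
    rw [ne_eq, Data.ofList_eq_nil]
    simp only [Bool.not_eq_true', decide_eq_false_iff_not, not_iff_not]
    constructor
    · intro h
      rcases hl : expand^[n i] [a i] with - | ⟨x, l⟩
      · rfl
      · rw [hl] at h1
        have := x.size_pos
        simp at h1; omega
    · intro h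
      rw [h] at h1
      simp at h1; omega
  · refine (size_ofList_le _).trans ?_
    rw [sum_size_iterate_expand]
    simp

/-- Doubling up to a bound. -/
theorem twoPow_clog {n : ι → ℕ} (hn : FP inp fun i => unary (n i)) :
    FP inp fun i => .cons (unary (2 ^ Nat.clog 2 (n i))) (unary (Nat.clog 2 (n i))) := by
  have hb : ∀ n, Nat.clog 2 n ≤ n := fun n =>
    (Nat.clog_le_iff_le_pow (by norm_num)).2 (Nat.lt_two_pow_self).le
  have key := iter_unary (st := fun i k => .cons (unary (n i))
      (.cons (unary (2 ^ min k (Nat.clog 2 (n i)))) (unary (min k (Nat.clog 2 (n i))))))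
    (B := fun i => 20 + 20 * (unary (n i)).size) hn
    (cons hn ((const (.cons (unary 1) (unary 0))).congr fun i => by simp)) ?_
    ((PolyBdd.const 20).add ((PolyBdd.const 20).mul hn.size)) fun i k hk => ?_
  · refine key.tail.congr fun i => ?_
    simp only [min_eq_right (hb (n i)), Data.tail_cons]
  · refine (cons id.head (ite_bool (isEmpty (l := fun p => (List.replicate (n p.1.1) true).drop
      (2 ^ min p.1.2 (Nat.clog 2 (n p.1.1)))) (drop id.head id.tail.head)) id.tail
      (cons (unary_add id.tail.head id.tail.head)
        (cons (const (ofBool true)) id.tail.tail)))).congr fun p => ?_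
    obtain ⟨⟨i, k⟩, hk⟩ := p
    dsimp only
    congr 1
    rcases Nat.lt_or_ge k (Nat.clog 2 (n i)) with h | h
    · have h1 := (Nat.lt_clog_iff_pow_lt (b := 2) (by norm_num)).1 h
      rw [min_eq_left h.le, min_eq_left (Nat.succ_le_of_lt h), if_neg (by simp; omega), pow_succ,
        mul_two]
      rfl
    · have h1 := (Nat.clog_le_iff_le_pow (b := 2) (by norm_num)).1 h
      rw [min_eq_right h, min_eq_right (h.trans (Nat.le_succ k)), if_pos]
      · rfl
      have := Nat.le_pow_clog (b := 2) (by norm_num) (n i)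
      rw [List.drop_replicate, List.isEmpty_iff, List.replicate_eq_nil_iff]; omega
  · have h1 : 2 ^ min k (Nat.clog 2 (n i)) ≤ 2 * n i + 1 := by
      rcases Nat.lt_or_ge (n i) 2 with h | h
      · rw [Nat.clog_of_right_le_one (by omega)]; simp
      · have := Nat.pow_pred_clog_lt_self (b := 2) (by norm_num) (x := n i) (by omega)
        have h3 : 0 < Nat.clog 2 (n i) := Nat.clog_pos (by norm_num) h
        refine (Nat.pow_le_pow_right (by norm_num) (min_le_right _ _)).trans ?_
        obtain ⟨c, hc⟩ : ∃ c, Nat.clog 2 (n i) = c + 1 := ⟨_, (Nat.succ_pred_eq_of_pos h3).symm⟩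
        rw [hc] at this ⊢
        simp only [Nat.pred_succ] at this
        rw [pow_succ]; omega
    have h2 := hb (n i)
    simp only [Data.size, Data.size_unary]; omega

/-- The unary result is exponential in the number of digits, hence the hypothesis `hb`. It is needed
for the index of the challenge, whose length is only logarithmic. -/
theorem unary_val {l : ι → List Bool} (hl : FP inp fun i => ofBits (l i))
    (hb : PolyBdd inp fun i => 2 ^ (l i).length) : FP inp fun i => unary (Bits.val (l i)) := by
  have hf : ∀ l : List Bool,
      l.foldl (fun n (b : Bool) => n + n + b.toNat) 0 = Bits.val l.reverse := by
    intro l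
    induction l using List.reverseRecOn with
    | nil => rfl
    | append_singleton l b ih =>
      rw [List.foldl_append, ih]
      simp [Bits.val]; ring
  refine (foldl_bits (encα := unary) (g := fun n b => n + n + b.toNat)
    (l := fun i => (l i).reverse) (a := fun _ => 0) (B := fun i => 1 + 4 * 2 ^ (l i).length)
    hl.reverse_bits (const _)
    (unary_add (unary_add id.head id.head) ((ite_bool id.tail (const (unary 1)) (const (unary 0))).congr
      fun p => by cases p.2 <;> rfl))
    ((PolyBdd.const 1).add ((PolyBdd.const 4).mul hb)) fun i j => ?_).congr fun i => by simp [hf]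
  rw [hf, Data.size_unary]
  have := Bits.val_lt ((l i).reverse.take j).reverse
  have h2 : 2 ^ ((l i).reverse.take j).reverse.length ≤ 2 ^ (l i).length :=
    Nat.pow_le_pow_right (by norm_num) (by simp)
  omega

end FP


/-! ## A machine that runs an attacker and simulates the tokenization -/

/-- The attacker: the programs still to be run, the variables, the coins still to be tossed, and
the number of steps that are left. -/
structure Thread where
  stack : List Prog
  store : ℕ → Data
  coins : List Bool
  clock : ℕ

/-- What the attacker does next. -/
inductive Thread.Act where
  | done : Act
  | dead : Act
  | ask (v : Data) : Act
  | go (a : Thread) : Act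

namespace Thread

/-- The next step of the attacker, who may not write down trees larger than `T`. -/
def act (T : ℕ) (a : Thread) : Act :=
  match a.stack with
  | [] => .done
  | p :: r =>
    if a.clock = 0 then .dead else
    match p with
    | .skip => .go ⟨r, a.store, a.coins, a.clock - 1⟩
    | .assign x e => if (e.eval a.store).size ≤ T then
        .go ⟨r, Function.update a.store x (e.eval a.store), a.coins, a.clock - 1⟩ else .dead
    | .flip x =>
        .go ⟨r, Function.update a.store x (.ofBool (a.coins.headD false)), a.coins.tail, a.clock - 1⟩
    | .query _ e => if (e.eval a.store).size ≤ T then .ask (e.eval a.store) else .dead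
    | .seq c d => .go ⟨c :: d :: r, a.store, a.coins, a.clock - 1⟩
    | .ite e c d => .go ⟨(if (e.eval a.store).toBool then c else d) :: r, a.store, a.coins, a.clock - 1⟩
    | .while e c => .go ⟨if (e.eval a.store).toBool then c :: .while e c :: r else r, a.store,
        a.coins, a.clock - 1⟩

/-- The attacker goes on with the answer to its query. -/
def resume (a : Thread) (tok : List Bool) : Thread :=
  match a.stack with
  | .query x _ :: r => ⟨r, Function.update a.store x (.ofBits tok), a.coins, a.clock - 1⟩
  | _ => a

theorem act_ask {T : ℕ} {a : Thread} {v : Data} (h : a.act T = .ask v) :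
    0 < a.clock ∧ v.size ≤ T ∧ ∃ x e r, a.stack = .query x e :: r ∧ v = e.eval a.store := by
  rcases a with ⟨stack, store, coins, clock⟩
  rcases stack with - | ⟨p, r⟩
  · simp [act] at h
  · by_cases hc : clock = 0
    · simp [act, hc] at h
    · cases p <;> simp [act, hc] at h
      · split at h <;> cases h
      · split at h <;> cases h
        exact ⟨Nat.pos_of_ne_zero hc, by assumption, _, _, _, rfl, rfl⟩

/-- A step replaces the top of the stack and leaves the rest in place; a query is never consumed in
this way. So the last program on the stack can be followed through a run. -/
theorem act_go {T : ℕ} {a b : Thread} (h : a.act T = .go b) :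
    b.clock + 1 = a.clock ∧
      ∃ p r l, a.stack = p :: r ∧ b.stack = l ++ r ∧ ∀ x e, p ≠ .query x e := by
  rcases a with ⟨stack, store, coins, clock⟩
  rcases stack with - | ⟨p, r⟩
  · simp [act] at h
  · by_cases hc : clock = 0
    · simp [act, hc] at h
    · have hc' : clock - 1 + 1 = clock := Nat.succ_pred_eq_of_ne_zero hc
      cases p <;> simp [act, hc] at h
      · subst h; exact ⟨hc', _, r, [], rfl, rfl, by simp⟩
      · split at h <;> cases h
        exact ⟨hc', _, r, [], rfl, rfl, by simp⟩
      · subst h; exact ⟨hc', _, r, [], rfl, rfl, by simp⟩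
      · split at h <;> cases h
      · subst h; exact ⟨hc', _, r, [_, _], rfl, rfl, by simp⟩
      · subst h; exact ⟨hc', _, r, [_], rfl, rfl, by simp⟩
      · rename_i e c
        subst h
        refine ⟨hc', _, r, if (e.eval store).toBool = true then [c, .while e c] else [], rfl, ?_, by simp⟩
        dsimp only; split <;> rfl

theorem act_done {T : ℕ} {a : Thread} : a.act T = .done ↔ a.stack = [] := by
  rcases a with ⟨stack, store, coins, clock⟩
  rcases stack with - | ⟨p, r⟩
  · simp [act]
  · by_cases hc : clock = 0
    · simp [act, hc]
    · cases p <;> simp only [act, hc, if_false] <;> (try split) <;> simp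

end Thread

/-! ### The machine and its dependence on the ciphertexts -/

namespace Tokenizer

/-- The parameters of the machine. -/
structure Params where
  /-- number of bits of a numeric code -/
  n : ℕ
  /-- block length -/
  m : ℕ
  /-- bound for the trees written down by the attacker -/
  T : ℕ
  /-- number of available encryptions -/
  Q : ℕ
  /-- number of numeric codes -/
  thr : ℕ
  /-- the function `f`, on bits -/
  fb : List Bool → List Bool → List Bool
  /-- the hidden numeric code -/
  X₀ : List Bool
  /-- the value predicted by the attacker, in terms of its variables -/
  guess : Expr
  /-- the value to be predicted, which is the hidden code by default -/
  goal : Option Expr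

/-- `run`: the attacker computes. `tok`: step 1 of the tokenization is due. `walk`: the block `x`
waits for its encryption. `coll`: a collision of `f` has been found. `bad`: low bits were repeated
or the encryptions are used up. `dead`: the attacker exceeded its limits, or the hidden code was out
of range from the start. -/
inductive Tag where
  | run | tok | walk | coll | bad | dead
  deriving DecidableEq

/-- The state of the machine. -/
structure State where
  th : Thread
  tag : Tag
  /-- the code and the additional input that are tokenized -/
  X : List Bool
  u : List Bool
  /-- the next block to be encrypted -/
  x : List Bool
  /-- a second additional input with the same image -/
  u' : List Bool
  /-- the blocks with which a tokenization has been started, and their additional inputs -/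
  V : List (List Bool × List Bool)
  /-- the low bits of the ciphertexts obtained -/
  Ys : List (List Bool)
  cnt : ℕ
  /-- the blocks encrypted, and the predictions of the attacker at these moments -/
  log : List (List Bool × List Bool)

variable (P : Params)

namespace Params

/-- Read a list of bits as a numeric code. -/
def code (l : List Bool) : List Bool :=
  if Bits.val (Bits.padTake P.n l) < P.thr then Bits.padTake P.n l else List.replicate P.n false

/-- The numeric code meant by a query. -/
def queryCode (v : Data) : List Bool :=
  if v.head.toBool then P.code (Bits.ofData v.tail.head) else P.code P.X₀

/-- The additional input meant by a query. -/
def queryInput (_ : Params) (v : Data) : List Bool :=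
  if v.head.toBool then Bits.ofData v.tail.tail else Bits.ofData v.tail

/-- The prediction of the attacker. -/
def predict (st : ℕ → Data) : List Bool := Bits.ofData (P.guess.eval st)

/-- The value to be predicted. -/
def target (st : ℕ → Data) : List Bool :=
  match P.goal with
  | none => P.X₀
  | some e => Bits.ofData (e.eval st)

end Params

/-- The machine receives the ciphertext `y` of the block `s.x`. -/
def answer (s : State) (y : List Bool) : State :=
  let yl := y.take P.n
  let log := (s.x, P.predict s.th.store) :: s.log
  if yl ∈ s.Ys then { s with tag := .bad, Ys := yl :: s.Ys, cnt := s.cnt + 1, log := log }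
  else if Bits.val yl < P.thr then
    { s with tag := .run, th := s.th.resume yl, Ys := yl :: s.Ys, cnt := s.cnt + 1, log := log }
  else { s with x := y, Ys := yl :: s.Ys, cnt := s.cnt + 1, log := log }

/-- A step of the machine, where the `k`-th ciphertext, for the block `x`, is `src k x`. -/
def step (src : ℕ → List Bool → List Bool) (s : State) : State :=
  match s.tag with
  | .run => match s.th.act P.T with
    | .done => s
    | .dead => { s with tag := .dead }
    | .ask v => { s with tag := .tok, X := P.queryCode v, u := P.queryInput v }
    | .go a => { s with th := a }
  | .tok => match Bits.lookup (s.X ++ P.fb s.u s.X) s.V with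
    | none => { s with
        tag := .walk
        x := s.X ++ P.fb s.u s.X
        V := (s.X ++ P.fb s.u s.X, s.u) :: s.V }
    | some u' =>
      if u' = s.u then { s with u := AddInput.succ s.u } else { s with tag := .coll, u' := u' }
  | .walk => if s.cnt < P.Q then answer P s (src s.cnt s.x) else { s with tag := .bad }
  | _ => s

/-- The attacker wins, or the simulation fails. -/
def Accept (s : State) : Prop :=
  s.tag = .bad ∨ s.tag = .coll ∨
    (s.tag = .run ∧ s.th.stack = [] ∧ P.predict s.th.store = P.target s.th.store)

/-- The first `N` steps of the machine. -/
abbrev run (src : ℕ → List Bool → List Bool) (s : State) (N : ℕ) : State := (step P src)^[N] s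

variable {P} {src src' : ℕ → List Bool → List Bool} {s : State}

theorem run_succ (N : ℕ) : run P src s (N + 1) = step P src (run P src s N) :=
  Function.iterate_succ_apply' _ _ _

/-- Accepting states are fixed points, so it suffices to run the machine long enough. -/
theorem step_of_accept (h : Accept P s) : step P src s = s := by
  rcases h with h | h | ⟨h, h', -⟩
  · simp [step, h]
  · simp [step, h]
  · simp [step, h, Thread.act_done.2 h']

theorem accept_run {N N' : ℕ} (hN : N ≤ N') (h : Accept P (run P src s N)) :
    run P src s N' = run P src s N := by
  induction N', hN using Nat.le_induction with
  | base => rfl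
  | succ N' _ ih => rw [run_succ, ih, step_of_accept h]

theorem answer_cnt (y : List Bool) : (answer P s y).cnt = s.cnt + 1 := by
  unfold answer; dsimp only; split_ifs <;> rfl

theorem answer_log (y : List Bool) :
    (answer P s y).log = (s.x, P.predict s.th.store) :: s.log := by
  unfold answer; dsimp only; split_ifs <;> rfl

/-- All steps but the encryptions leave the counter and the log unchanged. -/
theorem step_cnt_log : (s.tag = .walk ∧ s.cnt < P.Q ∧ step P src s = answer P s (src s.cnt s.x)) ∨
    (step P src s).cnt = s.cnt ∧ (step P src s).log = s.log ∧ step P src s = step P src' s := by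
  rcases h : s.tag
  case walk =>
    by_cases hc : s.cnt < P.Q
    · left; simp [step, h, hc]
    · right; simp [step, h, hc]
  case run =>
    right; cases h' : s.th.act P.T <;> simp [step, h, h']
  case tok =>
    right
    cases h' : Bits.lookup (s.X ++ P.fb s.u s.X) s.V with
    | none => simp [step, h, h']
    | some u' => simp only [step, h, h']; split_ifs <;> simp
  all_goals right; simp [step, h]

theorem cnt_le_step : s.cnt ≤ (step P src s).cnt := by
  rcases step_cnt_log (P := P) (src := src) (src' := src) (s := s) with ⟨-, -, h⟩ | ⟨h, -⟩
  · rw [h, answer_cnt]; omega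
  · omega

theorem log_suffix_step : s.log <:+ (step P src s).log := by
  rcases step_cnt_log (P := P) (src := src) (src' := src) (s := s) with ⟨-, -, h⟩ | ⟨-, h, -⟩
  · rw [h, answer_log]; exact List.suffix_cons _ _
  · rw [h]

theorem log_suffix_run {j N : ℕ} (h : j ≤ N) : (run P src s j).log <:+ (run P src s N).log := by
  induction N, h using Nat.le_induction with
  | base => exact List.suffix_rfl
  | succ N _ ih => rw [run_succ]; exact ih.trans log_suffix_step

/-- The answers from number `i` on do not affect the run before them. -/
theorem run_eq_or {i : ℕ} (h : ∀ k x, k < i → src k x = src' k x) (N : ℕ) :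
    run P src s N = run P src' s N ∨ (i < (run P src s N).cnt ∧ i < (run P src' s N).cnt) := by
  induction N with
  | zero => left; rfl
  | succ N ih =>
    rw [run_succ, run_succ]
    rcases ih with ih | ⟨h1, h2⟩
    · rw [← ih]
      rcases step_cnt_log (P := P) (src := src) (src' := src') (s := run P src s N) with
        ⟨ht, hc, h1⟩ | ⟨-, -, h1⟩
      · by_cases hi : (run P src s N).cnt = i
        · right
          have h2 : step P src' (run P src s N) =
              answer P (run P src s N) (src' (run P src s N).cnt (run P src s N).x) := by
            simp [step, ht, hc]
          rw [h1, h2, answer_cnt, answer_cnt]; omega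
        · rcases lt_or_gt_of_ne hi with hi | hi
          · left; simp [step, ht, h _ _ hi]
          · right; exact ⟨hi.trans_le cnt_le_step, hi.trans_le cnt_le_step⟩
      · left; exact h1
    · right; exact ⟨h1.trans_le cnt_le_step, h2.trans_le cnt_le_step⟩

theorem cnt_le_run (hs : s.cnt ≤ P.Q) (N : ℕ) : (run P src s N).cnt ≤ P.Q := by
  induction N with
  | zero => exact hs
  | succ N ih =>
    rw [run_succ]
    rcases step_cnt_log (P := P) (src := src) (src' := src) (s := run P src s N) with
      ⟨ht, hc, h1⟩ | ⟨h1, -⟩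
    · rw [h1, answer_cnt]; omega
    · omega

theorem cnt_eq_length (hs : s.cnt = s.log.length) (N : ℕ) :
    (run P src s N).cnt = (run P src s N).log.length := by
  induction N with
  | zero => exact hs
  | succ N ih =>
    rw [run_succ]
    rcases step_cnt_log (P := P) (src := src) (src' := src) (s := run P src s N) with
      ⟨ht, hc, h1⟩ | ⟨h1, h2, -⟩
    · rw [h1, answer_cnt, answer_log, List.length_cons, ih]
    · rw [h1, h2, ih]

/-- The requirements on the parameters. -/
structure Params.Valid (P : Params) : Prop where
  thr_pos : 0 < P.thr
  le : P.n ≤ P.m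
  fb_length : ∀ u X, X.length = P.n → Bits.val X < P.thr → (P.fb u X).length = P.m - P.n

/-- `X` is a numeric code. -/
def Params.IsCode (P : Params) (X : List Bool) : Prop := X.length = P.n ∧ Bits.val X < P.thr

theorem Params.Valid.isCode_code (hP : P.Valid) (l : List Bool) : P.IsCode (P.code l) := by
  unfold Params.code
  split_ifs with h
  · exact ⟨by simp, h⟩
  · exact ⟨by simp, by rw [Bits.val_replicate_false]; exact hP.thr_pos⟩

theorem Params.IsCode.code_eq {X : List Bool} (h : P.IsCode X) : P.code X = X := by
  have : Bits.padTake P.n X = X := by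
    rw [Bits.padTake_eq_take h.1.ge, ← h.1, List.take_length]
  rw [Params.code, this, if_pos h.2]

/-- Blocks that have been encrypted or are going to be. -/
def Known (P : Params) (s : State) (z : List Bool) : Prop :=
  z ∈ s.V.map Prod.fst ∨ (P.thr ≤ Bits.val (z.take P.n) ∧ z.take P.n ∈ s.Ys)

/-- The invariants of a run. -/
structure Inv (P : Params) (s : State) : Prop where
  isCode : P.IsCode s.X
  V : ∀ e ∈ s.V, ∃ X, P.IsCode X ∧ e.1 = X ++ P.fb e.2 X
  log : ∀ z ∈ s.log.map Prod.fst, Known P s z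
  walk : s.tag = .walk → s.x ∉ s.log.map Prod.fst ∧ s.x.length = P.m ∧ Known P s s.x
  coll : s.tag = .coll → (s.X ++ P.fb s.u s.X, s.u') ∈ s.V ∧ s.u' ≠ s.u
  query : s.tag = .tok ∨ s.tag = .walk → 0 < s.th.clock ∧ ∃ x e r, s.th.stack = .query x e :: r

end Tokenizer


/-! ### No block is encrypted twice -/

namespace Tokenizer

variable {P : Params} {src src' : ℕ → List Bool → List Bool} {s : State}

theorem Params.Valid.isCode_queryCode (hP : P.Valid) (v : Data) : P.IsCode (P.queryCode v) := by
  unfold Params.queryCode; split_ifs <;> exact hP.isCode_code _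

theorem Params.IsCode.take_append {X : List Bool} (h : P.IsCode X) (l : List Bool) :
    (X ++ l).take P.n = X := by
  rw [← h.1]; simp

/-- If the walk continues with `y`, then `y` is new: the starting blocks in `V` have low bits below
`thr`, those of `y` are not below, and every other known block has its low bits in `Ys`, where those
of `y` do not occur. -/
theorem Inv.answer (hs : Inv P s) (ht : s.tag = .walk) {y : List Bool}
    (hy : y.length = P.m) : Inv P (answer P s y) := by
  obtain ⟨hx, hxl, hk⟩ := hs.walk ht
  have hlog : ∀ z ∈ ((s.x, P.predict s.th.store) :: s.log).map Prod.fst,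
      z ∈ s.V.map Prod.fst ∨ (P.thr ≤ Bits.val (z.take P.n) ∧ z.take P.n ∈ y.take P.n :: s.Ys) := by
    intro z hz
    have hz : Known P s z := by
      rcases List.mem_cons.1 hz with rfl | hz
      · exact hk
      · exact hs.log z hz
    rcases hz with hz | ⟨h1, h2⟩
    · exact .inl hz
    · exact .inr ⟨h1, List.mem_cons_of_mem _ h2⟩
  unfold Tokenizer.answer
  dsimp only
  split_ifs with h1 h2
  · exact ⟨hs.isCode, hs.V, hlog, by simp, by simp, by simp⟩
  · exact ⟨hs.isCode, hs.V, hlog, by simp, by simp, by simp⟩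
  · refine ⟨hs.isCode, hs.V, hlog, fun _ => ⟨?_, hy, ?_⟩, by simp [ht], fun _ => hs.query (.inr ht)⟩
    · intro hmem
      have hmem : Known P s y := by
        rcases List.mem_cons.1 hmem with h | h
        · dsimp only at h; rw [h]; exact hk
        · exact hs.log y h
      rcases hmem with h | h
      · obtain ⟨e, he, rfl⟩ := List.mem_map.1 h
        obtain ⟨X, hX, h'⟩ := hs.V e he
        rw [h', hX.take_append] at h2
        exact h2 hX.2
      · exact h1 h.2
    · exact .inr ⟨not_lt.1 h2, by simp⟩

theorem Inv.step (hP : P.Valid) (hs : Inv P s) (hsrc : ∀ k x, (src k x).length = P.m) :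
    Inv P (step P src s) := by
  rcases ht : s.tag
  case walk =>
    by_cases hc : s.cnt < P.Q
    · simpa [Tokenizer.step, ht, hc] using hs.answer ht (hsrc _ _)
    · simp only [Tokenizer.step, ht, hc, if_false]
      exact ⟨hs.isCode, hs.V, hs.log, by simp, by simp, by simp⟩
  case run =>
    cases h : s.th.act P.T with
    | done => simpa [Tokenizer.step, ht, h] using hs
    | dead =>
      simp only [Tokenizer.step, ht, h]
      exact ⟨hs.isCode, hs.V, hs.log, by simp, by simp, by simp⟩
    | ask v =>
      simp only [Tokenizer.step, ht, h]
      obtain ⟨h1, -, x, e, r, h2, -⟩ := Thread.act_ask h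
      exact ⟨hP.isCode_queryCode v, hs.V, hs.log, by simp, by simp, fun _ => ⟨h1, x, e, r, h2⟩⟩
    | go a =>
      simp only [Tokenizer.step, ht, h]
      exact ⟨hs.isCode, hs.V, hs.log, by simp, by simp, by simp⟩
  case tok =>
    have hX := hs.isCode
    have hlen : (s.X ++ P.fb s.u s.X).length = P.m := by
      rw [List.length_append, hP.fb_length _ _ hX.1 hX.2, hX.1]; have := hP.le; omega
    cases h : Bits.lookup (s.X ++ P.fb s.u s.X) s.V with
    | none =>
      rw [Bits.lookup_none] at h
      simp only [Tokenizer.step, ht, Bits.lookup_none.2 h]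
      refine ⟨hs.isCode, ?_, ?_, fun _ => ⟨?_, hlen, ?_⟩, by simp, fun _ => hs.query (.inl ht)⟩
      · intro e he
        rcases List.mem_cons.1 he with rfl | he
        · exact ⟨s.X, hX, rfl⟩
        · exact hs.V e he
      · intro z hz
        rcases hs.log z hz with h | h
        · exact .inl (List.mem_cons_of_mem _ h)
        · exact .inr h
      -- A starting block that is not in `V` could only be known as an intermediate block, but its
      -- low bits are a numeric code.
      · intro hmem
        rcases hs.log _ hmem with h' | h'
        · exact h h'
        · rw [hX.take_append] at h'
          exact absurd hX.2 (not_lt.2 h'.1)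
      · exact .inl (by simp)
    | some u' =>
      by_cases hu : u' = s.u
      · simp only [Tokenizer.step, ht, h, hu, if_true]
        exact ⟨hs.isCode, hs.V, hs.log, by simp, by simp, by simpa [ht] using hs.query (.inl ht)⟩
      · simp only [Tokenizer.step, ht, h, hu, if_false]
        exact ⟨hs.isCode, hs.V, hs.log, by simp, fun _ => ⟨Bits.lookup_some h, hu⟩, by simp⟩
  all_goals simpa [Tokenizer.step, ht] using hs

theorem Inv.run (hP : P.Valid) (hs : Inv P s) (hsrc : ∀ k x, (src k x).length = P.m) (N : ℕ) :
    Inv P (run P src s N) := by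
  induction N with
  | zero => exact hs
  | succ N ih => rw [run_succ]; exact ih.step hP hsrc

/-- In the collision state, two additional inputs have the same image. -/
theorem Inv.fb_eq (hs : Inv P s) (ht : s.tag = .coll) :
    P.IsCode s.X ∧ s.u' ≠ s.u ∧ P.fb s.u s.X = P.fb s.u' s.X := by
  obtain ⟨h1, h2⟩ := hs.coll ht
  obtain ⟨X, hX, h⟩ := hs.V _ h1
  dsimp only at h
  obtain ⟨rfl, h'⟩ := List.append_inj h (hs.isCode.1.trans hX.1.symm)
  exact ⟨hs.isCode, h2, h'⟩

/-! ### Runs with ciphertexts from a given list -/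

/-- The number of ciphertexts among the first `k` that yield a token. -/
def lows (P : Params) (y : ℕ → List Bool) (k : ℕ) : ℕ :=
  ((Finset.range k).filter fun j => Bits.val ((y j).take P.n) < P.thr).card

theorem lows_succ (y : ℕ → List Bool) (k : ℕ) :
    lows P y (k + 1) = lows P y k + if Bits.val ((y k).take P.n) < P.thr then 1 else 0 := by
  unfold lows
  rw [Finset.range_add_one, Finset.filter_insert]
  split_ifs <;> simp

/-- Among the first `Q` ciphertexts, two have the same low bits, or less than `C` yield tokens. -/
def PoolBad (P : Params) (y : ℕ → List Bool) (C : ℕ) : Prop :=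
  (∃ k < P.Q, ∃ j < k, (y k).take P.n = (y j).take P.n) ∨ lows P y P.Q < C

/-- A ciphertext with low bits below `thr` ends a query and costs the attacker one unit of its
clock, so the number of such ciphertexts plus the clock never exceeds the initial clock. If the
encryptions run out within a query, the clock is still positive, and fewer than `s.th.clock` tokens
have been produced. -/
theorem poolBad_of_bad {y : ℕ → List Bool} (hP : P.Valid) (hs : Inv P s)
    (hy : ∀ k, (y k).length = P.m) (h0 : s.cnt = 0) (hYs : s.Ys = []) (htag : s.tag ≠ .bad) (N : ℕ)
    (h : (run P (fun k _ => y k) s N).tag = .bad) : PoolBad P y s.th.clock := by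
  have key : ∀ N, let r := run P (fun k _ => y k) s N
      (∀ z ∈ r.Ys, ∃ j < r.cnt, z = (y j).take P.n) ∧ r.cnt ≤ P.Q ∧
      (r.tag = .bad → PoolBad P y s.th.clock) ∧
      (r.tag ≠ .bad → lows P y r.cnt + r.th.clock ≤ s.th.clock) := by
    intro N
    induction N with
    | zero => simp [run, h0, hYs, htag, lows]
    | succ N ih =>
      obtain ⟨h1, h2, h3, h4⟩ := ih
      have hI := hs.run hP (src := fun k _ => y k) (fun k _ => hy k) N
      rw [run_succ]
      generalize run P (fun k _ => y k) s N = r at *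
      dsimp only at h1 h2 h3 h4 ⊢
      rcases ht : r.tag
      case walk =>
        have h4 := h4 (by simp [ht])
        obtain ⟨hcl, x, e, st, hq⟩ := hI.query (.inr ht)
        by_cases hc : r.cnt < P.Q
        · simp only [step, ht, hc, if_true]
          have hY : ∀ z ∈ (y r.cnt).take P.n :: r.Ys, ∃ j < r.cnt + 1, z = (y j).take P.n := by
            intro z hz
            rcases List.mem_cons.1 hz with rfl | hz
            · exact ⟨_, Nat.lt_succ_self _, rfl⟩
            · obtain ⟨j, hj, rfl⟩ := h1 z hz
              exact ⟨j, by omega, rfl⟩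
          unfold answer
          dsimp only
          split_ifs with hb hl
          · refine ⟨hY, hc, fun _ => .inl ?_, by simp⟩
            obtain ⟨j, hj, hj'⟩ := h1 _ hb
            exact ⟨_, hc, j, hj, hj'⟩
          · refine ⟨hY, hc, by simp, fun _ => ?_⟩
            dsimp only
            rw [lows_succ, if_pos hl]
            simp only [Thread.resume, hq]; omega
          · refine ⟨hY, hc, by simp [ht], fun _ => ?_⟩
            dsimp only
            rw [lows_succ, if_neg hl]; omega
        · simp only [step, ht, hc, if_false]
          refine ⟨h1, h2, fun _ => .inr ?_, by simp⟩
          rw [show r.cnt = P.Q by omega] at h4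
          omega
      case run =>
        have h4 := h4 (by simp [ht])
        cases h : r.th.act P.T with
        | done => simp [step, ht, h]; exact ⟨h1, h2, h4⟩
        | dead => simp [step, ht, h]; exact ⟨h1, h2, h4⟩
        | ask v => simp [step, ht, h]; exact ⟨h1, h2, h4⟩
        | go a =>
          have := (Thread.act_go h).1
          simp [step, ht, h]; exact ⟨h1, h2, by omega⟩
      case tok =>
        have h4 := h4 (by simp [ht])
        cases h : Bits.lookup (r.X ++ P.fb r.u r.X) r.V with
        | none => simp [step, ht, h]; exact ⟨h1, h2, h4⟩
        | some u' =>
          by_cases hu : u' = r.u <;> simp [step, ht, h, hu] <;> exact ⟨h1, h2, h4⟩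
      all_goals
        rw [show step P (fun k _ => y k) r = r by simp [step, ht]]
        exact ⟨h1, h2, h3, h4⟩
  exact (key N).2.2.1 h

/-- The attacker runs with tokens taken from a list of ciphertexts. -/
def refStep (n T Q thr : ℕ) (y : ℕ → List Bool) (p : Thread × ℕ) : Thread × ℕ :=
  match p.1.act T with
  | .go a => (a, p.2)
  | .ask _ =>
    if p.2 < Q then
      (if Bits.val ((y p.2).take n) < thr then p.1.resume ((y p.2).take n) else p.1, p.2 + 1)
    else p
  | _ => p

/-- What the attacker sees depends on the ciphertexts alone: `refStep` involves neither the hidden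
code nor the additional inputs, because the steps that deal with these leave thread and counter
unchanged. This is why the tokens carry no information about the hidden code. -/
theorem run_eq_ref {y : ℕ → List Bool} (htag : s.tag = .run) (N : ℕ)
    (h : (run P (fun k _ => y k) s N).tag = .run)
    (hst : (run P (fun k _ => y k) s N).th.stack = []) :
    (run P (fun k _ => y k) s N).th = ((refStep P.n P.T P.Q P.thr y)^[N] (s.th, s.cnt)).1 := by
  have key : ∀ N, let r := run P (fun k _ => y k) s N
      r.tag ≠ .bad → (∃ i ≤ N, (r.th, r.cnt) = (refStep P.n P.T P.Q P.thr y)^[i] (s.th, s.cnt)) ∧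
        (r.tag = .tok ∨ r.tag = .walk → ∃ v, r.th.act P.T = .ask v) := by
    intro N
    induction N with
    | zero => intro r _; exact ⟨⟨0, le_rfl, rfl⟩, by simp [r, run, htag]⟩
    | succ N ih =>
      intro r hr
      dsimp only at ih
      obtain ⟨⟨i, hi, hi'⟩, hq⟩ := ih fun h => hr (by simp only [r, run_succ]; simp [step, h])
      have hnext : ∀ p, p = refStep P.n P.T P.Q P.thr y
          ((run P (fun k _ => y k) s N).th, (run P (fun k _ => y k) s N).cnt) →
          ∃ i ≤ N + 1, p = (refStep P.n P.T P.Q P.thr y)^[i] (s.th, s.cnt) := by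
        rintro p rfl
        exact ⟨i + 1, by omega, by rw [Function.iterate_succ_apply', ← hi']⟩
      have hsame : ∃ i ≤ N + 1, ((run P (fun k _ => y k) s N).th, (run P (fun k _ => y k) s N).cnt) =
          (refStep P.n P.T P.Q P.thr y)^[i] (s.th, s.cnt) := ⟨i, by omega, hi'⟩
      revert hr
      simp only [r, run_succ]
      clear hi' r
      generalize run P (fun k _ => y k) s N = r at *
      intro hr
      rcases ht : r.tag
      case walk =>
        obtain ⟨v, hv⟩ := hq (.inr ht)
        by_cases hc : r.cnt < P.Q
        · simp only [step, ht, hc, if_true] at hr ⊢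
          unfold answer at hr ⊢
          dsimp only at hr ⊢
          split_ifs at hr ⊢ with hb hl
          · simp at hr
          · exact ⟨hnext _ (by simp [refStep, hv, hc, hl]), by simp⟩
          · exact ⟨hnext _ (by simp [refStep, hv, hc, hl]), fun _ => ⟨v, hv⟩⟩
        · simp [step, ht, hc] at hr
      case run =>
        cases h : r.th.act P.T with
        | done => simp only [step, ht, h]; exact ⟨hsame, by simp⟩
        | dead => simp only [step, ht, h]; exact ⟨hsame, by simp⟩
        | ask v => simp only [step, ht, h]; exact ⟨hsame, fun _ => ⟨v, rfl⟩⟩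
        | go a => simp only [step, ht, h]; exact ⟨hnext _ (by simp [refStep, h]), by simp⟩
      case tok =>
        obtain ⟨v, hv⟩ := hq (.inl ht)
        cases h : Bits.lookup (r.X ++ P.fb r.u r.X) r.V with
        | none => simp only [step, ht, h]; exact ⟨hsame, fun _ => ⟨v, hv⟩⟩
        | some u' =>
          by_cases hu : u' = r.u
          · simp only [step, ht, h, hu, if_true]; exact ⟨hsame, fun _ => ⟨v, hv⟩⟩
          · simp only [step, ht, h, hu, if_false]; exact ⟨hsame, by simp⟩
      all_goals
        simp only [step, ht]
        exact ⟨hsame, by simp⟩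
  obtain ⟨⟨i, hi, hi'⟩, -⟩ := key N (by simp [h])
  -- The reference run has skipped some steps; an empty stack is fixed by `refStep`, so the missing
  -- iterations can be added.
  obtain ⟨d, rfl⟩ := Nat.exists_eq_add_of_le' hi
  rw [Function.iterate_add_apply, ← hi']
  have hfix : refStep P.n P.T P.Q P.thr y
      ((run P (fun k _ => y k) s (d + i)).th, (run P (fun k _ => y k) s (d + i)).cnt) =
      ((run P (fun k _ => y k) s (d + i)).th, (run P (fun k _ => y k) s (d + i)).cnt) := by
    simp only [refStep, Thread.act_done.2 hst]
  rw [Function.iterate_fixed hfix]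

/-- If the attacker has predicted the answer to its last query, then some ciphertext has been
predicted before it was received. -/
theorem predicted_of_win {y : ℕ → List Bool} (hP : P.Valid) (hs : Inv P s)
    (hy : ∀ k, (y k).length = P.m) {v : ℕ} {q : Expr}
    (hlast : s.th.stack.getLast? = some (.query v q)) (hv : P.guess.vars ≤ v)
    (hgoal : P.goal = some (.var v)) (N : ℕ)
    (hst : (run P (fun k _ => y k) s N).th.stack = [])
    (hwin : P.predict (run P (fun k _ => y k) s N).th.store =
      P.target (run P (fun k _ => y k) s N).th.store) :
    ∃ j, let r := run P (fun k _ => y k) s j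
      j < N ∧ r.tag = .walk ∧ r.cnt < P.Q ∧ (y r.cnt).take P.n = P.predict r.th.store := by
  -- The checking query stays at the bottom of the stack until it is answered; this answer empties
  -- the stack and is the target. The prediction reads only variables below `v`, so writing the
  -- answer to `v` does not change it.
  have key : ∀ N, let r := run P (fun k _ => y k) s N
      (r.th.stack = [] ∧ ∃ j, let r' := run P (fun k _ => y k) s j
        j < N ∧ r'.tag = .walk ∧ r'.cnt < P.Q ∧ (y r'.cnt).take P.n = P.target r.th.store ∧
          P.predict r'.th.store = P.predict r.th.store) ∨
      r.th.stack.getLast? = some (.query v q) := by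
    intro N
    induction N with
    | zero => right; exact hlast
    | succ N ih =>
      have hI := hs.run hP (src := fun k _ => y k) (fun k _ => hy k) N
      dsimp only at ih ⊢
      rw [run_succ]
      rcases ih with ⟨h1, j, hj, h2⟩ | ih
      · have hth : (step P (fun k _ => y k) (run P (fun k _ => y k) s N)).th =
            (run P (fun k _ => y k) s N).th := by
          generalize run P (fun k _ => y k) s N = r at *
          rcases ht : r.tag
          case run => simp [step, ht, Thread.act_done.2 h1]
          case tok => obtain ⟨-, x, e, st, h⟩ := hI.query (.inl ht); simp [h1] at h
          case walk => obtain ⟨-, x, e, st, h⟩ := hI.query (.inr ht); simp [h1] at h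
          all_goals simp [step, ht]
        left; rw [hth]; exact ⟨h1, j, by omega, h2⟩
      · have hN : ∀ r, r = run P (fun k _ => y k) s N → r.tag = .walk → r.cnt < P.Q →
            P.target (step P (fun k _ => y k) r).th.store = (y r.cnt).take P.n →
            P.predict r.th.store = P.predict (step P (fun k _ => y k) r).th.store →
            ∃ j, let r' := run P (fun k _ => y k) s j
              j < N + 1 ∧ r'.tag = .walk ∧ r'.cnt < P.Q ∧
                (y r'.cnt).take P.n = P.target (step P (fun k _ => y k) r).th.store ∧
                P.predict r'.th.store = P.predict (step P (fun k _ => y k) r).th.store := by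
          rintro r rfl h1 h2 h3 h4
          exact ⟨N, by omega, h1, h2, h3.symm, h4⟩
        have hN := hN _ rfl
        generalize run P (fun k _ => y k) s N = r at *
        rcases ht : r.tag
        case walk =>
          obtain ⟨-, x, e, st, hq⟩ := hI.query (.inr ht)
          by_cases hc : r.cnt < P.Q
          · have hstep : step P (fun k _ => y k) r = answer P r (y r.cnt) := by simp [step, ht, hc]
            rw [hstep] at hN ⊢
            by_cases hres : (answer P r (y r.cnt)).th = r.th
            · right; rw [hres]; exact ih
            have hres : (answer P r (y r.cnt)).th = r.th.resume ((y r.cnt).take P.n) := by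
              revert hres
              unfold answer; dsimp only; split_ifs <;> simp
            rw [hres] at hN ⊢
            rcases st with - | ⟨p, st⟩
            · rw [hq] at ih
              obtain ⟨rfl, rfl⟩ : x = v ∧ e = q := by simpa using ih
              left
              refine ⟨by simp [Thread.resume, hq], hN ht hc ?_ ?_⟩
              · simp [Params.target, hgoal, Thread.resume, hq, Expr.eval, Bits.ofData_ofBits]
              · simp only [Params.predict, Thread.resume, hq]
                rw [Expr.eval_congr (M := x) (fun z hz => ?_) hv]
                rw [Function.update_of_ne (by omega)]
            · right; rw [hq] at ih; simpa [Thread.resume, hq] using ih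
          · right; simpa [step, ht, hc] using ih
        case run =>
          right
          cases h : r.th.act P.T with
          | done => simpa [step, ht, h] using ih
          | dead => simpa [step, ht, h] using ih
          | ask v => simpa [step, ht, h] using ih
          | go a =>
            simp only [step, ht, h]
            obtain ⟨-, p, st, l, h1, h2, h3⟩ := Thread.act_go h
            rw [h1] at ih
            rcases st with - | ⟨p', st⟩
            · exact absurd (by simpa using ih) (h3 v q)
            · rw [List.getLast?_cons_cons] at ih
              rw [h2, List.getLast?_append, ih]; rfl
        case tok =>
          right
          cases h : Bits.lookup (r.X ++ P.fb r.u r.X) r.V with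
          | none => simpa [step, ht, h] using ih
          | some u' => by_cases hu : u' = r.u <;> simpa [step, ht, h, hu] using ih
        all_goals right; simpa [step, ht] using ih
  rcases key N with ⟨-, j, hj, h1, h2, h3, h4⟩ | h'
  · exact ⟨j, hj, h1, h2, by rw [h3, h4, hwin]⟩
  · simp [hst] at h'

end Tokenizer


/-! ### Runs with the block cipher -/

theorem Bits.ofNat_mod (k x : ℕ) : ofNat k (x % 2 ^ k) = ofNat k x := by
  refine val_injective (by simp) ?_
  rw [val_ofNat, val_ofNat, Nat.mod_mod]

theorem Bits.take_ofNat {k m : ℕ} (h : k ≤ m) (x : ℕ) : (ofNat m x).take k = ofNat k x := by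
  obtain ⟨d, rfl⟩ := Nat.exists_eq_add_of_le h
  rw [ofNat_add, List.take_left' (by simp)]

theorem Bits.ofNat_mul_add {k m : ℕ} (h : k ≤ m) {x : ℕ} (hx : x < 2 ^ k) (y : ℕ) :
    ofNat m (2 ^ k * y + x) = ofNat k x ++ ofNat (m - k) y := by
  obtain ⟨d, rfl⟩ := Nat.exists_eq_add_of_le h
  rw [ofNat_add, ← ofNat_mod, Nat.mul_add_mod, Nat.mod_eq_of_lt hx,
    Nat.mul_add_div (by positivity), Nat.div_eq_of_lt hx, add_zero, Nat.add_sub_cancel_left]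

namespace AddInput

/-- Additional inputs, ordered by length and value. -/
def rank (u : List Bool) : ℕ := 2 ^ u.length + Bits.val u

theorem rank_lt_succ : ∀ u : List Bool, rank u < rank (succ u)
  | [] => by simp [rank, succ, Bits.val]
  | false :: u => by simp [rank, succ, Bits.val]
  | true :: u => by
    have := rank_lt_succ u
    simp only [rank, succ, Bits.val, List.length_cons, pow_succ] at *
    simp; omega

/-- `rank` grows with every increment, also at an overflow, where the string becomes longer. A chain
of retries thus never returns to an earlier input. -/
theorem iterate_succ_injective (u : List Bool) : Function.Injective fun k => succ^[k] u := by
  have : StrictMono fun k => rank (succ^[k] u) := strictMono_nat_of_lt_succ fun k => by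
    rw [Function.iterate_succ_apply']; exact rank_lt_succ _
  exact fun a b h => this.injective (congrArg rank h)

end AddInput

namespace TokenScheme

variable (S : TokenScheme) (κ : ℕ)

/-- The digits of a numeric code. -/
def bits {S : TokenScheme} {κ : ℕ} (X : NumCode (S.l κ)) : List Bool :=
  Bits.ofNat (codeBits (S.l κ)) X.val

theorem lt_two_pow (X : NumCode (S.l κ)) : X.val < 2 ^ codeBits (S.l κ) :=
  X.isLt.trans_le (Nat.le_pow_clog (by norm_num) _)

/-- The parameters of the machine. -/
def params (T Q : ℕ) (X₀ : List Bool) (guess : Expr) (goal : Option Expr) : Tokenizer.Params where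
  n := codeBits (S.l κ)
  m := S.E.m κ
  T := T
  Q := Q
  thr := 10 ^ S.l κ
  fb u X := if h : Bits.val X < 10 ^ S.l κ then
    Bits.ofNat (S.E.m κ - codeBits (S.l κ)) (S.f κ u ⟨Bits.val X, h⟩).toNat else []
  X₀ := X₀
  guess := guess
  goal := goal

/-- The block cipher, on bits. -/
def encBits (K : S.E.Key κ) (x : List Bool) : List Bool :=
  Bits.ofNat (S.E.m κ) (S.E.enc κ K (BitVec.ofNat _ (Bits.val x))).toNat

variable {S κ} {T Q : ℕ} {X₀ : List Bool} {guess : Expr} {goal : Option Expr}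

theorem params_valid : (S.params κ T Q X₀ guess goal).Valid where
  thr_pos := by simp [params]
  le := S.codeBits_le κ
  fb_length u X _ h := by
    have h : Bits.val X < 10 ^ S.l κ := h
    simp [params, h]

theorem val_bits (X : NumCode (S.l κ)) : Bits.val (bits X) = X.val := by
  rw [bits, Bits.val_ofNat, Nat.mod_eq_of_lt (S.lt_two_pow κ X)]

theorem bits_isCode (X : NumCode (S.l κ)) : (S.params κ T Q X₀ guess goal).IsCode (bits X) :=
  ⟨Bits.length_ofNat _ _, by rw [val_bits]; exact X.isLt⟩

theorem encBits_block (K : S.E.Key κ) (t : BitVec (S.E.m κ)) :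
    S.encBits κ K (Bits.ofNat (S.E.m κ) t.toNat) = Bits.ofNat (S.E.m κ) (S.E.enc κ K t).toNat := by
  rw [encBits, Bits.val_ofNat, Nat.mod_eq_of_lt t.isLt, BitVec.ofNat_toNat, BitVec.setWidth_eq]

theorem take_block (t : BitVec (S.E.m κ)) :
    (Bits.ofNat (S.E.m κ) t.toNat).take (codeBits (S.l κ)) =
      Bits.ofNat (codeBits (S.l κ)) (t.toNat % 2 ^ codeBits (S.l κ)) := by
  rw [Bits.take_ofNat (S.codeBits_le κ), Bits.ofNat_mod]

/-- The lists have the least significant bit first, so the code, which forms the low bits of the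
block, comes first. -/
theorem start_bits (u : AddInput) (X : NumCode (S.l κ)) :
    Bits.ofNat (S.E.m κ) (S.start κ u X).toNat =
      bits X ++ (S.params κ T Q X₀ guess goal).fb u (bits X) := by
  have hX := S.lt_two_pow κ X
  have h1 : (S.start κ u X).toNat = 2 ^ codeBits (S.l κ) * (S.f κ u X).toNat + X.val := by
    rw [start, BitVec.toNat_cast, BitVec.toNat_append, BitVec.toNat_ofNat, Nat.mod_eq_of_lt hX,
      Nat.shiftLeft_eq, mul_comm, Nat.two_pow_add_eq_or_of_lt hX]
  have h2 : Bits.val (bits X) < 10 ^ S.l κ := by rw [val_bits]; exact X.isLt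
  have h3 : (S.params κ T Q X₀ guess goal).fb u (bits X) =
      Bits.ofNat (S.E.m κ - codeBits (S.l κ)) (S.f κ u X).toNat := by
    have h4 : (⟨Bits.val (bits X), h2⟩ : NumCode (S.l κ)) = X := Fin.ext (val_bits X)
    simp only [params, h2, dif_pos, h4]
  rw [h1, h3, Bits.ofNat_mul_add (S.codeBits_le κ) hX]
  rfl

/-- The walk is determined by key and block. This identifies the token of a block found in `V` with
the one stored for it. -/
theorem Walk.unique {K : S.E.Key κ} {t : BitVec (S.E.m κ)} {tok tok' : NumCode (S.l κ)}
    (h : S.Walk κ K t tok) (h' : S.Walk κ K t tok') : tok = tok' := by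
  induction h with
  | done t h =>
    cases h' with
    | done => rfl
    | again _ _ h'' => exact absurd h (not_lt.2 h'')
  | again t tok h _ ih =>
    cases h' with
    | done _ h'' => exact absurd h'' (not_lt.2 h)
    | again _ _ _ hw => exact ih hw

end TokenScheme

namespace Tokenizer

open TokenScheme

variable {S : TokenScheme} {κ : ℕ} {T Q : ℕ} {X₀ : List Bool} {guess : Expr} {goal : Option Expr}
  {K : S.E.Key κ}

/-- Runs with the block cipher. -/
local notation "rrun" => run (S.params κ T Q X₀ guess goal) (fun _ => S.encBits κ K)

theorem run_add {P : Params} {src : ℕ → List Bool → List Bool} (s : State) (j k : ℕ) :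
    run P src s (k + j) = run P src (run P src s j) k :=
  Function.iterate_add_apply _ _ _ _

/-- Every step of a walk is an encryption, so the number of steps is the growth of the counter; the
one exception is a machine that stops because its budget is exhausted. The new token is not in
`s.Ys`, which later shows that it is not among the stored ones. -/
theorem run_walk {t : BitVec (S.E.m κ)} {tok : NumCode (S.l κ)} (hw : S.Walk κ K t tok) (s : State)
    (ht : s.tag = .walk) (hx : s.x = Bits.ofNat (S.E.m κ) t.toNat) :
    ∃ j, ((rrun s j).tag = .bad ∧ j + s.cnt ≤ (rrun s j).cnt + 1) ∨
      (j + s.cnt = (rrun s j).cnt ∧ (rrun s j).tag = .run ∧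
        (rrun s j).th = s.th.resume (bits tok) ∧ (rrun s j).V = s.V ∧
        bits tok ∈ (rrun s j).Ys ∧ s.Ys ⊆ (rrun s j).Ys ∧ bits tok ∉ s.Ys) := by
  induction hw generalizing s with
  | done t h =>
    refine ⟨1, ?_⟩
    by_cases hc : s.cnt < Q
    · have hc' : s.cnt < (S.params κ T Q X₀ guess goal).Q := hc
      have h1 : rrun s 1 = answer (S.params κ T Q X₀ guess goal) s
          (Bits.ofNat (S.E.m κ) (S.E.enc κ K t).toNat) := by
        simp [run, step, ht, hc', hx, encBits_block]
      have h2 : (Bits.ofNat (S.E.m κ) (S.E.enc κ K t).toNat).take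
          (S.params κ T Q X₀ guess goal).n = bits ⟨_, h⟩ := take_block _
      rw [h1]
      unfold answer
      rw [h2]
      dsimp only
      split_ifs with hb hl
      · left; exact ⟨rfl, by dsimp only; omega⟩
      · right; exact ⟨by dsimp only; omega, rfl, rfl, rfl, by simp, by simp, hb⟩
      · exact absurd (bits_isCode _).2 hl
    · have hc' : ¬ s.cnt < (S.params κ T Q X₀ guess goal).Q := hc
      left
      have h1 : rrun s 1 = { s with tag := .bad } := by simp [run, step, ht, hc']
      rw [h1]; exact ⟨rfl, by dsimp only; omega⟩
  | again t tok h hw ih =>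
    by_cases hc : s.cnt < Q
    · have hc' : s.cnt < (S.params κ T Q X₀ guess goal).Q := hc
      have h1 : rrun s 1 = answer (S.params κ T Q X₀ guess goal) s
          (Bits.ofNat (S.E.m κ) (S.E.enc κ K t).toNat) := by
        simp [run, step, ht, hc', hx, encBits_block]
      have h2 : (Bits.ofNat (S.E.m κ) (S.E.enc κ K t).toNat).take
          (S.params κ T Q X₀ guess goal).n = Bits.ofNat (codeBits (S.l κ))
            ((S.E.enc κ K t).toNat % 2 ^ codeBits (S.l κ)) := take_block _
      have h3 : ¬ Bits.val ((Bits.ofNat (S.E.m κ) (S.E.enc κ K t).toNat).take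
          (S.params κ T Q X₀ guess goal).n) < (S.params κ T Q X₀ guess goal).thr := by
        rw [h2, Bits.val_ofNat, Nat.mod_mod]; exact not_lt.2 h
      unfold answer at h1
      dsimp only at h1
      rw [if_neg h3] at h1
      split_ifs at h1 with hb
      · refine ⟨1, .inl ?_⟩
        rw [h1]; exact ⟨rfl, by dsimp only; omega⟩
      · obtain ⟨j, hj⟩ := ih (rrun s 1) (by rw [h1]; exact ht) (by rw [h1])
        refine ⟨j + 1, ?_⟩
        rw [run_add]
        refine hj.imp (fun hj => ?_) fun ⟨a1, a2, a3, a4, a5, a6, a7⟩ => ?_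
        · refine ⟨hj.1, ?_⟩
          have hj := hj.2
          rw [h1] at hj ⊢
          dsimp only at hj; omega
        · rw [h1] at *
          dsimp only at *
          exact ⟨by omega, a2, a3, a4, a5, fun z hz => a6 (List.mem_cons_of_mem _ hz),
            fun h => a7 (List.mem_cons_of_mem _ h)⟩
    · have hc' : ¬ s.cnt < (S.params κ T Q X₀ guess goal).Q := hc
      refine ⟨1, .inl ?_⟩
      have h1 : rrun s 1 = { s with tag := .bad } := by simp [run, step, ht, hc']
      rw [h1]; exact ⟨rfl, by dsimp only; omega⟩

/-- The machine with at most `C` steps of the attacker has the tokens `db` stored. -/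
structure Synced (K : S.E.Key κ) (C : ℕ) (db : Set (NumCode (S.l κ))) (s : State) : Prop where
  stored : ∀ tok ∈ db, bits tok ∈ s.Ys
  V : ∀ e ∈ s.V, ∃ tok ∈ db, S.Walk κ K (BitVec.ofNat _ (Bits.val e.1)) tok
  length : s.V.length + s.th.clock ≤ C

theorem ofNat_val_ofNat {m : ℕ} (t : BitVec m) :
    BitVec.ofNat m (Bits.val (Bits.ofNat m t.toNat)) = t := by
  rw [Bits.val_ofNat, Nat.mod_eq_of_lt t.isLt, BitVec.ofNat_toNat, BitVec.setWidth_eq]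

/-- A new starting block leads to a failure or to low bits outside `Ys`. As `Ys` contains all stored
tokens, the resulting token is new, and no retry follows. -/
theorem run_tokenize_new {C : ℕ} {db : Set (NumCode (S.l κ))} {X : NumCode (S.l κ)}
    {tok : NumCode (S.l κ)} (s : State) (hw : S.Walk κ K (S.start κ s.u X) tok)
    (ht : s.tag = .tok) (hX : s.X = bits X) (hs : Synced K C db s) {x : ℕ} {e : Expr}
    {r : List Prog} (hst : s.th.stack = .query x e :: r) (hcl : 0 < s.th.clock)
    (hl : Bits.lookup (Bits.ofNat (S.E.m κ) (S.start κ s.u X).toNat) s.V = none) :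
    ∃ j, j + s.cnt ≤ (rrun s j).cnt + 2 ∧
      (Accept (S.params κ T Q X₀ guess goal) (rrun s j) ∨
        (tok ∉ db ∧ (rrun s j).tag = .run ∧ (rrun s j).th = s.th.resume (bits tok) ∧
          Synced K C (insert tok db) (rrun s j))) := by
  have hstart : s.X ++ (S.params κ T Q X₀ guess goal).fb s.u s.X =
      Bits.ofNat (S.E.m κ) (S.start κ s.u X).toNat := by rw [start_bits, hX]
  have h1 : rrun s 1 = { s with
      tag := .walk
      x := Bits.ofNat (S.E.m κ) (S.start κ s.u X).toNat
      V := (Bits.ofNat (S.E.m κ) (S.start κ s.u X).toNat, s.u) :: s.V } := by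
    rw [run, Function.iterate_one, step, ht]
    dsimp only
    rw [hstart, hl]
  obtain ⟨j, hj⟩ := run_walk (T := T) (Q := Q) (X₀ := X₀) (guess := guess) (goal := goal) hw
    (rrun s 1) (by rw [h1]) (by rw [h1])
  refine ⟨j + 1, ?_⟩
  rw [run_add]
  have hc : (rrun s 1).cnt = s.cnt := by rw [h1]
  rcases hj with ⟨a1, a2⟩ | ⟨a1, a2, a3, a4, a5, a6, a7⟩
  · exact ⟨by omega, .inl (.inl a1)⟩
  · refine ⟨by omega, .inr ⟨fun hdb => a7 ?_, a2, ?_, ?_, ?_, ?_⟩⟩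
    · rw [h1]; exact hs.stored _ hdb
    · rw [a3, h1]
    · rintro z (rfl | hz)
      · exact a5
      · exact a6 (by rw [h1]; exact hs.stored z hz)
    · rw [a4, h1]
      intro e' he
      rcases List.mem_cons.1 he with rfl | he
      · exact ⟨tok, Set.mem_insert _ _, by rw [ofNat_val_ofNat]; exact hw⟩
      · obtain ⟨z, hz, hz'⟩ := hs.V e' he
        exact ⟨z, Set.mem_insert_of_mem _ hz, hz'⟩
    · rw [a4, a3, h1]
      have := hs.length
      simp only [Thread.resume, hst, List.length_cons]; omega

/-- For an input whose block is in `V` the token is stored already; the machine passes to the next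
input without encrypting, just as `T` retries after computing that token. The inputs tried so far
are distinct and occur in `V`, so `a ≤ s.V.length`, which bounds the retries. -/
theorem run_tokenize {C : ℕ} {db : Set (NumCode (S.l κ))} {X : NumCode (S.l κ)} {u : AddInput}
    {tok : NumCode (S.l κ)} (h : S.Tokenize κ K db X u tok) (s : State) (ht : s.tag = .tok)
    (hX : s.X = bits X) (hu : s.u = u) (hs : Synced K C db s) {x : ℕ} {e : Expr} {r : List Prog}
    (hst : s.th.stack = .query x e :: r) (hcl : 0 < s.th.clock) (u₀ : AddInput) (a : ℕ)
    (hu₀ : u = AddInput.succ^[a] u₀) (ha : ∀ b < a, AddInput.succ^[b] u₀ ∈ s.V.map Prod.snd) :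
    ∃ j, j + a + s.cnt ≤ (rrun s j).cnt + s.V.length + 2 ∧
      (Accept (S.params κ T Q X₀ guess goal) (rrun s j) ∨
        ((rrun s j).tag = .run ∧ (rrun s j).th = s.th.resume (bits tok) ∧
          Synced K C (insert tok db) (rrun s j))) := by
  have hlen : ∀ (s : State) (a : ℕ), (∀ b < a, AddInput.succ^[b] u₀ ∈ s.V.map Prod.snd) →
      a ≤ s.V.length := by
    intro s a ha
    have h1 : ((List.range a).map fun k => AddInput.succ^[k] u₀).Nodup :=
      List.nodup_range.map (AddInput.iterate_succ_injective u₀)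
    have h2 : ((List.range a).map fun k => AddInput.succ^[k] u₀) ⊆ s.V.map Prod.snd := by
      intro z hz
      obtain ⟨b, hb, rfl⟩ := List.mem_map.1 hz
      exact ha b (List.mem_range.1 hb)
    simpa using (List.subperm_of_subset h1 h2).length_le
  induction h generalizing s a with
  | fresh u tok hw hdb =>
    have hla := hlen s a ha
    subst hu
    cases hl : Bits.lookup (Bits.ofNat (S.E.m κ) (S.start κ s.u X).toNat) s.V with
    | none =>
      obtain ⟨j, hj, hj'⟩ := run_tokenize_new (T := T) (Q := Q) (X₀ := X₀) (guess := guess)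
        (goal := goal) s hw ht hX hs hst hcl hl
      exact ⟨j, by omega, hj'.imp_right fun h => h.2⟩
    | some u' =>
      -- A block in `V` has a stored token, so this input cannot yield a new one.
      obtain ⟨tok₁, hdb₁, hw₁⟩ := hs.V _ (Bits.lookup_some hl)
      rw [ofNat_val_ofNat] at hw₁
      exact absurd hdb₁ (hw.unique hw₁ ▸ hdb)
  | retry u tok₂ tok hw hdb ht' ih =>
    have hla := hlen s a ha
    subst hu
    have hstart : s.X ++ (S.params κ T Q X₀ guess goal).fb s.u s.X =
        Bits.ofNat (S.E.m κ) (S.start κ s.u X).toNat := by rw [start_bits, hX]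
    cases hl : Bits.lookup (Bits.ofNat (S.E.m κ) (S.start κ s.u X).toNat) s.V with
    | none =>
      obtain ⟨j, hj, hj' | hj'⟩ := run_tokenize_new (T := T) (Q := Q) (X₀ := X₀) (guess := guess)
        (goal := goal) s hw ht hX hs hst hcl hl
      · exact ⟨j, by omega, .inl hj'⟩
      · exact absurd hdb hj'.1
    | some u' =>
      by_cases hu' : u' = s.u
      · have h1 : rrun s 1 = { s with u := AddInput.succ s.u } := by
          rw [run, Function.iterate_one, step, ht]
          dsimp only
          rw [hstart, hl]
          dsimp only
          rw [if_pos hu', hX]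
        have hmem : s.u ∈ s.V.map Prod.snd :=
          List.mem_map.2 ⟨_, Bits.lookup_some hl, hu'⟩
        obtain ⟨j, hj, hj'⟩ := ih (rrun s 1) (by rw [h1]; exact ht) (by rw [h1]; exact hX)
          (by rw [h1]) (by rw [h1]; exact ⟨hs.stored, hs.V, hs.length⟩) (by rw [h1]; exact hst)
          (by rw [h1]; exact hcl) (a + 1) (by rw [Function.iterate_succ_apply', ← hu₀])
          (by
            rw [h1]
            intro b hb
            rcases Nat.lt_succ_iff_lt_or_eq.1 hb with hb | rfl
            · exact ha b hb
            · rw [← hu₀]; exact hmem)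
        refine ⟨j + 1, ?_⟩
        rw [run_add]
        have hc : (rrun s 1).cnt = s.cnt := by rw [h1]
        have hv : (rrun s 1).V = s.V := by rw [h1]
        have hth : (rrun s 1).th = s.th := by rw [h1]
        rw [hth] at hj'
        rw [hv] at hj
        exact ⟨by omega, hj'⟩
      · refine ⟨1, ?_, .inl (.inr (.inl ?_))⟩
        · have := cnt_le_step (P := S.params κ T Q X₀ guess goal)
            (src := fun _ => S.encBits κ K) (s := s)
          rw [run, Function.iterate_one]; omega
        · rw [run, Function.iterate_one, step, ht]
          dsimp only
          rw [hstart, hl]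
          dsimp only
          rw [if_neg hu']

end Tokenizer


/-! ### The machine follows a real attacker -/

namespace Tokenizer

open TokenScheme

/-- The machine stops in an accepting state or gets to a state with the property `R`, after a
number of steps that is bounded in terms of the clock. -/
def Reaches (P : Params) (src : ℕ → List Bool → List Bool) (k : ℕ) (s : State)
    (R : State → Prop) : Prop :=
  ∃ j, (Accept P (run P src s j) ∧ j + s.cnt ≤ (run P src s j).cnt + s.th.clock * k) ∨
    (R (run P src s j) ∧
      j + s.cnt + (run P src s j).th.clock * k ≤ (run P src s j).cnt + s.th.clock * k)

section

variable {P : Params} {src : ℕ → List Bool → List Bool} {k : ℕ} {s : State} {R R' : State → Prop}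

theorem Reaches.refl (h : R s) : Reaches P src k s R := ⟨0, .inr ⟨h, by simp [run]⟩⟩

theorem Reaches.bind (h : Reaches P src k s R) (h' : ∀ s', R s' → Reaches P src k s' R') :
    Reaches P src k s R' := by
  obtain ⟨j, hj | ⟨hj, h1⟩⟩ := h
  · exact ⟨j, .inl hj⟩
  · obtain ⟨i, hi⟩ := h' _ hj
    refine ⟨i + j, ?_⟩
    rw [run_add]
    exact hi.imp (fun hi => ⟨hi.1, by have := hi.2; omega⟩) fun hi => ⟨hi.1, by have := hi.2; omega⟩

theorem Reaches.mono (h : Reaches P src k s R) (h' : ∀ s', R s' → R' s') :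
    Reaches P src k s R' := h.bind fun s' hs => .refl (h' s' hs)

theorem Reaches.go {a : Thread} (hk : 0 < k) (ht : s.tag = .run) (ha : s.th.act P.T = .go a) :
    Reaches P src k s (· = { s with th := a }) := by
  have h1 : run P src s 1 = { s with th := a } := by simp [run, step, ht, ha]
  refine ⟨1, .inr ⟨h1, ?_⟩⟩
  rw [h1, ← (Thread.act_go ha).1]
  dsimp only
  nlinarith

end

variable {S : TokenScheme} {κ : ℕ} {T Q : ℕ} {X₀ : List Bool} {guess : Expr} {goal : Option Expr}
  {K : S.E.Key κ}

/-- Runs with the block cipher. -/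
local notation "rrun" => run (S.params κ T Q X₀ guess goal) (fun _ => S.encBits κ K)

theorem code_bits (Y : NumCode (S.l κ)) : (S.params κ T Q X₀ guess goal).code (bits Y) = bits Y :=
  (bits_isCode Y).code_eq

theorem data_eq_ofBits (Y : NumCode (S.l κ)) : Y.data = Data.ofBits (bits Y) := rfl

theorem pairOracle_inv {X : NumCode (S.l κ)} (hX₀ : X₀ = bits X) {db db' : Set (NumCode (S.l κ))}
    {v a : Data} (h : S.pairOracle κ K X db v a db') :
    ∃ Y u tok, S.Tokenize κ K db Y u tok ∧ a = Data.ofBits (bits tok) ∧ db' = insert tok db ∧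
      (S.params κ T Q X₀ guess goal).queryCode v = bits Y ∧
      (S.params κ T Q X₀ guess goal).queryInput v = u := by
  rcases h with ⟨_, _, _, _, ⟨_, u, tok, h⟩⟩ | ⟨_, _, _, _, ⟨_, Y, u, tok, h⟩⟩
  · refine ⟨X, u, tok, h, rfl, rfl, ?_, ?_⟩
    · have : (S.params κ T Q X₀ guess goal).X₀ = bits X := hX₀
      simp [Params.queryCode, Data.head, Data.ofBool, Data.toBool, this, code_bits]
    · simp [Params.queryInput, Data.head, Data.tail, Data.ofBool, Data.toBool, Bits.ofData_ofBits]
  · refine ⟨Y, u, tok, h, rfl, rfl, ?_, ?_⟩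
    · simp [Params.queryCode, Data.head, Data.tail, Data.ofBool, Data.toBool, data_eq_ofBits,
        Bits.ofData_ofBits, code_bits]
    · simp [Params.queryInput, Data.head, Data.tail, Data.ofBool, Data.toBool, Bits.ofData_ofBits]

/-- The machine is about to run the programs `r` of an attacker whose configuration is `st`. -/
structure Matches (K : S.E.Key κ) (C : ℕ) (ω : ℕ → Bool) (st : Config (Set (NumCode (S.l κ))))
    (r : List Prog) (s : State) : Prop where
  tag : s.tag = .run
  stack : s.th.stack = r
  store : s.th.store = st.store
  coins : ∀ k, s.th.coins.getD k false = ω (st.coins + k)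
  synced : Synced K C st.oracle s

/-- One step reads the query, and at most `s.V.length + 2` steps are added to the encryptions. Since
`s.V.length ≤ C`, the single unit of the clock that a query costs pays for them at the rate `C + 3`.
-/
theorem reaches_query {C : ℕ} {X : NumCode (S.l κ)} {db db' : Set (NumCode (S.l κ))}
    {v a : Data} (h : S.pairOracle κ K X db v a db') (s : State) (hX₀ : X₀ = bits X)
    (htag : s.tag = .run) (hs : Synced K C db s) {x : ℕ} {e : Expr} {r : List Prog}
    (hst : s.th.stack = .query x e :: r) (hv : e.eval s.th.store = v) (hT : v.size ≤ T)
    (hcl : 0 < s.th.clock) :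
    Reaches (S.params κ T Q X₀ guess goal) (fun _ => S.encBits κ K) (C + 3) s fun s' =>
      s'.tag = .run ∧ s'.th = ⟨r, Function.update s.th.store x a, s.th.coins, s.th.clock - 1⟩ ∧
        Synced K C db' s' := by
  obtain ⟨Y, u, tok, htok, rfl, rfl, hY, hu⟩ :=
    pairOracle_inv (T := T) (Q := Q) (guess := guess) (goal := goal) hX₀ h
  have hact : s.th.act (S.params κ T Q X₀ guess goal).T = .ask v := by
    have hT' : v.size ≤ (S.params κ T Q X₀ guess goal).T := hT
    simp [Thread.act, hst, hcl.ne', hv, hT']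
  have h1 : rrun s 1 = { s with tag := .tok, X := bits Y, u := u } := by
    rw [run, Function.iterate_one, step, htag]
    dsimp only
    rw [hact]
    dsimp only
    rw [hY, hu]
  obtain ⟨j, hj, hj'⟩ := run_tokenize (T := T) (Q := Q) (X₀ := X₀) (guess := guess) (goal := goal)
    htok (rrun s 1) (by rw [h1]) (by rw [h1]) (by rw [h1])
    (by rw [h1]; exact ⟨hs.stored, hs.V, hs.length⟩) (by rw [h1]; exact hst)
    (by rw [h1]; exact hcl) u 0 rfl (by simp)
  have hlen := hs.length
  have hc : (rrun s 1).cnt = s.cnt := by rw [h1]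
  have hV : (rrun s 1).V = s.V := by rw [h1]
  have hth : (rrun s 1).th = s.th := by rw [h1]
  rw [hc, hV] at hj
  rw [hth] at hj'
  refine ⟨j + 1, ?_⟩
  rw [run_add]
  obtain ⟨d, hd⟩ := Nat.exists_eq_add_of_lt hcl
  rw [zero_add] at hd
  rcases hj' with hj' | ⟨b1, b2, b3⟩
  · refine .inl ⟨hj', ?_⟩
    rw [hd]
    have : d * (C + 3) + (C + 3) = (d + 1) * (C + 3) := by ring
    omega
  · refine .inr ⟨⟨b1, ?_, b3⟩, ?_⟩
    · rw [b2]; simp only [Thread.resume, hst]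
    · have : (rrun (rrun s 1) j).th.clock = d := by
        rw [b2]; simp only [Thread.resume, hst]; omega
      rw [this, hd]
      have : d * (C + 3) + (C + 3) = (d + 1) * (C + 3) := by ring
      omega

theorem Exec.pos {σ : Type} {O : Oracle σ} {ω : ℕ → Bool} {c : Prog} {s s' : Config σ} {t : ℕ}
    (h : Exec O ω c s t s') : 0 < t := by
  induction h <;> omega

/-- The machine executes programs in small steps. A program with running time `t` uses at most `2 *
t - 1` units of the clock: taking a sequence apart costs a unit that `Exec` does not count, and `1 +
(2 * t - 1) + (2 * t' - 1)` is again of this form. -/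
theorem reaches_exec {C : ℕ} {X : NumCode (S.l κ)} (hX₀ : X₀ = bits X) {ω : ℕ → Bool} {c : Prog}
    {st st' : Config (Set (NumCode (S.l κ)))} {t : ℕ}
    (h : Exec (S.pairOracle κ K X) ω c st t st') (hT : t ≤ T) (s : State) (r : List Prog)
    (hs : Matches K C ω st (c :: r) s) (ht : 2 * t ≤ s.th.clock + 1) :
    Reaches (S.params κ T Q X₀ guess goal) (fun _ => S.encBits κ K) (C + 3) s fun s' =>
      Matches K C ω st' r s' ∧ s.th.clock + 1 ≤ s'.th.clock + 2 * t := by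
  have key : ∀ {s : State} {p : Prog} {r : List Prog} {st : Config (Set (NumCode (S.l κ)))}
      {st₁ : Config (Set (NumCode (S.l κ)))} {r₁ : List Prog} {l : List Bool},
      Matches K C ω st (p :: r) s →
      s.th.act T = .go ⟨r₁, st₁.store, l, s.th.clock - 1⟩ →
      (∀ k, l.getD k false = ω (st₁.coins + k)) → st₁.oracle = st.oracle →
      Reaches (S.params κ T Q X₀ guess goal) (fun _ => S.encBits κ K) (C + 3) s fun s' =>
        Matches K C ω st₁ r₁ s' ∧ s.th.clock ≤ s'.th.clock + 1 := by
    intro s p r st st₁ r₁ l hs hact hl ho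
    refine (Reaches.go (P := S.params κ T Q X₀ guess goal) (k := C + 3) (by omega) hs.tag
      hact).mono ?_
    rintro _ rfl
    refine ⟨⟨hs.tag, rfl, rfl, hl, ?_⟩, by dsimp only; omega⟩
    rw [ho]
    exact ⟨hs.synced.stored, hs.synced.V, by have := hs.synced.length; dsimp only; omega⟩
  induction h generalizing s r with
  | skip st =>
    have hcl : s.th.clock ≠ 0 := by omega
    refine (key hs (st₁ := st) (r₁ := r) (l := s.th.coins) ?_ hs.coins rfl).mono
      fun s' h => ⟨h.1, by omega⟩
    simp [Thread.act, hs.stack, hs.store, hcl]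
  | assign x e st =>
    have hcl : s.th.clock ≠ 0 := by omega
    refine (key hs (st₁ := ⟨Function.update st.store x (e.eval st.store), st.coins, st.oracle⟩)
      (r₁ := r) (l := s.th.coins) ?_ hs.coins rfl).mono fun s' h => ⟨h.1, by omega⟩
    have : (e.eval st.store).size ≤ T := by omega
    simp [Thread.act, hs.stack, hs.store, hcl, this]
  | flip x st =>
    have hcl : s.th.clock ≠ 0 := by omega
    refine (key hs (st₁ := ⟨Function.update st.store x (.ofBool (ω st.coins)), st.coins + 1,
      st.oracle⟩) (r₁ := r) (l := s.th.coins.tail) ?_ ?_ rfl).mono fun s' h => ⟨h.1, by omega⟩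
    · have : s.th.coins.head?.getD false = ω st.coins := by
        have := hs.coins 0
        cases h : s.th.coins <;> simp_all
      simp [Thread.act, hs.stack, hs.store, hcl, this]
    · intro k
      have := hs.coins (k + 1)
      rw [show st.coins + 1 + k = st.coins + (k + 1) by ring, ← this]
      cases s.th.coins <;> simp
  | query x e st a q h =>
    have hcl : 0 < s.th.clock := by omega
    refine (reaches_query (T := T) (Q := Q) (guess := guess) (goal := goal) h s hX₀ hs.tag
      hs.synced hs.stack (by rw [hs.store]) (by omega) hcl).mono ?_
    rintro s' ⟨h1, h2, h3⟩
    refine ⟨⟨h1, by rw [h2], by rw [h2, hs.store], ?_, h3⟩, by rw [h2]; dsimp only; omega⟩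
    rw [h2]; exact hs.coins
  | seq c d st st₁ st₂ t t' h h' ih ih' =>
    have p1 := Exec.pos h
    have p2 := Exec.pos h'
    have hcl : s.th.clock ≠ 0 := by omega
    refine (key hs (st₁ := st) (r₁ := c :: d :: r) (l := s.th.coins) ?_ hs.coins rfl).bind ?_
    · simp [Thread.act, hs.stack, hs.store, hcl]
    · rintro s₁ ⟨h1, h2⟩
      refine (ih (by omega) s₁ (d :: r) h1 (by omega)).bind ?_
      rintro s₂ ⟨h3, h4⟩
      exact (ih' (by omega) s₂ r h3 (by omega)).mono fun s₃ h => ⟨h.1, by omega⟩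
  | iteTrue e c d st st₁ t he h ih =>
    have hcl : s.th.clock ≠ 0 := by omega
    refine (key hs (st₁ := st) (r₁ := c :: r) (l := s.th.coins) ?_ hs.coins rfl).bind ?_
    · have := Data.toBool_iff.2 he
      simp [Thread.act, hs.stack, hs.store, hcl, this]
    · rintro s₁ ⟨h1, h2⟩
      exact (ih (by omega) s₁ r h1 (by omega)).mono fun s₃ h => ⟨h.1, by omega⟩
  | iteFalse e c d st st₁ t he h ih =>
    have hcl : s.th.clock ≠ 0 := by omega
    refine (key hs (st₁ := st) (r₁ := d :: r) (l := s.th.coins) ?_ hs.coins rfl).bind ?_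
    · simp [Thread.act, hs.stack, hs.store, hcl, he, Data.toBool]
    · rintro s₁ ⟨h1, h2⟩
      exact (ih (by omega) s₁ r h1 (by omega)).mono fun s₃ h => ⟨h.1, by omega⟩
  | whileFalse e c st he =>
    have hcl : s.th.clock ≠ 0 := by omega
    refine (key hs (st₁ := st) (r₁ := r) (l := s.th.coins) ?_ hs.coins rfl).mono
      fun s' h => ⟨h.1, by omega⟩
    simp [Thread.act, hs.stack, hs.store, hcl, he, Data.toBool]
  | whileTrue e c st st₁ st₂ t t' he h h' ih ih' =>
    have p1 := Exec.pos h
    have p2 := Exec.pos h'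
    have hcl : s.th.clock ≠ 0 := by omega
    refine (key hs (st₁ := st) (r₁ := c :: .while e c :: r) (l := s.th.coins) ?_ hs.coins
      rfl).bind ?_
    · have := Data.toBool_iff.2 he
      simp [Thread.act, hs.stack, hs.store, hcl, this]
    · rintro s₁ ⟨h1, h2⟩
      refine (ih (by omega) s₁ (.while e c :: r) h1 (by omega)).bind ?_
      rintro s₂ ⟨h3, h4⟩
      exact (ih' (by omega) s₂ r h3 (by omega)).mono fun s₃ h => ⟨h.1, by omega⟩

/-- The machine at the start, with an attacker that has coins `a` and at most `C` steps. -/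
def initial (P : Params) (κ : ℕ) (stack : List Prog) (a : List Bool) (C : ℕ) : State where
  th := ⟨stack, fun x => if x = 0 then .unary κ else .nil, a, C⟩
  tag := if Bits.val P.X₀ < P.thr then .run else .dead
  X := List.replicate P.n false
  u := []
  x := []
  u' := []
  V := []
  Ys := []
  cnt := 0
  log := []

theorem matches_initial {X : NumCode (S.l κ)} (hX₀ : X₀ = bits X) {stack : List Prog}
    {a : List Bool} {C : ℕ} {ω : ℕ → Bool} (ha : ∀ k, a.getD k false = ω k) :
    Matches K C ω ⟨fun x => if x = 0 then .unary κ else .nil, 0, ∅⟩ stack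
      (initial (S.params κ T Q X₀ guess goal) κ stack a C) where
  tag := by
    have h : Bits.val X₀ < 10 ^ S.l κ := by rw [hX₀, val_bits]; exact X.isLt
    exact if_pos h
  stack := rfl
  store := rfl
  coins k := by rw [zero_add]; exact ha k
  synced := ⟨by simp, by simp [initial], by simp [initial]⟩

theorem Reaches.accept {P : Params} {src : ℕ → List Bool → List Bool} {k : ℕ} {s : State}
    (h : Reaches P src k s (Accept P)) (hs : s.cnt ≤ P.Q) {N : ℕ}
    (hN : P.Q + s.th.clock * k ≤ N) : Accept P (run P src s N) := by
  obtain ⟨j, hj⟩ := h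
  have hc := cnt_le_run (src := src) hs j
  have : j ≤ N ∧ Accept P (run P src s j) := by
    rcases hj with ⟨h1, h2⟩ | ⟨h1, h2⟩
    · exact ⟨by omega, h1⟩
    · exact ⟨by
        have : 0 ≤ (run P src s j).th.clock * k := Nat.zero_le _
        omega, h1⟩
  rw [accept_run this.1 this.2]
  exact this.2

/-- If the attacker finds the hidden numeric code, then the machine accepts. -/
theorem accept_of_recovery {X : NumCode (S.l κ)} {ω : ℕ → Bool} {c : Prog} {B C N : ℕ}
    {db' : Set (NumCode (S.l κ))} {a : List Bool} (ha : ∀ k, a.getD k false = ω k)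
    (h : RunsTo (S.pairOracle κ K X) ω c (.unary κ) ∅ B X.data db') (hT : B ≤ T) (hC : 2 * B ≤ C)
    (hN : Q + C * (C + 3) ≤ N) :
    Accept (S.params κ T Q (bits X) (.var 0) none)
      (run (S.params κ T Q (bits X) (.var 0) none) (fun _ => S.encBits κ K)
        (initial (S.params κ T Q (bits X) (.var 0) none) κ [c] a C) N) := by
  obtain ⟨t, st', hex, ht, hout, -⟩ := h
  refine Reaches.accept (k := C + 3) ?_ (Nat.zero_le _) hN
  refine (reaches_exec (T := T) (C := C) rfl hex (by omega) _ [] (matches_initial rfl ha)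
    (by simp only [initial]; omega)).mono ?_
  rintro s ⟨hs, -⟩
  refine .inr (.inr ⟨hs.tag, hs.stack, ?_⟩)
  rw [hs.store]
  simp [Params.predict, Params.target, params, Expr.eval, hout, data_eq_ofBits, Bits.ofData_ofBits]

/-- The query that checks a forgery. -/
def checkExpr : Expr :=
  .cons (.cons .nil .nil) (.cons (.head (.var 0)) (.head (.tail (.var 0))))

/-- If the attacker predicts a token, then the machine accepts. -/
theorem accept_of_forgery {X : NumCode (S.l κ)} {ω : ℕ → Bool} {c : Prog} {B C N : ℕ}
    {Y tok : NumCode (S.l κ)} {u : AddInput}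
    {db' : Set (NumCode (S.l κ))} {a : List Bool} (ha : ∀ k, a.getD k false = ω k)
    (h : RunsTo (S.pairOracle κ K X) ω c (.unary κ) ∅ B
      (.cons Y.data (.cons (.ofBits u) tok.data)) db') (htok : S.Tokenize κ K db' Y u tok)
    (hT : 4 * κ + 3 * B + 8 ≤ T) (hC : 2 * B + 2 ≤ C) (hN : Q + C * (C + 3) ≤ N) {v : ℕ}
    (hv : 1 ≤ v) :
    Accept (S.params κ T Q (bits X) (.tail (.tail (.var 0))) (some (.var v)))
      (run (S.params κ T Q (bits X) (.tail (.tail (.var 0))) (some (.var v)))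
        (fun _ => S.encBits κ K)
        (initial (S.params κ T Q (bits X) (.tail (.tail (.var 0))) (some (.var v))) κ
          [c, .query v checkExpr] a C) N) := by
  obtain ⟨t, st', hex, ht, hout, hdb⟩ := h
  have hp := Exec.pos hex
  -- The forged pair is part of the output, whose size is bounded by the running time; this shows
  -- that the checking query respects the limit `T`.
  have hsize : ∀ x, (st'.store x).size ≤ (1 + 4 * κ) + 3 * t := by
    refine Exec.size_le hex fun x => ?_
    dsimp only
    split_ifs
    · rw [Data.size_unary]
    · simp [Data.size]
  refine Reaches.accept (k := C + 3) ?_ (Nat.zero_le _) hN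
  refine (reaches_exec (T := T) (C := C) rfl hex (by omega) _ _ (matches_initial rfl ha)
    (by simp only [initial]; omega)).bind ?_
  rintro s ⟨hs, hcl⟩
  have hq : checkExpr.eval s.th.store = .cons (.ofBool true) (.cons Y.data (.ofBits u)) := by
    rw [hs.store]
    simp [checkExpr, Expr.eval, hout, Data.head, Data.tail, Data.ofBool]
  have hsz : (Data.cons (.ofBool true) (.cons Y.data (.ofBits u))).size ≤ T := by
    have := hsize 0
    rw [hout] at this
    simp only [Data.size, Data.ofBool] at this ⊢
    omega
  refine (reaches_query (T := T) (Q := Q) (X := X) (db := db') (db' := insert tok db')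
    (.known _ _ _ _ (.token _ Y u tok htok)) s rfl
    hs.tag (hdb ▸ hs.synced) hs.stack hq hsz (by simp only [initial] at hcl; omega)).mono ?_
  rintro s' ⟨h1, h2, -⟩
  refine .inr (.inr ⟨h1, by rw [h2], ?_⟩)
  rw [h2]
  simp only [Params.predict, Params.target, params, Expr.eval]
  rw [Function.update_self, Function.update_of_ne (by omega), hs.store, hout]
  rfl

end Tokenizer


/-! ### The machine as a program -/

/-- The position of an entry in a list. -/
noncomputable def List.place {α : Type} : List α → α → ℕ
  | [], _ => 0
  | p :: L, a => open Classical in if a = p then 0 else place L a + 1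

theorem List.place_le {α : Type} : ∀ (L : List α) (a : α), L.place a ≤ L.length
  | [], _ => le_rfl
  | p :: L, a => by
    have := place_le L a
    simp only [place, List.length_cons]; split_ifs <;> omega

namespace FP

open Data

variable {ι : Type} {inp : ι → Data}

/-- Case distinction over the entries of a list. -/
theorem dispatch {α : Type} (L : List α) {a : ι → α} {out : ι → Data}
    (ha : FP inp fun i => unary (L.place (a i))) (h : ∀ i, a i ∈ L)
    (hp : ∀ p ∈ L, FP (fun i : {i // a i = p} => inp i) fun i => out i) : FP inp out := by
  induction L generalizing ι with
  | nil => exact nil.congr fun i => absurd (h i) (by simp)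
  | cons p L ih =>
    have hz : ∀ i, unary ((p :: L).place (a i)) = Data.nil ↔ a i = p := fun i => by
      by_cases hi : a i = p <;> simp [List.place, hi, unary, List.replicate_succ]
    refine ite ha (ih (a := fun i => a i.1) ((ha.comap Subtype.val).tail.congr fun i => ?_)
      (fun i => ?_) fun q hq => ?_) ?_
    · have := (hz i).not.1 i.2
      simp [List.place, this, unary, List.replicate_succ, Data.tail]
    · exact (List.mem_cons.1 (h i)).resolve_left ((hz i).not.1 i.2)
    · exact (hp q (List.mem_cons_of_mem _ hq)).comap
        fun j : {j : {i // unary ((p :: L).place (a i)) ≠ .nil} // a j = q} => ⟨j.1.1, j.2⟩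
    · exact (hp p (List.mem_cons_self)).comap
        fun j : {i // unary ((p :: L).place (a i)) = .nil} => ⟨j.1, (hz j).1 j.2⟩

theorem getD {l : ι → List Data} (hl : FP inp fun i => ofList (l i)) (k : ℕ) :
    FP inp fun i => (l i).getD k .nil := by
  induction k generalizing l with
  | zero => exact hl.head.congr fun i => by cases l i <;> rfl
  | succ k ih =>
    exact (ih (l := fun i => (l i).tail) (hl.tail.congr fun i => by cases l i <;> rfl)).congr
      fun i => by cases l i <;> simp

theorem ofList_map {β : Type} {st : ι → β → Data} (K : List β)
    (h : ∀ k ∈ K, FP inp fun i => st i k) : FP inp fun i => ofList (K.map (st i)) := by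
  induction K with
  | nil => exact nil
  | cons k K ih =>
    exact cons (h k List.mem_cons_self) (ih fun k hk => h k (List.mem_cons_of_mem _ hk))

theorem eval {st : ι → ℕ → Data} {M : ℕ} (h : ∀ k < M, FP inp fun i => st i k) :
    ∀ {e : Expr}, e.vars ≤ M → FP inp fun i => e.eval (st i)
  | .var x, he => h x he
  | .nil, _ => nil
  | .cons a b, he => by
    simp only [Expr.vars] at he
    exact cons (eval h (by omega)) (eval h (by omega))
  | .head a, he => head (eval h he)
  | .tail a, he => tail (eval h he)

end FP

namespace Tokenizer

open Data

/-- A state of the machine with the remaining resources. -/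
structure Snapshot where
  κ : ℕ
  X₀ : List Bool
  /-- ciphertexts for the time when the oracle is no longer used -/
  pool : List Bool
  /-- number of encryptions for which the oracle is used -/
  idx : ℕ
  /-- number of encryptions left -/
  budget : ℕ
  s : State

/-- The machine goes on, where `y` is the ciphertext if it comes from the oracle. -/
def Snapshot.next (P : Params) (c : Snapshot) (y : List Bool) : Snapshot :=
  if c.s.tag = .walk ∧ c.s.cnt < P.Q then
    { c with
      s := answer P c.s (if c.idx = 0 then Bits.padTake P.m c.pool else y)
      pool := c.pool.drop P.m
      idx := c.idx - 1
      budget := c.budget - 1 }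
  else { c with s := step P (fun _ _ => []) c.s }

def tags : List Tag := [.run, .tok, .walk, .coll, .bad, .dead]

theorem mem_tags (t : Tag) : t ∈ tags := by cases t <;> simp [tags]

/-- The representation of a snapshot, for programs in `L` with variables below `M`. -/
noncomputable def Snapshot.enc (L : List Prog) (M : ℕ) (c : Snapshot) : Data :=
  -- The log is omitted, since it serves only the analysis, and the counter is represented by the
  -- remaining budget.
  ofList [unary c.κ, ofBits c.X₀, ofBits c.pool, unary c.idx, unary c.budget,
    ofList (c.s.th.stack.map fun p => unary (L.place p)),
    ofList ((List.range M).map c.s.th.store), ofBits c.s.th.coins, unary c.s.th.clock,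
    unary (tags.place c.s.tag), ofBits c.s.X, ofBits c.s.u, ofBits c.s.x, ofBits c.s.u',
    FP.encPairs c.s.V, ofList (c.s.Ys.map ofBits)]

variable {ι : Type} {inp : ι → Data} {L : List Prog} {M : ℕ} {c : ι → Snapshot}

/-- All parts of a snapshot are computed in polynomial time. -/
structure FPSnap (L : List Prog) (M : ℕ) (inp : ι → Data) (c : ι → Snapshot) : Prop where
  κ : FP inp fun i => unary (c i).κ
  X₀ : FP inp fun i => ofBits (c i).X₀
  pool : FP inp fun i => ofBits (c i).pool
  idx : FP inp fun i => unary (c i).idx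
  budget : FP inp fun i => unary (c i).budget
  stack : FP inp fun i => ofList ((c i).s.th.stack.map fun p => unary (L.place p))
  store : ∀ k < M, FP inp fun i => (c i).s.th.store k
  coins : FP inp fun i => ofBits (c i).s.th.coins
  clock : FP inp fun i => unary (c i).s.th.clock
  tag : FP inp fun i => unary (tags.place (c i).s.tag)
  X : FP inp fun i => ofBits (c i).s.X
  u : FP inp fun i => ofBits (c i).s.u
  x : FP inp fun i => ofBits (c i).s.x
  u' : FP inp fun i => ofBits (c i).s.u'
  V : FP inp fun i => FP.encPairs (c i).s.V
  Ys : FP inp fun i => ofList ((c i).s.Ys.map ofBits)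

theorem FPSnap.enc (h : FPSnap L M inp c) : FP inp fun i => (c i).enc L M :=
  .cons h.κ <| .cons h.X₀ <| .cons h.pool <| .cons h.idx <| .cons h.budget <| .cons h.stack <|
  .cons (.ofList_map _ fun k hk => h.store k (List.mem_range.1 hk)) <| .cons h.coins <|
  .cons h.clock <| .cons h.tag <| .cons h.X <| .cons h.u <| .cons h.x <| .cons h.u' <|
  .cons h.V <| .cons h.Ys .nil

theorem FPSnap.of_enc (h : FP inp fun i => (c i).enc L M) : FPSnap L M inp c where
  κ := FP.getD h 0
  X₀ := FP.getD h 1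
  pool := FP.getD h 2
  idx := FP.getD h 3
  budget := FP.getD h 4
  stack := FP.getD h 5
  store k hk := (FP.getD (FP.getD h 6) k).congr fun i => by simp [hk]
  coins := FP.getD h 7
  clock := FP.getD h 8
  tag := FP.getD h 9
  X := FP.getD h 10
  u := FP.getD h 11
  x := FP.getD h 12
  u' := FP.getD h 13
  V := FP.getD h 14
  Ys := FP.getD h 15

theorem FPSnap.comap {κ : Type} (h : FPSnap L M inp c) (φ : κ → ι) :
    FPSnap L M (fun k => inp (φ k)) fun k => c (φ k) :=
  .of_enc (h.enc.comap φ)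

/-- The attacker and the quantities that determine the parameters of the machine. -/
structure Setup (S : TokenScheme) where
  hm : PolyTime Data.unary fun κ => Data.unary (S.E.m κ)
  hl : PolyTime Data.unary fun κ => Data.unary (S.l κ)
  hf : S.PolyTimeF
  /-- the programs that may occur -/
  L : List Prog
  M : ℕ
  vars : ∀ p ∈ L, p.vars ≤ M
  comp : ∀ c d, .seq c d ∈ L → c ∈ L ∧ d ∈ L
  cond : ∀ e c d, .ite e c d ∈ L → c ∈ L ∧ d ∈ L
  loop : ∀ e c, .while e c ∈ L → c ∈ L
  /-- the attacker at the start -/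
  stack : List Prog
  stack_subset : ∀ p ∈ stack, p ∈ L
  /-- the number of coins of the attacker -/
  coins : Polynomial ℕ
  /-- the number of steps of the attacker -/
  clock : Polynomial ℕ
  /-- bound for the trees written down by the attacker -/
  T : Polynomial ℕ
  /-- the least number of available encryptions -/
  q : Polynomial ℕ
  guess : Expr
  goal : Option Expr
  guess_vars : guess.vars ≤ M
  goal_vars : ∀ e, goal = some e → e.vars ≤ M

/-- The number of bits for the index of an encryption. -/
def Setup.b {S : TokenScheme} (A : Setup S) (κ : ℕ) : ℕ := Nat.clog 2 (A.q.eval κ)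

/-- The number of available encryptions. -/
def Setup.Q {S : TokenScheme} (A : Setup S) (κ : ℕ) : ℕ := 2 ^ A.b κ

/-- The parameters of the machine. -/
def Setup.par {S : TokenScheme} (A : Setup S) (c : Snapshot) : Params :=
  S.params c.κ (A.T.eval c.κ) (A.Q c.κ) c.X₀ A.guess A.goal

variable {S : TokenScheme} (A : Setup S)

/-- The snapshots that are considered. -/
structure Setup.Good (c : Snapshot) : Prop where
  pos : 1 ≤ S.l c.κ
  stack : ∀ p ∈ c.s.th.stack, p ∈ A.L
  budget : c.budget = A.Q c.κ - c.s.cnt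
  isCode : (A.par c).IsCode c.s.X

end Tokenizer


theorem Bits.padTake_nil : ∀ k, padTake k [] = List.replicate k false
  | 0 => rfl
  | k + 1 => by rw [List.replicate_succ, ← padTake_nil k]; rfl

/-! ### A step of the machine in polynomial time -/

namespace Tokenizer

open Data TokenScheme

variable {ι : Type} {inp : ι → Data} {S : TokenScheme} {A : Setup S}

namespace Setup

section

variable {κ : ι → ℕ}

theorem fp_m (A : Setup S) (hκ : FP inp fun i => unary (κ i)) :
    FP inp fun i => unary (S.E.m (κ i)) := FP.of A.hm.fp κ hκ

theorem fp_thr (A : Setup S) (hκ : FP inp fun i => unary (κ i)) (h : ∀ i, 1 ≤ S.l (κ i)) :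
    FP inp fun i => ofBits (Bits.ofNat (codeBits (S.l (κ i))) (10 ^ S.l (κ i))) :=
  (FP.trim (FP.tenPow (FP.of A.hl.fp κ hκ))).congr fun i => by rw [Bits.trim_tenPow (h i)]

theorem fp_n (A : Setup S) (hκ : FP inp fun i => unary (κ i)) (h : ∀ i, 1 ≤ S.l (κ i)) :
    FP inp fun i => unary (codeBits (S.l (κ i))) :=
  (FP.unary_length_bits (A.fp_thr hκ h)).congr fun i => by simp

theorem val_thr {l : ℕ} (h : 1 ≤ l) : Bits.val (Bits.ofNat (codeBits l) (10 ^ l)) = 10 ^ l := by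
  rw [Bits.val_ofNat, Nat.mod_eq_of_lt]
  rw [← Bits.size_ten_pow h]; exact Nat.lt_size_self _

theorem fp_lt_thr (A : Setup S) (hκ : FP inp fun i => unary (κ i)) (h : ∀ i, 1 ≤ S.l (κ i))
    {y : ι → List Bool} (hy : FP inp fun i => ofBits (y i))
    (hlen : ∀ i, (y i).length = codeBits (S.l (κ i))) :
    FP inp fun i => ofBool (decide (Bits.val (y i) < 10 ^ S.l (κ i))) :=
  (FP.val_lt_val hy (A.fp_thr hκ h) fun i => by rw [hlen, Bits.length_ofNat]).congr fun i => by
    rw [val_thr (h i)]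

end

variable {c : ι → Snapshot}

theorem fp_code (hκ : FP inp fun i => unary (c i).κ) (h : ∀ i, 1 ≤ S.l (c i).κ)
    {y : ι → List Bool} (hy : FP inp fun i => ofBits (y i)) :
    FP inp fun i => ofBits ((A.par (c i)).code (y i)) := by
  have hp : FP inp fun i => ofBits (Bits.padTake (codeBits (S.l (c i).κ)) (y i)) :=
    FP.padTake hy (A.fp_n hκ h)
  refine (FP.ite_bool (A.fp_lt_thr hκ h hp fun i => by simp) hp
    (FP.padTake (l := fun _ => []) FP.nil (A.fp_n hκ h))).congr fun i => ?_
  unfold Params.code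
  simp only [decide_eq_true_eq]
  split_ifs with h1 h2 h2
  · rfl
  · exact absurd h1 h2
  · exact absurd h2 h1
  · rw [Bits.padTake_nil]; rfl

theorem fp_queryCode (hc : FPSnap A.L A.M inp c) (h : ∀ i, 1 ≤ S.l (c i).κ) {v : ι → Data}
    (hv : FP inp v) : FP inp fun i => ofBits ((A.par (c i)).queryCode (v i)) := by
  refine (FP.ite_bool (FP.isCons hv.head fun i => toBool_iff)
    (fp_code (A := A) hc.κ h (FP.ofData hv.tail.head)) (fp_code (A := A) hc.κ h hc.X₀)).congr
    fun i => ?_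
  unfold Params.queryCode
  split <;> rfl

theorem fp_queryInput {v : ι → Data} (hv : FP inp v) :
    FP inp fun i => ofBits ((A.par (c i)).queryInput (v i)) := by
  refine (FP.ite_bool (FP.isCons hv.head fun i => toBool_iff)
    (FP.ofData hv.tail.tail) (FP.ofData hv.tail)).congr fun i => ?_
  unfold Params.queryInput
  split <;> rfl

/-- The program for `f` is guaranteed to work on numeric codes only, so the promise `IsCode`, which
is part of `Good`, is needed here. -/
theorem fp_start (hc : FPSnap A.L A.M inp c) (h : ∀ i, (A.par (c i)).IsCode (c i).s.X) :
    FP inp fun i => ofBits ((c i).s.X ++ (A.par (c i)).fb (c i).s.u (c i).s.X) := by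
  have hX : ∀ i, Bits.val (c i).s.X < 10 ^ S.l (c i).κ := fun i => (h i).2
  have hd : ∀ i, NumCode.data (⟨Bits.val (c i).s.X, hX i⟩ : NumCode (S.l (c i).κ)) =
      ofBits (c i).s.X := fun i => by
    rw [data_eq_ofBits, bits]
    have : (c i).s.X.length = codeBits (S.l (c i).κ) := (h i).1
    rw [← this, Bits.ofNat_val]
  refine FP.append_bits hc.X ((FP.of A.hf.fp
    (fun i => ⟨(c i).κ, (c i).s.u, ⟨Bits.val (c i).s.X, hX i⟩⟩)
    (.cons hc.κ (.cons hc.u (hc.X.congr fun i => (hd i).symm)))).congr fun i => ?_)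
  simp only [par, params, hX, dif_pos]
  rfl

theorem fp_predict (hc : FPSnap A.L A.M inp c) :
    FP inp fun i => ofBits ((A.par (c i)).predict (c i).s.th.store) :=
  FP.ofData (FP.eval hc.store A.guess_vars)

theorem fp_target (hc : FPSnap A.L A.M inp c) :
    FP inp fun i => ofBits ((A.par (c i)).target (c i).s.th.store) := by
  cases h : A.goal with
  | none => exact hc.X₀.congr fun i => by simp [Params.target, par, params, h]
  | some e =>
    exact (FP.ofData (FP.eval hc.store (A.goal_vars e h))).congr fun i => by
      simp [Params.target, par, params, h]

theorem fp_dead (hc : FPSnap A.L A.M inp c) :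
    FP inp fun i => Snapshot.enc A.L A.M { c i with s := { (c i).s with tag := .dead } } :=
  FPSnap.enc { hc with tag := FP.const (unary (tags.place .dead)) }

theorem fp_thread (hc : FPSnap A.L A.M inp c) {a : ι → Thread}
    (h1 : FP inp fun i => ofList ((a i).stack.map fun p => unary (A.L.place p)))
    (h2 : ∀ k < A.M, FP inp fun i => (a i).store k) (h3 : FP inp fun i => ofBits (a i).coins)
    (h4 : FP inp fun i => unary (a i).clock) :
    FPSnap A.L A.M inp fun i => { c i with s := { (c i).s with th := a i } } :=
  { hc with stack := h1, store := h2, coins := h3, clock := h4 }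

theorem fp_update {st : ι → ℕ → Data} {M : ℕ} (h : ∀ k < M, FP inp fun i => st i k) (x : ℕ)
    {v : ι → Data} (hv : FP inp v) : ∀ k < M, FP inp fun i => Function.update (st i) x (v i) k := by
  intro k hk
  by_cases hx : k = x
  · subst hx; simpa using hv
  · simpa [Function.update_of_ne hx] using h k hk

theorem fp_pred {k : ι → ℕ} (h : FP inp fun i => unary (k i)) :
    FP inp fun i => unary (k i - 1) :=
  h.tail.congr fun i => by cases k i <;> rfl

theorem unary_eq_nil {k : ℕ} : unary k = .nil ↔ k = 0 := by
  cases k <;> simp [unary, List.replicate_succ]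

theorem next_of_not_walk {P : Params} {c : Snapshot} {y : List Bool} (h : c.s.tag ≠ .walk) :
    c.next P y = { c with s := step P (fun _ _ => []) c.s } := by
  simp [Snapshot.next, h]

/-- The attacker makes a step. -/
theorem fp_next_prog (hc : FPSnap A.L A.M inp c) (y : ι → List Bool)
    (h : ∀ i, A.Good (c i)) (ht : ∀ i, (c i).s.tag = .run) {p : Prog} (hp : p ∈ A.L)
    {r : ι → List Prog} (hr : ∀ i, (c i).s.th.stack = p :: r i)
    (hcl : ∀ i, (c i).s.th.clock ≠ 0) :
    FP inp fun i => ((c i).next (A.par (c i)) (y i)).enc A.L A.M := by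
  have hnext : ∀ i, (c i).next (A.par (c i)) (y i) =
      { c i with s := step (A.par (c i)) (fun _ _ => []) (c i).s } := fun i =>
    next_of_not_walk (by simp [ht])
  have hstack : FP inp fun i => ofList ((r i).map fun p => unary (A.L.place p)) :=
    hc.stack.tail.congr fun i => by simp [hr]
  have hcl' := fp_pred hc.clock
  have hvars := A.vars p hp
  have hT : FP inp fun i => unary (A.T.eval (c i).κ) := FP.unary_eval _ hc.κ
  -- As `p` is a fixed program, each case is an explicit combination of subroutines; the limit on
  -- written trees is tested by `FP.size_le`.
  cases p with
  | skip =>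
    refine (fp_thread hc (a := fun i => ⟨r i, (c i).s.th.store, (c i).s.th.coins,
      (c i).s.th.clock - 1⟩) hstack hc.store hc.coins hcl').enc.congr fun i => ?_
    rw [hnext]; simp [step, ht, Thread.act, hr, hcl]
  | assign x e =>
    simp only [Prog.vars] at hvars
    have he : FP inp fun i => e.eval (c i).s.th.store := FP.eval hc.store (by omega)
    refine (FP.ite_bool (FP.size_le he hT) (fp_thread hc (a := fun i => ⟨r i,
      Function.update (c i).s.th.store x (e.eval (c i).s.th.store), (c i).s.th.coins,
      (c i).s.th.clock - 1⟩) hstack (fp_update hc.store x he) hc.coins hcl').enc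
      (fp_dead hc)).congr fun i => ?_
    rw [hnext]
    by_cases hs : (e.eval (c i).s.th.store).size ≤ A.T.eval (c i).κ
    · have hs' : (e.eval (c i).s.th.store).size ≤ (A.par (c i)).T := hs
      simp [step, ht, Thread.act, hr, hcl, hs, hs']
    · have hs' : ¬ (e.eval (c i).s.th.store).size ≤ (A.par (c i)).T := hs
      simp [step, ht, Thread.act, hr, hcl, hs, hs']
  | flip x =>
    refine (fp_thread hc (a := fun i => ⟨r i, Function.update (c i).s.th.store x
      (.ofBool ((c i).s.th.coins.headD false)), (c i).s.th.coins.tail,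
      (c i).s.th.clock - 1⟩) hstack (fp_update hc.store x (FP.head_bits hc.coins))
      (FP.tail_bits hc.coins) hcl').enc.congr fun i => ?_
    rw [hnext]; simp [step, ht, Thread.act, hr, hcl]
  | query x e =>
    simp only [Prog.vars] at hvars
    have he : FP inp fun i => e.eval (c i).s.th.store := FP.eval hc.store (by omega)
    have hask : FPSnap A.L A.M inp fun i => { c i with s := { (c i).s with
        tag := .tok
        X := (A.par (c i)).queryCode (e.eval (c i).s.th.store)
        u := (A.par (c i)).queryInput (e.eval (c i).s.th.store) } } :=
      { hc with
        tag := FP.const (unary (tags.place .tok))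
        X := fp_queryCode hc (fun i => (h i).pos) he
        u := fp_queryInput (A := A) (c := c) he }
    refine (FP.ite_bool (FP.size_le he hT) hask.enc (fp_dead hc)).congr fun i => ?_
    rw [hnext]
    by_cases hs : (e.eval (c i).s.th.store).size ≤ A.T.eval (c i).κ
    · have hs' : (e.eval (c i).s.th.store).size ≤ (A.par (c i)).T := hs
      simp [step, ht, Thread.act, hr, hcl, hs, hs']
    · have hs' : ¬ (e.eval (c i).s.th.store).size ≤ (A.par (c i)).T := hs
      simp [step, ht, Thread.act, hr, hcl, hs, hs']
  | seq d d' =>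
    refine (fp_thread hc (a := fun i => ⟨d :: d' :: r i, (c i).s.th.store, (c i).s.th.coins,
      (c i).s.th.clock - 1⟩) (.cons (FP.const _) (.cons (FP.const _) hstack)) hc.store hc.coins
      hcl').enc.congr fun i => ?_
    rw [hnext]; simp [step, ht, Thread.act, hr, hcl]
  | ite e d d' =>
    simp only [Prog.vars] at hvars
    have he : FP inp fun i => e.eval (c i).s.th.store := FP.eval hc.store (by omega)
    refine (FP.ite_bool (FP.isCons he fun i => toBool_iff)
      (fp_thread hc (a := fun i => ⟨d :: r i, (c i).s.th.store, (c i).s.th.coins,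
        (c i).s.th.clock - 1⟩) (.cons (FP.const _) hstack) hc.store hc.coins hcl').enc
      (fp_thread hc (a := fun i => ⟨d' :: r i, (c i).s.th.store, (c i).s.th.coins,
        (c i).s.th.clock - 1⟩) (.cons (FP.const _) hstack) hc.store hc.coins hcl').enc).congr
      fun i => ?_
    rw [hnext]
    by_cases hs : (e.eval (c i).s.th.store).toBool = true <;>
      simp [step, ht, Thread.act, hr, hcl, hs]
  | _ =>
    rename_i e d
    simp only [Prog.vars] at hvars
    have he : FP inp fun i => e.eval (c i).s.th.store := FP.eval hc.store (by omega)
    refine (FP.ite_bool (FP.isCons he fun i => toBool_iff)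
      (fp_thread hc (a := fun i => ⟨d :: .while e d :: r i, (c i).s.th.store, (c i).s.th.coins,
        (c i).s.th.clock - 1⟩) (.cons (FP.const _) (.cons (FP.const _) hstack)) hc.store hc.coins
        hcl').enc
      (fp_thread hc (a := fun i => ⟨r i, (c i).s.th.store, (c i).s.th.coins,
        (c i).s.th.clock - 1⟩) hstack hc.store hc.coins hcl').enc).congr
      fun i => ?_
    rw [hnext]
    by_cases hs : (e.eval (c i).s.th.store).toBool = true <;>
      simp [step, ht, Thread.act, hr, hcl, hs]

/-- Case distinction over the program to be run next. -/
theorem fp_cases_stack (hc : FPSnap A.L A.M inp c) (h : ∀ i, A.Good (c i)) {out : ι → Data}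
    (hnil : FP (fun i : {i // (c i).s.th.stack = []} => inp i) fun i => out i)
    (hcons : ∀ p ∈ A.L, FP (fun i : {i // ∃ r, (c i).s.th.stack = p :: r} => inp i)
      fun i => out i) : FP inp out := by
  have hz : ∀ i, ofList ((c i).s.th.stack.map fun p => unary (A.L.place p)) = .nil ↔
      (c i).s.th.stack = [] := fun i => by rw [ofList_eq_nil]; simp
  refine FP.ite hc.stack ?_ (hnil.comap fun i : {i // ofList _ = Data.nil} => ⟨i.1, (hz i).1 i.2⟩)
  refine FP.dispatch A.L (a := fun i => (c i.1).s.th.stack.headD .skip)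
    ((hc.stack.comap Subtype.val).head.congr fun i => ?_) (fun i => ?_) fun p hp => ?_
  · have := (hz i).not.1 i.2
    obtain ⟨p, r, hr⟩ := List.exists_cons_of_ne_nil this
    simp [hr, Data.head]
  · have := (hz i).not.1 i.2
    obtain ⟨p, r, hr⟩ := List.exists_cons_of_ne_nil this
    exact (h i).stack _ (by simp [hr])
  · refine (hcons p hp).comap fun j : {j : {i // ofList _ ≠ Data.nil} //
      (c j.1).s.th.stack.headD .skip = p} => ⟨j.1.1, (c j.1.1).s.th.stack.tail, ?_⟩
    have := (hz j.1).not.1 j.1.2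
    obtain ⟨p', r, hr⟩ := List.exists_cons_of_ne_nil this
    have hj := j.2
    simp only [hr] at hj ⊢
    simp_all

theorem fp_next_run (hc : FPSnap A.L A.M inp c) (y : ι → List Bool)
    (h : ∀ i, A.Good (c i)) (ht : ∀ i, (c i).s.tag = .run) :
    FP inp fun i => ((c i).next (A.par (c i)) (y i)).enc A.L A.M := by
  have hnext : ∀ i, (c i).next (A.par (c i)) (y i) =
      { c i with s := step (A.par (c i)) (fun _ _ => []) (c i).s } := fun i =>
    next_of_not_walk (by simp [ht])
  refine fp_cases_stack hc h ?_ fun p hp => ?_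
  · refine (hc.enc.comap Subtype.val).congr fun i => ?_
    rw [hnext, step, ht, Thread.act_done.2 i.2]
  · have hc' := hc.comap fun i : {i // ∃ r, (c i).s.th.stack = p :: r} => i.1
    refine FP.ite hc'.clock ?_ ?_
    · refine fp_next_prog (hc'.comap Subtype.val) (fun i => y i.1) (fun i => h i.1)
        (fun i => ht i.1) hp (r := fun i => i.1.2.choose) (fun i => i.1.2.choose_spec) fun i h0 =>
          i.2 (unary_eq_nil.2 h0)
    · refine (fp_dead (hc'.comap Subtype.val)).congr fun i => ?_
      obtain ⟨r, hr⟩ := i.1.2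
      have h0 := unary_eq_nil.1 i.2
      rw [hnext]
      simp [step, ht, Thread.act, hr, h0]

theorem fp_next_tok (hc : FPSnap A.L A.M inp c) (y : ι → List Bool)
    (h : ∀ i, A.Good (c i)) (ht : ∀ i, (c i).s.tag = .tok) :
    FP inp fun i => ((c i).next (A.par (c i)) (y i)).enc A.L A.M := by
  have hnext : ∀ i, (c i).next (A.par (c i)) (y i) =
      { c i with s := step (A.par (c i)) (fun _ _ => []) (c i).s } := fun i =>
    next_of_not_walk (by simp [ht])
  have hstart := fp_start hc fun i => (h i).isCode
  obtain ⟨b, hb⟩ : ∃ b : ι → List Bool, ∀ i, b i = (c i).s.X ++ (A.par (c i)).fb (c i).s.u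
    (c i).s.X := ⟨_, fun _ => rfl⟩
  simp only [← hb] at hstart
  have hl := FP.lookup hstart hc.V
  refine FP.ite hl ?_ ?_
  · have hc' := hc.comap
      fun i : {i // FP.encOption (Bits.lookup (b i) (c i).s.V) ≠ Data.nil} => i.1
    have hv : ∀ i : {i // FP.encOption (Bits.lookup (b i) (c i).s.V) ≠ Data.nil},
        ∃ v, Bits.lookup (b i) (c i).s.V = some v := fun i => by
      have := i.2
      cases hi : Bits.lookup (b i.1) (c i.1).s.V with
      | none => rw [hi] at this; exact absurd rfl this
      | some v => exact ⟨v, rfl⟩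
    choose v hv using hv
    have hvf : FP (fun i : {i // FP.encOption (Bits.lookup (b i) (c i).s.V) ≠ Data.nil} => inp i)
        fun i => ofBits (v i) :=
      (hl.comap Subtype.val).tail.congr fun i => by rw [hv]; rfl
    refine (FP.ite_bool (FP.eq_bits hvf hc'.u)
      (FPSnap.enc (c := fun i => { c i.1 with s := { (c i.1).s with
        u := AddInput.succ (c i.1).s.u } }) { hc' with u := FP.succ hc'.u })
      (FPSnap.enc (c := fun i => { c i.1 with s := { (c i.1).s with tag := .coll, u' := v i } })
        { hc' with tag := FP.const (unary (tags.place .coll)), u' := hvf })).congr fun i => ?_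
    rw [hnext, step, ht]
    dsimp only
    rw [← hb, hv]
    by_cases hu : v i = (c i.1).s.u <;> simp [hu, ht]
  · have hc' := hc.comap
      fun i : {i // FP.encOption (Bits.lookup (b i) (c i).s.V) = Data.nil} => i.1
    have hstart' := hstart.comap
      fun i : {i // FP.encOption (Bits.lookup (b i) (c i).s.V) = Data.nil} => i.1
    refine (FPSnap.enc (c := fun i => { c i.1 with s := { (c i.1).s with
      tag := .walk, x := b i.1, V := (b i.1, (c i.1).s.u) :: (c i.1).s.V } }) { hc' with
          tag := FP.const (unary (tags.place .walk))
          x := hstart'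
          V := .cons (.cons hstart' hc'.u) hc'.V }).congr fun i => ?_
    have hn : Bits.lookup (b i.1) (c i.1).s.V = none := by
      have := i.2
      cases hi : Bits.lookup (b i.1) (c i.1).s.V with
      | none => rfl
      | some v => rw [hi] at this; exact absurd this (by simp [FP.encOption])
    rw [hnext, step, ht]
    dsimp only
    rw [← hb, hn]

/-- The attacker receives a token. -/
theorem fp_resume (hc : FPSnap A.L A.M inp c) (h : ∀ i, A.Good (c i)) {y : ι → List Bool}
    (hy : FP inp fun i => ofBits (y i)) :
    FP inp fun i => Snapshot.enc A.L A.M { c i with s := { (c i).s with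
      tag := .run, th := (c i).s.th.resume (y i) } } := by
  have hrun : FPSnap A.L A.M inp fun i => { c i with s := { (c i).s with tag := .run } } :=
    { hc with tag := FP.const (unary (tags.place .run)) }
  refine fp_cases_stack hc h ?_ fun p _ => ?_
  · refine (hrun.enc.comap Subtype.val).congr fun i => ?_
    simp [Thread.resume, i.2]
  · have hrun' := hrun.comap fun i : {i // ∃ r, (c i).s.th.stack = p :: r} => i.1
    by_cases hp : ∃ x e, p = .query x e
    · obtain ⟨x, e, rfl⟩ := hp
      refine (fp_thread hrun' (a := fun i => ⟨(c i.1).s.th.stack.tail,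
        Function.update (c i.1).s.th.store x (ofBits (y i.1)), (c i.1).s.th.coins,
        (c i.1).s.th.clock - 1⟩) (hrun'.stack.tail.congr fun i => ?_)
        (fp_update hrun'.store x (hy.comap _)) hrun'.coins (fp_pred hrun'.clock)).enc.congr
        fun i => ?_
      · rw [tail_ofList, List.map_tail]
      · obtain ⟨r, hr⟩ := i.2
        simp [Thread.resume, hr]
    · refine hrun'.enc.congr fun i => ?_
      obtain ⟨r, hr⟩ := i.2
      have : (c i.1).s.th.resume (y i.1) = (c i.1).s.th := by
        unfold Thread.resume
        rw [hr]
        split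
        · rename_i heq
          cases heq
          exact absurd ⟨_, _, rfl⟩ hp
        · rfl
      rw [this]

/-- The test `s.cnt < Q` becomes a test whether the unary budget is empty. For `idx = 0` the
ciphertext is cut off from the pool, which fixes its length; for an answer of the oracle the length
has to be promised (`hlen`). -/
theorem fp_next_walk (hc : FPSnap A.L A.M inp c) {y : ι → List Bool}
    (hy : FP inp fun i => ofBits (y i)) (h : ∀ i, A.Good (c i)) (ht : ∀ i, (c i).s.tag = .walk)
    (hlen : ∀ i, (c i).s.cnt < A.Q (c i).κ → (c i).idx ≠ 0 → (y i).length = S.E.m (c i).κ) :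
    FP inp fun i => ((c i).next (A.par (c i)) (y i)).enc A.L A.M := by
  have hpos := fun i => (h i).pos
  refine FP.ite hc.budget ?_ ?_
  · obtain ⟨z, hz⟩ : ∃ z : ι → List Bool, ∀ i, z i =
      if (c i).idx = 0 then Bits.padTake (S.E.m (c i).κ) (c i).pool else y i := ⟨_, fun _ => rfl⟩
    have hzf : FP inp fun i => ofBits (z i) := by
      refine FP.ite hc.idx ((hy.comap Subtype.val).congr fun i => ?_)
        (((FP.padTake hc.pool (A.fp_m hc.κ)).comap Subtype.val).congr fun i => ?_)
      · rw [hz, if_neg fun h => i.2 (unary_eq_nil.2 h)]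
      · rw [hz, if_pos (unary_eq_nil.1 i.2)]
    have hcnt : ∀ i : {i // unary (c i).budget ≠ .nil}, (c i).s.cnt < A.Q (c i).κ := fun i => by
      have h1 : (c i).budget ≠ 0 := fun h => i.2 (unary_eq_nil.2 h)
      have h2 := (h i).budget
      omega
    have hzl : ∀ i : {i // unary (c i).budget ≠ .nil}, (z i).length = S.E.m (c i).κ := fun i => by
      rw [hz]; split_ifs with h0
      · simp
      · exact hlen i (hcnt i) h0
    have hc' := hc.comap fun i : {i // unary (c i).budget ≠ .nil} => i.1
    have hz' := hzf.comap fun i : {i // unary (c i).budget ≠ .nil} => i.1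
    have hyl : FP (fun i : {i // unary (c i).budget ≠ .nil} => inp i)
        fun i => ofBits ((z i).take (codeBits (S.l (c i).κ))) :=
      (FP.padTake hz' (A.fp_n hc'.κ fun i => hpos i.1)).congr fun i => by
        rw [Bits.padTake_eq_take]
        rw [hzl]; exact S.codeBits_le _
    have hbase : FPSnap A.L A.M (fun i : {i // unary (c i).budget ≠ .nil} => inp i) fun i =>
        { c i.1 with
          s := { (c i.1).s with
            Ys := (z i.1).take (codeBits (S.l (c i.1).κ)) :: (c i.1).s.Ys
            cnt := (c i.1).s.cnt + 1
            log := ((c i.1).s.x, (A.par (c i.1)).predict (c i.1).s.th.store) :: (c i.1).s.log }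
          pool := (c i.1).pool.drop (S.E.m (c i.1).κ)
          idx := (c i.1).idx - 1
          budget := (c i.1).budget - 1 } :=
      { hc' with
        pool := FP.drop hc'.pool (A.fp_m hc'.κ)
        idx := fp_pred hc'.idx
        budget := fp_pred hc'.budget
        Ys := .cons hyl hc'.Ys }
    refine (FP.ite_bool (FP.mem hyl hc'.Ys)
      (FPSnap.enc (c := fun i : {i // unary (c i).budget ≠ .nil} =>
        { c i.1 with
          s := { (c i.1).s with
            tag := .bad
            Ys := (z i.1).take (codeBits (S.l (c i.1).κ)) :: (c i.1).s.Ys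
            cnt := (c i.1).s.cnt + 1
            log := ((c i.1).s.x, (A.par (c i.1)).predict (c i.1).s.th.store) :: (c i.1).s.log }
          pool := (c i.1).pool.drop (S.E.m (c i.1).κ)
          idx := (c i.1).idx - 1
          budget := (c i.1).budget - 1 }) { hbase with tag := FP.const (unary (tags.place .bad)) })
      (FP.ite_bool (A.fp_lt_thr hc'.κ (fun i => hpos i.1) hyl fun i => ?_)
        (fp_resume hbase (fun i => ⟨(h i).pos, (h i).stack, ?_, (h i).isCode⟩) hyl)
        (FPSnap.enc (c := fun i : {i // unary (c i).budget ≠ .nil} =>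
        { c i.1 with
          s := { (c i.1).s with
            x := z i.1
            Ys := (z i.1).take (codeBits (S.l (c i.1).κ)) :: (c i.1).s.Ys
            cnt := (c i.1).s.cnt + 1
            log := ((c i.1).s.x, (A.par (c i.1)).predict (c i.1).s.th.store) :: (c i.1).s.log }
          pool := (c i.1).pool.drop (S.E.m (c i.1).κ)
          idx := (c i.1).idx - 1
          budget := (c i.1).budget - 1 }) { hbase with x := hz' }))).congr fun i => ?_
    · rw [List.length_take, hzl, min_eq_left (S.codeBits_le _)]
    · have := (h i).budget
      dsimp only; omega
    · have hn : (c i.1).next (A.par (c i.1)) (y i.1) = { c i.1 with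
          s := answer (A.par (c i.1)) (c i.1).s (z i.1)
          pool := (c i.1).pool.drop (S.E.m (c i.1).κ)
          idx := (c i.1).idx - 1
          budget := (c i.1).budget - 1 } := by
        rw [hz, Snapshot.next, if_pos ⟨ht i.1, hcnt i⟩]; rfl
      have hn' : (A.par (c i.1)).n = codeBits (S.l (c i.1).κ) := rfl
      have hthr : (A.par (c i.1)).thr = 10 ^ S.l (c i.1).κ := rfl
      rw [hn, answer, hn', hthr]
      simp only [decide_eq_true_eq]
      split_ifs <;> rfl
  · have hc' := hc.comap fun i : {i // unary (c i).budget = .nil} => i.1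
    refine (FPSnap.enc (c := fun i : {i // unary (c i).budget = .nil} => { c i.1 with
      s := { (c i.1).s with tag := .bad } })
        { hc' with tag := FP.const (unary (tags.place .bad)) }).congr fun i => ?_
    have h1 := unary_eq_nil.1 i.2
    have h2 := (h i).budget
    have h3 : ¬ (c i.1).s.cnt < (A.par (c i.1)).Q := by
      show ¬ _ < A.Q _; omega
    simp [Snapshot.next, step, ht, h3]

/-- A step of the machine is computed in polynomial time. -/
theorem fp_next (hc : FPSnap A.L A.M inp c) {y : ι → List Bool}
    (hy : FP inp fun i => ofBits (y i)) (h : ∀ i, A.Good (c i))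
    (hlen : ∀ i, (c i).s.tag = .walk → (c i).s.cnt < A.Q (c i).κ → (c i).idx ≠ 0 →
      (y i).length = S.E.m (c i).κ) :
    FP inp fun i => ((c i).next (A.par (c i)) (y i)).enc A.L A.M := by
  refine FP.dispatch tags hc.tag (fun i => mem_tags _) fun t _ => ?_
  have hc' := hc.comap fun i : {i // (c i).s.tag = t} => i.1
  have hy' := hy.comap fun i : {i // (c i).s.tag = t} => i.1
  cases t with
  | run => exact fp_next_run hc' (fun i => y i.1) (fun i => h i.1) fun i => i.2
  | tok => exact fp_next_tok hc' (fun i => y i.1) (fun i => h i.1) fun i => i.2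
  | walk => exact fp_next_walk hc' hy' (fun i => h i.1) (fun i => i.2) fun i => hlen i.1 i.2
  | _ =>
    refine hc'.enc.congr fun i => ?_
    rw [next_of_not_walk (by simp [i.2])]
    simp [step, i.2]

end Setup

end Tokenizer


/-! ### Programs that play a game -/

theorem PolyBdd.eval {ι : Type} {inp : ι → Data} {f : ι → ℕ} (hf : PolyBdd inp f)
    (p : Polynomial ℕ) : PolyBdd inp fun i => p.eval (f i) := by
  obtain ⟨P, hP⟩ := hf
  exact ⟨p.comp P, fun i => by rw [Polynomial.eval_comp]; exact p.eval_nat_mono (hP i)⟩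

theorem PolyBdd.id {ι : Type} {inp : ι → Data} : PolyBdd inp fun i => (inp i).size :=
  ⟨.X, fun i => by simp⟩

theorem PolyBdd.exists_eval {G : ℕ → Prop} {f : {κ // G κ} → ℕ}
    (hf : PolyBdd (fun κ : {κ // G κ} => Data.unary κ) f) :
    ∃ p : Polynomial ℕ, ∀ κ, f κ ≤ p.eval κ.1 := by
  obtain ⟨P, hP⟩ := hf
  refine ⟨P.comp (1 + 4 * .X), fun κ => ?_⟩
  have := hP κ
  rw [Data.size_unary] at this
  simpa [Polynomial.eval_comp] using this

section

variable {σ : Type} {O : Oracle σ} {ω : ℕ → Bool}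

theorem Ev.flip {x : ℕ} {s : Config σ} {Q : Config σ → Prop}
    (h : Q ⟨Function.update s.store x (.ofBool (ω s.coins)), s.coins + 1, s.oracle⟩) :
    Ev O ω (.flip x) s 1 Q := ⟨_, _, .flip _ _, le_rfl, h⟩

theorem Ev.query {x : ℕ} {e : Expr} {s : Config σ} {B : ℕ} {Q : Config σ → Prop} {a : Data} {q : σ}
    (h : O s.oracle (e.eval s.store) a q) (hB : (e.eval s.store).size + a.size ≤ B)
    (hQ : Q ⟨Function.update s.store x a, s.coins, q⟩) :
    Ev O ω (.query x e) s (1 + B) Q := ⟨_, _, .query _ _ _ _ _ h, by omega, hQ⟩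

/-- Apply a subroutine, given that `Q` holds for all its possible results. -/
theorem FPWith.ev {ι : Type} {c : Prog} {p : Polynomial ℕ} {M : ℕ} {inp out : ι → Data}
    (h : FPWith c p M inp out) (i : ι) {s : Config σ} (hs : s.store 0 = inp i) {B : ℕ}
    (hB : p.eval (inp i).size ≤ B) {Q : Config σ → Prop}
    (hQ : ∀ s', s'.store 0 = out i → Config.Same M s s' → Q s') : Ev O ω c s B Q :=
  ((h i).2 O ω s hs).mono hB fun s' hs' => hQ s' hs'.1 hs'.2

end

/-- Toss as many coins as the list in variable `k` has entries. -/
def Prog.tossCoins (M : ℕ) : Prog :=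
  .seq (.assign M .nil) (.forList (M + 1)
    (.seq (.flip (M + 2)) (.assign M (.cons (.var (M + 2)) (.var M)))))

/-- New coins are put in front, so the list comes out in reverse order. With `h0` the coins are
those from number `0` on. -/
theorem Ev.tossCoins {σ : Type} {O : Oracle σ} {ω : ℕ → Bool} {M w : ℕ} {s : Config σ}
    (hs : s.store (M + 1) = .unary w) (h0 : s.coins = 0) {B : ℕ} (hB : 7 + 8 * w ≤ B) :
    Ev O ω (.tossCoins M) s (3 + w * (2 * B)) fun s' =>
      s'.store M = .ofBits ((List.range w).map ω).reverse ∧ (∀ x < M, s'.store x = s.store x) ∧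
        (∀ x > M + 2, s'.store x = s.store x) ∧ s'.oracle = s.oracle := by
  have hw : (Data.unary w).size = 1 + 4 * w := Data.size_unary w
  refine Ev.mono (Ev.assign_seq (B := 1) (B' := w * ((1 + (1 + (4 + 4 * w))) + (1 + 4 * w) + 2) + 1)
    (by simp [Expr.eval, Data.size]) ?_) (by nlinarith) fun _ h => h
  have hl := Ev.forList (O := O) (ω := ω) (k := M + 1)
    (c := .seq (.flip (M + 2)) (.assign M (.cons (.var (M + 2)) (.var M)))) (N := w)
    (B := 1 + (1 + (4 + 4 * w))) (C := 1 + 4 * w)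
    (fun j s' => s'.store M = .ofBits ((List.range j).map ω).reverse ∧
      (∀ x < M, s'.store x = s.store x) ∧ (∀ x > M + 2, s'.store x = s.store x) ∧
      s'.oracle = s.oracle ∧ s'.coins = j) ?_ ?_ (List.replicate w (Data.ofBool true)) 0 (by simp)
    (by rw [← Data.unary_eq_ofList, hw])
    ⟨Function.update s.store M .nil, s.coins, s.oracle⟩ ?_ ?_
  · rw [List.length_replicate] at hl
    exact hl.mono le_rfl fun s' h => ⟨h.1, h.2.1, h.2.2.1, h.2.2.2.1⟩
  · rintro j s' d ⟨h1, h2, h3, h4, h5⟩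
    refine ⟨by simpa using h1, fun x hx => ?_, fun x hx => ?_, h4, h5⟩
    · dsimp only; rw [Function.update_of_ne (by omega)]; exact h2 x hx
    · dsimp only; rw [Function.update_of_ne (by omega)]; exact h3 x hx
  · rintro j hj s' ⟨h1, h2, h3, h4, h5⟩
    have heq : (Expr.cons (.var (M + 2)) (.var M)).eval
        (Function.update s'.store (M + 2) (.ofBool (ω s'.coins))) =
        .ofBits ((List.range (j + 1)).map ω).reverse := by
      simp [Expr.eval, h1, h5, List.range_succ]
    refine Ev.seq (Ev.flip (Q := (· = _)) rfl) ?_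
    rintro _ rfl
    refine Ev.assign (by
      dsimp only; rw [heq]; refine (Data.size_ofBits_le _).trans ?_; simp; omega) ⟨⟨?_, ?_, ?_, ?_, ?_⟩, ?_⟩
    · dsimp only; rw [Function.update_self]; exact heq
    · intro x hx
      dsimp only; rw [Function.update_of_ne (by omega), Function.update_of_ne (by omega)]; exact h2 x hx
    · intro x hx
      dsimp only; rw [Function.update_of_ne (by omega), Function.update_of_ne (by omega)]; exact h3 x hx
    · exact h4
    · dsimp only; omega
    · dsimp only; rw [Function.update_of_ne (by omega), Function.update_of_ne (by omega)]
  · refine ⟨by simp, fun x hx => ?_, fun x hx => ?_, rfl, h0⟩ <;>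
      (dsimp only; rw [Function.update_of_ne (by omega)])
  · dsimp only; rw [Function.update_of_ne (by omega), hs, Data.unary_eq_ofList]

/-- A program that tosses coins, computes an initial state and then a number of further states
with the help of an oracle. -/
theorem FP.exists_prog {α : Type} {enc req fin : α → Data} {next : α → List Bool → α}
    {init : ℕ → List Bool → α} {G : ℕ → Prop} {w N B : ℕ → ℕ} {Ok : α → Prop}
    {OkY : α → List Bool → Prop}
    (hinit : FP (fun i : {κ // G κ} × List Bool => .cons (.unary i.1) (.ofBits i.2))
      fun i => enc (init i.1 i.2))
    (hreq : FP (fun a : {a // Ok a} => enc a) fun a => req a)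
    (hnext : FP (fun p : {p : α × List Bool // Ok p.1 ∧ OkY p.1 p.2} =>
      .cons (enc p.1.1) (.ofBits p.1.2)) fun p => enc (next p.1.1 p.1.2))
    (hfin : FP (fun a : {a // Ok a} => enc a) fun a => fin a)
    (hw : FP (fun κ : {κ // G κ} => Data.unary κ) fun κ => Data.unary (w κ))
    (hN : FP (fun κ : {κ // G κ} => Data.unary κ) fun κ => Data.unary (N κ))
    (hB : PolyBdd (fun κ : {κ // G κ} => Data.unary κ) fun κ => B κ) :
    ∃ (c : Prog) (p : Polynomial ℕ), ∀ κ, G κ → w κ ≤ p.eval κ ∧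
      ∀ {σ : Type} (O : Oracle σ) (ω : ℕ → Bool) (a : ℕ → α) (y : ℕ → List Bool) (q : ℕ → σ),
        a 0 = init κ ((List.range (w κ)).map ω) →
        (∀ j ≤ N κ, Ok (a j) ∧ (enc (a j)).size ≤ B κ) →
        (∀ j < N κ, a (j + 1) = next (a j) (y j) ∧ OkY (a j) (y j) ∧
          (Data.ofBits (y j)).size ≤ B κ ∧
          (req (a j) = .nil ∧ y j = [] ∧ q (j + 1) = q j ∨
            req (a j) ≠ .nil ∧ O (q j) (req (a j)) (.ofBits (y j)) (q (j + 1)))) →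
        RunsTo O ω c (.unary κ) (q 0) (p.eval κ) (fin (a (N κ))) (q (N κ)) := by
  -- The tossed coins arrive reversed and are turned round before the initial state is computed.
  have hinit' : FP (fun i : {κ // G κ} × List Bool => .cons (.unary i.1) (.ofBits i.2.reverse))
      fun i => enc (init i.1 i.2) :=
    hinit.of (fun i => i) (.cons FP.id.head ((FP.reverse_bits (l := fun i => i.2.reverse)
      FP.id.tail).congr fun i => by simp))
  have hwB : PolyBdd (fun κ : {κ // G κ} => Data.unary κ) fun κ => w κ :=
    hw.size.mono fun κ => by rw [Data.size_unary]; omega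
  have hNB : PolyBdd (fun κ : {κ // G κ} => Data.unary κ) fun κ => N κ :=
    hN.size.mono fun κ => by rw [Data.size_unary]; omega
  obtain ⟨ci, pi, Mi, hMi, hi⟩ := hinit'
  obtain ⟨cr, pr, Mr, hMr, hr⟩ := hreq
  obtain ⟨cn, pn, Mn, hMn, hn⟩ := hnext
  obtain ⟨cf, pf, Mf, hMf, hf⟩ := hfin
  obtain ⟨cw, pw, Mw, hMw, hw⟩ := hw
  obtain ⟨cN, pN, MN, hMN, hN⟩ := hN
  obtain ⟨M, hM⟩ : ∃ M, Mi ≤ M ∧ Mr ≤ M ∧ Mn ≤ M ∧ Mf ≤ M ∧ Mw ≤ M ∧ MN ≤ M :=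
    ⟨Mi + Mr + Mn + Mf + Mw + MN, by omega⟩
  replace hi := hi.mono hM.1
  replace hr := hr.mono hM.2.1
  replace hn := hn.mono hM.2.2.1
  replace hf := hf.mono hM.2.2.2.1
  replace hw := hw.mono hM.2.2.2.2.1
  replace hN := hN.mono hM.2.2.2.2.2
  have hM0 : 0 < M := by omega
  have hid : PolyBdd (fun κ : {κ // G κ} => Data.unary κ) fun κ => 1 + 4 * κ.1 :=
    PolyBdd.id.mono fun κ => by rw [Data.size_unary]
  have hbody : PolyBdd (fun κ : {κ // G κ} => Data.unary κ) fun κ =>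
      (1 + B κ) + (pr.eval (B κ) + ((1 + (1 + (pr.eval (B κ) + B κ))) +
        ((1 + (1 + B κ + B κ)) + pn.eval (1 + B κ + B κ)))) := by
    have h1 := hB.eval pr
    have h2 := ((PolyBdd.const 1).add hB).add hB
    have h3 := h2.eval pn
    exact ((PolyBdd.const 1).add hB).add (h1.add (((PolyBdd.const 1).add ((PolyBdd.const 1).add
      (h1.add hB))).add (((PolyBdd.const 1).add h2).add h3)))
  -- The running time of the program below, part by part; `w κ` is added so that the time bound,
  -- which is also the length of the tape, covers all coins.
  have htot : PolyBdd (fun κ : {κ // G κ} => Data.unary κ) fun κ =>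
      w κ + ((1 + (1 + 4 * κ.1)) + (pw.eval (1 + 4 * κ.1) + ((1 + (1 + 4 * w κ)) +
      ((3 + w κ * (2 * (7 + 8 * w κ))) + ((1 + (1 + 4 * κ.1)) + (pN.eval (1 + 4 * κ.1) +
      ((1 + (1 + 4 * N κ)) + ((1 + (1 + (1 + 4 * κ.1) + (1 + 4 * w κ))) +
      (pi.eval (1 + (1 + 4 * κ.1) + (1 + 4 * w κ)) +
      ((N κ * (((1 + B κ) + (pr.eval (B κ) + ((1 + (1 + (pr.eval (B κ) + B κ))) +
        ((1 + (1 + B κ + B κ)) + pn.eval (1 + B κ + B κ))))) + (1 + 4 * N κ) + 2) + 1) +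
      pf.eval (B κ))))))))))) := by
    have c : ∀ k, PolyBdd (fun κ : {κ // G κ} => Data.unary κ) fun _ => k := PolyBdd.const
    have h2 := (c 1).add ((c 4).mul hwB)
    have h3 := ((c 1).add hid).add h2
    have h4 := (c 1).add ((c 4).mul hNB)
    exact hwB.add (((c 1).add hid).add ((hid.eval pw).add (((c 1).add h2).add
      (((c 3).add (hwB.mul ((c 2).mul ((c 7).add ((c 8).mul hwB))))).add
      (((c 1).add hid).add ((hid.eval pN).add (((c 1).add h4).add
      (((c 1).add h3).add ((h3.eval pi).add
      (((hNB.mul ((hbody.add h4).add (c 2))).add (c 1)).add (hB.eval pf)))))))))))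
  obtain ⟨p, hp⟩ := htot.exists_eval
  -- Variable `M` holds the coins, `M + 1` the loop counter, `M + 2` the oracle's answer, `M + 3`
  -- the security parameter and `M + 4` the state before the query.
  refine ⟨.seq (.assign (M + 3) (.var 0)) (.seq cw (.seq (.assign (M + 1) (.var 0))
    (.seq (.tossCoins M) (.seq (.assign 0 (.var (M + 3))) (.seq cN (.seq (.assign (M + 1) (.var 0))
    (.seq (.assign 0 (.cons (.var (M + 3)) (.var M))) (.seq ci (.seq (.forList (M + 1)
      (.seq (.assign (M + 4) (.var 0)) (.seq cr (.seq (.ite (.var 0) (.query (M + 2) (.var 0))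
        (.assign (M + 2) .nil)) (.seq (.assign 0 (.cons (.var (M + 4)) (.var (M + 2)))) cn)))))
      cf))))))))), p, fun κ hκ => ⟨?_, ?_⟩⟩
  · have := hp ⟨κ, hκ⟩; dsimp only at this; omega
  intro σ O ω a y q ha hok hstep
  have hp := hp ⟨κ, hκ⟩
  suffices H : Ev O ω _ ⟨fun x => if x = 0 then .unary κ else .nil, 0, q 0⟩ (p.eval κ)
      fun s' => s'.store 0 = fin (a (N κ)) ∧ s'.oracle = q (N κ) from H
  have hsz := Data.size_unary κ
  have hszw := Data.size_unary (w κ)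
  have hszN := Data.size_unary (N κ)
  have hszW : (Data.ofBits ((List.range (w κ)).map ω).reverse).size ≤ 1 + 4 * w κ := by
    refine (Data.size_ofBits_le _).trans ?_; simp
  refine Ev.mono ?_ (le_trans (Nat.le_add_left _ _) hp) fun _ h => h
  refine Ev.assign_seq (by simp [Expr.eval, hsz]) ?_
  refine (hw.ev ⟨κ, hκ⟩ (by simp [Expr.eval]) (by rw [hsz]) (Q := fun s =>
    s.store 0 = .unary (w κ) ∧ s.store (M + 3) = .unary κ ∧ s.coins = 0 ∧ s.oracle = q 0)
    fun s h1 h2 => ⟨h1, ?_, h2.2.1, h2.2.2⟩).seq ?_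
  · rw [h2.1 _ (by omega)]; simp [Expr.eval]
  rintro s₁ ⟨h1, h2, h3, h4⟩
  refine Ev.assign_seq (by simp [Expr.eval, h1, hszw]) ?_
  have h1' : (Function.update s₁.store (M + 1) ((Expr.var 0).eval s₁.store)) (M + 1) =
      .unary (w κ) := by simp [Expr.eval, h1]
  refine Ev.seq (Ev.tossCoins (s := ⟨Function.update s₁.store (M + 1) ((Expr.var 0).eval s₁.store),
    s₁.coins, s₁.oracle⟩) h1' h3 le_rfl) ?_
  rintro s₂ ⟨h5, -, h6, h7⟩
  have h8 : s₂.store (M + 3) = .unary κ := by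
    rw [h6 _ (by omega)]; simp [h2]
  refine Ev.assign_seq (by simp [Expr.eval, h8, hsz]) ?_
  refine (hN.ev ⟨κ, hκ⟩ (by simp [Expr.eval, h8]) (by rw [hsz]) (Q := fun s =>
    s.store 0 = .unary (N κ) ∧ s.store (M + 3) = .unary κ ∧
      s.store M = .ofBits ((List.range (w κ)).map ω).reverse ∧ s.oracle = q 0)
    fun s h1 h2 => ⟨h1, ?_, ?_, ?_⟩).seq ?_
  · rw [h2.1 _ (by omega)]; simp [h8]
  · rw [h2.1 _ le_rfl]; dsimp only; rw [Function.update_of_ne (by omega)]; exact h5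
  · rw [h2.2.2]; exact h7.trans h4
  rintro s₃ ⟨h9, h10, h11, h12⟩
  refine Ev.assign_seq (by simp [Expr.eval, h9, hszN]) ?_
  have heval : (Expr.cons (.var (M + 3)) (.var M)).eval (Function.update s₃.store (M + 1)
      ((Expr.var 0).eval s₃.store)) =
      .cons (.unary κ) (.ofBits ((List.range (w κ)).map ω).reverse) := by
    simp [Expr.eval, h10, h11]
  have hszi : (Data.cons (.unary κ) (.ofBits ((List.range (w κ)).map ω).reverse)).size ≤
      1 + (1 + 4 * κ) + (1 + 4 * w κ) := by simp only [Data.size]; omega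
  refine Ev.assign_seq (by dsimp only; rw [heval]; exact hszi) ?_
  refine (hi.ev ⟨⟨κ, hκ⟩, (List.range (w κ)).map ω⟩ (by dsimp only; rw [heval]; simp)
    (pi.eval_nat_mono hszi) (Q := fun s => s.store 0 = enc (a 0) ∧
      s.store (M + 1) = .unary (N κ) ∧ s.oracle = q 0) fun s h1 h2 => ⟨?_, ?_, ?_⟩).seq ?_
  · rw [h1, ha]
  · rw [h2.1 _ (by omega)]; dsimp only
    rw [Function.update_of_ne (by omega), Function.update_self]; exact h9
  · rw [h2.2.2]; exact h12
  rintro s₄ ⟨h13, h14, h15⟩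
  refine Ev.seq ?_ (Q := fun s => s.store 0 = enc (a (N κ)) ∧ s.oracle = q (N κ)) ?_
  · have hl := Ev.forList (O := O) (ω := ω) (k := M + 1)
      (c := (.seq (.assign (M + 4) (.var 0)) (.seq cr (.seq (.ite (.var 0) (.query (M + 2) (.var 0))
        (.assign (M + 2) .nil)) (.seq (.assign 0 (.cons (.var (M + 4)) (.var (M + 2)))) cn)))))
      (N := N κ) (B := (1 + B κ) + (pr.eval (B κ) + ((1 + (1 + (pr.eval (B κ) + B κ))) +
        ((1 + (1 + B κ + B κ)) + pn.eval (1 + B κ + B κ))))) (C := 1 + 4 * N κ)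
      (fun j s => s.store 0 = enc (a j) ∧ s.oracle = q j) ?_ ?_
      (List.replicate (N κ) (Data.ofBool true)) 0 (by simp)
      (by rw [← Data.unary_eq_ofList, hszN]) s₄ ⟨h13, h15⟩ (by rw [h14, Data.unary_eq_ofList])
    · rw [List.length_replicate] at hl; exact hl
    · rintro j s d ⟨h1, h2⟩
      exact ⟨by dsimp only; rw [Function.update_of_ne (by omega)]; exact h1, h2⟩
    · rintro j hj s ⟨k1, k2⟩
      obtain ⟨hnx, hoy, hys, hor⟩ := hstep j hj
      obtain ⟨hokj, hszj⟩ := hok j hj.le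
      have hsr : (req (a j)).size ≤ pr.eval (B κ) :=
        ((hr ⟨a j, hokj⟩).1).trans (pr.eval_nat_mono hszj)
      refine Ev.assign_seq (by simpa [Expr.eval, k1] using hszj) ?_
      refine (hr.ev ⟨a j, hokj⟩ (by simp [Expr.eval, k1]) (pr.eval_nat_mono hszj)
        (Q := fun s' => s'.store 0 = req (a j) ∧ s'.store (M + 4) = enc (a j) ∧
          s'.store (M + 1) = s.store (M + 1) ∧ s'.oracle = q j)
        fun s' h1 h2 => ⟨h1, ?_, ?_, ?_⟩).seq ?_
      · rw [h2.1 _ (by omega)]; simp [Expr.eval, k1]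
      · rw [h2.1 _ (by omega)]; simp
      · rw [h2.2.2]; exact k2
      rintro s' ⟨k3, k4, k5, k6⟩
      refine Ev.seq (Q := fun s'' => s''.store (M + 2) = .ofBits (y j) ∧
        s''.store (M + 4) = enc (a j) ∧ s''.store (M + 1) = s.store (M + 1) ∧
        s''.oracle = q (j + 1)) ?_ ?_
      · refine Ev.ite (fun hne => ?_) fun he => ?_
        · simp only [Expr.eval, k3] at hne
          obtain ⟨ho, -⟩ | ⟨-, ho⟩ := hor
          · exact absurd ho hne
          · refine Ev.query (a := .ofBits (y j)) (q := q (j + 1))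
              (by simpa [Expr.eval, k3, k6] using ho) ?_ ⟨by simp, ?_, ?_, rfl⟩
            · simp only [Expr.eval, k3]; omega
            · simp [k4]
            · simp [k5]
        · simp only [Expr.eval, k3] at he
          obtain ⟨-, hy, hq⟩ | ⟨ho, -⟩ := hor
          · refine Ev.assign ?_ ⟨by simp [Expr.eval, hy], ?_, ?_, ?_⟩
            · have := (enc (a j)).size_pos
              simp only [Expr.eval, Data.size]; omega
            · simp [k4]
            · simp [k5]
            · rw [hq]; exact k6
          · exact absurd he ho
      · rintro s'' ⟨k7, k8, k9, k10⟩
        have he : (Expr.cons (.var (M + 4)) (.var (M + 2))).eval s''.store =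
            .cons (enc (a j)) (.ofBits (y j)) := by simp [Expr.eval, k7, k8]
        have hs : (Data.cons (enc (a j)) (.ofBits (y j))).size ≤ 1 + B κ + B κ := by
          simp only [Data.size]; omega
        refine Ev.assign_seq (by rw [he]; exact hs) ?_
        refine hn.ev ⟨(a j, y j), hokj, hoy⟩ (by simp [he]) (pn.eval_nat_mono hs)
          fun s₅ h1 h2 => ⟨⟨?_, ?_⟩, ?_⟩
        · rw [h1, hnx]
        · rw [h2.2.2]; exact k10
        · rw [h2.1 _ (by omega)]; simp [k9]
  · rintro s₅ ⟨k1, k2⟩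
    obtain ⟨h1, h2⟩ := hok (N κ) le_rfl
    refine hf.ev ⟨a (N κ), h1⟩ k1 (pf.eval_nat_mono h2) fun s₆ h3 h4 => ⟨h3, ?_⟩
    rw [h4.2.2]; exact k2


theorem AddInput.length_succ_le : ∀ u : AddInput, (succ u).length ≤ u.length + 1
  | [] => le_rfl
  | false :: u => by simp [succ]
  | true :: u => by
    have := length_succ_le u
    simp only [succ, List.length_cons]; omega

namespace Tokenizer

open Data TokenScheme

/-! ### The size of the states -/

/-- The stack only ever contains parts of the attacker's program. These form the finite list `A.L`,
so that a program can be represented by its position in it. -/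
theorem Setup.act_mem {S : TokenScheme} (A : Setup S) {T : ℕ} {a b : Thread}
    (h : a.act T = .go b) (ha : ∀ p ∈ a.stack, p ∈ A.L) : ∀ p ∈ b.stack, p ∈ A.L := by
  rcases a with ⟨stack, store, coins, clock⟩
  rcases stack with - | ⟨p, r⟩
  · simp [Thread.act] at h
  by_cases hc : clock = 0
  · simp [Thread.act, hc] at h
  simp only [List.mem_cons, forall_eq_or_imp] at ha
  obtain ⟨hp, hr⟩ := ha
  cases p <;> simp only [Thread.act, hc, if_false] at h
  · cases h; exact hr
  · split at h <;> cases h; exact hr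
  · cases h; exact hr
  · split at h <;> cases h
  · cases h
    have := A.comp _ _ hp
    simpa using ⟨this.1, this.2, hr⟩
  · cases h
    have := A.cond _ _ _ hp
    dsimp only
    split
    · simpa using ⟨this.1, hr⟩
    · simpa using ⟨this.2, hr⟩
  · cases h
    have := A.loop _ _ hp
    dsimp only
    split
    · simpa using ⟨this, hp, hr⟩
    · exact hr

theorem Setup.step_mem {S : TokenScheme} (A : Setup S) {P : Params}
    {src : ℕ → List Bool → List Bool} {s : State} (hs : ∀ p ∈ s.th.stack, p ∈ A.L) :
    ∀ p ∈ (step P src s).th.stack, p ∈ A.L := by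
  have hres : ∀ y, ∀ p ∈ (s.th.resume y).stack, p ∈ A.L := by
    intro y p hp
    unfold Thread.resume at hp
    split at hp
    · rename_i x e r heq
      exact hs p (by rw [heq]; exact List.mem_cons_of_mem _ hp)
    · exact hs p hp
  rcases ht : s.tag
  case run =>
    cases h : s.th.act P.T with
    | go a => simpa [step, ht, h] using A.act_mem h hs
    | _ => simpa [step, ht, h] using hs
  case walk =>
    by_cases hc : s.cnt < P.Q
    · simp only [step, ht, hc, if_true]
      unfold answer
      dsimp only
      split_ifs
      · exact hs
      · exact hres _
      · exact hs
    · simpa [step, ht, hc] using hs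
  case tok =>
    cases h : Bits.lookup (s.X ++ P.fb s.u s.X) s.V with
    | none => simpa [step, ht, h] using hs
    | some v => by_cases hv : v = s.u <;> simpa [step, ht, h, hv] using hs
  all_goals simpa [step, ht] using hs

theorem act_bounds {T D : ℕ} {a b : Thread} (h : a.act T = .go b) (hT : T + 4 ≤ D)
    (ha : ∀ x, (a.store x).size ≤ D) :
    b.stack.length ≤ a.stack.length + 1 ∧ (∀ x, (b.store x).size ≤ D) ∧
      b.coins.length ≤ a.coins.length ∧ b.clock ≤ a.clock := by
  rcases a with ⟨stack, store, coins, clock⟩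
  have hup : ∀ x v, v.size ≤ D → ∀ z, (Function.update store x v z).size ≤ D := by
    intro x v hv z
    by_cases hz : z = x
    · subst hz; simpa using hv
    · rw [Function.update_of_ne hz]; exact ha z
  rcases stack with - | ⟨p, r⟩
  · simp [Thread.act] at h
  by_cases hc : clock = 0
  · simp [Thread.act, hc] at h
  cases p <;> simp only [Thread.act, hc, if_false] at h
  · cases h; exact ⟨by simp only [List.length_cons]; omega, ha, le_rfl, Nat.sub_le _ _⟩
  · split at h <;> cases h
    exact ⟨by simp only [List.length_cons]; omega, hup _ _ (by omega), le_rfl, Nat.sub_le _ _⟩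
  · cases h
    exact ⟨by simp only [List.length_cons]; omega, hup _ _ ((size_ofBool_le _).trans (by omega)),
      by simp, Nat.sub_le _ _⟩
  · split at h <;> cases h
  · cases h; exact ⟨by simp, ha, le_rfl, Nat.sub_le _ _⟩
  · cases h; exact ⟨by simp, ha, le_rfl, Nat.sub_le _ _⟩
  · cases h
    refine ⟨?_, ha, le_rfl, Nat.sub_le _ _⟩
    dsimp only; split <;> simp only [List.length_cons] <;> omega

/-- Bounds for a state after `j` steps. -/
structure Bounded (n D j : ℕ) (s : State) : Prop where
  stack : s.th.stack.length ≤ D + j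
  store : ∀ x, (s.th.store x).size ≤ D
  coins : s.th.coins.length ≤ D
  clock : s.th.clock ≤ D
  X : s.X.length ≤ n
  u : s.u.length ≤ D + j
  u' : s.u'.length ≤ D + j
  x : s.x.length ≤ D
  V : s.V.length ≤ j
  V_mem : ∀ e ∈ s.V, e.1.length ≤ D ∧ e.2.length ≤ D + j
  Ys : s.Ys.length ≤ j
  Ys_mem : ∀ y ∈ s.Ys, y.length ≤ D

theorem Bounded.succ {n D j : ℕ} {s : State} (h : Bounded n D j s) : Bounded n D (j + 1) s where
  stack := by have := h.stack; omega
  store := h.store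
  coins := h.coins
  clock := h.clock
  X := h.X
  u := by have := h.u; omega
  u' := by have := h.u'; omega
  x := h.x
  V := by have := h.V; omega
  V_mem e he := ⟨(h.V_mem e he).1, by have := (h.V_mem e he).2; omega⟩
  Ys := by have := h.Ys; omega
  Ys_mem := h.Ys_mem

/-- Only the stack, the additional inputs and the lists `V` and `Ys` grow, each by at most one per
step; everything else is limited by `T` or by the block length. The term `4 * P.m` in `hD` covers
the tree of a token. -/
theorem Bounded.step {P : Params} {D j : ℕ} {src : ℕ → List Bool → List Bool} {s : State}
    (h : Bounded P.n D j s) (hD : P.T + 4 * P.m + P.n + 4 ≤ D)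
    (hfb : ∀ u X, (P.fb u X).length ≤ P.m) (hsrc : ∀ k x, (src k x).length ≤ P.m) :
    Bounded P.n D (j + 1) (step P src s) := by
  have hs := h.succ
  rcases ht : s.tag
  case run =>
    cases ha : s.th.act P.T with
    | done => simpa [Tokenizer.step, ht, ha] using hs
    | dead => simp only [Tokenizer.step, ht, ha]; exact { hs with }
    | ask v =>
      simp only [Tokenizer.step, ht, ha]
      have hv := (Thread.act_ask ha).2.1
      refine { hs with X := ?_, u := ?_ }
      · have hcode : ∀ l, (P.code l).length ≤ P.n := fun l => by
          unfold Params.code; split_ifs <;> simp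
        dsimp only [Params.queryCode]; split_ifs <;> exact hcode _
      · have h1 : v.tail.size ≤ v.size := size_tail_le v
        have h2 : v.tail.tail.size ≤ v.tail.size := size_tail_le _
        have h3 := Bits.length_ofData_le v.tail
        have h4 := Bits.length_ofData_le v.tail.tail
        dsimp only [Params.queryInput]; split_ifs <;> omega
    | go a =>
      simp only [Tokenizer.step, ht, ha]
      obtain ⟨h1, h2, h3, h4⟩ := act_bounds (D := D) ha (by omega) h.store
      exact { hs with
        stack := by have := h.stack; dsimp only; omega
        store := h2
        coins := h3.trans h.coins
        clock := h4.trans h.clock }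
  case walk =>
    by_cases hc : s.cnt < P.Q
    · simp only [Tokenizer.step, ht, hc, if_true]
      have hy := hsrc s.cnt s.x
      generalize src s.cnt s.x = y at hy
      have hbase : Bounded P.n D (j + 1) { s with Ys := y.take P.n :: s.Ys } :=
        { hs with
          Ys := by have := h.Ys; simp only [List.length_cons]; omega
          Ys_mem := by
            intro z hz
            rcases List.mem_cons.1 hz with rfl | hz
            · rw [List.length_take]; omega
            · exact h.Ys_mem z hz }
      unfold answer
      dsimp only
      split_ifs
      · exact { hbase with }
      · have hl : (y.take P.n).length ≤ P.m := by rw [List.length_take]; omega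
        have hres : (s.th.resume (y.take P.n)).stack.length ≤ s.th.stack.length ∧
            (∀ x, ((s.th.resume (y.take P.n)).store x).size ≤ D) ∧
            (s.th.resume (y.take P.n)).coins = s.th.coins ∧
            (s.th.resume (y.take P.n)).clock ≤ s.th.clock := by
          unfold Thread.resume
          split
          · rename_i x e r heq
            refine ⟨by rw [heq]; simp, fun z => ?_, rfl, Nat.sub_le _ _⟩
            dsimp only
            by_cases hz : z = x
            · subst hz
              rw [Function.update_self]
              exact (size_ofBits_le _).trans (by omega)
            · rw [Function.update_of_ne hz]; exact h.store z
          · exact ⟨le_rfl, h.store, rfl, le_rfl⟩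
        obtain ⟨h1, h2, h3, h4⟩ := hres
        exact { hbase with
          stack := h1.trans hs.stack
          store := h2
          coins := by rw [h3]; exact h.coins
          clock := h4.trans h.clock }
      · exact { hbase with x := by dsimp only; omega }
    · simp only [Tokenizer.step, ht, hc, if_false]
      exact { hs with }
  case tok =>
    have hx : (s.X ++ P.fb s.u s.X).length ≤ D := by
      have := h.X
      have := hfb s.u s.X
      rw [List.length_append]; omega
    cases hl : Bits.lookup (s.X ++ P.fb s.u s.X) s.V with
    | none =>
      simp only [Tokenizer.step, ht, hl]
      exact { hs with
        x := hx
        V := by have := h.V; simp only [List.length_cons]; omega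
        V_mem := by
          intro e he
          rcases List.mem_cons.1 he with rfl | he
          · exact ⟨hx, hs.u⟩
          · exact hs.V_mem e he }
    | some v =>
      by_cases hv : v = s.u
      · simp only [Tokenizer.step, ht, hl, hv, if_true]
        have h1 := AddInput.length_succ_le s.u
        have h2 := h.u
        exact { hs with u := by dsimp only; omega }
      · simp only [Tokenizer.step, ht, hl, hv, if_false]
        exact { hs with u' := (hs.V_mem _ (Bits.lookup_some hl)).2 }
  all_goals simpa [Tokenizer.step, ht] using hs

theorem size_ofList_le_mul {l : List Data} {k B : ℕ} (hl : l.length ≤ k)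
    (h : ∀ d ∈ l, d.size ≤ B) : (ofList l).size ≤ 1 + k * (1 + B) := by
  rw [size_ofList]
  have := List.sum_le_card_nsmul (l.map fun d => 1 + d.size) (1 + B) (by
    intro x hx
    obtain ⟨d, hd, rfl⟩ := List.mem_map.1 hx
    have := h d hd
    omega)
  simp only [List.length_map, smul_eq_mul] at this
  have h2 : l.length * (1 + B) ≤ k * (1 + B) := Nat.mul_le_mul_right _ hl
  omega

/-- A bound for the size of the representation of a snapshot. -/
def sizeBound (L M D j : ℕ) : ℕ :=
  17 + 11 * (1 + 4 * (D + j)) + (1 + (D + j) * (1 + (1 + 4 * L))) + (1 + M * (1 + D)) +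
    25 + (1 + j * (1 + (1 + (1 + 4 * D) + (1 + 4 * (D + j))))) + (1 + j * (1 + (1 + 4 * D)))

theorem size_enc_le {L : List Prog} {M n D j : ℕ} {c : Snapshot} (hn : n ≤ D)
    (h : Bounded n D j c.s) (h1 : c.κ ≤ D) (h2 : c.X₀.length ≤ D) (h3 : c.pool.length ≤ D)
    (h4 : c.idx ≤ D) (h5 : c.budget ≤ D) : (c.enc L M).size ≤ sizeBound L.length M D j := by
  have hb : ∀ l : List Bool, l.length ≤ D + j → (ofBits l).size ≤ 1 + 4 * (D + j) := fun l hl =>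
    (size_ofBits_le l).trans (by omega)
  have hu : ∀ k, k ≤ D + j → (unary k).size ≤ 1 + 4 * (D + j) := fun k hk => by
    rw [size_unary]; omega
  have e1 := hu c.κ (by omega)
  have e2 := hb c.X₀ (by omega)
  have e3 := hb c.pool (by omega)
  have e4 := hu c.idx (by omega)
  have e5 := hu c.budget (by omega)
  have e6 : (ofList (c.s.th.stack.map fun p => unary (L.place p))).size ≤
      1 + (D + j) * (1 + (1 + 4 * L.length)) := by
    refine size_ofList_le_mul (by simpa using h.stack) fun d hd => ?_
    obtain ⟨p, -, rfl⟩ := List.mem_map.1 hd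
    have := L.place_le p
    rw [size_unary]; omega
  have e7 : (ofList ((List.range M).map c.s.th.store)).size ≤ 1 + M * (1 + D) := by
    refine size_ofList_le_mul (by simp) fun d hd => ?_
    obtain ⟨p, -, rfl⟩ := List.mem_map.1 hd
    exact h.store p
  have e8 := hb c.s.th.coins (h.coins.trans (by omega))
  have e9 := hu c.s.th.clock (h.clock.trans (by omega))
  have e10 : (unary (tags.place c.s.tag)).size ≤ 25 := by
    have := tags.place_le c.s.tag
    rw [size_unary]; simp only [tags, List.length_cons, List.length_nil] at this ⊢; omega
  have e11 := hb c.s.X (h.X.trans (by omega))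
  have e12 := hb c.s.u h.u
  have e13 := hb c.s.x (h.x.trans (by omega))
  have e14 := hb c.s.u' h.u'
  have e15 : (FP.encPairs c.s.V).size ≤
      1 + j * (1 + (1 + (1 + 4 * D) + (1 + 4 * (D + j)))) := by
    refine size_ofList_le_mul (by simpa using h.V) fun d hd => ?_
    obtain ⟨e, he, rfl⟩ := List.mem_map.1 hd
    have := h.V_mem e he
    have h1 := size_ofBits_le e.1
    have h2 := size_ofBits_le e.2
    simp only [Data.size]; omega
  have e16 : (ofList (c.s.Ys.map ofBits)).size ≤ 1 + j * (1 + (1 + 4 * D)) := by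
    refine size_ofList_le_mul (by simpa using h.Ys) fun d hd => ?_
    obtain ⟨e, he, rfl⟩ := List.mem_map.1 hd
    have := h.Ys_mem e he
    exact (size_ofBits_le e).trans (by omega)
  have e : (c.enc L M).size = 17 + (unary c.κ).size + (ofBits c.X₀).size + (ofBits c.pool).size +
      (unary c.idx).size + (unary c.budget).size +
      (ofList (c.s.th.stack.map fun p => unary (L.place p))).size +
      (ofList ((List.range M).map c.s.th.store)).size + (ofBits c.s.th.coins).size +
      (unary c.s.th.clock).size + (unary (tags.place c.s.tag)).size + (ofBits c.s.X).size +
      (ofBits c.s.u).size + (ofBits c.s.x).size + (ofBits c.s.u').size +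
      (FP.encPairs c.s.V).size + (ofList (c.s.Ys.map ofBits)).size := by
    simp only [Snapshot.enc, ofList, Data.size]; ring
  rw [e, sizeBound]
  linarith

end Tokenizer


/-! ### Queries and outputs of the adversary -/

namespace Tokenizer

open Data TokenScheme

/-- The query to the challenger, or `nil`. -/
def Snapshot.request (P : Params) (c : Snapshot) : Data :=
  if c.s.tag = .walk ∧ c.s.cnt < P.Q ∧ c.idx ≠ 0 then
    if c.idx = 1 then
      .cons (ofBool true) (.cons (ofBits (Bits.padTake P.m c.pool)) (ofBits c.s.x))
    else .cons (ofBool false) (ofBits c.s.x)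
  else .nil

theorem Snapshot.request_eq_nil {P : Params} {c : Snapshot} :
    c.request P = .nil ↔ ¬ (c.s.tag = .walk ∧ c.s.cnt < P.Q ∧ c.idx ≠ 0) := by
  unfold request
  split_ifs <;> simp_all

open Classical in
/-- The output of an adversary that accepts. -/
noncomputable def Snapshot.verdict (P : Params) (c : Snapshot) : Data :=
  ofBool (decide (Accept P c.s))

/-- The two pairs of a collision. -/
def Snapshot.pairs (c : Snapshot) : Data :=
  .cons (.cons (ofBits c.s.X) (ofBits c.s.u)) (.cons (ofBits c.s.X) (ofBits c.s.u'))

variable {S : TokenScheme} (A : Setup S)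

namespace Setup

section

variable {ι : Type} {inp : ι → Data} {A} {c : ι → Snapshot}

theorem fp_tag_eq (hc : FPSnap A.L A.M inp c) (t : Tag) :
    FP inp fun i => ofBool (decide ((c i).s.tag = t)) :=
  FP.dispatch tags hc.tag (fun i => mem_tags _) fun t' _ =>
    (FP.const (ofBool (decide (t' = t)))).congr fun i => by rw [i.2]

theorem fp_request (hc : FPSnap A.L A.M inp c) (h : ∀ i, A.Good (c i)) :
    FP inp fun i => (c i).request (A.par (c i)) := by
  have hx := hc.x
  refine (FP.ite_bool (FP.and (fp_tag_eq hc .walk) (FP.and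
      (FP.isCons hc.budget (c := fun i => decide ((c i).budget ≠ 0)) fun i => ?_)
      (FP.isCons hc.idx (c := fun i => decide ((c i).idx ≠ 0)) fun i => ?_)))
    (FP.ite_bool (FP.eq_unary hc.idx (FP.const (unary 1)))
      (.cons (FP.const (ofBool true)) (.cons (FP.padTake hc.pool (A.fp_m hc.κ)) hx))
      (.cons (FP.const (ofBool false)) hx)) FP.nil).congr fun i => ?_
  · rw [decide_eq_true_eq, ne_eq, ne_eq, unary_eq_nil]
  · rw [decide_eq_true_eq, ne_eq, ne_eq, unary_eq_nil]
  · have hb : (c i).budget ≠ 0 ↔ (c i).s.cnt < (A.par (c i)).Q := by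
      have := (h i).budget
      show _ ↔ _ < A.Q _
      omega
    simp only [Snapshot.request, ← hb, Bool.and_eq_true, decide_eq_true_eq]
    rfl

theorem fp_verdict (hc : FPSnap A.L A.M inp c) :
    FP inp fun i => (c i).verdict (A.par (c i)) := by
  refine (FP.or (fp_tag_eq hc .bad) (FP.or (fp_tag_eq hc .coll) (FP.and (fp_tag_eq hc .run)
    (FP.and (FP.not (FP.isCons hc.stack (c := fun i => decide ((c i).s.th.stack ≠ [])) fun i => ?_))
      (FP.eq_bits (fp_predict hc) (fp_target hc)))))).congr fun i => ?_
  · rw [decide_eq_true_eq, ne_eq, ne_eq, ofList_eq_nil, List.map_eq_nil_iff]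
  · rw [Snapshot.verdict]
    congr 1
    rw [Bool.eq_iff_iff]
    refine Iff.trans ?_ (@decide_eq_true_iff _ (Classical.propDecidable _)).symm
    simp [Accept]

theorem fp_pairs (hc : FPSnap A.L A.M inp c) : FP inp fun i => (c i).pairs :=
  .cons (.cons hc.X hc.u) (.cons hc.X hc.u')

end

/-! ### The start -/

/-- The number of random bits. -/
def width (κ : ℕ) : ℕ :=
  A.coins.eval κ + codeBits (S.l κ) + A.b κ + S.E.m κ * A.Q κ

/-- The coins of the attacker. -/
def tape (κ : ℕ) (W : List Bool) : List Bool := Bits.padTake (A.coins.eval κ) W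

/-- The hidden numeric code. -/
def secret (κ : ℕ) (W : List Bool) : List Bool :=
  Bits.padTake (codeBits (S.l κ)) (W.drop (A.coins.eval κ))

/-- The index of an encryption. -/
def index (κ : ℕ) (W : List Bool) : ℕ :=
  Bits.val (Bits.padTake (A.b κ) (W.drop (A.coins.eval κ + codeBits (S.l κ))))

/-- Random blocks, in a row. -/
def pool (κ : ℕ) (W : List Bool) : List Bool :=
  W.drop (A.coins.eval κ + codeBits (S.l κ) + A.b κ)

/-- The parameters of the machine, with hidden numeric code `X₀`. -/
def params (κ : ℕ) (X₀ : List Bool) : Params :=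
  S.params κ (A.T.eval κ) (A.Q κ) X₀ A.guess A.goal

/-- The machine at the start. -/
def start (κ : ℕ) (X₀ a : List Bool) : State :=
  initial (A.params κ X₀) κ A.stack a (A.clock.eval κ)

/-- The snapshot of a state, if the oracle is used for `i` encryptions. -/
def snap (κ : ℕ) (X₀ pool : List Bool) (i : ℕ) (s : State) : Snapshot where
  κ := κ
  X₀ := X₀
  pool := pool.drop (S.E.m κ * s.cnt)
  idx := i - s.cnt
  budget := A.Q κ - s.cnt
  s := s

/-- The number of encryptions for which the oracle is used. -/
def uses (challenge : Bool) (κ : ℕ) (W : List Bool) : ℕ :=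
  if challenge then A.index κ W + 1 else 0

def init (challenge : Bool) (κ : ℕ) (W : List Bool) : Snapshot :=
  A.snap κ (A.secret κ W) (A.pool κ W) (A.uses challenge κ W)
    (A.start κ (A.secret κ W) (A.tape κ W))

section

variable {ι : Type} {inp : ι → Data} {A} {κ : ι → ℕ} {W : ι → List Bool}

theorem fp_q (A : Setup S) (hκ : FP inp fun i => unary (κ i)) : FP inp fun i => unary (A.Q (κ i)) :=
  (FP.twoPow_clog (FP.unary_eval A.q hκ)).head

theorem fp_b (A : Setup S) (hκ : FP inp fun i => unary (κ i)) : FP inp fun i => unary (A.b (κ i)) :=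
  (FP.twoPow_clog (FP.unary_eval A.q hκ)).tail

theorem fp_width (A : Setup S) (hκ : FP inp fun i => unary (κ i)) (h : ∀ i, 1 ≤ S.l (κ i)) :
    FP inp fun i => unary (A.width (κ i)) :=
  FP.unary_add (FP.unary_add (FP.unary_add (FP.unary_eval _ hκ) (A.fp_n hκ h)) (A.fp_b hκ))
    (FP.unary_mul (A.fp_m hκ) (A.fp_q hκ))

theorem fp_init (A : Setup S) (challenge : Bool) (hκ : FP inp fun i => unary (κ i))
    (h : ∀ i, 1 ≤ S.l (κ i)) (hW : FP inp fun i => ofBits (W i)) :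
    FP inp fun i => (A.init challenge (κ i) (W i)).enc A.L A.M := by
  have hp : FP inp fun i => unary (A.coins.eval (κ i)) := FP.unary_eval _ hκ
  have hn := A.fp_n hκ h
  have hX₀ : FP inp fun i => ofBits (A.secret (κ i) (W i)) := FP.padTake (FP.drop hW hp) hn
  have hi : FP inp fun i => unary (A.index (κ i) (W i)) := by
    refine FP.unary_val (FP.padTake (FP.drop hW (FP.unary_add hp hn)) (A.fp_b hκ)) ?_
    refine (A.fp_q hκ).size.mono fun i => ?_
    rw [Bits.length_padTake, size_unary, Q]; omega
  refine FPSnap.enc ⟨hκ, hX₀, ?_, ?_, A.fp_q hκ, ?_, fun k _ => ?_, FP.padTake hW hp,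
    FP.unary_eval _ hκ, ?_, ?_, FP.nil, FP.nil, FP.nil, FP.nil, FP.nil⟩
  · exact (FP.drop hW (FP.unary_add (FP.unary_add hp hn) (A.fp_b hκ))).congr fun i => by
      simp [init, snap, Setup.pool, start, initial]
  · cases challenge with
    | false => exact FP.nil.congr fun i => by simp [init, snap, uses, unary]
    | true =>
      exact (FP.unary_add hi (FP.const (unary 1))).congr fun i => by
        simp [init, snap, uses, start, initial]
  · exact FP.const (ofList (A.stack.map fun p => unary (A.L.place p)))
  · by_cases hk : k = 0
    · exact hκ.congr fun i => by simp [init, snap, start, initial, hk]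
    · exact FP.nil.congr fun i => by simp [init, snap, start, initial, hk]
  · refine (FP.ite_bool (A.fp_lt_thr hκ h hX₀ fun i => by simp [secret])
      (FP.const (unary (tags.place .run))) (FP.const (unary (tags.place .dead)))).congr fun i => ?_
    have : (A.init challenge (κ i) (W i)).s.tag =
        if Bits.val (A.secret (κ i) (W i)) < 10 ^ S.l (κ i) then Tag.run else Tag.dead := rfl
    rw [this]
    simp only [decide_eq_true_eq]
    split_ifs <;> rfl
  · exact (FP.padTake (l := fun _ => []) FP.nil hn).congr fun i => by rw [Bits.padTake_nil]; rfl

end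

/-! ### The program -/

variable {A} {κ : ℕ} {X₀ a pool : List Bool}

theorem inv_start : Inv (A.params κ X₀) (A.start κ X₀ a) where
  isCode := ⟨by simp [start, initial], by
    simp only [start, initial, Bits.val_replicate_false]
    show 0 < 10 ^ S.l κ
    positivity⟩
  V := by simp [start, initial]
  log := by simp [start, initial]
  walk := by simp only [start, initial]; split_ifs <;> simp
  coll := by simp only [start, initial]; split_ifs <;> simp
  query := by simp only [start, initial]; split_ifs <;> simp

theorem params_valid : (A.params κ X₀).Valid := TokenScheme.params_valid

theorem good_snap {s : State} (h : 1 ≤ S.l κ) (i : ℕ) (hs : ∀ p ∈ s.th.stack, p ∈ A.L)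
    (hinv : Inv (A.params κ X₀) s) : A.Good (A.snap κ X₀ pool i s) where
  pos := h
  stack := hs
  budget := rfl
  isCode := hinv.isCode

theorem run_mem {src : ℕ → List Bool → List Bool} (N : ℕ) :
    ∀ p ∈ (run (A.params κ X₀) src (A.start κ X₀ a) N).th.stack, p ∈ A.L := by
  induction N with
  | zero => exact A.stack_subset
  | succ N ih => rw [run_succ]; exact A.step_mem ih

/-- The source of ciphertexts that uses `O` for the first `i` of them. -/
theorem next_snap {P : Params} (hP : P = A.params κ X₀) {i : ℕ} {s : State} {y : List Bool}
    {src : ℕ → List Bool → List Bool}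
    (hsrc : ∀ k x, i ≤ k → src k x = Bits.padTake (S.E.m κ) (pool.drop (S.E.m κ * k)))
    (hy : s.tag = .walk → s.cnt < A.Q κ → s.cnt < i → y = src s.cnt s.x) :
    (A.snap κ X₀ pool i s).next P y = A.snap κ X₀ pool i (step P src s) := by
  subst hP
  have hc : (A.snap κ X₀ pool i s).s = s := rfl
  rcases step_cnt_log (P := A.params κ X₀) (src := src) (src' := fun _ _ => []) (s := s) with
    ⟨h1, h2, h3⟩ | ⟨h1, -, h3⟩
  · have hcnt := answer_cnt (P := A.params κ X₀) (s := s) (src s.cnt s.x)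
    have hz : (if (A.snap κ X₀ pool i s).idx = 0 then
        Bits.padTake (A.params κ X₀).m (A.snap κ X₀ pool i s).pool else y) = src s.cnt s.x := by
      have : (A.snap κ X₀ pool i s).idx = i - s.cnt := rfl
      rw [this]
      split_ifs with h0
      · exact (hsrc _ _ (by omega)).symm
      · exact hy h1 h2 (by omega)
    rw [Snapshot.next, if_pos ⟨h1, h2⟩, hz, h3, hc]
    simp only [snap, hcnt, Nat.sub_add_eq, Nat.mul_succ, List.drop_drop]
    rfl
  · have hn : ¬ (s.tag = .walk ∧ s.cnt < (A.params κ X₀).Q) := by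
      rintro ⟨h4, h5⟩
      have : step (A.params κ X₀) src s = answer (A.params κ X₀) s (src s.cnt s.x) := by
        simp [step, h4, h5]
      rw [this, answer_cnt] at h1
      omega
    rw [Snapshot.next, if_neg (by rw [hc]; exact hn), hc, ← h3]
    simp only [snap, h1]

/-- The number of steps of the machine. -/
def steps (A : Setup S) (κ : ℕ) : ℕ := A.Q κ + A.clock.eval κ * (A.clock.eval κ + 3)

/-- A bound for the sizes of the parts of a state. -/
def bound (A : Setup S) (κ : ℕ) : ℕ :=
  (A.T.eval κ + 4 * S.E.m κ + codeBits (S.l κ) + 4) + (1 + 4 * κ) + A.coins.eval κ +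
    A.clock.eval κ + A.stack.length + A.width κ + A.Q κ

theorem bounded_run {src : ℕ → List Bool → List Bool} (ha : a.length = A.coins.eval κ)
    (hsrc : ∀ k x, (src k x).length = S.E.m κ) (j : ℕ) :
    Bounded (codeBits (S.l κ)) (A.bound κ) j (run (A.params κ X₀) src (A.start κ X₀ a) j) := by
  induction j with
  | zero =>
    refine ⟨?_, fun x => ?_, ?_, ?_, ?_, ?_, ?_, ?_, ?_, ?_, ?_, ?_⟩
    · simp only [run, Function.iterate_zero, id, start, initial, bound]; omega
    · simp only [run, Function.iterate_zero, id, start, initial, bound]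
      split_ifs
      · rw [size_unary]; omega
      · simp only [Data.size]; omega
    · simp only [run, Function.iterate_zero, id, start, initial, bound, ha]; omega
    · simp only [run, Function.iterate_zero, id, start, initial, bound]; omega
    · simp [run, start, initial, Setup.params, TokenScheme.params]
    all_goals simp [run, start, initial]
  | succ j ih =>
    rw [run_succ]
    refine ih.step (P := A.params κ X₀) ?_ (fun u X => ?_) fun k x => (hsrc k x).le
    · simp only [Setup.params, TokenScheme.params, bound]; omega
    · simp only [Setup.params, TokenScheme.params]
      split_ifs
      · simp
      · simp

theorem sizeBound_mono {L M D j N : ℕ} (h : j ≤ N) : sizeBound L M D j ≤ sizeBound L M D N := by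
  unfold sizeBound; gcongr

theorem fp_steps (A : Setup S) :
    FP (fun κ : {κ // 1 ≤ S.l κ} => unary κ) fun κ => unary (A.steps κ) := by
  have hid : FP (fun κ : {κ // 1 ≤ S.l κ} => unary κ) fun κ => unary κ := FP.id
  have hC := FP.unary_eval A.clock hid
  exact FP.unary_add (A.fp_q hid) (FP.unary_mul hC (FP.unary_add hC (FP.const (unary 3))))

theorem polyBdd_of_fp {ι : Type} {inp : ι → Data} {f : ι → ℕ} (h : FP inp fun i => unary (f i)) :
    PolyBdd inp f := h.size.mono fun κ => by rw [size_unary]; omega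

theorem polyBdd_bound (A : Setup S) :
    PolyBdd (fun κ : {κ // 1 ≤ S.l κ} => unary κ) fun κ => A.bound κ := by
  have hid : FP (fun κ : {κ // 1 ≤ S.l κ} => unary κ) fun κ => unary κ := FP.id
  have hl : ∀ κ : {κ // 1 ≤ S.l κ}, 1 ≤ S.l κ := fun κ => κ.2
  have k : ∀ n : ℕ, PolyBdd (fun κ : {κ // 1 ≤ S.l κ} => unary κ) fun _ => n := PolyBdd.const
  have h1 := polyBdd_of_fp (FP.unary_eval A.T hid)
  have h2 := polyBdd_of_fp (A.fp_m hid)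
  have h3 := polyBdd_of_fp (A.fp_n hid hl)
  have h4 := polyBdd_of_fp hid
  have h5 := polyBdd_of_fp (FP.unary_eval A.coins hid)
  have h6 := polyBdd_of_fp (FP.unary_eval A.clock hid)
  have h7 := polyBdd_of_fp (A.fp_width hid hl)
  have h8 := polyBdd_of_fp (A.fp_q hid)
  exact (((((((h1.add ((k 4).mul h2)).add h3).add (k 4)).add ((k 1).add ((k 4).mul h4))).add
    h5).add h6).add (k A.stack.length)).add h7 |>.add h8

theorem polyBdd_sizeBound {ι : Type} {inp : ι → Data} {D N : ι → ℕ} (L M : ℕ)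
    (hD : PolyBdd inp D) (hN : PolyBdd inp N) :
    PolyBdd inp fun i => sizeBound L M (D i) (N i) := by
  have k : ∀ n : ℕ, PolyBdd inp fun _ => n := PolyBdd.const
  have hDN := hD.add hN
  have h4 := (k 1).add ((k 4).mul hD)
  have h4' := (k 1).add ((k 4).mul hDN)
  unfold sizeBound
  exact (((((k 17).add ((k 11).mul h4')).add ((k 1).add (hDN.mul (k _)))).add
    ((k 1).add ((k M).mul ((k 1).add hD)))).add (k 25)).add
    ((k 1).add (hN.mul ((k 1).add (((k 1).add h4).add h4')))) |>.add
    ((k 1).add (hN.mul ((k 1).add h4)))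

/-- A bound for the sizes of the representations of the states. -/
def dataBound (A : Setup S) (κ : ℕ) : ℕ :=
  sizeBound A.L.length A.M (A.bound κ) (A.steps κ) + (1 + 4 * A.bound κ)

theorem polyBdd_size (A : Setup S) :
    PolyBdd (fun κ : {κ // 1 ≤ S.l κ} => unary κ) fun κ => A.dataBound κ :=
  (polyBdd_sizeBound _ _ A.polyBdd_bound (polyBdd_of_fp A.fp_steps)).add
    ((PolyBdd.const 1).add ((PolyBdd.const 4).mul A.polyBdd_bound))

/-- A program that runs the machine. -/
theorem exists_prog (A : Setup S) (challenge : Bool) {fin : Snapshot → Data}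
    (hfin : ∀ {ι : Type} {inp : ι → Data} {c : ι → Snapshot}, FPSnap A.L A.M inp c →
      FP inp fun i => fin (c i)) :
    ∃ (c : Prog) (p : Polynomial ℕ), ∀ κ, 1 ≤ S.l κ → A.width κ ≤ p.eval κ ∧
      ∀ {σ : Type} (O : Oracle σ) (ω : ℕ → Bool) (W : List Bool) (src : ℕ → List Bool → List Bool)
        (s : ℕ → State) (q : ℕ → σ),
        W = (List.range (A.width κ)).map ω →
        (∀ j, s j = run (A.params κ (A.secret κ W)) src
          (A.start κ (A.secret κ W) (A.tape κ W)) j) →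
        (∀ k x, (src k x).length = S.E.m κ) →
        (∀ k x, A.uses challenge κ W ≤ k →
          src k x = Bits.padTake (S.E.m κ) ((A.pool κ W).drop (S.E.m κ * k))) →
        (∀ j < A.steps κ, (¬ ((s j).tag = .walk ∧ (s j).cnt < A.Q κ ∧ (s j).cnt < A.uses challenge κ W) →
            q (j + 1) = q j) ∧
          ((s j).tag = .walk → (s j).cnt < A.Q κ → (s j).cnt < A.uses challenge κ W →
            O (q j) ((A.snap κ (A.secret κ W) (A.pool κ W) (A.uses challenge κ W) (s j)).request
              (A.params κ (A.secret κ W))) (ofBits (src (s j).cnt (s j).x)) (q (j + 1)))) →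
        RunsTo O ω c (unary κ) (q 0) (p.eval κ) (fin (A.snap κ (A.secret κ W) (A.pool κ W)
          (A.uses challenge κ W) (s (A.steps κ)))) (q (A.steps κ)) := by
  have hid : FP (fun κ : {κ // 1 ≤ S.l κ} => unary κ) fun κ => unary κ := FP.id
  have hl : ∀ κ : {κ // 1 ≤ S.l κ}, 1 ≤ S.l κ := fun κ => κ.2
  have h1 : FP (fun i : {κ // 1 ≤ S.l κ} × List Bool => .cons (unary i.1) (ofBits i.2))
      fun i => (A.init challenge i.1 i.2).enc A.L A.M :=
    A.fp_init challenge FP.id.head (fun i => i.1.2) FP.id.tail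
  have hg : FPSnap A.L A.M (fun c : {c // A.Good c} => c.1.enc A.L A.M) fun c => c.1 :=
    .of_enc FP.id
  have h2 : FP (fun c : {c // A.Good c} => c.1.enc A.L A.M) fun c => c.1.request (A.par c.1) :=
    fp_request hg fun i => i.2
  let OkY : Snapshot → List Bool → Prop := fun c y =>
    c.s.tag = .walk → c.s.cnt < A.Q c.κ → c.idx ≠ 0 → y.length = S.E.m c.κ
  have hg' : FPSnap A.L A.M (fun p : {p : Snapshot × List Bool // A.Good p.1 ∧ OkY p.1 p.2} =>
      .cons (p.1.1.enc A.L A.M) (ofBits p.1.2)) fun p => p.1.1 := .of_enc (FP.id.head.congr fun _ => rfl)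
  have h3 : FP (fun p : {p : Snapshot × List Bool // A.Good p.1 ∧ OkY p.1 p.2} =>
      .cons (p.1.1.enc A.L A.M) (ofBits p.1.2))
      fun p => (p.1.1.next (A.par p.1.1) p.1.2).enc A.L A.M :=
    fp_next hg' (FP.id.tail.congr fun _ => rfl) (fun p => p.2.1) fun p => p.2.2
  have h4 : FP (fun c : {c // A.Good c} => c.1.enc A.L A.M) fun c => fin c.1 := hfin hg
  have h5 := A.fp_width hid hl
  obtain ⟨c, p, h⟩ := FP.exists_prog (enc := Snapshot.enc A.L A.M)
    (req := fun c => c.request (A.par c)) (fin := fin) (next := fun c y => c.next (A.par c) y)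
    (init := A.init challenge) (G := fun κ => 1 ≤ S.l κ) (w := A.width) (N := A.steps)
    (B := A.dataBound) (Ok := A.Good) (OkY := OkY) h1 h2 h3 h4 h5 A.fp_steps A.polyBdd_size
  refine ⟨c, p, fun κ hκ => ⟨(h κ hκ).1, ?_⟩⟩
  intro σ O ω W src s q hW hs hsrc hpool hq
  have hlenW : W.length = A.width κ := by simp [hW]
  have hreq : ∀ j, ((A.snap κ (A.secret κ W) (A.pool κ W) (A.uses challenge κ W) (s j)).request
      (A.params κ (A.secret κ W)) = .nil ↔
      ¬ ((s j).tag = .walk ∧ (s j).cnt < A.Q κ ∧ (s j).cnt < A.uses challenge κ W)) := by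
    intro j
    have : (A.snap κ (A.secret κ W) (A.pool κ W) (A.uses challenge κ W) (s j)).idx ≠ 0 ↔
      (s j).cnt < A.uses challenge κ W := Nat.sub_ne_zero_iff_lt
    rw [Snapshot.request_eq_nil, ← this]
    rfl
  have hinv : ∀ j, Inv (A.params κ (A.secret κ W)) (s j) := fun j => by
    rw [hs]; exact inv_start.run params_valid hsrc j
  refine (h κ hκ).2 O ω (fun j => A.snap κ (A.secret κ W) (A.pool κ W) (A.uses challenge κ W) (s j))
    (fun j => open Classical in if (s j).tag = .walk ∧ (s j).cnt < A.Q κ ∧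
      (s j).cnt < A.uses challenge κ W then src (s j).cnt (s j).x else []) q ?_ (fun j hj => ⟨?_, ?_⟩)
      fun j hj => ⟨?_, fun h1 h2 h3 => ?_, ?_, ?_⟩
  · rw [← hW, hs]; rfl
  · exact good_snap hκ _ (by rw [hs]; exact run_mem j) (hinv j)
  · have hb := bounded_run (A := A) (κ := κ) (X₀ := A.secret κ W) (a := A.tape κ W) (src := src)
      (by simp [tape]) hsrc j
    rw [← hs] at hb
    have hpl : (A.pool κ W).length ≤ A.width κ := by
      rw [Setup.pool, List.length_drop, hlenW]; omega
    have huse : A.uses challenge κ W ≤ A.Q κ := by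
      unfold uses
      split_ifs
      · have := Bits.val_lt (Bits.padTake (A.b κ) (W.drop (A.coins.eval κ + codeBits (S.l κ))))
        rw [Bits.length_padTake] at this
        exact this
      · omega
    refine (size_enc_le (n := codeBits (S.l κ)) (D := A.bound κ) (j := j) ?_ hb ?_ ?_ ?_ ?_
      ?_).trans ((sizeBound_mono hj).trans (Nat.le_add_right _ _))
    · simp only [bound]; omega
    · simp only [bound, snap]; omega
    · simp only [bound, snap, secret, Bits.length_padTake]; omega
    · simp only [bound, snap, List.length_drop]; omega
    · simp only [bound, snap]; omega
    · simp only [bound, snap]; omega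
  · rw [hs (j + 1), run_succ, ← hs]
    refine (next_snap rfl hpool fun h1 h2 h3 => ?_).symm
    rw [if_pos ⟨h1, h2, h3⟩]
  · have h3' : (s j).cnt < A.uses challenge κ W := Nat.sub_ne_zero_iff_lt.1 h3
    rw [if_pos ⟨h1, h2, h3'⟩]
    exact hsrc _ _
  · refine (size_ofBits_le _).trans ?_
    have : S.E.m κ ≤ A.bound κ := by simp only [bound]; omega
    simp only [dataBound]
    split_ifs
    · rw [hsrc]; omega
    · simp; omega
  · by_cases hc : (s j).tag = .walk ∧ (s j).cnt < A.Q κ ∧ (s j).cnt < A.uses challenge κ W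
    · right
      rw [if_pos hc]
      exact ⟨(hreq j).not.2 (not_not.2 hc), (hq j hj).2 hc.1 hc.2.1 hc.2.2⟩
    · left
      exact ⟨(hreq j).2 hc, by rw [if_neg hc], (hq j hj).1 hc⟩

end Setup

end Tokenizer


/-! ### The adversaries -/

theorem BlockCipher.block_injective {m : ℕ} :
    Function.Injective (BlockCipher.block (m := m)) := fun x y h => by
  have h : Bits.ofNat m x.toNat = Bits.ofNat m y.toNat := Data.ofBits_injective h
  have h := congrArg Bits.val h
  rw [Bits.val_ofNat, Bits.val_ofNat, Nat.mod_eq_of_lt x.isLt, Nat.mod_eq_of_lt y.isLt] at h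
  exact BitVec.eq_of_toNat_eq h

theorem BlockCipher.cpaOracle_inv {m : ℕ} {e : BitVec m → BitVec m} {ν : Bool}
    {q q' : CPAState m} {d a : Data} (h : cpaOracle e ν q d a q') :
    (∃ x, d = .cons (.ofBool false) (block x) ∧ a = block (e x) ∧
      q' = ⟨insert x q.asked, q.challenge⟩) ∨
    ∃ x₀ x₁, d = .cons (.ofBool true) (.cons (block x₀) (block x₁)) ∧
      a = block (e (if ν then x₁ else x₀)) ∧ q' = ⟨q.asked, some (x₀, x₁)⟩ := by
  cases h with
  | encrypt _ x h => exact .inl ⟨x, rfl, rfl, rfl⟩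
  | challenge _ x₀ x₁ h h₀ h₁ => exact .inr ⟨x₀, x₁, rfl, rfl, rfl⟩

theorem BlockCipher.cpaOracle_functional {m : ℕ} (e : BitVec m → BitVec m) (ν : Bool) :
    (BlockCipher.cpaOracle e ν).Functional := by
  intro q d a a' q' q'' h h'
  rcases cpaOracle_inv h with ⟨x, rfl, rfl, rfl⟩ | ⟨x₀, x₁, rfl, rfl, rfl⟩ <;>
    rcases cpaOracle_inv h' with ⟨x', hd, rfl, rfl⟩ | ⟨x₀', x₁', hd, rfl, rfl⟩
  · obtain rfl := BlockCipher.block_injective (Data.cons.inj hd).2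
    exact ⟨rfl, rfl⟩
  · simp [Data.ofBool] at hd
  · simp [Data.ofBool] at hd
  · obtain ⟨hd₀, hd₁⟩ := Data.cons.inj (Data.cons.inj hd).2
    obtain rfl := BlockCipher.block_injective hd₀
    obtain rfl := BlockCipher.block_injective hd₁
    exact ⟨rfl, rfl⟩

namespace Tokenizer

open Data TokenScheme

/-- A bit string as a block. -/
def toBlock (m : ℕ) (x : List Bool) : BitVec m := BitVec.ofNat m (Bits.val x)

theorem ofNat_toBlock {m : ℕ} {x : List Bool} (h : x.length = m) :
    Bits.ofNat m (toBlock m x).toNat = x := by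
  subst h
  rw [toBlock, BitVec.toNat_ofNat, Nat.mod_eq_of_lt (Bits.val_lt x), Bits.ofNat_val]

theorem toBlock_ofNat {m : ℕ} (z : BitVec m) : toBlock m (Bits.ofNat m z.toNat) = z :=
  ofNat_val_ofNat z

theorem block_toBlock {m : ℕ} {x : List Bool} (h : x.length = m) :
    BlockCipher.block (toBlock m x) = ofBits x := by
  rw [← congrArg ofBits (ofNat_toBlock h)]; rfl

namespace Setup

variable {S : TokenScheme} (A : Setup S)

/-- Block number `k` of the pool. -/
def chunk (κ : ℕ) (W : List Bool) (k : ℕ) : List Bool :=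
  Bits.padTake (S.E.m κ) ((A.pool κ W).drop (S.E.m κ * k))

/-- The final state of the machine. -/
def final (κ : ℕ) (X₀ a : List Bool) (src : ℕ → List Bool → List Bool) : State :=
  run (A.params κ X₀) src (A.start κ X₀ a) (A.steps κ)

/-- The machine accepts. -/
def Accepts (κ : ℕ) (X₀ a : List Bool) (src : ℕ → List Bool → List Bool) : Prop :=
  Accept (A.params κ X₀) (A.final κ X₀ a src)

/-- Ciphertexts in the game, where `y` is the pool and `i` is the index of the challenge. -/
def gameSrc (κ : ℕ) (K : S.E.Key κ) (y : ℕ → List Bool) (i : ℕ) (ν : Bool) (k : ℕ)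
    (x : List Bool) : List Bool :=
  if k < i then S.encBits κ K x
  else if k = i then S.encBits κ K (if ν then x else y k) else y k

/-- The state of the challenger. -/
def challenger (m : ℕ) (z : List Bool) (i : ℕ) (s : State) : BlockCipher.CPAState m where
  asked := {b | Bits.ofNat m b.toNat ∈ (s.log.reverse.take i).map Prod.fst}
  challenge := (s.log.reverse[i]?).map fun e => (toBlock m z, toBlock m e.1)

variable {A}

theorem length_encBits {κ : ℕ} {K : S.E.Key κ} (x : List Bool) :
    (S.encBits κ K x).length = S.E.m κ := Bits.length_ofNat _ _

theorem challenger_eq {m i : ℕ} {z : List Bool} {s s' : State} (h : s.log = s'.log) :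
    challenger m z i s = challenger m z i s' := by
  unfold challenger; rw [h]

/-- The machine as an adversary in the IND-CPA game. -/
theorem exists_adversary (A : Setup S) :
    ∃ (c : Prog) (p : Polynomial ℕ), ∀ κ, 1 ≤ S.l κ → A.width κ ≤ p.eval κ ∧
      ∀ (K : S.E.Key κ) (ν : Bool) (τ : Tape (p.eval κ)) (W : List Bool),
        W = (List.range (A.width κ)).map τ.coin →
        A.chunk κ W (A.index κ W) ∉ (A.final κ (A.secret κ W) (A.tape κ W)
          fun _ => S.encBits κ K).log.map Prod.fst →
        (S.E.GuessOne c (p.eval κ) κ K ν τ ↔ A.Accepts κ (A.secret κ W) (A.tape κ W)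
          (gameSrc κ K (A.chunk κ W) (A.index κ W) ν)) := by
  obtain ⟨c, p, h⟩ := A.exists_prog true (fin := fun c => c.verdict (A.par c)) fp_verdict
  refine ⟨c, p, fun κ hκ => ⟨(h κ hκ).1, ?_⟩⟩
  intro K ν τ W hW hfresh
  set X₀ := A.secret κ W with hX₀
  set a := A.tape κ W with ha
  set i := A.index κ W with hi
  set y := A.chunk κ W with hy
  set src := gameSrc κ K y i ν with hsrc
  have hylen : ∀ k, (y k).length = S.E.m κ := fun k => by simp [hy, chunk]
  have hlen : ∀ k x, (src k x).length = S.E.m κ := fun k x => by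
    simp only [hsrc, gameSrc]
    split_ifs
    · exact length_encBits _
    · exact length_encBits _
    · exact length_encBits _
    · exact hylen k
  set s : ℕ → State := fun j => run (A.params κ X₀) src (A.start κ X₀ a) j with hs
  have hinv : ∀ j, Inv (A.params κ X₀) (s j) := fun j => inv_start.run params_valid hlen j
  have hcl : ∀ j, (s j).cnt = (s j).log.length := fun j => cnt_eq_length rfl j
  have huses : A.uses true κ W = i + 1 := rfl
  have hstep : ∀ j, s (j + 1) = step (A.params κ X₀) src (s j) := fun j => run_succ j
  have hans : ∀ j, (s j).tag = .walk → (s j).cnt < A.Q κ →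
      (s (j + 1)).log = ((s j).x, (A.params κ X₀).predict (s j).th.store) :: (s j).log := by
    intro j h1 h2
    have h2' : (s j).cnt < (A.params κ X₀).Q := h2
    rw [hstep]
    simp only [step, h1, h2', if_true]
    exact answer_log _
  have hrun := (h κ hκ).2 (BlockCipher.cpaOracle (S.E.enc κ K) ν) τ.coin W src s
    (fun j => challenger (S.E.m κ) (y i) i (s j)) hW (fun j => rfl) hlen (fun k x hk => ?_)
    fun j hj => ⟨fun hn => ?_, fun h1 h2 h3 => ?_⟩
  · have hq0 : challenger (S.E.m κ) (y i) i (s 0) = ⟨∅, none⟩ := by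
      have h0 : (s 0).log = [] := rfl
      simp [challenger, h0]
    rw [hq0] at hrun
    obtain ⟨t, s', hex, ht, hout, hq⟩ := hrun
    constructor
    · rintro ⟨q', t₂, s₂, hex₂, -, hout₂, -⟩
      obtain ⟨-, rfl⟩ := hex.deterministic (BlockCipher.cpaOracle_functional _ _) hex₂
      rw [hout] at hout₂
      exact (@decide_eq_true_iff _ (Classical.propDecidable _)).1 (ofBool_injective hout₂)
    · intro hacc
      refine ⟨s'.oracle, t, s', hex, ht, ?_, rfl⟩
      rw [hout]
      exact congrArg ofBool ((@decide_eq_true_iff _ (Classical.propDecidable _)).2 hacc)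
  · rw [huses] at hk
    simp only [hsrc, gameSrc]
    rw [if_neg (by omega), if_neg (by omega)]
    rfl
  -- Here no query is made. After the challenge the log still grows, but the state of the challenger
  -- reads only its oldest `i + 1` entries.
  · rcases step_cnt_log (P := A.params κ X₀) (src := src) (src' := src) (s := s j) with
      ⟨h1, h2, h3⟩ | ⟨-, h2, -⟩
    · have h4 : i + 1 ≤ (s j).cnt := by
        by_contra h4
        exact hn ⟨h1, h2, by rw [huses]; omega⟩
      have hl := hans j h1 h2
      have h5 : i < (s j).log.reverse.length := by rw [List.length_reverse, ← hcl]; omega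
      unfold challenger
      rw [hl, List.reverse_cons, List.take_append_of_le_length h5.le, List.getElem?_append_left h5]
    · exact challenger_eq (by rw [hstep]; exact h2)
  · rw [huses] at h3
    obtain ⟨hx, hxl, -⟩ := (hinv j).walk h1
    replace hxl : (s j).x.length = S.E.m κ := hxl
    have hl := hans j h1 h2
    have h5 : (s j).log.reverse.length = (s j).cnt := by rw [List.length_reverse, ← hcl]
    have hidx : (A.snap κ X₀ (A.pool κ W) (A.uses true κ W) (s j)).idx = i + 1 - (s j).cnt := rfl
    have hch : (challenger (S.E.m κ) (y i) i (s j)).challenge = none := by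
      simp only [challenger]
      rw [List.getElem?_eq_none (by omega)]; rfl
    have htake : (s j).log.reverse.take i = (s j).log.reverse := List.take_of_length_le (by omega)
    have hreq : (A.snap κ X₀ (A.pool κ W) (A.uses true κ W) (s j)).request (A.params κ X₀) =
        if (s j).cnt = i then .cons (ofBool true) (.cons (ofBits (y i)) (ofBits (s j).x))
        else .cons (ofBool false) (ofBits (s j).x) := by
      unfold Snapshot.request
      rw [if_pos ⟨h1, h2, by rw [hidx]; omega⟩, hidx]
      by_cases hc : (s j).cnt = i
      · rw [if_pos hc, if_pos (by omega)]
        rw [hy, chunk, ← hc]; rfl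
      · rw [if_neg hc, if_neg (by omega)]; rfl
    rw [hreq, ← block_toBlock hxl]
    by_cases hc : (s j).cnt = i
    · rw [if_pos hc, ← block_toBlock (hylen i)]
      -- Up to the challenge the run coincides with the real one, so `hfresh` makes the random
      -- plaintext admissible; the other plaintext is new by the invariant.
      have hreal : s j = run (A.params κ X₀) (fun _ => S.encBits κ K) (A.start κ X₀ a) j := by
        refine (run_eq_or (i := i) (src := src) (src' := fun _ => S.encBits κ K)
          (fun k x hk => ?_) j).resolve_right fun h => ?_
        · simp only [hsrc, gameSrc, if_pos hk]
        · exact absurd h.1 (by show ¬ i < (s j).cnt; omega)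
      have hsuf : (s j).log.map Prod.fst ⊆ (A.final κ X₀ a fun _ => S.encBits κ K).log.map
          Prod.fst := by
        rw [hreal]
        exact ((log_suffix_run hj.le).map _).subset
      have hans : ofBits (src (s j).cnt (s j).x) = BlockCipher.block (S.E.enc κ K
          (if ν then toBlock _ (s j).x else toBlock _ (y i))) := by
        simp only [hsrc, gameSrc]
        rw [if_neg (by omega), if_pos hc, hc]
        cases ν <;> rfl
      rw [hans]
      have hnew : challenger (S.E.m κ) (y i) i (s (j + 1)) =
          ⟨(challenger (S.E.m κ) (y i) i (s j)).asked,
            some (toBlock _ (y i), toBlock _ (s j).x)⟩ := by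
        unfold challenger
        rw [hl, List.reverse_cons, List.take_append_of_le_length (by omega),
          List.getElem?_append_right (by omega), h5, hc]
        simp
      rw [hnew]
      refine .challenge _ _ _ hch (fun hmem => ?_) fun hmem => ?_
      · simp only [challenger, Set.mem_ofPred_eq, htake, ofNat_toBlock (hylen i)] at hmem
        exact hfresh (hsuf (by simpa using hmem))
      · simp only [challenger, Set.mem_ofPred_eq, htake, ofNat_toBlock hxl] at hmem
        exact hx (by simpa using hmem)
    · rw [if_neg hc]
      have hans : ofBits (src (s j).cnt (s j).x) =
          BlockCipher.block (S.E.enc κ K (toBlock _ (s j).x)) := by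
        simp only [hsrc, gameSrc]
        rw [if_pos (by omega)]
        rfl
      rw [hans]
      have hnew : challenger (S.E.m κ) (y i) i (s (j + 1)) =
          ⟨insert (toBlock _ (s j).x) (challenger (S.E.m κ) (y i) i (s j)).asked,
            (challenger (S.E.m κ) (y i) i (s j)).challenge⟩ := by
        rw [hch]
        unfold challenger
        rw [htake, hl, List.reverse_cons, List.take_of_length_le (by rw [List.length_append]; simp only [List.length_singleton]; omega),
          List.getElem?_eq_none (by rw [List.length_append]; simp only [List.length_singleton]; omega)]
        simp only [Option.map_none, BlockCipher.CPAState.mk.injEq, and_true]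
        ext b
        simp only [List.map_append, List.mem_append, Set.mem_ofPred_eq, Set.mem_insert_iff,
          List.map_cons, List.map_nil, List.mem_singleton]
        have : Bits.ofNat (S.E.m κ) b.toNat = (s j).x ↔ b = toBlock _ (s j).x :=
          ⟨fun h => by rw [← h, toBlock_ofNat], fun h => by rw [h, ofNat_toBlock hxl]⟩
        rw [this]; tauto
      rw [hnew]
      exact .encrypt _ _ fun y₀ y₁ h => by rw [hch] at h; cases h

/-- The machine without an oracle, as a program that finds collisions. -/
theorem exists_finder (A : Setup S) :
    ∃ (c : Prog) (p : Polynomial ℕ), ∀ κ, 1 ≤ S.l κ → A.width κ ≤ p.eval κ ∧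
      ∀ (τ : Tape (p.eval κ)) (W : List Bool), W = (List.range (A.width κ)).map τ.coin →
        (A.final κ (A.secret κ W) (A.tape κ W) fun k _ => A.chunk κ W k).tag = .coll →
        ∃ (X₁ X₂ : NumCode (S.l κ)) (u₁ u₂ : AddInput),
          (X₁, u₁) ≠ (X₂, u₂) ∧ S.f κ u₁ X₁ = S.f κ u₂ X₂ ∧
          RunsTo noOracle τ.coin c (.unary κ) () (p.eval κ)
            (.cons (.cons X₁.data (.ofBits u₁)) (.cons X₂.data (.ofBits u₂))) () := by
  obtain ⟨c, p, h⟩ := A.exists_prog false (fin := Snapshot.pairs) fp_pairs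
  refine ⟨c, p, fun κ hκ => ⟨(h κ hκ).1, ?_⟩⟩
  intro τ W hW hcoll
  have hylen : ∀ k, (A.chunk κ W k).length = S.E.m κ := fun k => by simp [chunk]
  have hrun := (h κ hκ).2 noOracle τ.coin W (fun k _ => A.chunk κ W k) _ (fun _ => ()) hW
    (fun j => rfl) (fun k _ => hylen k) (fun k x _ => rfl)
    fun j _ => ⟨fun _ => rfl, fun _ _ h3 => absurd h3 (Nat.not_lt_zero _)⟩
  have hinv : Inv (A.params κ (A.secret κ W)) (A.final κ (A.secret κ W) (A.tape κ W)
      fun k _ => A.chunk κ W k) := inv_start.run params_valid (fun k _ => hylen k) _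
  obtain ⟨h1, h2, h3⟩ := hinv.fb_eq hcoll
  change RunsTo _ _ _ _ _ _ (Snapshot.pairs (A.snap κ (A.secret κ W) (A.pool κ W)
    (A.uses false κ W) (A.final κ (A.secret κ W) (A.tape κ W) fun k _ => A.chunk κ W k))) _ at hrun
  generalize A.final κ (A.secret κ W) (A.tape κ W) (fun k _ => A.chunk κ W k) = s at *
  have hX : Bits.val s.X < 10 ^ S.l κ := h1.2
  have hd : NumCode.data (⟨Bits.val s.X, hX⟩ : NumCode (S.l κ)) = ofBits s.X := by
    have : s.X.length = codeBits (S.l κ) := h1.1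
    rw [data_eq_ofBits, bits, ← this, Bits.ofNat_val]
  refine ⟨⟨Bits.val s.X, hX⟩, ⟨Bits.val s.X, hX⟩, s.u, s.u', ?_, ?_, ?_⟩
  · rintro h; exact h2 (Prod.ext_iff.1 h).2.symm
  · simp only [Setup.params, TokenScheme.params, hX, dif_pos] at h3
    have := congrArg (toBlock (S.E.m κ - codeBits (S.l κ))) h3
    rwa [toBlock_ofNat, toBlock_ofNat] at this
  · rw [hd]; exact hrun

end Setup

end Tokenizer


/-! ### Uniform probabilities -/

section Uprob

variable {α β γ : Type}

theorem uprob_nonneg (s : Set α) : 0 ≤ uprob s := by unfold uprob; positivity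

theorem uprob_mono [Finite α] {s t : Set α} (h : s ⊆ t) : uprob s ≤ uprob t := by
  unfold uprob
  gcongr
  exact t.toFinite

theorem uprob_union_le [Finite α] (s t : Set α) : uprob (s ∪ t) ≤ uprob s + uprob t := by
  unfold uprob
  rw [← add_div]
  gcongr
  exact_mod_cast Set.ncard_union_le s t

theorem uprob_iUnion_le [Finite α] {k : ℕ} (s : Fin k → Set α) {ε : ℝ} (h : ∀ i, uprob (s i) ≤ ε) :
    uprob (⋃ i, s i) ≤ k * ε := by
  refine le_trans ?_ ((Finset.sum_le_sum (s := Finset.univ) fun i _ => h i).trans_eq (by simp))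
  unfold uprob
  rw [← Finset.sum_div]
  gcongr
  have := Finset.set_ncard_biUnion_le Finset.univ s
  simp only [Finset.mem_univ, Set.iUnion_true] at this
  exact_mod_cast this

theorem uprob_le_add_of_imp [Finite α] {s t u : Set α} (h : ∀ a ∈ s, a ∉ u → a ∈ t) :
    uprob s ≤ uprob t + uprob u :=
  (uprob_mono fun a ha => by
    by_cases hu : a ∈ u
    · exact .inr hu
    · exact .inl (h a ha hu)).trans (uprob_union_le t u)

/-- Maps that preserve the uniform distribution. -/
def PreservesUprob (φ : α → β) : Prop := ∀ s, uprob (φ ⁻¹' s) = uprob s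

namespace PreservesUprob

theorem comp {φ : α → β} {ψ : β → γ} (h' : PreservesUprob ψ) (h : PreservesUprob φ) :
    PreservesUprob (ψ ∘ φ) := fun s => by rw [Set.preimage_comp, h, h']

theorem equiv (e : α ≃ β) : PreservesUprob e := fun s => by
  unfold uprob
  rw [← e.image_symm_eq_preimage, Set.ncard_image_of_injective _ e.symm.injective,
    Nat.card_congr e]

theorem fst [Finite β] [Nonempty β] : PreservesUprob (Prod.fst : α × β → α) := fun s => by
  have : (Prod.fst ⁻¹' s : Set (α × β)) = s ×ˢ Set.univ := by ext; simp
  have h0 : (Nat.card β : ℝ) ≠ 0 := by simp [Nat.card_pos.ne']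
  unfold uprob
  rw [this, Set.ncard_prod, Set.ncard_univ, Nat.card_prod]
  push_cast
  rw [mul_div_mul_right _ _ h0]

theorem snd [Finite α] [Nonempty α] : PreservesUprob (Prod.snd : α × β → β) := by
  have h : PreservesUprob (Prod.fst ∘ Equiv.prodComm α β) := fst.comp (equiv _)
  exact h

/-- Restriction along an injective map. -/
theorem restrict [Finite β] {ι : α → β} (h : Function.Injective ι) :
    PreservesUprob fun (g : β → Bool) a => g (ι a) := by
  classical
  obtain ⟨e₁, he₁⟩ : ∃ e : (β → Bool) ≃
      ({b // b ∈ Set.range ι} → Bool) × ({b // b ∉ Set.range ι} → Bool),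
      ∀ g b, (e g).1 b = g b :=
    ⟨Equiv.piEquivPiSubtypeProd (· ∈ Set.range ι) fun _ => Bool, fun _ _ => rfl⟩
  obtain ⟨e₂, he₂⟩ : ∃ e : ({b // b ∈ Set.range ι} → Bool) ≃ (α → Bool),
      ∀ g a, e g a = g ⟨ι a, a, rfl⟩ :=
    ⟨(Equiv.ofInjective ι h).symm.arrowCongr (Equiv.refl Bool), fun _ _ => rfl⟩
  have h₁ : PreservesUprob (Prod.fst ∘ e₁) := fst.comp (equiv e₁)
  have h₂ : PreservesUprob (e₂ ∘ Prod.fst ∘ e₁) := (equiv e₂).comp h₁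
  have h₃ : e₂ ∘ Prod.fst ∘ e₁ = fun (g : β → Bool) a => g (ι a) := by
    funext g a
    simp [he₁, he₂]
  rwa [h₃] at h₂

/-- Replacing one coordinate. -/
theorem update {k : ℕ} (i : Fin k) [Finite α] [Nonempty α] :
    PreservesUprob fun p : (Fin k → α) × α => Function.update p.1 i p.2 := by
  -- Exchanging coordinate `i` with the additional value is an involution on pairs, and the map in
  -- question is its first component.
  have h : Function.Involutive fun p : (Fin k → α) × α => (Function.update p.1 i p.2, p.1 i) :=
    fun p => by simp
  have h' : PreservesUprob (Prod.fst ∘ h.toPerm) := fst.comp (equiv _)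
  intro s
  rw [← h' s]
  rfl

end PreservesUprob

theorem uprob_prod [Fintype α] [Finite β] (P : α × β → Prop) :
    uprob {w | P w} = (∑ a, uprob {b | P (a, b)}) / Fintype.card α := by
  have h : Nat.card {w // P w} = ∑ a, Nat.card {b // P (a, b)} := by
    rw [Nat.card_congr (Equiv.subtypeProdEquivSigmaSubtype fun a b => P (a, b)), Nat.card_sigma]
  unfold uprob
  rw [← Finset.sum_div, div_div, Nat.card_prod, Nat.card_eq_fintype_card (α := α)]
  simp only [← Nat.card_coe_set_eq]
  congr 1
  · exact_mod_cast h
  · push_cast; ring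

theorem uprob_prod_le [Finite α] [Nonempty α] [Finite β] {P : α × β → Prop} {ε : ℝ}
    (h : ∀ a, uprob {b | P (a, b)} ≤ ε) : uprob {w | P w} ≤ ε := by
  have := Fintype.ofFinite α
  rw [uprob_prod, div_le_iff₀ (by exact_mod_cast Fintype.card_pos)]
  exact (Finset.sum_le_sum fun a _ => h a).trans_eq (by simp [mul_comm])

theorem uprob_prod_congr [Finite α] [Finite β] [Finite γ] {P : α × β → Prop} {P' : α × γ → Prop}
    (h : ∀ a, uprob {b | P (a, b)} = uprob {b | P' (a, b)}) : uprob {w | P w} = uprob {w | P' w} := by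
  have := Fintype.ofFinite α
  rw [uprob_prod, uprob_prod, Finset.sum_congr rfl fun a _ => h a]

theorem uprob_prod_mono [Finite α] [Finite β] [Finite γ] {P : α × β → Prop} {P' : α × γ → Prop} {c : ℝ}
    (h : ∀ a, uprob {b | P (a, b)} ≤ c * uprob {b | P' (a, b)}) :
    uprob {w | P w} ≤ c * uprob {w | P' w} := by
  have := Fintype.ofFinite α
  rw [uprob_prod, uprob_prod, ← mul_div_assoc, Finset.mul_sum]
  gcongr with a
  exact h a

/-- Resampling one coordinate preserves the uniform distribution, so an estimate with all other
coordinates fixed is enough. -/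
theorem uprob_update_le {k : ℕ} (i : Fin k) [Finite α] [Nonempty α] {P : (Fin k → α) → Prop} {ε : ℝ}
    (h : ∀ g, uprob {a | P (Function.update g i a)} ≤ ε) : uprob {g | P g} ≤ ε := by
  rw [← PreservesUprob.update i]
  exact uprob_prod_le h

theorem uprob_pi {k : ℕ} [Finite α] [Nonempty α] (s : Set α) (I : Finset (Fin k)) :
    uprob {g : Fin k → α | ∀ i ∈ I, g i ∈ s} = uprob s ^ I.card := by
  classical
  have := Fintype.ofFinite α
  have h : {g : Fin k → α | ∀ i ∈ I, g i ∈ s} =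
      Fintype.piFinset fun i => if i ∈ I then s.toFinset else Finset.univ := by
    ext g
    simp only [Set.mem_ofPred_eq, Finset.mem_coe, Fintype.mem_piFinset]
    refine forall_congr' fun i => ?_
    by_cases hi : i ∈ I <;> simp [hi]
  have h0 : (Fintype.card α : ℝ) ≠ 0 := by exact_mod_cast Fintype.card_ne_zero
  unfold uprob
  rw [h, Set.ncard_coe_finset, Fintype.card_piFinset, Nat.card_eq_fintype_card,
    Nat.card_eq_fintype_card, Fintype.card_fun, Fintype.card_fin, Set.ncard_eq_toFinset_card']
  have h1 : ∀ i, (if i ∈ I then s.toFinset else Finset.univ).card =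
      if i ∈ I then s.toFinset.card else Fintype.card α := fun i => by
    split_ifs <;> rfl
  rw [Finset.prod_congr rfl fun i _ => h1 i, Finset.prod_ite, Finset.prod_const, Finset.prod_const]
  have h2 : (Finset.univ.filter (· ∈ I)) = I := by ext; simp
  have h3 : (Finset.univ.filter (· ∉ I)).card + I.card = k := by
    have := Finset.card_filter_add_card_filter_not (s := (Finset.univ : Finset (Fin k))) (· ∈ I)
    rw [h2, Finset.card_univ, Fintype.card_fin] at this
    omega
  rw [h2]
  have h4 : (Fintype.card α : ℝ) ^ k = Fintype.card α ^ (Finset.univ.filter (· ∉ I)).card *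
      (Fintype.card α : ℝ) ^ I.card := by rw [← pow_add, h3]
  push_cast
  rw [h4, div_pow, mul_comm, mul_div_mul_left _ _ (pow_ne_zero _ h0)]

end Uprob

section Tape

/-- Tapes as numbers. -/
noncomputable def Tape.equivFin (N : ℕ) : Tape N ≃ Fin (2 ^ N) :=
  Equiv.ofBijective (fun τ => ⟨Bits.val (List.ofFn τ), by
      simpa using Bits.val_lt (List.ofFn τ)⟩)
    ((Fintype.bijective_iff_injective_and_card _).2 ⟨fun τ τ' h => List.ofFn_injective
      (Bits.val_injective (by simp) (Fin.mk.inj h)), by simp⟩)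

theorem Tape.val_equivFin {N : ℕ} (τ : Tape N) :
    (Tape.equivFin N τ : ℕ) = Bits.val (List.ofFn τ) := rfl

theorem uprob_ofFn_mem_le (N : ℕ) (G : List (List Bool)) :
    uprob {τ : Tape N | List.ofFn τ ∈ G} ≤ G.length / 2 ^ N := by
  unfold uprob
  have h : {τ : Tape N | List.ofFn τ ∈ G}.ncard ≤ G.length := by
    refine le_trans ?_ (List.toFinset_card_le G)
    rw [← Set.ncard_coe_finset]
    exact Set.ncard_le_ncard_of_injOn List.ofFn (fun τ h => by simpa using h)
      (List.ofFn_injective.injOn) (Finset.finite_toSet _)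
  rw [Nat.card_eq_fintype_card, Fintype.card_fun, Fintype.card_fin, Fintype.card_bool]
  push_cast
  gcongr

theorem preservesUprob_take {n N : ℕ} (h : n ≤ N) :
    PreservesUprob fun (τ : Tape N) (i : Fin n) => τ (Fin.castLE h i) :=
  .restrict (Fin.castLE_injective h)

theorem ofFn_castLE {n N : ℕ} (h : n ≤ N) (τ : Tape N) :
    List.ofFn (fun i : Fin n => τ (Fin.castLE h i)) = (List.ofFn τ).take n := by
  refine List.ext_getElem (by simp [h]) fun i h1 h2 => ?_
  simp

theorem uprob_take_mem_le {n N : ℕ} (h : n ≤ N) (G : List (List Bool)) :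
    uprob {τ : Tape N | (List.ofFn τ).take n ∈ G} ≤ G.length / 2 ^ n := by
  simp only [← ofFn_castLE h]
  exact (preservesUprob_take h {τ | List.ofFn τ ∈ G}).trans_le (uprob_ofFn_mem_le n G)

theorem uprob_le_val_take {n N t : ℕ} (h : n ≤ N) (ht : t ≤ 2 ^ n) :
    uprob {τ : Tape N | ¬ Bits.val ((List.ofFn τ).take n) < t} = 1 - t / 2 ^ n := by
  simp only [← ofFn_castLE h]
  refine (preservesUprob_take h {τ | ¬ Bits.val (List.ofFn τ) < t}).trans ?_
  refine (PreservesUprob.equiv (Tape.equivFin n) {i | ¬ (i : ℕ) < t}).trans ?_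
  have h1 : {i : Fin (2 ^ n) | ¬ (i : ℕ) < t}.ncard = 2 ^ n - t := by
    rw [Set.ncard_eq_toFinset_card']
    simp only [Set.toFinset_ofPred, not_lt]
    have := Fin.card_filter_val_lt (n := 2 ^ n) (m := t)
    have h2 := Finset.card_filter_add_card_filter_not (s := (Finset.univ : Finset (Fin (2 ^ n))))
      (fun i => (i : ℕ) < t)
    simp only [not_lt, Finset.card_univ, Fintype.card_fin] at h2
    rw [this] at h2
    omega
  unfold uprob
  rw [h1, Nat.card_eq_fintype_card, Fintype.card_fin, Nat.cast_sub ht, sub_div]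
  push_cast
  rw [div_self (by positivity)]

end Tape


/-! ### Random tapes for the machine -/

section Tape

open Bits

theorem Bits.padTake_drop_map_range {ω : ℕ → Bool} {w a k : ℕ} (h : a + k ≤ w) :
    padTake k (((List.range w).map ω).drop a) = List.ofFn fun i : Fin k => ω (a + i) := by
  rw [padTake_eq_take (by simp; omega)]
  refine List.ext_getElem (by simp; omega) fun i h1 h2 => ?_
  simp

theorem Bits.padTake_drop_of_le {l : List Bool} {a k : ℕ} (h : l.length ≤ a) :
    padTake k (l.drop a) = List.replicate k false := by
  rw [List.drop_eq_nil_of_le h, padTake_nil]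

theorem PreservesUprob.prodMap {α β γ : Type} [Finite α] [Finite β] [Finite γ] {φ : β → γ}
    (h : PreservesUprob φ) : PreservesUprob fun p : α × β => (p.1, φ p.2) := fun s =>
  uprob_prod_congr (P := fun w : α × β => (w.1, φ w.2) ∈ s) (P' := fun w : α × γ => w ∈ s)
    fun a => h {b | (a, b) ∈ s}

/-- A tape, cut into pieces. -/
theorem Tape.exists_split {c n b Q m p : ℕ} (h : c + n + b + m * Q ≤ p) :
    ∃ φ : Tape p → Tape b × Tape c × Tape n × (Fin Q → Tape m), PreservesUprob φ ∧
      ∀ τ, (∀ i, (φ τ).1 i = τ.coin (c + n + i)) ∧ (∀ i, (φ τ).2.1 i = τ.coin (0 + i)) ∧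
        (∀ i, (φ τ).2.2.1 i = τ.coin (c + i)) ∧
        ∀ k j, (φ τ).2.2.2 k j = τ.coin (c + n + b + m * k + j) := by
  have hk : ∀ (k : Fin Q) (j : Fin m), m * k + j < m * Q := fun k j =>
    calc m * k + j < m * k + m := by omega
      _ = m * (k + 1) := by ring
      _ ≤ m * Q := Nat.mul_le_mul_left _ k.isLt
  -- The tape contains the coins of the attacker, the hidden code, the index and the pool, in this
  -- order. The pieces occupy disjoint positions and are therefore independent.
  let pos : Fin b ⊕ Fin c ⊕ Fin n ⊕ Fin Q × Fin m → ℕ := Sum.elim (fun i => c + n + i)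
    (Sum.elim (fun i => i) (Sum.elim (fun i => c + i) fun k => c + n + b + (m * k.1 + k.2)))
  have hpos : ∀ x, pos x < p := by
    rintro (i | i | i | ⟨k, j⟩)
    · simp only [pos, Sum.elim_inl]; omega
    · simp only [pos, Sum.elim_inl, Sum.elim_inr]; omega
    · simp only [pos, Sum.elim_inl, Sum.elim_inr]; omega
    · have := hk k j
      simp only [pos, Sum.elim_inr]; omega
  have hinj : Function.Injective pos := by
    rintro (i | i | i | ⟨k, j⟩) (i' | i' | i' | ⟨k', j'⟩) h <;>
      simp only [pos, Sum.elim_inl, Sum.elim_inr] at h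
    · exact congrArg _ (Fin.ext (by omega))
    · omega
    · omega
    · omega
    · omega
    · exact congrArg (fun z => Sum.inr (Sum.inl z)) (Fin.ext (by omega))
    · omega
    · omega
    · omega
    · omega
    · exact congrArg (fun z => Sum.inr (Sum.inr (Sum.inl z))) (Fin.ext (by omega))
    · omega
    · omega
    · omega
    · omega
    · have h : m * k + j = m * k' + j' := by omega
      have h1 : (j : ℕ) = j' := by
        have := congrArg (· % m) h
        simpa [Nat.mul_add_mod, Nat.mod_eq_of_lt] using this
      have h2 : (k : ℕ) = k' := Nat.eq_of_mul_eq_mul_left (j.pos) (by omega)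
      rw [Fin.ext h1, Fin.ext h2]
  obtain ⟨e, he⟩ : ∃ e : (Fin b ⊕ Fin c ⊕ Fin n ⊕ Fin Q × Fin m → Bool) ≃
      Tape b × Tape c × Tape n × (Fin Q → Tape m),
      ∀ g, e g = (fun i => g (.inl i), fun i => g (.inr (.inl i)), fun i => g (.inr (.inr (.inl i))),
        fun k j => g (.inr (.inr (.inr (k, j))))) :=
    ⟨(Equiv.sumArrowEquivProdArrow _ _ _).trans (Equiv.prodCongr (Equiv.refl _)
      ((Equiv.sumArrowEquivProdArrow _ _ _).trans (Equiv.prodCongr (Equiv.refl _)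
        ((Equiv.sumArrowEquivProdArrow _ _ _).trans (Equiv.prodCongr (Equiv.refl _)
          (Equiv.curry _ _ _)))))), fun _ => rfl⟩
  have hres : PreservesUprob fun (τ : Tape p) x => τ ⟨pos x, hpos x⟩ :=
    .restrict fun x y h => hinj (Fin.mk.inj h)
  refine ⟨_, (PreservesUprob.equiv e).comp hres, fun τ => ?_⟩
  have hcoin : ∀ x, τ ⟨pos x, hpos x⟩ = τ.coin (pos x) := fun x => by
    rw [Tape.coin, dif_pos (hpos x)]
  simp only [Function.comp, he, hcoin]
  refine ⟨fun _ => rfl, fun i => ?_, fun _ => rfl, fun k j => ?_⟩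
  · rw [zero_add]; rfl
  · rw [add_assoc]; rfl

end Tape

namespace Tokenizer

open Data TokenScheme

/-- Blocks from a list, as bits. -/
def poolOf {Q m : ℕ} (Y : Fin Q → Tape m) (k : ℕ) : List Bool :=
  if h : k < Q then List.ofFn (Y ⟨k, h⟩) else List.replicate m false

theorem length_poolOf {Q m : ℕ} (Y : Fin Q → Tape m) (k : ℕ) : (poolOf Y k).length = m := by
  unfold poolOf; split_ifs <;> simp

theorem poolOf_update {Q m : ℕ} (Y : Fin Q → Tape m) (i : Fin Q) (t : Tape m) (k : ℕ) :
    poolOf (Function.update Y i t) k = if k = i then List.ofFn t else poolOf Y k := by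
  unfold poolOf
  by_cases hk : k < Q
  · rw [dif_pos hk, dif_pos hk]
    by_cases h : k = i
    · subst h; simp
    · rw [if_neg h, Function.update_of_ne fun h' => h (Fin.ext_iff.1 h')]
  · rw [dif_neg hk, dif_neg hk, if_neg (by omega)]

/-- Tapes as blocks. -/
noncomputable def tapeBlock (m : ℕ) : Tape m ≃ BitVec m :=
  (Tape.equivFin m).trans ⟨BitVec.ofFin, BitVec.toFin, fun _ => rfl, fun _ => rfl⟩

theorem ofNat_tapeBlock {m : ℕ} (t : Tape m) : Bits.ofNat m (tapeBlock m t).toNat = List.ofFn t := by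
  have h := Bits.ofNat_val (List.ofFn t)
  rwa [List.length_ofFn] at h

variable {S : TokenScheme}

/-- Encryption of tapes. -/
noncomputable def encTape (κ : ℕ) (K : S.E.Key κ) : Tape (S.E.m κ) ≃ Tape (S.E.m κ) :=
  (tapeBlock _).trans ((S.E.enc κ K).trans (tapeBlock _).symm)

theorem ofFn_encTape {κ : ℕ} (K : S.E.Key κ) (t : Tape (S.E.m κ)) :
    List.ofFn (encTape κ K t) = S.encBits κ K (List.ofFn t) := by
  rw [← ofNat_tapeBlock, encTape, Equiv.trans_apply, Equiv.trans_apply, Equiv.apply_symm_apply,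
    ← ofNat_tapeBlock t, encBits_block]

end Tokenizer


/-! ### The hybrid argument -/

theorem uprob_compl {α : Type} [Finite α] [Nonempty α] (P : α → Prop) :
    uprob {a | ¬ P a} = 1 - uprob {a | P a} := by
  have h0 : (Nat.card α : ℝ) ≠ 0 := by simp [Nat.card_pos.ne']
  have := Set.ncard_add_ncard_compl {a | P a}
  unfold uprob
  rw [eq_sub_iff_add_eq, ← add_div, div_eq_one_iff_eq h0, add_comm]
  exact_mod_cast this

/-- Averaging over the hidden bit, the guess is right with probability `(x + (1 - y)) / 2`, where
`x` and `y` are the probabilities of the guess `1` for the bits `1` and `0`. -/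
theorem BlockCipher.advantage_eq (E : BlockCipher) (c : Prog) (T κ : ℕ) :
    E.advantage c T κ = |uprob {v : E.Key κ × Tape T | E.GuessOne c T κ v.1 true v.2} -
      uprob {v : E.Key κ × Tape T | E.GuessOne c T κ v.1 false v.2}| / 2 := by
  have := E.key_finite κ
  have := E.key_nonempty κ
  let e : Bool × E.Key κ × Tape T ≃ E.Key κ × Bool × Tape T :=
    ⟨fun w => (w.2.1, w.1, w.2.2), fun w => (w.2.1, w.1, w.2.2), fun _ => rfl, fun _ => rfl⟩
  unfold advantage
  rw [← PreservesUprob.equiv e]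
  have h := uprob_prod (α := Bool) (β := E.Key κ × Tape T)
    fun w => E.GuessOne c T κ w.2.1 w.1 w.2.2 ↔ w.1 = true
  have h' : uprob (e ⁻¹' {w | E.GuessOne c T κ w.1 w.2.1 w.2.2 ↔ w.2.1 = true}) = _ := h
  rw [h']
  simp only [Fintype.sum_bool, iff_true, Bool.false_eq_true, iff_false, Fintype.card_bool]
  rw [uprob_compl fun v : E.Key κ × Tape T => E.GuessOne c T κ v.1 false v.2]
  rw [show ∀ x y : ℝ, (x + (1 - y)) / (2 : ℕ) - 1 / 2 = (x - y) / 2 by intros; push_cast; ring,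
    abs_div, abs_two]

namespace Tokenizer.Setup

open Data TokenScheme

variable {S : TokenScheme} (A : Setup S)

/-- The coins of the attacker, the hidden code, and random blocks. -/
abbrev Sample (κ : ℕ) : Type :=
  Tape (A.coins.eval κ) × Tape (codeBits (S.l κ)) × (Fin (A.Q κ) → Tape (S.E.m κ))

/-- Encryptions, from number `i` on replaced by given blocks. -/
def hybridSrc (κ : ℕ) (K : S.E.Key κ) (y : ℕ → List Bool) (i k : ℕ) (x : List Bool) : List Bool :=
  if k < i then S.encBits κ K x else y k

/-- The probability that the machine accepts, if the first `i` encryptions are real. -/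
noncomputable def hybrid (κ i : ℕ) : ℝ :=
  uprob {w : S.E.Key κ × A.Sample κ | A.Accepts κ (List.ofFn w.2.2.1) (List.ofFn w.2.1)
    (hybridSrc κ w.1 (poolOf w.2.2.2) i)}

/-- The probability that the machine accepts with real encryptions. -/
noncomputable def real (κ : ℕ) : ℝ :=
  uprob {w : S.E.Key κ × Tape (A.coins.eval κ) × Tape (codeBits (S.l κ)) |
    A.Accepts κ (List.ofFn w.2.2) (List.ofFn w.2.1) fun _ => S.encBits κ w.1}

variable {A}

theorem cnt_final_le {κ : ℕ} {X₀ a : List Bool} {src : ℕ → List Bool → List Bool} :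
    (A.final κ X₀ a src).cnt ≤ A.Q κ :=
  cnt_le_run (P := A.params κ X₀) (s := A.start κ X₀ a) (Nat.zero_le _) _

theorem length_log_final_le {κ : ℕ} {X₀ a : List Bool} {src : ℕ → List Bool → List Bool} :
    (A.final κ X₀ a src).log.length ≤ A.Q κ := by
  have h : (A.final κ X₀ a src).cnt = (A.final κ X₀ a src).log.length := cnt_eq_length rfl _
  rw [← h]; exact cnt_final_le

/-- The machine never uses more than `Q` ciphertexts, so a source that is real for the first `Q` of
them is real throughout the run. -/
theorem hybrid_Q (κ : ℕ) : A.hybrid κ (A.Q κ) = A.real κ := by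
  have := S.E.key_finite κ
  refine uprob_prod_congr fun K => uprob_prod_congr fun a => ?_
  refine Eq.trans ?_ (PreservesUprob.fst (β := Fin (A.Q κ) → Tape (S.E.m κ))
    {X | A.Accepts κ (List.ofFn X) (List.ofFn a) fun _ => S.encBits κ K})
  congr 1
  ext ⟨X, Y⟩
  have h : A.final κ (List.ofFn X) (List.ofFn a) (hybridSrc κ K (poolOf Y) (A.Q κ)) =
      A.final κ (List.ofFn X) (List.ofFn a) fun _ => S.encBits κ K := by
    refine (run_eq_or (i := A.Q κ) (fun k x hk => ?_) _).resolve_right fun h => ?_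
    · rw [hybridSrc, if_pos hk]
    · exact absurd h.1 (not_lt.2 cnt_final_le)
  show A.Accepts _ _ _ _ ↔ A.Accepts _ _ _ _
  rw [Accepts, Accepts, h]

/-- A random tape, cut into pieces. -/
theorem exists_sample (A : Setup S) {κ p : ℕ} (h : A.width κ ≤ p) :
    ∃ φ : Tape p → Tape (A.b κ) × A.Sample κ, PreservesUprob φ ∧ ∀ τ,
      ∃ W, W = (List.range (A.width κ)).map τ.coin ∧
      A.tape κ W = List.ofFn (φ τ).2.1 ∧ A.secret κ W = List.ofFn (φ τ).2.2.1 ∧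
      A.index κ W = Tape.equivFin _ (φ τ).1 ∧ A.chunk κ W = poolOf (φ τ).2.2.2 := by
  obtain ⟨φ, hφ, h'⟩ := Tape.exists_split h
  refine ⟨φ, hφ, fun τ => ⟨_, rfl, ?_, ?_, ?_, ?_⟩⟩
  · obtain ⟨-, h2, -⟩ := h' τ
    rw [tape, ← List.drop_zero (l := List.map _ _), Bits.padTake_drop_map_range
      (by unfold width; omega)]
    exact congrArg List.ofFn (funext fun i => (h2 i).symm)
  · obtain ⟨-, -, h3, -⟩ := h' τ
    rw [secret, Bits.padTake_drop_map_range (by unfold width; omega)]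
    exact congrArg List.ofFn (funext fun i => (h3 i).symm)
  · obtain ⟨h1, -⟩ := h' τ
    rw [index, Bits.padTake_drop_map_range (by unfold width; omega), Tape.val_equivFin]
    exact congrArg (fun g => Bits.val (List.ofFn g)) (funext fun i => (h1 i).symm)
  · obtain ⟨-, -, -, h4⟩ := h' τ
    funext k
    rw [chunk, pool, List.drop_drop, poolOf]
    split_ifs with hk
    · have : S.E.m κ * k + S.E.m κ ≤ S.E.m κ * A.Q κ :=
        calc S.E.m κ * k + S.E.m κ = S.E.m κ * (k + 1) := by ring
          _ ≤ _ := Nat.mul_le_mul_left _ hk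
      rw [Bits.padTake_drop_map_range (by unfold width; omega)]
      exact congrArg List.ofFn (funext fun i => (h4 ⟨k, hk⟩ i).symm)
    · have : S.E.m κ * A.Q κ ≤ S.E.m κ * k := Nat.mul_le_mul_left _ (not_lt.1 hk)
      exact Bits.padTake_drop_of_le (by simp [width]; omega)

theorem uprob_poolOf_mem_le {Q m i : ℕ} (hi : i < Q) (G : List (List Bool)) :
    uprob {Y : Fin Q → Tape m | poolOf Y i ∈ G} ≤ G.length / 2 ^ m :=
  uprob_update_le ⟨i, hi⟩ fun Y => by
    simp only [poolOf_update, if_true]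
    exact uprob_ofFn_mem_le _ _

/-- The samples for which the plaintext of the challenge is not admissible. -/
def breaking (A : Setup S) (κ : ℕ) : Set (S.E.Key κ × Tape (A.b κ) × A.Sample κ) :=
  {w | poolOf w.2.2.2.2 (Tape.equivFin _ w.2.1) ∈ (A.final κ (List.ofFn w.2.2.2.1)
    (List.ofFn w.2.2.1) fun _ => S.encBits κ w.1).log.map Prod.fst}

/-- The log of the real run does not involve the pool and has at most `Q` entries, while the chosen
block of the pool is uniform. -/
theorem uprob_breaking_le (κ : ℕ) : uprob (A.breaking κ) ≤ A.Q κ / 2 ^ S.E.m κ := by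
  have := S.E.key_finite κ
  have := S.E.key_nonempty κ
  have key : ∀ (K : S.E.Key κ) (b : Tape (A.b κ)) (a : Tape (A.coins.eval κ))
      (X : Tape (codeBits (S.l κ))), uprob {Y : Fin (A.Q κ) → Tape (S.E.m κ) |
        poolOf Y (Tape.equivFin _ b) ∈ (A.final κ (List.ofFn X) (List.ofFn a)
          fun _ => S.encBits κ K).log.map Prod.fst} ≤ A.Q κ / 2 ^ S.E.m κ := fun K b a X => by
    refine (uprob_poolOf_mem_le (Tape.equivFin (A.b κ) b).isLt _).trans ?_
    gcongr
    rw [List.length_map]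
    exact length_log_final_le
  exact uprob_prod_le fun K => uprob_prod_le fun b => uprob_prod_le fun a => uprob_prod_le fun X =>
    key K b a X

/-- The samples for which the machine accepts in the game. -/
def accepting (A : Setup S) (κ : ℕ) (ν : Bool) : Set (S.E.Key κ × Tape (A.b κ) × A.Sample κ) :=
  {w | A.Accepts κ (List.ofFn w.2.2.2.1) (List.ofFn w.2.2.1)
    (gameSrc κ w.1 (poolOf w.2.2.2.2) (Tape.equivFin _ w.2.1) ν)}

theorem gameSrc_true {κ : ℕ} {K : S.E.Key κ} {y : ℕ → List Bool} {i : ℕ} :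
    gameSrc κ K y i true = hybridSrc κ K y (i + 1) := by
  funext k x
  simp only [gameSrc, hybridSrc, if_true]
  split_ifs <;> first | rfl | omega

/-- Encryption permutes the blocks; applied to coordinate `i` of the pool it preserves the uniform
distribution, so the encrypted random block may be exchanged for a random block. -/
theorem uprob_gameSrc_false {κ : ℕ} (i : Fin (A.Q κ)) :
    uprob {w : S.E.Key κ × A.Sample κ | A.Accepts κ (List.ofFn w.2.2.1) (List.ofFn w.2.1)
      (gameSrc κ w.1 (poolOf w.2.2.2) i false)} = A.hybrid κ i := by
  have := S.E.key_finite κ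
  refine uprob_prod_congr fun K => uprob_prod_congr fun a => uprob_prod_congr fun X => ?_
  refine Eq.trans ?_ (PreservesUprob.equiv (Equiv.piCongrRight fun k =>
    if k = i then encTape κ K else Equiv.refl _)
    {Y | A.Accepts κ (List.ofFn X) (List.ofFn a) (hybridSrc κ K (poolOf Y) i)})
  congr 1
  ext Y
  have h : gameSrc κ K (poolOf Y) i false = hybridSrc κ K (poolOf (Equiv.piCongrRight (fun k =>
      if k = i then encTape κ K else Equiv.refl _) Y)) i := by
    funext k x
    simp only [gameSrc, hybridSrc]
    split_ifs with h1 h2 h3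
    · rfl
    · cases h3
    · subst h2
      simp [poolOf, ofFn_encTape]
    · unfold poolOf
      split_ifs with h4
      · have : (⟨k, h4⟩ : Fin (A.Q κ)) ≠ i := fun h => h2 (Fin.ext_iff.1 h)
        simp [this]
      · rfl
  show A.Accepts κ _ _ (gameSrc κ K (poolOf Y) i false) ↔ _
  rw [h]
  rfl

/-- `Q` is a power of two, so `b` coins give an exactly uniform index, and the game averages over
the hybrids. For `ν` true the challenge is one more real encryption, hence `i + 1`. -/
theorem uprob_accepting (κ : ℕ) (ν : Bool) : uprob (A.accepting κ ν) =
    (∑ i ∈ Finset.range (A.Q κ), A.hybrid κ (if ν then i + 1 else i)) / A.Q κ := by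
  have := S.E.key_finite κ
  let e : Tape (A.b κ) × S.E.Key κ × A.Sample κ ≃ S.E.Key κ × Tape (A.b κ) × A.Sample κ :=
    ⟨fun w => (w.2.1, w.1, w.2.2), fun w => (w.2.1, w.1, w.2.2), fun _ => rfl, fun _ => rfl⟩
  rw [← PreservesUprob.equiv e]
  have h := uprob_prod (α := Tape (A.b κ)) (β := S.E.Key κ × A.Sample κ)
    fun w => e w ∈ A.accepting κ ν
  have h' : uprob (e ⁻¹' A.accepting κ ν) = _ := h
  rw [h', ← Fin.sum_univ_eq_sum_range fun i => A.hybrid κ (if ν then i + 1 else i)]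
  congr 1
  · refine Fintype.sum_equiv (Tape.equivFin _) _ _ fun b => ?_
    cases ν
    · exact uprob_gameSrc_false (A := A) (Tape.equivFin _ b)
    · simp only [accepting, gameSrc_true]
      rfl
  · simp [Q]

/-- Real encryptions can be replaced by random blocks. -/
theorem exists_real_le (A : Setup S) :
    ∃ (c : Prog) (p : Polynomial ℕ), ∀ κ, 1 ≤ S.l κ → A.real κ ≤
      A.hybrid κ 0 + A.Q κ * (2 * S.E.advantage c (p.eval κ) κ + 2 * (A.Q κ / 2 ^ S.E.m κ)) := by
  obtain ⟨c, p, h⟩ := A.exists_adversary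
  refine ⟨c, p, fun κ hκ => ?_⟩
  have := S.E.key_finite κ
  have := S.E.key_nonempty κ
  obtain ⟨hw, h⟩ := h κ hκ
  obtain ⟨φ, hφ, hW⟩ := A.exists_sample hw
  have hφ' := hφ.prodMap (α := S.E.Key κ)
  have key : ∀ ν (v : S.E.Key κ × Tape (p.eval κ)), (v.1, φ v.2) ∉ A.breaking κ →
      (S.E.GuessOne c (p.eval κ) κ v.1 ν v.2 ↔ (v.1, φ v.2) ∈ A.accepting κ ν) := by
    rintro ν ⟨K, τ⟩ hfresh
    obtain ⟨W, hW, h1, h2, h3, h4⟩ := hW τ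
    have h := h K ν τ W hW
    rw [h1, h2, h3, h4] at h
    exact h hfresh
  have hb := uprob_breaking_le (A := A) κ
  rw [← hφ'] at hb
  -- Game and hybrid agree outside `breaking`, which is charged once for either value of the hidden
  -- bit.
  have h1 := uprob_le_add_of_imp (s := {v : S.E.Key κ × Tape (p.eval κ) | (v.1, φ v.2) ∈
    A.accepting κ true}) (t := {v | S.E.GuessOne c (p.eval κ) κ v.1 true v.2}) (u := {v | (v.1, φ v.2) ∈
    A.breaking κ}) fun v hv hv' => (key true v hv').2 hv
  have h2 := uprob_le_add_of_imp (s := {v : S.E.Key κ × Tape (p.eval κ) |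
    S.E.GuessOne c (p.eval κ) κ v.1 false v.2})
    (t := {v : S.E.Key κ × Tape (p.eval κ) | (v.1, φ v.2) ∈ A.accepting κ false})
    (u := {v | (v.1, φ v.2) ∈ A.breaking κ}) fun v hv hv' => (key false v hv').1 hv
  have e1 : uprob {v : S.E.Key κ × Tape (p.eval κ) | (v.1, φ v.2) ∈ A.accepting κ true} = _ :=
    (hφ' _).trans (uprob_accepting κ true)
  have e2 : uprob {v : S.E.Key κ × Tape (p.eval κ) | (v.1, φ v.2) ∈ A.accepting κ false} = _ :=
    (hφ' _).trans (uprob_accepting κ false)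
  rw [e1] at h1
  rw [e2] at h2
  simp only [if_true, Bool.false_eq_true, if_false] at h1 h2
  have hadv := S.E.advantage_eq c (p.eval κ) κ
  have habs := le_abs_self (uprob {v : S.E.Key κ × Tape (p.eval κ) |
    S.E.GuessOne c (p.eval κ) κ v.1 true v.2} -
      uprob {v : S.E.Key κ × Tape (p.eval κ) | S.E.GuessOne c (p.eval κ) κ v.1 false v.2})
  have hQ : (0 : ℝ) < A.Q κ := by simp [Q]
  -- The difference of the two averages telescopes to that of the extreme hybrids divided by `Q`;
  -- this is where the factor `Q` is lost.
  have htel := Finset.sum_range_sub (A.hybrid κ) (A.Q κ)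
  rw [Finset.sum_sub_distrib, hybrid_Q] at htel
  have hd : (∑ i ∈ Finset.range (A.Q κ), A.hybrid κ (i + 1)) / A.Q κ -
      (∑ i ∈ Finset.range (A.Q κ), A.hybrid κ i) / A.Q κ = (A.real κ - A.hybrid κ 0) / A.Q κ := by
    rw [← htel, sub_div]
  have : (A.real κ - A.hybrid κ 0) / A.Q κ ≤
      2 * S.E.advantage c (p.eval κ) κ + 2 * (A.Q κ / 2 ^ S.E.m κ) := by
    rw [← hd]
    have hb' : uprob {v : S.E.Key κ × Tape (p.eval κ) | (v.1, φ v.2) ∈ A.breaking κ} ≤ _ := hb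
    linarith
  rw [div_le_iff₀ hQ] at this
  linarith

end Tokenizer.Setup


/-! ### Failures of the simulation with random blocks -/

namespace Tokenizer

open Data TokenScheme

/-- Birthday bound: block number `k`, resampled with the others fixed, has to meet the low bits of
one of fewer than `Q` earlier blocks. -/
theorem uprob_collision_le {Q m n : ℕ} (h : n ≤ m) :
    uprob {Y : Fin Q → Tape m | ∃ k < Q, ∃ j < k, (poolOf Y k).take n = (poolOf Y j).take n} ≤
      Q * (Q / 2 ^ n) := by
  refine le_trans (uprob_mono ?_) (uprob_iUnion_le (fun k : Fin Q => {Y : Fin Q → Tape m |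
    (poolOf Y k).take n ∈ (List.range k).map fun j => (poolOf Y j).take n}) fun k => ?_)
  · rintro Y ⟨k, hk, j, hj, h⟩
    exact Set.mem_iUnion.2 ⟨⟨k, hk⟩, List.mem_map.2 ⟨j, List.mem_range.2 hj, h.symm⟩⟩
  · refine uprob_update_le k fun Y => ?_
    have hY : ∀ t, (List.range k).map (fun j => (poolOf (Function.update Y k t) j).take n) =
        (List.range k).map fun j => (poolOf Y j).take n := fun t => List.map_congr_left fun j hj => by
      rw [poolOf_update, if_neg (List.mem_range.1 hj).ne]
    refine le_trans (uprob_mono fun t ht => ?_) ((uprob_take_mem_le h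
      ((List.range k).map fun j => (poolOf Y j).take n)).trans ?_)
    · have ht : (poolOf (Function.update Y k t) k).take n ∈ (List.range k).map fun j =>
        (poolOf (Function.update Y k t) j).take n := ht
      rwa [hY, poolOf_update, if_pos rfl] at ht
    · gcongr
      simp

/-- Of the `C` disjoint groups of `κ` consecutive ciphertexts, at least one contains no token, since
otherwise there would be `C` tokens. -/
theorem exists_block_of_lows_lt {P : Params} {y : ℕ → List Bool} {C κ : ℕ} (h : C * κ ≤ P.Q)
    (hl : lows P y P.Q < C) :
    ∃ r < C, ∀ i < κ, ¬ Bits.val ((y (r * κ + i)).take P.n) < P.thr := by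
  by_contra! hc
  choose! g hg using hc
  refine absurd hl (not_lt.2 ?_)
  have hblock : ∀ r < C, (r * κ + g r) / κ = r := fun r hr => by
    have := (hg r hr).1
    rw [mul_comm, Nat.mul_add_div (by omega), Nat.div_eq_of_lt this, add_zero]
  have : (Finset.range C).card ≤ lows P y P.Q := by
    refine Finset.card_le_card_of_injOn (fun r => r * κ + g r) (fun r hr => ?_) fun r hr r' hr' h => ?_
    · have hr := Finset.mem_range.1 (Finset.mem_coe.1 hr)
      refine Finset.mem_coe.2 (Finset.mem_filter.2 ⟨Finset.mem_range.2 ?_, (hg r hr).2⟩)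
      calc r * κ + g r < r * κ + κ := by have := (hg r hr).1; omega
        _ = (r + 1) * κ := by ring
        _ ≤ C * κ := Nat.mul_le_mul_right _ hr
        _ ≤ P.Q := h
    · have hr := Finset.mem_range.1 (Finset.mem_coe.1 hr)
      have hr' := Finset.mem_range.1 (Finset.mem_coe.1 hr')
      rw [← hblock r hr, ← hblock r' hr']
      exact congrArg (· / κ) h
  simpa using this

/-- At least half of the words of `n` bits are below `thr`, so by independence a given group of `κ`
blocks has no token with probability at most `(1 / 2) ^ κ`; then the `C` groups are added up. -/
theorem uprob_lows_le {P : Params} {C κ m : ℕ} (h : C * κ ≤ P.Q) (hn : P.n ≤ m)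
    (ht : P.thr ≤ 2 ^ P.n) (ht' : 2 ^ P.n ≤ 2 * P.thr) :
    uprob {Y : Fin P.Q → Tape m | lows P (poolOf Y) P.Q < C} ≤ C * (1 / 2) ^ κ := by
  refine le_trans (uprob_mono ?_) (uprob_iUnion_le (fun r : Fin C => {Y : Fin P.Q → Tape m |
    ∀ i < κ, ¬ Bits.val ((poolOf Y (r * κ + i)).take P.n) < P.thr}) fun r => ?_)
  · intro Y hY
    obtain ⟨r, hr, h⟩ := exists_block_of_lows_lt h hY
    exact Set.mem_iUnion.2 ⟨⟨r, hr⟩, h⟩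
  · have hlt : ∀ i : Fin κ, r * κ + i < P.Q := fun i =>
      calc (r : ℕ) * κ + i < r * κ + κ := by omega
        _ = (r + 1) * κ := by ring
        _ ≤ C * κ := Nat.mul_le_mul_right _ r.isLt
        _ ≤ P.Q := h
    have hinj : Function.Injective fun i : Fin κ => (⟨r * κ + i, hlt i⟩ : Fin P.Q) :=
      fun i j h => Fin.ext (by simpa using h)
    let I : Finset (Fin P.Q) := Finset.univ.map ⟨_, hinj⟩
    have hI : I.card = κ := by simp [I]
    have hs := uprob_le_val_take hn ht
    have hle : uprob {τ : Tape m | ¬ Bits.val ((List.ofFn τ).take P.n) < P.thr} ≤ 1 / 2 := by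
      have h1 : ((2 : ℝ) ^ P.n) ≤ 2 * P.thr := by exact_mod_cast ht'
      rw [hs, sub_le_iff_le_add, ← sub_le_iff_le_add', le_div_iff₀ (by positivity)]
      linarith
    refine le_trans (uprob_mono ?_) ((uprob_pi _ I).trans_le ((pow_le_pow_left₀ (uprob_nonneg _) hle
      _).trans_eq (by rw [hI])))
    intro Y hY k hk
    obtain ⟨i, -, rfl⟩ := Finset.mem_map.1 hk
    have := hY i i.isLt
    rw [poolOf, dif_pos (hlt i)] at this
    exact this

theorem uprob_poolBad_le {P : Params} {C κ m : ℕ} (h : C * κ ≤ P.Q) (hn : P.n ≤ m)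
    (ht : P.thr ≤ 2 ^ P.n) (ht' : 2 ^ P.n ≤ 2 * P.thr) :
    uprob {Y : Fin P.Q → Tape m | PoolBad P (poolOf Y) C} ≤
      P.Q * (P.Q / 2 ^ P.n) + C * (1 / 2) ^ κ :=
  (uprob_union_le _ _).trans (add_le_add (uprob_collision_le hn) (uprob_lows_le h hn ht ht'))

end Tokenizer

theorem pow_le_two_pow_codeBits (l : ℕ) : 10 ^ l ≤ 2 ^ codeBits l := Nat.le_pow_clog (by norm_num) _

theorem two_pow_codeBits_le (l : ℕ) : 2 ^ codeBits l ≤ 2 * 10 ^ l := by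
  rcases Nat.eq_zero_or_pos l with rfl | hl
  · simp [codeBits]
  · have h1 : 1 < 10 ^ l := Nat.one_lt_pow hl.ne' (by norm_num)
    have h := Nat.pow_pred_clog_lt_self (b := 2) (by norm_num) h1
    have hpos := Nat.clog_pos (b := 2) (by norm_num) (show 2 ≤ 10 ^ l from h1)
    rw [codeBits]
    obtain ⟨k, hk⟩ := Nat.exists_eq_add_of_lt hpos
    rw [hk] at h ⊢
    simp only [zero_add, Nat.pred_eq_sub_one, Nat.add_sub_cancel] at h ⊢
    rw [pow_succ]; omega

/-- The probability of finding a collision of `f`. -/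
noncomputable def TokenScheme.collisionProb (S : TokenScheme) (c : Prog) (T κ : ℕ) : ℝ :=
  uprob {τ : Tape T | ∃ (X₁ X₂ : NumCode (S.l κ)) (u₁ u₂ : AddInput),
    (X₁, u₁) ≠ (X₂, u₂) ∧ S.f κ u₁ X₁ = S.f κ u₂ X₂ ∧
    RunsTo noOracle τ.coin c (.unary κ) () T
      (.cons (.cons X₁.data (.ofBits u₁)) (.cons X₂.data (.ofBits u₂))) ()}

/-! ### Acceptance with random blocks -/

namespace Tokenizer.Setup

open Data TokenScheme

variable {S : TokenScheme} {A : Setup S}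

/-- The final state of a run with random blocks. -/
def ideal (A : Setup S) (κ : ℕ) (w : A.Sample κ) : State :=
  A.final κ (List.ofFn w.2.1) (List.ofFn w.1) fun k _ => poolOf w.2.2 k

/-- In a run with random blocks, the attacker wins. -/
def Wins (A : Setup S) (κ : ℕ) (w : A.Sample κ) : Prop :=
  (A.ideal κ w).tag = .run ∧ (A.ideal κ w).th.stack = [] ∧
    (A.params κ (List.ofFn w.2.1)).predict (A.ideal κ w).th.store =
      (A.params κ (List.ofFn w.2.1)).target (A.ideal κ w).th.store

theorem start_tag_ne {κ : ℕ} {X₀ a : List Bool} : (A.start κ X₀ a).tag ≠ .bad := by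
  simp only [start, initial]; split_ifs <;> simp

theorem exists_coll_le (A : Setup S) : ∃ (c : Prog) (p : Polynomial ℕ), ∀ κ, 1 ≤ S.l κ →
    uprob {w : A.Sample κ | (A.ideal κ w).tag = .coll} ≤ S.collisionProb c (p.eval κ) κ := by
  obtain ⟨c, p, h⟩ := A.exists_finder
  refine ⟨c, p, fun κ hκ => ?_⟩
  obtain ⟨hw, h⟩ := h κ hκ
  obtain ⟨φ, hφ, hW⟩ := A.exists_sample hw
  have hφ' : PreservesUprob (Prod.snd ∘ φ) := PreservesUprob.snd.comp hφ
  rw [← hφ']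
  refine uprob_mono fun τ hτ => ?_
  obtain ⟨W, hW, h1, h2, -, h4⟩ := hW τ
  refine h τ W hW ?_
  rw [h1, h2, h4]
  exact hτ

/-- With random blocks, the machine accepts with small probability. -/
theorem exists_hybrid_zero_le (A : Setup S) : ∃ (c : Prog) (p : Polynomial ℕ), ∀ κ, 1 ≤ S.l κ →
    A.clock.eval κ * κ ≤ A.Q κ → A.hybrid κ 0 ≤
      A.Q κ * (A.Q κ / 2 ^ codeBits (S.l κ)) + A.clock.eval κ * (1 / 2) ^ κ +
        S.collisionProb c (p.eval κ) κ + uprob {w | A.Wins κ w} := by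
  obtain ⟨c, p, h⟩ := A.exists_coll_le
  refine ⟨c, p, fun κ hκ hC => ?_⟩
  have := S.E.key_finite κ
  have := S.E.key_nonempty κ
  have hsub : {w : S.E.Key κ × A.Sample κ | A.Accepts κ (List.ofFn w.2.2.1) (List.ofFn w.2.1)
      (hybridSrc κ w.1 (poolOf w.2.2.2) 0)} = Prod.snd ⁻¹' {w : A.Sample κ |
        Accept (A.params κ (List.ofFn w.2.1)) (A.ideal κ w)} := rfl
  rw [hybrid, hsub, PreservesUprob.snd]
  have hbad : uprob {w : A.Sample κ | (A.ideal κ w).tag = .bad} ≤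
      A.Q κ * (A.Q κ / 2 ^ codeBits (S.l κ)) + A.clock.eval κ * (1 / 2) ^ κ := by
    have key : ∀ (a : Tape (A.coins.eval κ)) (X : Tape (codeBits (S.l κ))),
        uprob {Y : Fin (A.Q κ) → Tape (S.E.m κ) | (A.ideal κ (a, X, Y)).tag = .bad} ≤
          A.Q κ * (A.Q κ / 2 ^ codeBits (S.l κ)) + A.clock.eval κ * (1 / 2) ^ κ := fun a X => by
      refine le_trans (uprob_mono fun Y hY => ?_) (uprob_poolBad_le (P := A.params κ (List.ofFn X))
        (C := A.clock.eval κ) (m := S.E.m κ) hC (S.codeBits_le κ) (pow_le_two_pow_codeBits _)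
        (two_pow_codeBits_le _))
      exact poolBad_of_bad (P := A.params κ (List.ofFn X)) params_valid inv_start
        (length_poolOf Y) rfl rfl start_tag_ne _ hY
    exact uprob_prod_le fun a => uprob_prod_le fun X => key a X
  have hunion : {w : A.Sample κ | Accept (A.params κ (List.ofFn w.2.1)) (A.ideal κ w)} =
      {w | (A.ideal κ w).tag = .bad} ∪ ({w | (A.ideal κ w).tag = .coll} ∪ {w | A.Wins κ w}) := rfl
  rw [hunion]
  have h1 := uprob_union_le {w : A.Sample κ | (A.ideal κ w).tag = .bad}
    ({w | (A.ideal κ w).tag = .coll} ∪ {w | A.Wins κ w})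
  have h2 := uprob_union_le {w : A.Sample κ | (A.ideal κ w).tag = .coll} {w | A.Wins κ w}
  have h3 := h κ hκ
  linarith

/-- The hidden numeric code can only be guessed. -/
theorem uprob_wins_le_of_none (hgoal : A.goal = none) (κ : ℕ) :
    uprob {w | A.Wins κ w} ≤ 1 / 2 ^ codeBits (S.l κ) := by
  let e : Tape (A.coins.eval κ) × (Fin (A.Q κ) → Tape (S.E.m κ)) × Tape (codeBits (S.l κ)) ≃
      A.Sample κ :=
    ⟨fun w => (w.1, w.2.2, w.2.1), fun w => (w.1, w.2.2, w.2.1), fun _ => rfl, fun _ => rfl⟩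
  rw [← PreservesUprob.equiv e]
  have key : ∀ (a : Tape (A.coins.eval κ)) (Y : Fin (A.Q κ) → Tape (S.E.m κ)),
      uprob {X : Tape (codeBits (S.l κ)) | A.Wins κ (a, X, Y)} ≤ 1 / 2 ^ codeBits (S.l κ) := by
    intro a Y
    let th : Thread := ⟨A.stack, fun x => if x = 0 then .unary κ else .nil, List.ofFn a,
      A.clock.eval κ⟩
    -- The final store of the reference run, which does not involve `X`. The prediction is thus a
    -- fixed list, which a uniform `X` equals with probability at most `2 ^ (-n)`.
    let out := ((refStep (codeBits (S.l κ)) (A.T.eval κ) (A.Q κ) (10 ^ S.l κ)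
      (poolOf Y))^[A.steps κ] (th, 0)).1.store
    refine le_trans (uprob_mono fun X hX => ?_) ((uprob_ofFn_mem_le (codeBits (S.l κ))
      [Bits.ofData (A.guess.eval out)]).trans_eq (by simp))
    obtain ⟨h1, h2, h3⟩ := hX
    -- A machine that starts in `dead`, because `X` is no code, stays there and does not win.
    have hstart : (A.start κ (List.ofFn X) (List.ofFn a)).tag = .run := by
      by_contra h
      have hd : (A.start κ (List.ofFn X) (List.ofFn a)).tag = .dead := by
        revert h; simp only [start, initial]; split_ifs <;> simp
      have : step (A.params κ (List.ofFn X)) (fun k _ => poolOf Y k)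
          (A.start κ (List.ofFn X) (List.ofFn a)) = A.start κ (List.ofFn X) (List.ofFn a) := by
        simp [step, hd]
      have hr : A.ideal κ (a, X, Y) = A.start κ (List.ofFn X) (List.ofFn a) :=
        Function.iterate_fixed this _
      rw [hr, hd] at h1
      cases h1
    have hth := run_eq_ref (P := A.params κ (List.ofFn X)) (y := poolOf Y) hstart (A.steps κ) h1 h2
    have hst : (A.ideal κ (a, X, Y)).th.store = out := congrArg Thread.store hth
    rw [hst] at h3
    have ht : (A.params κ (List.ofFn X)).target out = List.ofFn X := by
      simp only [Params.target, Setup.params, TokenScheme.params, hgoal]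
    rw [ht] at h3
    exact List.mem_singleton.2 h3.symm
  exact uprob_prod_le fun a => uprob_prod_le fun Y => key a Y

/-- The answer to the last query cannot be predicted. -/
theorem uprob_wins_le_of_query {v : ℕ} {q : Expr}
    (hlast : A.stack.getLast? = some (.query v q)) (hv : A.guess.vars ≤ v)
    (hgoal : A.goal = some (.var v)) (κ : ℕ) :
    uprob {w | A.Wins κ w} ≤ A.Q κ * (A.Q κ / 2 ^ codeBits (S.l κ)) := by
  have key : ∀ (a : Tape (A.coins.eval κ)) (X : Tape (codeBits (S.l κ))),
      uprob {Y : Fin (A.Q κ) → Tape (S.E.m κ) | A.Wins κ (a, X, Y)} ≤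
        A.Q κ * (A.Q κ / 2 ^ codeBits (S.l κ)) := by
    intro a X
    -- All predictions logged in the run in which block `k` is replaced by zeros. They do not depend
    -- on block `k`, and they include the prediction made just before that block is received, since
    -- the run up to then is unaffected.
    let G : Fin (A.Q κ) → (Fin (A.Q κ) → Tape (S.E.m κ)) → List (List Bool) := fun k Y =>
      (A.ideal κ (a, X, Function.update Y k fun _ => false)).log.map Prod.snd
    refine le_trans (uprob_mono ?_) (uprob_iUnion_le (fun k : Fin (A.Q κ) =>
      {Y : Fin (A.Q κ) → Tape (S.E.m κ) | (poolOf Y k).take (codeBits (S.l κ)) ∈ G k Y}) fun k => ?_)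
    · rintro Y ⟨-, h2, h3⟩
      obtain ⟨j, hj, hwalk, hcnt, hpred⟩ := predicted_of_win (P := A.params κ (List.ofFn X))
        (s := A.start κ (List.ofFn X) (List.ofFn a)) params_valid inv_start (length_poolOf Y)
        hlast hv hgoal (A.steps κ) h2 h3
      let k : Fin (A.Q κ) := ⟨_, hcnt⟩
      refine Set.mem_iUnion.2 ⟨k, ?_⟩
      let Y' := Function.update Y k fun _ => false
      have hrun : run (A.params κ (List.ofFn X)) (fun k _ => poolOf Y k)
          (A.start κ (List.ofFn X) (List.ofFn a)) j = run (A.params κ (List.ofFn X))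
          (fun k _ => poolOf Y' k) (A.start κ (List.ofFn X) (List.ofFn a)) j := by
        refine (run_eq_or (i := k) (fun i x hi => ?_) j).resolve_right fun h => ?_
        · exact ((poolOf_update Y k _ i).trans (if_neg hi.ne)).symm
        · exact absurd h.1 (lt_irrefl _)
      have hlog : (run (A.params κ (List.ofFn X)) (fun k _ => poolOf Y' k)
          (A.start κ (List.ofFn X) (List.ofFn a)) (j + 1)).log <:+
          (A.ideal κ (a, X, Y')).log := log_suffix_run hj
      rw [run_succ, ← hrun, step, hwalk] at hlog
      dsimp only at hlog
      rw [if_pos hcnt, answer_log] at hlog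
      refine List.mem_map.2 ⟨_, hlog.subset List.mem_cons_self, hpred.symm⟩
    · refine uprob_update_le k fun Y => ?_
      have hG : ∀ t, G k (Function.update Y k t) = G k Y := fun t => by
        simp only [G, Function.update_idem]
      simp only [hG, poolOf_update, if_true]
      refine (uprob_take_mem_le (S.codeBits_le κ) _).trans ?_
      gcongr
      rw [List.length_map]
      exact length_log_final_le
  exact uprob_prod_le fun a => uprob_prod_le fun X => key a X

end Tokenizer.Setup


/-! ### Negligible functions -/

section Negligible

open Filter Topology

theorem Negligible.polynomial_mul {ε : ℕ → ℝ} (h : Negligible ε) (p : Polynomial ℕ) :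
    Negligible fun κ => ((p.eval κ : ℕ) : ℝ) * ε κ := by
  refine (Asymptotics.SuperpolynomialDecay.polynomial_mul h (p.map (Nat.castRingHom ℝ))).congr
    fun κ => ?_
  rw [Polynomial.eval_natCast_map]
  rfl

theorem Negligible.of_le {ε δ : ℕ → ℝ} (h : Negligible δ) (h0 : ∀ κ, 0 ≤ ε κ)
    (hle : ∀ᶠ κ in atTop, ε κ ≤ δ κ) : Negligible ε := by
  refine Asymptotics.SuperpolynomialDecay.trans_eventually_abs_le h (hle.mono fun κ hκ => ?_)
  simp only [Function.comp, abs_of_nonneg (h0 κ)]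
  exact hκ.trans (le_abs_self _)

theorem negligible_half_pow : Negligible fun κ => (1 / 2 : ℝ) ^ κ := fun n =>
  tendsto_pow_const_mul_const_pow_of_abs_lt_one n (by rw [abs_of_pos] <;> norm_num)

/-- For `l κ = 0` the value is `1`, which cannot happen arbitrarily late in a null sequence. So the
case `l = 0`, excluded in the constructions of programs, is irrelevant. -/
theorem Negligible.eventually_pos {l : ℕ → ℕ} (h : Negligible fun κ => 1 / (10 : ℝ) ^ l κ) :
    ∀ᶠ κ in atTop, 1 ≤ l κ := by
  have h0 := h 0
  simp only [pow_zero, one_mul] at h0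
  filter_upwards [h0.eventually_lt_const one_pos] with κ hκ
  by_contra hl
  simp [show l κ = 0 by omega] at hκ

end Negligible

/-! ### The machine accepts with negligible probability -/

namespace Tokenizer

open Data TokenScheme

namespace Setup

variable {S : TokenScheme} {A : Setup S}

theorem q_le_Q (κ : ℕ) : A.q.eval κ ≤ A.Q κ := Nat.le_pow_clog (by norm_num) _

theorem Q_le (κ : ℕ) : A.Q κ ≤ 2 * A.q.eval κ + 1 := by
  rcases Nat.lt_or_ge 1 (A.q.eval κ) with h | h
  · have h1 := Nat.pow_pred_clog_lt_self (b := 2) (by norm_num) h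
    have hpos := Nat.clog_pos (b := 2) (by norm_num) (show 2 ≤ A.q.eval κ from h)
    obtain ⟨k, hk⟩ := Nat.exists_eq_add_of_lt hpos
    rw [Q, b]
    rw [hk] at h1 ⊢
    simp only [zero_add, Nat.pred_eq_sub_one, Nat.add_sub_cancel] at h1 ⊢
    rw [pow_succ]; omega
  · rw [Q, b, Nat.clog_of_right_le_one h]; simp

/-- The machine accepts with negligible probability, also with real encryptions. -/
theorem negligible_real (hlarge : Negligible fun κ => 1 / (10 : ℝ) ^ S.l κ)
    (hcr : S.CollisionResistant) (hE : S.E.INDCPA)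
    (hq : ∀ κ, A.clock.eval κ * κ ≤ A.q.eval κ)
    (hwins : ∀ κ, 1 ≤ A.Q κ → uprob {w | A.Wins κ w} ≤
      A.Q κ * (A.Q κ / 2 ^ codeBits (S.l κ))) : Negligible A.real := by
  obtain ⟨c₁, p₁, h₁⟩ := A.exists_real_le
  obtain ⟨c₂, p₂, h₂⟩ := A.exists_hybrid_zero_le
  let Q : Polynomial ℕ := 2 * A.q + 1
  -- Four terms are of the order `Q ^ 2 / 10 ^ l`: two from inadmissible challenges, one from
  -- repeated low bits and one from wins.
  have n1 := hlarge.polynomial_mul (4 * Q ^ 2)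
  have n2 := negligible_half_pow.polynomial_mul A.clock
  have n3 : Negligible fun κ => S.collisionProb c₂ (p₂.eval κ) κ := hcr c₂ p₂
  have n4 := (hE c₁ p₁).polynomial_mul (2 * Q)
  refine Negligible.of_le (((n1.add n2).add n3).add n4) (fun κ => uprob_nonneg _) ?_
  filter_upwards [hlarge.eventually_pos] with κ hκ
  have h₁ := h₁ κ hκ
  have h₂ := h₂ κ hκ ((hq κ).trans (q_le_Q κ))
  have h₃ := hwins κ Nat.one_le_two_pow
  have hQ : (A.Q κ : ℝ) ≤ Q.eval κ := by
    have : Q.eval κ = 2 * A.q.eval κ + 1 := by simp [Q]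
    rw [this]
    exact_mod_cast Q_le κ
  have hn : (10 : ℝ) ^ S.l κ ≤ 2 ^ codeBits (S.l κ) := by
    exact_mod_cast pow_le_two_pow_codeBits (S.l κ)
  have hm : (2 : ℝ) ^ codeBits (S.l κ) ≤ 2 ^ S.E.m κ :=
    pow_le_pow_right₀ (by norm_num) (S.codeBits_le κ)
  have hQQ : ∀ d : ℝ, (10 : ℝ) ^ S.l κ ≤ d →
      (A.Q κ : ℝ) * (A.Q κ / d) ≤ Q.eval κ ^ 2 * (1 / 10 ^ S.l κ) := fun d hd => by
    have : 0 < d := lt_of_lt_of_le (by positivity) hd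
    calc (A.Q κ : ℝ) * (A.Q κ / d) ≤ Q.eval κ * (Q.eval κ / 10 ^ S.l κ) := by gcongr
      _ = _ := by ring
  have k1 := hQQ _ hn
  have k2 := hQQ _ (hn.trans hm)
  have k3 : (A.Q κ : ℝ) * (2 * S.E.advantage c₁ (p₁.eval κ) κ) ≤
      2 * Q.eval κ * S.E.advantage c₁ (p₁.eval κ) κ := by
    have : 0 ≤ S.E.advantage c₁ (p₁.eval κ) κ := abs_nonneg _
    calc _ ≤ ((Q.eval κ : ℕ) : ℝ) * (2 * S.E.advantage c₁ (p₁.eval κ) κ) := by gcongr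
      _ = _ := by ring
  simp only [Pi.add_apply, Polynomial.eval_mul, Polynomial.eval_pow, Polynomial.eval_ofNat]
  push_cast
  linarith

theorem ofFn_equivFin_symm {κ : ℕ} (X : NumCode (S.l κ)) :
    List.ofFn ((Tape.equivFin _).symm ⟨X.val, S.lt_two_pow κ X⟩) = bits (S := S) (κ := κ) X := by
  have h := Tape.val_equivFin ((Tape.equivFin _).symm ⟨X.val, S.lt_two_pow κ X⟩)
  rw [Equiv.apply_symm_apply] at h
  have h' := Bits.ofNat_val (List.ofFn ((Tape.equivFin _).symm ⟨X.val, S.lt_two_pow κ X⟩))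
  rw [← h, List.length_ofFn] at h'
  exact h'.symm

/-- Codes embed into the words of `n` bits, of which there are at most `2 * 10 ^ l`; passing from a
uniform code to a uniform word costs at most a factor 2. -/
theorem uprob_bits_le {κ : ℕ} (P : List Bool → Prop) :
    uprob {X : NumCode (S.l κ) | P (bits (S := S) (κ := κ) X)} ≤
      2 * uprob {X : Tape (codeBits (S.l κ)) | P (List.ofFn X)} := by
  have h : {X : NumCode (S.l κ) | P (bits (S := S) (κ := κ) X)}.ncard ≤
      {X : Tape (codeBits (S.l κ)) | P (List.ofFn X)}.ncard := by
    refine Set.ncard_le_ncard_of_injOn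
      (fun X => (Tape.equivFin _).symm ⟨X.val, S.lt_two_pow κ X⟩) (fun X hX => ?_) ?_ (Set.toFinite _)
    · have : P (bits (S := S) (κ := κ) X) := hX
      rw [← ofFn_equivFin_symm] at this
      exact this
    · intro X _ Y _ h
      exact Fin.ext (Fin.mk.inj ((Tape.equivFin _).symm.injective h))
  have h2 : (2 : ℝ) ^ codeBits (S.l κ) ≤ 2 * 10 ^ S.l κ := by
    exact_mod_cast two_pow_codeBits_le (S.l κ)
  unfold uprob
  rw [Nat.card_eq_fintype_card, Nat.card_eq_fintype_card, Fintype.card_fun, Fintype.card_fin,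
    Fintype.card_bool, Fintype.card_fin, ← mul_div_assoc, div_le_div_iff₀ (by positivity)
    (by positivity)]
  push_cast
  calc _ ≤ ({X : Tape (codeBits (S.l κ)) | P (List.ofFn X)}.ncard : ℝ) * (2 * 10 ^ S.l κ) := by
        gcongr
    _ = _ := by ring

/-- If the attacker wins only when the machine accepts, then it wins with negligible
probability. -/
theorem uprob_le_real {κ : ℕ} {P : S.E.Key κ × NumCode (S.l κ) × Tape (A.coins.eval κ) → Prop}
    (h : ∀ w, P w → A.Accepts κ (bits (S := S) (κ := κ) w.2.1) (List.ofFn w.2.2)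
      fun _ => S.encBits κ w.1) : uprob {w | P w} ≤ 2 * A.real κ := by
  have := S.E.key_finite κ
  let e : S.E.Key κ × Tape (A.coins.eval κ) × NumCode (S.l κ) ≃
      S.E.Key κ × NumCode (S.l κ) × Tape (A.coins.eval κ) :=
    ⟨fun w => (w.1, w.2.2, w.2.1), fun w => (w.1, w.2.2, w.2.1), fun _ => rfl, fun _ => rfl⟩
  rw [← PreservesUprob.equiv e]
  have hle : uprob (e ⁻¹' {w | P w}) ≤ uprob {w : S.E.Key κ × Tape (A.coins.eval κ) ×
      NumCode (S.l κ) | A.Accepts κ (bits (S := S) (κ := κ) w.2.2) (List.ofFn w.2.1)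
        fun _ => S.encBits κ w.1} := uprob_mono fun w hw => h (e w) hw
  refine hle.trans ?_
  have key : ∀ (K : S.E.Key κ) (a : Tape (A.coins.eval κ)),
      uprob {X : NumCode (S.l κ) | A.Accepts κ (bits (S := S) (κ := κ) X) (List.ofFn a)
        fun _ => S.encBits κ K} ≤ 2 * uprob {X : Tape (codeBits (S.l κ)) |
          A.Accepts κ (List.ofFn X) (List.ofFn a) fun _ => S.encBits κ K} := fun K a =>
    uprob_bits_le fun X => A.Accepts κ X (List.ofFn a) fun _ => S.encBits κ K
  have key' : ∀ K : S.E.Key κ, uprob {w : Tape (A.coins.eval κ) × NumCode (S.l κ) |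
      A.Accepts κ (bits (S := S) (κ := κ) w.2) (List.ofFn w.1) fun _ => S.encBits κ K} ≤
        2 * uprob {w : Tape (A.coins.eval κ) × Tape (codeBits (S.l κ)) |
          A.Accepts κ (List.ofFn w.2) (List.ofFn w.1) fun _ => S.encBits κ K} := fun K =>
    uprob_prod_mono fun a => key K a
  exact uprob_prod_mono fun K => key' K

end Setup

end Tokenizer

/-! ### Attackers -/

namespace Prog

/-- The parts of a program. -/
def subs : Prog → List Prog
  | skip => [skip]
  | assign x e => [assign x e]
  | flip x => [flip x]
  | query x e => [query x e]
  | seq c d => seq c d :: (c.subs ++ d.subs)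
  | ite e c d => ite e c d :: (c.subs ++ d.subs)
  | .while e c => .while e c :: c.subs

theorem self_mem_subs (c : Prog) : c ∈ c.subs := by cases c <;> simp [subs]

theorem subs_subset : ∀ {c d : Prog}, c ∈ d.subs → c.subs ⊆ d.subs
  | c, skip, h => by obtain rfl := List.mem_singleton.1 h; exact fun _ h => h
  | c, assign x e, h => by obtain rfl := List.mem_singleton.1 h; exact fun _ h => h
  | c, flip x, h => by obtain rfl := List.mem_singleton.1 h; exact fun _ h => h
  | c, query x e, h => by obtain rfl := List.mem_singleton.1 h; exact fun _ h => h
  | c, seq d d', h => by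
    rcases List.mem_cons.1 h with rfl | h
    · exact fun _ h => h
    · rcases List.mem_append.1 h with h | h
      · exact fun x hx => List.mem_cons_of_mem _ (List.mem_append_left _ (subs_subset h hx))
      · exact fun x hx => List.mem_cons_of_mem _ (List.mem_append_right _ (subs_subset h hx))
  | c, ite e d d', h => by
    rcases List.mem_cons.1 h with rfl | h
    · exact fun _ h => h
    · rcases List.mem_append.1 h with h | h
      · exact fun x hx => List.mem_cons_of_mem _ (List.mem_append_left _ (subs_subset h hx))
      · exact fun x hx => List.mem_cons_of_mem _ (List.mem_append_right _ (subs_subset h hx))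
  | c, .while e d, h => by
    rcases List.mem_cons.1 h with rfl | h
    · exact fun _ h => h
    · exact fun x hx => List.mem_cons_of_mem _ (subs_subset h hx)

theorem vars_le_of_mem_subs : ∀ {c d : Prog}, c ∈ d.subs → c.vars ≤ d.vars
  | c, skip, h => by obtain rfl := List.mem_singleton.1 h; exact le_rfl
  | c, assign x e, h => by obtain rfl := List.mem_singleton.1 h; exact le_rfl
  | c, flip x, h => by obtain rfl := List.mem_singleton.1 h; exact le_rfl
  | c, query x e, h => by obtain rfl := List.mem_singleton.1 h; exact le_rfl
  | c, seq d d', h => by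
    rcases List.mem_cons.1 h with rfl | h
    · exact le_rfl
    · rcases List.mem_append.1 h with h | h
      · exact (vars_le_of_mem_subs h).trans (le_max_left _ _)
      · exact (vars_le_of_mem_subs h).trans (le_max_right _ _)
  | c, ite e d d', h => by
    rcases List.mem_cons.1 h with rfl | h
    · exact le_rfl
    · rcases List.mem_append.1 h with h | h
      · exact (vars_le_of_mem_subs h).trans ((le_max_left _ _).trans (le_max_right _ _))
      · exact (vars_le_of_mem_subs h).trans ((le_max_right _ _).trans (le_max_right _ _))
  | c, .while e d, h => by
    rcases List.mem_cons.1 h with rfl | h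
    · exact le_rfl
    · exact (vars_le_of_mem_subs h).trans (le_max_right _ _)

/-- All queries are tagged by `b`. -/
def tagged (b : Expr) : Prog → Prog
  | skip => skip
  | assign x e => assign x e
  | flip x => flip x
  | query x e => query x (.cons b e)
  | seq c d => seq (c.tagged b) (d.tagged b)
  | ite e c d => ite e (c.tagged b) (d.tagged b)
  | .while e c => .while e (c.tagged b)

end Prog

/-- Tagging enlarges a query by one node and the tag, at most four nodes together, and a query takes
at least one step; hence the factor 5. -/
theorem Exec.tagged {σ : Type} {O O' : Oracle σ} {ω : ℕ → Bool} {b : Expr} {v : Data}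
    (hb : ∀ st, b.eval st = v) (hv : v.size ≤ 3)
    (hO : ∀ q d a q', O q d a q' → O' q (.cons v d) a q') {c : Prog} {s s' : Config σ} {t : ℕ}
    (h : Exec O ω c s t s') : ∃ t' ≤ 5 * t, Exec O' ω (c.tagged b) s t' s' := by
  induction h with
  | skip s => exact ⟨_, by omega, .skip s⟩
  | assign x e s => exact ⟨_, by omega, .assign x e s⟩
  | flip x s => exact ⟨_, by omega, .flip x s⟩
  | query x e s a q h =>
    have he : (Expr.cons b e).eval s.store = .cons v (e.eval s.store) := by
      rw [Expr.eval, hb]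
    refine ⟨_, ?_, .query x (.cons b e) s a q (by rw [he]; exact hO _ _ _ _ h)⟩
    rw [he]
    simp only [Data.size]
    omega
  | seq c d s s' s'' t t' _ _ ih ih' =>
    obtain ⟨t₁, h₁, ih⟩ := ih
    obtain ⟨t₂, h₂, ih'⟩ := ih'
    exact ⟨_, by omega, .seq _ _ _ _ _ _ _ ih ih'⟩
  | iteTrue e c d s s' t he _ ih =>
    obtain ⟨t₁, h₁, ih⟩ := ih
    exact ⟨_, by omega, .iteTrue _ _ _ _ _ _ he ih⟩
  | iteFalse e c d s s' t he _ ih =>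
    obtain ⟨t₁, h₁, ih⟩ := ih
    exact ⟨_, by omega, .iteFalse _ _ _ _ _ _ he ih⟩
  | whileFalse e c s he => exact ⟨_, by omega, .whileFalse _ _ _ he⟩
  | whileTrue e c s s' s'' t t' he _ _ ih ih' =>
    obtain ⟨t₁, h₁, ih⟩ := ih
    obtain ⟨t₂, h₂, ih'⟩ := ih'
    exact ⟨_, by omega, .whileTrue _ _ _ _ _ _ _ he ih ih'⟩

theorem RunsTo.tagged {σ : Type} {O O' : Oracle σ} {ω : ℕ → Bool} {b : Expr} {v : Data}
    (hb : ∀ st, b.eval st = v) (hv : v.size ≤ 3)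
    (hO : ∀ q d a q', O q d a q' → O' q (.cons v d) a q') {c : Prog} {d out : Data} {q q' : σ}
    {T : ℕ} (h : RunsTo O ω c d q T out q') : RunsTo O' ω (c.tagged b) d q (5 * T) out q' := by
  obtain ⟨t, s, h, ht, hout, hq⟩ := h
  obtain ⟨t', ht', h'⟩ := h.tagged hb hv hO
  exact ⟨t', s, h', by omega, hout, hq⟩

namespace Tokenizer

open Data TokenScheme

variable {S : TokenScheme}

/-- An attacker, which may be followed by a query that checks a forgery. -/
noncomputable def attack (hm : PolyTime Data.unary fun κ => Data.unary (S.E.m κ))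
    (hl : PolyTime Data.unary fun κ => Data.unary (S.l κ)) (hf : S.PolyTimeF)
    (check : Bool) (c : Prog) (p : Polynomial ℕ) : Setup S where
  hm := hm
  hl := hl
  hf := hf
  L := .query 1 checkExpr :: c.subs
  M := c.vars + 2
  vars d hd := by
    rcases List.mem_cons.1 hd with rfl | hd
    · simp [Prog.vars, checkExpr, Expr.vars]
    · exact (Prog.vars_le_of_mem_subs hd).trans (Nat.le_add_right _ _)
  comp d d' h := by
    have h := (List.mem_cons.1 h).resolve_left (by simp)
    refine ⟨List.mem_cons_of_mem _ (Prog.subs_subset h ?_),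
      List.mem_cons_of_mem _ (Prog.subs_subset h ?_)⟩
    · simp [Prog.subs, Prog.self_mem_subs]
    · simp [Prog.subs, Prog.self_mem_subs]
  cond e d d' h := by
    have h := (List.mem_cons.1 h).resolve_left (by simp)
    refine ⟨List.mem_cons_of_mem _ (Prog.subs_subset h ?_),
      List.mem_cons_of_mem _ (Prog.subs_subset h ?_)⟩
    · simp [Prog.subs, Prog.self_mem_subs]
    · simp [Prog.subs, Prog.self_mem_subs]
  loop e d h := by
    have h := (List.mem_cons.1 h).resolve_left (by simp)
    refine List.mem_cons_of_mem _ (Prog.subs_subset h ?_)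
    simp [Prog.subs, Prog.self_mem_subs]
  stack := if check then [c, .query 1 checkExpr] else [c]
  stack_subset d hd := by
    have hc := Prog.self_mem_subs c
    cases check
    · obtain rfl : d = c := by simpa using hd
      exact List.mem_cons_of_mem _ hc
    · rcases (by simpa using hd : d = c ∨ d = .query 1 checkExpr) with rfl | rfl
      · exact List.mem_cons_of_mem _ hc
      · exact List.mem_cons_self
  coins := p
  -- The running time is at most `5 * p` after tagging; it is doubled because of `reaches_exec`, and
  -- 2 is added for the checking query. `T` is the limit required by `accept_of_forgery` for this
  -- running time. `q` provides `κ` encryptions for each unit of the clock.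
  clock := 10 * p + 2
  T := 4 * .X + 15 * p + 8
  q := (10 * p + 2) * .X
  guess := if check then .tail (.tail (.var 0)) else .var 0
  goal := if check then some (.var 1) else none
  guess_vars := by cases check <;> simp [Expr.vars]
  goal_vars e h := by
    cases check
    · simp at h
    · obtain rfl : Expr.var 1 = e := by simpa using h
      simp [Expr.vars]

variable {hm : PolyTime Data.unary fun κ => Data.unary (S.E.m κ)}
  {hl : PolyTime Data.unary fun κ => Data.unary (S.l κ)} {hf : S.PolyTimeF}
  {c : Prog} {p : Polynomial ℕ}

theorem getD_ofFn_eq_coin {N : ℕ} (τ : Tape N) (k : ℕ) : (List.ofFn τ).getD k false = τ.coin k := by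
  unfold Tape.coin
  split_ifs with h
  · simp [h]
  · simp [h]

theorem attack_accepts_of_recovery {κ : ℕ} {K : S.E.Key κ} {X : NumCode (S.l κ)}
    {τ : Tape (p.eval κ)} {db : Set (NumCode (S.l κ))}
    (h : RunsTo (S.pairOracle κ K X) τ.coin c (.unary κ) ∅ (5 * p.eval κ) X.data db) :
    (attack hm hl hf false c p).Accepts κ (bits (S := S) (κ := κ) X) (List.ofFn τ)
      fun _ => S.encBits κ K := by
  refine accept_of_recovery (getD_ofFn_eq_coin τ) h ?_ ?_ le_rfl
  · simp only [attack, Polynomial.eval_add, Polynomial.eval_mul, Polynomial.eval_ofNat]; omega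
  · simp only [attack, Polynomial.eval_add, Polynomial.eval_mul, Polynomial.eval_ofNat]; omega

theorem attack_accepts_of_forgery {κ : ℕ} {K : S.E.Key κ} {X Y tok : NumCode (S.l κ)}
    {u : AddInput} {τ : Tape (p.eval κ)} {db : Set (NumCode (S.l κ))}
    (h : RunsTo (S.pairOracle κ K X) τ.coin c (.unary κ) ∅ (5 * p.eval κ)
      (.cons Y.data (.cons (.ofBits u) tok.data)) db) (htok : S.Tokenize κ K db Y u tok) :
    (attack hm hl hf true c p).Accepts κ (bits (S := S) (κ := κ) X) (List.ofFn τ)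
      fun _ => S.encBits κ K := by
  refine accept_of_forgery (getD_ofFn_eq_coin τ) h htok ?_ ?_ le_rfl le_rfl
  · simp only [attack, Polynomial.eval_add, Polynomial.eval_mul, Polynomial.eval_ofNat,
      Polynomial.eval_X]
    omega
  · simp only [attack, Polynomial.eval_add, Polynomial.eval_mul, Polynomial.eval_ofNat]; omega

theorem negligible_attack (hlarge : Negligible fun κ => 1 / (10 : ℝ) ^ S.l κ)
    (hcr : S.CollisionResistant) (hE : S.E.INDCPA) (check : Bool) :
    Negligible (attack hm hl hf check c p).real := by
  refine Setup.negligible_real hlarge hcr hE (fun κ => ?_) fun κ hQ => ?_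
  · simp [attack]
  · cases check
    · refine (Setup.uprob_wins_le_of_none rfl κ).trans ?_
      have : (1 : ℝ) ≤ (attack hm hl hf false c p).Q κ := by exact_mod_cast hQ
      rw [← mul_div_assoc]
      gcongr
      nlinarith
    · exact Setup.uprob_wins_le_of_query (v := 1) (q := checkExpr) rfl le_rfl rfl κ

/-- An attacker that wins only when the machine accepts wins with negligible probability. -/
theorem negligible_of_accepts (hlarge : Negligible fun κ => 1 / (10 : ℝ) ^ S.l κ)
    (hcr : S.CollisionResistant) (hE : S.E.INDCPA) {check : Bool}
    {P : ∀ κ, S.E.Key κ × NumCode (S.l κ) × Tape (p.eval κ) → Prop}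
    (h : ∀ κ w, P κ w → (attack hm hl hf check c p).Accepts κ (bits (S := S) (κ := κ) w.2.1)
      (List.ofFn w.2.2) fun _ => S.encBits κ w.1) : Negligible fun κ => uprob {w | P κ w} := by
  have hreal : Negligible (attack hm hl hf check c p).real := negligible_attack hlarge hcr hE check
  have h2 : Negligible fun κ => 2 * (attack hm hl hf check c p).real κ := hreal.const_mul 2
  refine h2.of_le (fun _ => uprob_nonneg _) (.of_forall fun κ => ?_)
  exact Setup.uprob_le_real (A := attack hm hl hf check c p) (h κ)

end Tokenizer

/-! ### The three requirements -/

theorem corollary1 (S : TokenScheme)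
    (hm : PolyTime Data.unary fun κ => Data.unary (S.E.m κ))
    (hl : PolyTime Data.unary fun κ => Data.unary (S.l κ))
    (hlarge : Negligible fun κ => 1 / (10 : ℝ) ^ S.l κ)
    (hf : S.PolyTimeF)
    (hcr : S.CollisionResistant)
    (hE : S.E.INDCPA) :
    S.A1 ∧ S.A2 ∧ S.A3 := by
  refine ⟨fun c p => ?_, fun c p => ?_, fun c p => ?_⟩
  -- An attacker with hidden queries only becomes one with both kinds of queries when its queries
  -- are tagged by `nil`.
  · refine Tokenizer.negligible_of_accepts (hm := hm) (hl := hl) (hf := hf)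
      (c := c.tagged .nil) hlarge hcr hE (check := false) fun κ w ⟨db, h⟩ => ?_
    exact Tokenizer.attack_accepts_of_recovery (h.tagged (b := .nil) (v := .nil) (fun _ => rfl)
      (by simp [Data.size]) fun _ _ _ _ h => .hidden _ _ _ _ h)
  · refine Tokenizer.negligible_of_accepts (hm := hm) (hl := hl) (hf := hf) (c := c) hlarge hcr hE
      (check := false) fun κ w ⟨db, h⟩ => ?_
    obtain ⟨t, s, h, ht, h'⟩ := h
    exact Tokenizer.attack_accepts_of_recovery ⟨t, s, h, by omega, h'⟩
  -- This game has no hidden code. The machine needs one, so an unused code is drawn, and it is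
  -- integrated out at the end.
  · have key := Tokenizer.negligible_of_accepts (hm := hm) (hl := hl) (hf := hf) (p := p)
      (c := c.tagged (.cons .nil .nil)) hlarge hcr hE (check := true)
      (P := fun κ w => ∃ (X : NumCode (S.l κ)) (u : AddInput) (tok : NumCode (S.l κ))
        (db' : Set (NumCode (S.l κ))),
        RunsTo (S.knownOracle κ w.1) w.2.2.coin c (.unary κ) ∅ (p.eval κ)
          (.cons X.data (.cons (.ofBits u) tok.data)) db' ∧ S.Tokenize κ w.1 db' X u tok)
      fun κ w ⟨X, u, tok, db, h, htok⟩ => Tokenizer.attack_accepts_of_forgery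
        (h.tagged (b := .cons .nil .nil) (v := .cons .nil .nil) (fun _ => rfl) (by simp [Data.size])
          fun _ _ _ _ h => .known _ _ _ _ h) htok
    refine key.congr fun κ => ?_
    have := S.E.key_finite κ
    refine uprob_prod_congr fun K => ?_
    exact PreservesUprob.snd (α := NumCode (S.l κ)) {τ : Tape (p.eval κ) |
      ∃ (X : NumCode (S.l κ)) (u : AddInput) (tok : NumCode (S.l κ))
        (db' : Set (NumCode (S.l κ))),
        RunsTo (S.knownOracle κ K) τ.coin c (.unary κ) ∅ (p.eval κ)
          (.cons X.data (.cons (.ofBits u) tok.data)) db' ∧ S.Tokenize κ K db' X u tok}
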